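/- **Codes and distances.** For words $u,v$ of equal length, $\mathsf{HAM}(u,v)$ is the fraction of positions where they differ (words of different lengths are never close). $\mathsf{ED}(u,v)$ is the least number of insertions and deletions that turn $u$ into $v$, divided by $2|u|$. A code $C[K,k,q_1,q_2]=(\mathsf{Enc},\mathsf{Dec})$ with $|\Sigma_i|=q_i$ consists of a (possibly randomized) encoder $\mathsf{Enc}\colon\Sigma_1^k\to\Sigma_2^K$ and a randomized decoder $\mathsf{Dec}$ that, given an index $i\in[k]$ and query access to a word $y'\in\Sigma_2^*$ of known length, outputs a symbol of $\Sigma_1$. A word $y'$ *fools* the decoder, for a codeword $y$ of $x$, if $\mathsf{dist}(y,y')\le\rho$ and $\Pr[\mathsf{Dec}^{y'}(i)=x_i]<p$ for some $i\in[k]$. The code is an $(\ell,\rho,p,\varepsilon,\mathsf{dist},\mathbb A)$-LDC if $\mathsf{Dec}$ always makes at most $\ell$ queries and, for every algorithm $\mathcal A\in\mathbb A$ and every $x\in\Sigma_1^k$, the word $\mathcal A(y)$, $y\leftarrow\mathsf{Enc}(x)$, fools the decoder with probability at most $\varepsilon$. **Algorithms.** Algorithms are randomized parallel programs (data-parallel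 PRAM programs with unit-cost addition, subtraction and halving); the costs of algorithms run one after the other add up. Adversaries are given the alphabet size and the codeword. For $T,S\colon\mathbb N\to\mathbb N$ let $\mathbb C=\mathbb C(T,S)$ be the class of parallel PPT algorithms on binary words that, on inputs of length $n$, run in parallel (i.e. sequential) time $T(n)$, space $S(n)$ and total work polynomial in $n$. **Theorem.** For every $d\in\mathbb N$ there are programs $\mathsf{compile}$ and $\mathsf{recover}$, a length function $n=n(K,q_2)$, negligible functions $\vartheta_1,\vartheta_2$ and a function $\rho\mapsto\rho_f=\Theta(\rho)$ such that the following holds for all $K\ge1$ and all alphabet sizes $2\le q_2\le(K+1)^d$, with all implied constants, and the exponents of $\mathrm{polylog}$, depending on $d$ only. 1. $n=\Theta(K\log q_2)$. The program $\mathsf{compile}$ computes a map $\Sigma_2^K\to\{0,1\}^n$; $\mathsf{recover}$ takes $y\in\Sigma_2^K$ and any word $Y'\in\{0,1\}^*$. Both run in parallel time $\mathrm{polylog}(n)$ with space and total work $n\cdot\mathrm{polylog}(n)$. 2. For $A\in\mathbb C$ let $\mathsf{reduce}(A)$ be the algorithm that on input $y\in\Sigma_2^K$ runs $\mathsf{compile}$,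 then $A$ on the compiled word, then $\mathsf{recover}$ on $y$ and the answer of $A$. Let $\overline{\mathbb C}(n)$, the closure of $\mathbb C$, be the least class that contains $\mathsf{reduce}(A)$ for all $A\in\mathbb C$. For all $T,S$, every algorithm in $\overline{\mathbb C}(n)$ runs in parallel time $T(n)+\mathrm{polylog}(n)$, space $S(n)+n\cdot\mathrm{polylog}(n)$ and total work polynomial in $n$ on words of $\Sigma_2^K$. 3. For every code $C[K,k,q_1,q_2]=(\mathsf{Enc},\mathsf{Dec})$ there is a binary code $C_f[n,k,q_1,2]$ with encoder $\mathsf{compile}\circ\mathsf{Enc}$ such that for all $T,S$, all $\ell\in\mathbb N$, all real $\varepsilon$ and all reals $\rho,p>0$ and $p_f<p$: if $C$ is an $(\ell,\rho,p,\varepsilon,\mathsf{HAM},\overline{\mathbb C}(n))$-LDC and $1-\frac{p_f}{p}-\frac{\vartheta_1(n)}{p}-\vartheta_2(n)>0$, then $C_f$ is an $(\ell_f,\rho_f,p_f,\varepsilon_f,\mathsf{ED},\mathbb C)$-LDC with $$\ell_f=\ell\cdot O(\log^4 n),\qquad \varepsilon_f=\frac{\varepsilon}{1-\frac{p_f}{p}-\frac{\vartheta_1(n)}{p}-\vartheta_2(n)}.$$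 -/

import Mathlib

open scoped ENNReal

noncomputable section

namespace InsDelLDC

/-! ### Words and fractional distances -/

/-- Fractional Hamming distance. It is only meaningful for words of equal length; words of different
lengths are at infinite distance, that is, never within any error rate. -/
def hamDist {σ : Type} [DecidableEq σ] (u v : List σ) : ℝ≥0∞ :=
  if u.length = v.length then
    (((u.zip v).countP fun a => decide (a.1 ≠ a.2) : ℕ) : ℝ≥0∞) / (u.length : ℝ≥0∞)
  else ⊤

/-- `InsDelSteps m u v`: the word `u` can be turned into `v` by exactly `m` insertions and
deletions of single symbols. -/
inductive InsDelSteps {σ : Type} : ℕ → List σ → List σ → Prop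
  | refl (u : List σ) : InsDelSteps 0 u u
  | insert {m : ℕ} {u v w : List σ} (a : σ) :
      InsDelSteps m u (v ++ w) → InsDelSteps (m + 1) u (v ++ a :: w)
  | delete {m : ℕ} {u v w : List σ} (a : σ) :
      InsDelSteps m u (v ++ a :: w) → InsDelSteps (m + 1) u (v ++ w)

/-- The least number of insertions and deletions that turn `u` into `v`. -/
def insDel {σ : Type} (u v : List σ) : ℕ := sInf {m | InsDelSteps m u v}

/-- Fractional edit distance of `v` from `u`: insertions and deletions, normalized by `2 |u|`. -/
def editDist {σ : Type} (u v : List σ) : ℝ≥0∞ :=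
  (insDel u v : ℝ≥0∞) / (2 * (u.length : ℝ≥0∞))

/-- The probability of an event under a discrete distribution. -/
def prob {α : Type} (μ : PMF α) (E : Set α) : ℝ := (μ.toOuterMeasure E).toReal

/-- Negligible functions: non-negative and `o(n ^ (-c))` for every `c`. -/
def Negligible (f : ℕ → ℝ) : Prop :=
  (∀ n, 0 ≤ f n) ∧
    Asymptotics.SuperpolynomialDecay Filter.atTop (fun n : ℕ => (n : ℝ)) f

/-! ### Randomized parallel algorithms

The machine is a randomized vector machine: the data-parallel form of the concurrent-read
concurrent-write PRAM with unit-cost addition, subtraction and halving (no multiplication).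
A register holds a vector of natural numbers. One instruction acts on all entries of its operands
at once and is one step of parallel (that is, sequential) time; its work is the number of entries it
touches. Space is the number of bits in all registers. Input tapes are read-only and the output is
write-only; neither is charged as space. -/

/-- The read-only input tapes. -/
abbrev Tapes : Type := List (List ℕ)

/-- Vector instructions. The first argument of each, save `emit`, is the target register; other
arguments are registers, except `c` (a constant) and `k` (the number of an input tape). -/
inductive Instr : Type
  | const (r c : ℕ)
  | iota (r a : ℕ)
  | length (r a : ℕ)
  | add (r a b : ℕ)
  | sub (r a b : ℕ)
  | half (r a : ℕ)
  | less (r a b : ℕ)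
  | select (r m a b : ℕ)
  | gather (r a i : ℕ)
  | scatter (r a i v : ℕ)
  | flip (r a : ℕ)
  | tapeLength (r k : ℕ)
  | read (r k i : ℕ)
  | emit (a : ℕ)

/-- The registers that an instruction reads. -/
def Instr.operands : Instr → List ℕ
  | .const _ _ => []
  | .iota _ a => [a]
  | .length _ a => [a]
  | .add _ a b => [a, b]
  | .sub _ a b => [a, b]
  | .half _ a => [a]
  | .less _ a b => [a, b]
  | .select _ m a b => [m, a, b]
  | .gather _ a i => [a, i]
  | .scatter _ a i v => [a, i, v]
  | .flip _ a => [a]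
  | .tapeLength _ _ => []
  | .read _ _ i => [i]
  | .emit a => [a]

/-- The register that an instruction writes; `none` means the output. -/
def Instr.target : Instr → Option ℕ
  | .const r _ => some r
  | .iota r _ => some r
  | .length r _ => some r
  | .add r _ _ => some r
  | .sub r _ _ => some r
  | .half r _ => some r
  | .less r _ _ => some r
  | .select r _ _ _ => some r
  | .gather r _ _ => some r
  | .scatter r _ _ _ => some r
  | .flip r _ => some r
  | .tapeLength r _ => some r
  | .read r _ _ => some r
  | .emit _ => none

/-- `n` independent fair coins. -/
def coins : ℕ → PMF (List ℕ)
  | 0 => PMF.pure []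
  | n + 1 => (PMF.uniformOfFintype Bool).bind fun b => (coins n).map fun l => b.toNat :: l

/-- The vector that an instruction produces from the input tapes `I` and the registers `s`.
Entrywise operations cut their operands to the shortest one. In `scatter`, the write with the largest
position in the index vector wins, and indices out of range are ignored. `read` shows a tape entry
`v` as `v + 1`, and `0` beyond the end of the tape. -/
def Instr.result (I : Tapes) (s : ℕ → List ℕ) : Instr → PMF (List ℕ)
  | .const _ c => PMF.pure [c]
  | .iota _ a => PMF.pure (List.range ((s a).headD 0))
  | .length _ a => PMF.pure [(s a).length]
  | .add _ a b => PMF.pure (List.zipWith (· + ·) (s a) (s b))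
  | .sub _ a b => PMF.pure (List.zipWith (· - ·) (s a) (s b))
  | .half _ a => PMF.pure ((s a).map (· / 2))
  | .less _ a b => PMF.pure (List.zipWith (fun x y => if x < y then 1 else 0) (s a) (s b))
  | .select _ m a b => PMF.pure
      (List.zipWith (fun c xy => if c ≠ 0 then xy.1 else xy.2) (s m) ((s a).zip (s b)))
  | .gather _ a i => PMF.pure ((s i).map fun j => (s a).getD j 0)
  | .scatter _ a i v => PMF.pure
      (((s i).zip (s v)).foldl (fun l jx => l.set jx.1 jx.2) (s a))
  | .flip _ a => coins (s a).length
  | .tapeLength _ k => PMF.pure [(I.getD k []).length]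
  | .read _ k i => PMF.pure
      ((s i).map fun j => ((I.getD k [])[j]?).elim 0 fun v => v + 1)
  | .emit a => PMF.pure (s a)

/-- Registers, output so far, elapsed parallel time, work done, and peak space. -/
structure State where
  regs : ℕ → List ℕ
  out : List ℕ
  time : ℕ
  work : ℕ
  space : ℕ

/-- The start: all registers and the output are empty. -/
def State.init : State := ⟨fun _ => [], [], 0, 0, 0⟩

/-- The number of bits held in the registers below `m`. -/
def regBits (m : ℕ) (s : ℕ → List ℕ) : ℕ :=
  ∑ r ∈ Finset.range m, ((s r).map fun v => Nat.size v + 1).sum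

/-- One unit of time and work, for the test of a branch or a loop. -/
def State.tick (s : State) : State := { s with time := s.time + 1, work := s.work + 1 }

/-- Execution of one instruction on a machine with `m` registers. -/
def Instr.exec (I : Tapes) (m : ℕ) (i : Instr) (s : State) : PMF State :=
  (i.result I s.regs).map fun v =>
    let regs' := match i.target with
      | some r => Function.update s.regs r v
      | none => s.regs
    { regs := regs'
      out := match i.target with
        | some _ => s.out
        | none => s.out ++ v
      time := s.time + 1
      work := s.work + 1 + (i.operands.map fun r => (s.regs r).length).sum + v.length
      space := max s.space (regBits m regs') }

/-- Programs. Branches and loops test whether the first entry of a register is nonzero. -/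
inductive Program : Type
  | instr (i : Instr)
  | seq (P Q : Program)
  | ite (r : ℕ) (P Q : Program)
  | while (r : ℕ) (P : Program)

/-- One more than the largest register that occurs in the program. -/
def Program.width : Program → ℕ
  | .instr i => (i.target.toList ++ i.operands).foldr (fun r m => max (r + 1) m) 0
  | .seq P Q => max P.width Q.width
  | .ite r P Q => max (r + 1) (max P.width Q.width)
  | .while r P => max (r + 1) P.width

/-- At most `fuel` iterations of a loop on register `r`; `none` if that is not enough. -/
def loop (r : ℕ) (body : State → PMF (Option State)) : ℕ → State → PMF (Option State)
  | 0, _ => PMF.pure none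
  | fuel + 1, s =>
    if (s.regs r).headD 0 ≠ 0 then
      (body s.tick).bind fun o => o.elim (PMF.pure none) fun s' => loop r body fuel s'
    else PMF.pure (some s.tick)

/-- Execution of a program in which every loop is cut off after `fuel` iterations; the result `none`
means that a loop was cut off. -/
def Program.exec (I : Tapes) (m fuel : ℕ) : Program → State → PMF (Option State)
  | .instr i, s => (i.exec I m s).map some
  | .seq P Q, s =>
      (P.exec I m fuel s).bind fun o => o.elim (PMF.pure none) fun s' => Q.exec I m fuel s'
  | .ite r P Q, s =>
      if (s.regs r).headD 0 ≠ 0 then P.exec I m fuel s.tick else Q.exec I m fuel s.tick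
  | .while r P, s => loop r (fun s' => P.exec I m fuel s') fuel s

/-- A parallel algorithm: a program, or the composite that runs a program `pre`, hands its output as
a binary word to the algorithm `A`, and then runs a program `post` on the original input
together with the answer of `A`. -/
inductive ParAlg : Type
  | prog (P : Program)
  | reduce (pre : Program) (A : ParAlg) (post : Program)

/-- Output, parallel time, work and space of a finished run. -/
structure Outcome where
  out : List ℕ
  time : ℕ
  work : ℕ
  space : ℕ

/-- A run of a program from the start. -/
def Program.run (fuel : ℕ) (P : Program) (I : Tapes) : PMF (Option Outcome) :=
  (P.exec I P.width fuel State.init).map fun o =>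
    o.map fun s => ⟨s.out, s.time, s.work, s.space⟩

/-- A run of a parallel algorithm; the costs of a composite are the sums of the costs of its parts.
The input of an algorithm on words consists of two tapes, the alphabet size and the word. The answer of
the inner algorithm is read as a binary word, that is, modulo 2. -/
def ParAlg.run (fuel : ℕ) : ParAlg → Tapes → PMF (Option Outcome)
  | .prog P, I => P.run fuel I
  | .reduce pre A post, I =>
      (pre.run fuel I).bind fun oa => oa.elim (PMF.pure none) fun a =>
      (A.run fuel [[2], a.out]).bind fun ob => ob.elim (PMF.pure none) fun b =>
      (post.run fuel (I ++ [b.out.map (· % 2)])).map fun oc => oc.map fun c =>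
        ⟨c.out, a.time + b.time + c.time, a.work + b.work + c.work,
          a.space + b.space + c.space⟩

/-- For all coin tosses, the algorithm halts on `I` within parallel time `t`, space `s` and total
work `w`, and its output satisfies `post`. -/
def ParAlg.RunsIn (A : ParAlg) (I : Tapes) (t s w : ℕ) (post : List ℕ → Prop) : Prop :=
  ∃ fuel, ∀ o ∈ (A.run fuel I).support,
    ∃ c, o = some c ∧ c.time ≤ t ∧ c.space ≤ s ∧ c.work ≤ w ∧ post c.out

/-- A word over `{0, …, q-1}` as the contents of a tape. -/
def tape {q : ℕ} (w : List (Fin q)) : List ℕ := w.map Fin.val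

/-- The class of parallel PPT algorithms (on binary words) that run in sequential time `T` and space
`S`, as functions of the input length. -/
def parPPT (T S : ℕ → ℕ) : Set ParAlg :=
  {A | ∃ P : Polynomial ℕ, ∀ z : List (Fin 2),
    A.RunsIn [[2], tape z] (T z.length) (S z.length) (P.eval z.length) fun _ => True}

/-! ### Codes -/

/-- Deterministic adaptive query algorithms (decision trees) on a word over `σ`, with output in `o`.
A query beyond the end of the word is answered by `none`. -/
inductive QueryTree (σ o : Type) : Type
  | output (b : o)
  | query (j : ℕ) (next : Option σ → QueryTree σ o)

/-- The output on the word `w`. -/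
def QueryTree.eval {σ o : Type} (w : List σ) : QueryTree σ o → o
  | .output b => b
  | .query j next => (next w[j]?).eval w

/-- The number of queries made to the word `w`. -/
def QueryTree.cost {σ o : Type} (w : List σ) : QueryTree σ o → ℕ
  | .output _ => 0
  | .query j next => (next w[j]?).cost w + 1

/-- A coding scheme `C[K, k, q₁, q₂]` with a possibly randomized encoder and a randomized decoder with
query access. A randomized query algorithm is a distribution over deterministic ones. The decoder
receives the index `i` and the length of the received word. -/
structure Code (K k q₁ q₂ : ℕ) where
  enc : (Fin k → Fin q₁) → PMF (Fin K → Fin q₂)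
  dec : Fin k → ℕ → PMF (QueryTree (Fin q₂) (Fin q₁))

variable {K k q₁ q₂ : ℕ}

/-- The probability that the decoder, on index `i` and with query access to `w`, outputs `b`. -/
def Code.decProb (C : Code K k q₁ q₂) (i : Fin k) (w : List (Fin q₂)) (b : Fin q₁) : ℝ :=
  prob (C.dec i w.length) {t | t.eval w = b}

/-- The corrupted word `w` of the codeword `y` of the message `x` fools the decoder. -/
def Code.Fool (C : Code K k q₁ q₂) (dist : List (Fin q₂) → List (Fin q₂) → ℝ≥0∞) (ρ p : ℝ)
    (x : Fin k → Fin q₁) (y : Fin K → Fin q₂) (w : List (Fin q₂)) : Prop :=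
  dist (List.ofFn y) w ≤ ENNReal.ofReal ρ ∧ ∃ i, C.decProb i w (x i) < p

/-- A codeword of `x` and a run of the adversary `A` on it. -/
def Code.attack (C : Code K k q₁ q₂) (A : ParAlg) (fuel : ℕ) (x : Fin k → Fin q₁) :
    PMF ((Fin K → Fin q₂) × Option Outcome) :=
  (C.enc x).bind fun y => (A.run fuel [[q₂], tape (List.ofFn y)]).map fun o => (y, o)

/-- `C` is an `(ℓ, ρ, p, ε, dist, 𝒜)`-locally decodable code against the class `𝒜`. The probability
that an adversary halts with loops cut off after `fuel` iterations, and fools the decoder, increases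
with `fuel`; the bound for every `fuel` is therefore the bound for the full run. -/
def Code.IsLDC (C : Code K k q₁ q₂) (ℓ : ℕ) (ρ p ε : ℝ)
    (dist : List (Fin q₂) → List (Fin q₂) → ℝ≥0∞) (𝒜 : Set ParAlg) : Prop :=
  (∀ (i : Fin k) (w : List (Fin q₂)), ∀ t ∈ (C.dec i w.length).support, t.cost w ≤ ℓ) ∧
  ∀ A ∈ 𝒜, ∀ (x : Fin k → Fin q₁) (fuel : ℕ),
    prob (C.attack A fuel x)
      {a | ∃ c w, a.2 = some c ∧ tape w = c.out ∧ C.Fool dist ρ p x a.1 w} ≤ ε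

/-! ### Hamming-to-InsDel compilers and closures -/

/-- A map on codewords, from words of length `K` over `q` letters to binary words of length
`len q K`, and two programs: `compile`, meant to compute this map, and `recover`, meant to
turn a corrupted binary word back into a word over `q` letters. -/
structure Compiler where
  len : ℕ → ℕ → ℕ
  map : ∀ {q K : ℕ}, (Fin K → Fin q) → (Fin (len q K) → Fin 2)
  compile : Program
  recover : Program

/-- The closure of a class of algorithms with respect to the reduction that sends `A` to
`recover ∘ A ∘ compile`: the least class that contains the reduction of every `A` in `𝒞`. -/
def Compiler.closure (R : Compiler) (𝒞 : Set ParAlg) : Set ParAlg :=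
  {B | ∃ A ∈ 𝒞, B = ParAlg.reduce R.compile A R.recover}

/-- A polylogarithmic bound of degree `a`. -/
def polylog (a n : ℕ) : ℕ := a * (Nat.log 2 n + 1) ^ a

/-- On words of length `K` over `q` letters, with `n = len q K`: the program `compile` computes the
compiled word, `recover` halts on every corrupted word, and both run in parallel time
`polylog n`, with space and total work `n * polylog n`. -/
def Compiler.RunsInPolylog (R : Compiler) (a q K : ℕ) : Prop :=
  ∀ y : Fin K → Fin q,
    (ParAlg.prog R.compile).RunsIn [[q], tape (List.ofFn y)] (polylog a (R.len q K))
      (R.len q K * polylog a (R.len q K)) (R.len q K * polylog a (R.len q K))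
      (fun z => z = tape (List.ofFn (R.map y))) ∧
    ∀ w : List (Fin 2),
      (ParAlg.prog R.recover).RunsIn [[q], tape (List.ofFn y), tape w] (polylog a (R.len q K))
        (R.len q K * polylog a (R.len q K)) (R.len q K * polylog a (R.len q K)) (fun _ => True)

end InsDelLDC

end

open InsDelLDC

namespace InsDelLDC

/-! ### Deterministic runs with resource bounds -/

/-! The code. The symbols of a codeword of `C` are collected into groups of `O(log K)` bits. Each
group becomes a block: a long marker of zeros, then `2 ^ η` codewords of a short inner code, which
together spell out the number of the block and its symbols. The inner code has messages of `m` bits,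
where `m` is of the order of `log K`, and length `2 ^ 14 * m`. It comes from a multiply-shift hash
function, with a one after each hash bit. Close words are few (`card_close_le`) and the hash is
pairwise independent up to constants (`card_hash_le`), so a union bound yields a seed for which a
constant fraction of edits can be corrected (`exists_goodSeed`). The constant in `m` is small enough
that tables over all seeds and all words of the inner length have `O(n)` entries; hence the programs
find the seed and the decoding table by exhaustive search.

Labels. A position of the received word gets a label if what follows looks like a block: few ones
where the marker should be, and windows that decode to pieces with the right numbers. If a block
suffers at most `m` edits, then the `m` positions from its start on carry the right label. If two
neighbouring blocks are both that lightly corrupted, every label in the image of the first is the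
content of one of the two, and sits near the start of that block (`Layout.labelAt_ne_zero`): inside
a block, a window as long as the marker meets too many of the ones that the codewords contain. So
wrong labels occur only next to heavily corrupted blocks.

The search. A block is locally good if at every scale there are few edits around it. A covering
argument (`card_not_locallyGood_mul_le`) bounds the number of other blocks by a constant times
(edits) / `m`, so a small edit distance spoils a small fraction of the symbols
(`hamDist_decoded_le`). A locally good block `i` is found by a noisy search. A label at position `x`
that names block `j` suggests the offset `x - j * B`, where `B` is the length of a block, and near a
good block the true offsets drift very slowly. If the offset is known up to `P / 2`, random
positions from a window of length `2 * P` hit more starts of blocks than wrong labels, so a majority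
vote over the labels halves the uncertainty (`searchStep_close`, `Layout.step_close`). After `O(log
n)` rounds a scan of half a block reads off the label (`Layout.decodeBlock_eq`). With `O(log² n)`
samples, Chernoff bounds and a union over all scales and windows leave a failure probability of
about `2 ^ (-log² n)` times a polynomial (`measure_exists_not_faithful`), which is negligible. A
label costs `B = O(log n)` queries, so a symbol costs `O(log⁴ n)` (`queryCount_le`).

The reduction. One set of coins serves all blocks and all scales. Once the coins are fixed, a
received word `w` determines a decoded word over the large alphabet. The new decoder tosses these
coins and runs the old decoder on that word; `recover` tosses them and outputs the whole word. If
`w` fools the new decoder at index `i`, then the success probability of the old decoder has mean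
below `pf`; by Markov's inequality it reaches `p` with probability at most `pf / p`. Apart from the
failure probability of the sampling, the decoded word is within Hamming distance `ρ`. So `recover`
turns `w` into a word that fools the old decoder with probability at least `1 - pf / p - failure n`
(`Code.Fool.decoded`). Averaging over the codeword and the adversary gives the bound for `ε_f`
(`Implements.attack_le`, `Implements.isLDC`). Here `ϑ₁ = 0` and `ϑ₂ = failure`.

The programs. Both programs are written in a small language of data-parallel stages: in a stage all
lanes run the same loop-bounded code. `Cmd.leads` translates a stage into vector instructions and
bounds its time. Lengths stay below `n * polylog n`, and the largest value at most doubles in a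
step, so entries have polylogarithmically many bits; this bounds space and work. The remaining
verification uses loop invariants that match each program with its mathematical definition. -/

/-- Register contents. -/
abbrev Regs : Type := ℕ → List ℕ

/-- The result of an instruction other than `flip`. -/
def Instr.val (I : Tapes) (s : Regs) : Instr → List ℕ
  | .const _ c => [c]
  | .iota _ a => List.range ((s a).headD 0)
  | .length _ a => [(s a).length]
  | .add _ a b => List.zipWith (· + ·) (s a) (s b)
  | .sub _ a b => List.zipWith (· - ·) (s a) (s b)
  | .half _ a => (s a).map (· / 2)
  | .less _ a b => List.zipWith (fun x y => if x < y then 1 else 0) (s a) (s b)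
  | .select _ m a b =>
      List.zipWith (fun c xy => if c ≠ 0 then xy.1 else xy.2) (s m) ((s a).zip (s b))
  | .gather _ a i => (s i).map fun j => (s a).getD j 0
  | .scatter _ a i v => ((s i).zip (s v)).foldl (fun l jx => l.set jx.1 jx.2) (s a)
  | .flip _ _ => []
  | .tapeLength _ k => [(I.getD k []).length]
  | .read _ k i => (s i).map fun j => ((I.getD k [])[j]?).elim 0 fun v => v + 1
  | .emit a => s a

/-- The state after an instruction whose result is `v`. -/
def Instr.after (m : ℕ) (i : Instr) (v : List ℕ) (s : State) : State :=
  let regs' := match i.target with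
    | some r => Function.update s.regs r v
    | none => s.regs
  { regs := regs'
    out := match i.target with
      | some _ => s.out
      | none => s.out ++ v
    time := s.time + 1
    work := s.work + 1 + (i.operands.map fun r => (s.regs r).length).sum + v.length
    space := max s.space (regBits m regs') }

theorem Instr.exec_eq_map (I : Tapes) (m : ℕ) (i : Instr) (s : State) :
    i.exec I m s = (i.result I s.regs).map fun v => i.after m v s := rfl

/-- Side conditions under which an instruction keeps within the length bound `Λ` and the value
bound `V`. -/
def Instr.Fits (I : Tapes) (Λ V : ℕ) (s : Regs) : Instr → Prop
  | .const _ c => c ≤ V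
  | .iota _ a => (s a).headD 0 ≤ Λ
  | .tapeLength _ k => (I.getD k []).length ≤ V
  | .flip _ _ => False
  | _ => True

/-- Bounds on a state: lengths at most `Λ`, values at most doubling in every step. -/
structure Bounded (m Λ V : ℕ) (s : State) : Prop where
  len : ∀ r, (s.regs r).length ≤ Λ
  val : ∀ r, ∀ v ∈ s.regs r, v ≤ V * 2 ^ s.time
  work : s.work ≤ s.time * (4 * Λ + 1)
  space : s.space ≤ m * (Λ * (Nat.size (V * 2 ^ s.time) + 1))

/-- Bounds on the tapes. -/
structure TapesFit (I : Tapes) (Λ V : ℕ) : Prop where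
  pos : 1 ≤ Λ
  le : Λ ≤ V
  entry : ∀ k, ∀ v ∈ I.getD k [], v + 1 ≤ V

theorem regBits_le {m Λ V : ℕ} {s : Regs} (hl : ∀ r, (s r).length ≤ Λ)
    (hv : ∀ r, ∀ v ∈ s r, v ≤ V) : regBits m s ≤ m * (Λ * (Nat.size V + 1)) := by
  unfold regBits
  refine (Finset.sum_le_card_nsmul _ _ (Λ * (Nat.size V + 1)) ?_).trans (by simp)
  intro r _
  refine (List.sum_le_card_nsmul _ (Nat.size V + 1) ?_).trans ?_
  · intro x hx
    obtain ⟨v, hv', rfl⟩ := List.mem_map.1 hx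
    exact Nat.succ_le_succ (Nat.size_le_size (hv r v hv'))
  · rw [List.length_map, smul_eq_mul]
    exact Nat.mul_le_mul_right _ (hl r)

theorem operands_length_le (i : Instr) : i.operands.length ≤ 3 := by
  cases i <;> simp [Instr.operands]

theorem Bounded.after {m Λ V : ℕ} {s : State} (hs : Bounded m Λ V s) {i : Instr} {v : List ℕ}
    (hl : v.length ≤ Λ) (hv : ∀ x ∈ v, x ≤ V * 2 ^ (s.time + 1)) :
    Bounded m Λ V (i.after m v s) := by
  have h2 : V * 2 ^ s.time ≤ V * 2 ^ (s.time + 1) :=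
    Nat.mul_le_mul_left _ (Nat.pow_le_pow_right (by norm_num) (by omega))
  have hlen : ∀ r, ((i.after m v s).regs r).length ≤ Λ := by
    intro r
    unfold Instr.after
    cases h : i.target with
    | none => simpa [h] using hs.len r
    | some t =>
      by_cases hr : r = t
      · subst hr; simpa [h] using hl
      · simpa [h, Function.update_of_ne hr] using hs.len r
  have hval : ∀ r, ∀ x ∈ (i.after m v s).regs r, x ≤ V * 2 ^ (s.time + 1) := by
    intro r
    unfold Instr.after
    cases h : i.target with
    | none => simpa [h] using fun x hx => (hs.val r x hx).trans h2
    | some t =>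
      by_cases hr : r = t
      · subst hr; simpa [h] using hv
      · simpa [h, Function.update_of_ne hr] using fun x hx => (hs.val r x hx).trans h2
  refine ⟨hlen, hval, ?_, ?_⟩
  -- At most three operands and one result, each of length at most `Λ`, plus the unit charge: hence
  -- `4 * Λ + 1` units of work per step.
  · have h3 : (i.operands.map fun r => (s.regs r).length).sum ≤ 3 * Λ := by
      refine (List.sum_le_card_nsmul _ Λ ?_).trans ?_
      · intro x hx
        obtain ⟨r, _, rfl⟩ := List.mem_map.1 hx
        exact hs.len r
      · simpa using Nat.mul_le_mul_right _ (operands_length_le i)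
    have := hs.work
    simp only [Instr.after]
    have e : (s.time + 1) * (4 * Λ + 1) = s.time * (4 * Λ + 1) + (4 * Λ + 1) := by ring
    omega
  · have h1 := regBits_le (m := m) hlen hval
    have h3 : m * (Λ * (Nat.size (V * 2 ^ s.time) + 1))
        ≤ m * (Λ * (Nat.size (V * 2 ^ (s.time + 1)) + 1)) := by
      have := Nat.size_le_size h2
      gcongr
    exact max_le (hs.space.trans h3) h1

theorem mem_zipWith_le {α β : Type} {f : α → β → ℕ} {B : ℕ} {u : List α} {v : List β}
    (h : ∀ a ∈ u, ∀ b ∈ v, f a b ≤ B) : ∀ x ∈ List.zipWith f u v, x ≤ B := by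
  induction u generalizing v with
  | nil => simp
  | cons a u ih =>
    cases v with
    | nil => simp
    | cons b v =>
      intro x hx
      rcases List.mem_cons.1 hx with rfl | hx
      · exact h _ (by simp) _ (by simp)
      · exact ih (fun a ha b hb => h a (by simp [ha]) b (by simp [hb])) x hx

theorem foldl_set_length (w : List (ℕ × ℕ)) (l : List ℕ) :
    (w.foldl (fun l jx => l.set jx.1 jx.2) l).length = l.length := by
  induction w generalizing l with
  | nil => rfl
  | cons a w ih => simp [ih]

theorem foldl_set_mem_le {B : ℕ} (w : List (ℕ × ℕ)) (l : List ℕ) (hw : ∀ p ∈ w, p.2 ≤ B)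
    (hl : ∀ x ∈ l, x ≤ B) : ∀ x ∈ w.foldl (fun l jx => l.set jx.1 jx.2) l, x ≤ B := by
  induction w generalizing l with
  | nil => simpa using hl
  | cons a w ih =>
    refine ih _ (fun p hp => hw p (by simp [hp])) ?_
    intro x hx
    rcases List.mem_or_eq_of_mem_set hx with h | rfl
    · exact hl x h
    · exact hw _ (by simp)

theorem getD_le {B : ℕ} {l : List ℕ} (hl : ∀ x ∈ l, x ≤ B) (j : ℕ) : l.getD j 0 ≤ B := by
  rw [List.getD_eq_getElem?_getD]
  cases h : l[j]? with
  | none => simp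
  | some x => simpa using hl x (List.mem_of_getElem? h)

/-- Addition is the only instruction that can exceed the values present, and it at most doubles the
maximum. Constants, lengths and tape entries lie below `V`. As there is no multiplication, entries
gain at most one bit per step. -/
theorem Instr.val_bounds {I : Tapes} {m Λ V : ℕ} (hI : TapesFit I Λ V) {s : State}
    (hs : Bounded m Λ V s) {i : Instr} (hi : i.Fits I Λ V s.regs) :
    (i.val I s.regs).length ≤ Λ ∧ ∀ x ∈ i.val I s.regs, x ≤ V * 2 ^ (s.time + 1) := by
  have hp : 1 ≤ 2 ^ s.time := Nat.one_le_two_pow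
  have e : V * 2 ^ (s.time + 1) = V * 2 ^ s.time + V * 2 ^ s.time := by ring
  have hV : V ≤ V * 2 ^ s.time := Nat.le_mul_of_pos_right _ hp
  have hΛ := hI.pos
  have hΛV := hI.le
  have hl := hs.len
  have hv := hs.val
  rw [e]
  generalize V * 2 ^ s.time = U at *
  cases i with
  | const r c => simp [Instr.val, Instr.Fits] at *; omega
  | iota r a =>
    simp only [Instr.val, Instr.Fits, List.length_range, List.mem_range] at *
    exact ⟨hi, fun x hx => by omega⟩
  | length r a => have := hl a; simp [Instr.val] at *; omega
  | add r a b =>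
    refine ⟨?_, mem_zipWith_le fun x hx y hy => Nat.add_le_add (hv a x hx) (hv b y hy)⟩
    simp only [Instr.val, List.length_zipWith]; exact (min_le_left _ _).trans (hl a)
  | sub r a b =>
    refine ⟨?_, mem_zipWith_le fun x hx y hy => ?_⟩
    · simp only [Instr.val, List.length_zipWith]; exact (min_le_left _ _).trans (hl a)
    · have := hv a x hx; omega
  | half r a =>
    refine ⟨by simpa [Instr.val] using hl a, fun x hx => ?_⟩
    obtain ⟨y, hy, rfl⟩ := List.mem_map.1 hx
    have := hv a y hy
    omega
  | less r a b =>
    refine ⟨?_, mem_zipWith_le fun x hx y hy => ?_⟩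
    · simp only [Instr.val, List.length_zipWith]; exact (min_le_left _ _).trans (hl a)
    · split_ifs <;> omega
  | select r c a b =>
    refine ⟨?_, mem_zipWith_le fun x hx y hy => ?_⟩
    · simp only [Instr.val, List.length_zipWith]; exact (min_le_left _ _).trans (hl c)
    · have h1 := hv a y.1 (List.of_mem_zip hy).1
      have h2 := hv b y.2 (List.of_mem_zip hy).2
      split_ifs <;> omega
  | gather r a j =>
    refine ⟨by simpa [Instr.val] using hl j, fun x hx => ?_⟩
    obtain ⟨y, hy, rfl⟩ := List.mem_map.1 hx
    have := getD_le (hv a) y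
    omega
  | scatter r a j v =>
    refine ⟨by simpa [Instr.val, foldl_set_length] using hl a, ?_⟩
    refine foldl_set_mem_le _ _ (fun p hp => ?_) (fun x hx => ?_)
    · have := hv v p.2 (List.of_mem_zip (a := p.1) hp).2; omega
    · have := hv a x hx; omega
  | flip r a => exact hi.elim
  | tapeLength r k => simp only [Instr.val, Instr.Fits, List.length_singleton, List.mem_singleton, forall_eq] at *; omega
  | read r k j =>
    refine ⟨by simpa [Instr.val] using hl j, fun x hx => ?_⟩
    obtain ⟨y, hy, rfl⟩ := List.mem_map.1 hx
    cases h : (I.getD k [])[y]? with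
    | none => simp
    | some z => have := hI.entry k z (List.mem_of_getElem? h); simp only [Option.elim]; omega
  | emit a =>
    refine ⟨hl a, fun x hx => ?_⟩
    have := hv a x hx
    omega

/-- From `s` the program `P` certainly reaches `s'` within time `t`, and stays within bounds. -/
structure Runs (I : Tapes) (m Λ V : ℕ) (P : Program) (s s' : State) (t : ℕ) : Prop where
  exec : ∀ fuel, t < fuel → P.exec I m fuel s = PMF.pure (some s')
  le : s.time ≤ s'.time
  time : s'.time ≤ s.time + t
  bdd : Bounded m Λ V s → Bounded m Λ V s'

section
variable {I : Tapes} {m Λ V : ℕ}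

theorem Runs.mono {P : Program} {s s' : State} {t u : ℕ} (h : Runs I m Λ V P s s' t)
    (htu : t ≤ u) : Runs I m Λ V P s s' u :=
  ⟨fun f hf => h.exec f (by omega), h.le, by have := h.time; omega, h.bdd⟩

theorem Runs.instr (hI : TapesFit I Λ V) {i : Instr} {s : State} (hi : i.Fits I Λ V s.regs) :
    Runs I m Λ V (.instr i) s (i.after m (i.val I s.regs) s) 1 := by
  refine ⟨fun f _ => ?_, by simp [Instr.after], by simp [Instr.after], fun hs => ?_⟩
  · have : i.result I s.regs = PMF.pure (i.val I s.regs) := by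
      cases i <;> first | rfl | exact hi.elim
    simp [Program.exec, Instr.exec_eq_map, this, PMF.pure_map]
  · obtain ⟨h1, h2⟩ := Instr.val_bounds hI hs hi
    exact hs.after h1 h2

theorem Runs.seq {P Q : Program} {s s' s'' : State} {t u : ℕ} (h : Runs I m Λ V P s s' t)
    (h' : Runs I m Λ V Q s' s'' u) : Runs I m Λ V (.seq P Q) s s'' (t + u) := by
  refine ⟨fun f hf => ?_, h.le.trans h'.le, by have := h.time; have := h'.time; omega,
    fun hs => h'.bdd (h.bdd hs)⟩
  simp [Program.exec, h.exec f (by omega), h'.exec f (by omega), PMF.pure_bind]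

theorem Bounded.tick {s : State} (h : Bounded m Λ V s) : Bounded m Λ V s.tick := by
  have h2 : V * 2 ^ s.time ≤ V * 2 ^ (s.time + 1) :=
    Nat.mul_le_mul_left _ (Nat.pow_le_pow_right (by norm_num) (by omega))
  refine ⟨h.len, fun r v hv => (h.val r v hv).trans h2, ?_, h.space.trans ?_⟩
  · have := h.work
    simp only [State.tick]
    have e : (s.time + 1) * (4 * Λ + 1) = s.time * (4 * Λ + 1) + (4 * Λ + 1) := by ring
    omega
  · have := Nat.size_le_size h2
    simp only [State.tick]
    gcongr

end

/-! ### A language of data-parallel stages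

Registers below `90` hold arrays, registers `90, …, 99` counters, registers `100, …, 139` the
variables of the lanes of a stage, and the others temporary values. -/

/-- The first entry of a register. -/
def hd (A : Regs) (a : ℕ) : ℕ := (A a).headD 0

/-- Expressions evaluated in every lane: `var` is a lane variable, `par` the first entry of an array,
`get` an array access and `rd` an access to an input tape. -/
inductive Ex : Type
  | var (x : ℕ)
  | lit (c : ℕ)
  | par (a : ℕ)
  | add (e f : Ex)
  | sub (e f : Ex)
  | half (e : Ex)
  | less (e f : Ex)
  | sel (c e f : Ex)
  | get (a : ℕ) (e : Ex)
  | rd (k : ℕ) (e : Ex)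

namespace Ex

/-- The value of an expression. -/
def eval (I : Tapes) (A : Regs) (ρ : ℕ → ℕ) : Ex → ℕ
  | var x => ρ x
  | lit c => c
  | par a => hd A a
  | add e f => e.eval I A ρ + f.eval I A ρ
  | sub e f => e.eval I A ρ - f.eval I A ρ
  | half e => e.eval I A ρ / 2
  | less e f => if e.eval I A ρ < f.eval I A ρ then 1 else 0
  | sel c e f => if c.eval I A ρ ≠ 0 then e.eval I A ρ else f.eval I A ρ
  | get a e => (A a).getD (e.eval I A ρ) 0
  | rd k e => ((I.getD k [])[e.eval I A ρ]?).elim 0 fun v => v + 1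

/-- Well-formedness: registers are within their ranges. -/
def ok : Ex → Bool
  | var x => decide (x < 40)
  | lit _ => true
  | par a => decide (a < 90)
  | add e f => e.ok && f.ok
  | sub e f => e.ok && f.ok
  | half e => e.ok
  | less e f => e.ok && f.ok
  | sel c e f => c.ok && e.ok && f.ok
  | get a e => decide (a < 90) && e.ok
  | rd _ e => e.ok

/-- The largest constant. -/
def maxLit : Ex → ℕ
  | var _ => 0
  | lit c => c
  | par _ => 0
  | add e f => max e.maxLit f.maxLit
  | sub e f => max e.maxLit f.maxLit
  | half e => e.maxLit
  | less e f => max e.maxLit f.maxLit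
  | sel c e f => max c.maxLit (max e.maxLit f.maxLit)
  | get _ e => e.maxLit
  | rd _ e => e.maxLit

/-- The number of instructions. -/
def cost : Ex → ℕ
  | var _ => 2
  | lit _ => 3
  | par _ => 2
  | add e f => e.cost + f.cost + 1
  | sub e f => e.cost + f.cost + 1
  | half e => e.cost + 1
  | less e f => e.cost + f.cost + 1
  | sel c e f => c.cost + e.cost + f.cost + 1
  | get _ e => e.cost + 1
  | rd _ e => e.cost + 1

/-- Code that computes the expression in all lanes, in register `t`, with temporary registers from
`t` on. -/
def code : Ex → ℕ → Program
  | var x, t => .seq (.instr (.add t (100 + x) (100 + x))) (.instr (.half t t))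
  | lit c, t => .seq (.instr (.const (t + 1) c))
      (.seq (.instr (.sub t 100 100)) (.instr (.gather t (t + 1) t)))
  | par a, t => .seq (.instr (.sub t 100 100)) (.instr (.gather t a t))
  | add e f, t => .seq (e.code t) (.seq (f.code (t + 1)) (.instr (.add t t (t + 1))))
  | sub e f, t => .seq (e.code t) (.seq (f.code (t + 1)) (.instr (.sub t t (t + 1))))
  | half e, t => .seq (e.code t) (.instr (.half t t))
  | less e f, t => .seq (e.code t) (.seq (f.code (t + 1)) (.instr (.less t t (t + 1))))
  | sel c e f, t => .seq (c.code t) (.seq (e.code (t + 1)) (.seq (f.code (t + 2))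
      (.instr (.select t t (t + 1) (t + 2)))))
  | get a e, t => .seq (e.code t) (.instr (.gather t a t))
  | rd k e, t => .seq (e.code t) (.instr (.read t k t))

end Ex

/-- The lane variables of `N` lanes are `ρ`. -/
def Lanes (N : ℕ) (ρ : ℕ → ℕ → ℕ) (s : Regs) : Prop :=
  ∀ x < 40, s (100 + x) = (List.range N).map fun l => ρ l x

/-- The arrays are `A`. -/
def Arrays (A : Regs) (s : Regs) : Prop := ∀ a < 90, s a = A a

section
variable {I : Tapes} {m Λ V : ℕ}

/-- `P` leads from `s`, within time `t` and without output, to registers that satisfy `Q`. -/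
def Leads (I : Tapes) (m Λ V : ℕ) (P : Program) (s : State) (t : ℕ) (Q : Regs → Prop) : Prop :=
  ∃ s', Runs I m Λ V P s s' t ∧ s'.out = s.out ∧ Q s'.regs

theorem Leads.mono {P : Program} {s : State} {t u : ℕ} {Q Q' : Regs → Prop}
    (h : Leads I m Λ V P s t Q) (htu : t ≤ u) (hQ : ∀ r, Q r → Q' r) :
    Leads I m Λ V P s u Q' := by
  obtain ⟨s', h1, h2, h3⟩ := h
  exact ⟨s', h1.mono htu, h2, hQ _ h3⟩

theorem Leads.seq {P P' : Program} {s : State} {t u : ℕ} {Q Q' : Regs → Prop}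
    (h : Leads I m Λ V P s t Q)
    (h' : ∀ s' : State, Q s'.regs → Leads I m Λ V P' s' u Q') :
    Leads I m Λ V (.seq P P') s (t + u) Q' := by
  obtain ⟨s', h1, h2, h3⟩ := h
  obtain ⟨s'', h4, h5, h6⟩ := h' s' h3
  exact ⟨s'', h1.seq h4, h5.trans h2, h6⟩

theorem Leads.instr (hI : TapesFit I Λ V) {i : Instr} {s : State} (hi : i.Fits I Λ V s.regs)
    {r : ℕ} (hr : i.target = some r) :
    Leads I m Λ V (.instr i) s 1 fun s' => s' = Function.update s.regs r (i.val I s.regs) := by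
  refine ⟨_, Runs.instr hI hi, ?_, ?_⟩ <;> simp [Instr.after, hr]

/-- The machine has no move instruction; a register is copied by adding it to itself and halving. -/
theorem add_half (l : List ℕ) : (List.zipWith (· + ·) l l).map (· / 2) = l := by
  rw [List.zipWith_self, List.map_map]
  conv_rhs => rw [← List.map_id l]
  exact List.map_congr_left fun a _ => by simp only [Function.comp, id]; omega

theorem Leads.copy (hI : TapesFit I Λ V) {s : State} (r a : ℕ) :
    Leads I m Λ V (.seq (.instr (.add r a a)) (.instr (.half r r))) s 2
      fun s' => s' = Function.update s.regs r (s.regs a) := by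
  refine Leads.seq (u := 1) (Leads.instr hI (by trivial) rfl) fun s' h => ?_
  refine Leads.mono (Leads.instr hI (by trivial) rfl) le_rfl fun r' h' => ?_
  rw [h', h]
  simp only [Instr.val, Function.update_self, add_half, Function.update_idem]

/-- A loop that runs `n` times, with an invariant. -/
theorem Leads.loop {r : ℕ} {P : Program} {u n : ℕ} {Q : ℕ → Regs → Prop}
    (hr : ∀ k ≤ n, ∀ A, Q k A → (hd A r = 0 ↔ k = n))
    (hb : ∀ k < n, ∀ s : State, Q k s.regs → Leads I m Λ V P s.tick u (Q (k + 1)))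
    {s : State} (h0 : Q 0 s.regs) : Leads I m Λ V (.while r P) s (n * (u + 1) + 1) (Q n) := by
  -- Induction on the number `j` of remaining iterations. Fuel plays two roles: `g` counts the
  -- iterations of this loop, and `fuel` is passed on to the body, so it is irrelevant when `j = 0`.
  have key : ∀ j k, k + j = n → ∀ s : State, Q k s.regs → ∃ s' : State,
      (∀ fuel, j = 0 ∨ u < fuel → ∀ g > j, InsDelLDC.loop r (fun s => P.exec I m fuel s) g s
        = PMF.pure (some s')) ∧
      s.time ≤ s'.time ∧ s'.time ≤ s.time + (j * (u + 1) + 1) ∧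
      (Bounded m Λ V s → Bounded m Λ V s') ∧ s'.out = s.out ∧ Q n s'.regs := by
    intro j
    induction j with
    | zero =>
      rintro k hk s hs
      obtain rfl : k = n := hk
      have h1 : (s.regs r).headD 0 = 0 := (hr k le_rfl _ hs).2 rfl
      refine ⟨s.tick, fun fuel _ g hg => ?_, by simp [State.tick], by simp [State.tick],
        Bounded.tick, rfl, hs⟩
      obtain ⟨g, rfl⟩ := Nat.exists_eq_succ_of_ne_zero hg.ne'
      rw [InsDelLDC.loop, if_neg (not_not.2 h1)]
    | succ j ih =>
      rintro k hk s hs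
      have h1 : (s.regs r).headD 0 ≠ 0 := fun h => by
        have := (hr k (by omega) _ hs).1 h; omega
      obtain ⟨s1, g1, g2, g3⟩ := hb k (by omega) s hs
      obtain ⟨s2, f1, f2, f3, f4, f5, f6⟩ := ih (k + 1) (by omega) s1 g3
      have t1 := g1.le
      have t2 := g1.time
      simp only [State.tick] at t1 t2
      have e : (j + 1) * (u + 1) = j * (u + 1) + (u + 1) := by ring
      refine ⟨s2, fun fuel hf g hg => ?_, by omega, by omega, fun h => f4 (g1.bdd h.tick),
        f5.trans g2, f6⟩
      obtain ⟨g, rfl⟩ := Nat.exists_eq_succ_of_ne_zero (Nat.ne_zero_of_lt hg)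
      rw [InsDelLDC.loop, if_pos h1, g1.exec fuel (by omega), PMF.pure_bind]
      exact f1 fuel (by omega) g (by omega)
  obtain ⟨s', h1, h2, h3, h4, h5, h6⟩ := key n 0 (by omega) s h0
  refine ⟨s', ⟨fun fuel hf => h1 fuel ?_ fuel ?_, h2, h3, h4⟩, h5, h6⟩
  · rcases Nat.eq_zero_or_pos n with rfl | hn
    · exact Or.inl rfl
    · have := Nat.le_mul_of_pos_left (u + 1) hn; omega
  · have : n ≤ n * (u + 1) := Nat.le_mul_of_pos_right n (Nat.succ_pos u); omega

/-- Temporaries form a stack from `t` on: the code leaves registers below `t` alone, so operands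
that are already evaluated survive. A constant or an array head is broadcast to all lanes by
gathering at the zero vector, which is register `100` minus itself. -/
theorem Ex.leads (hI : TapesFit I Λ V) {A : Regs} {N : ℕ} {ρ : ℕ → ℕ → ℕ} (e : Ex)
    (he : e.ok = true) (hV : e.maxLit ≤ V) (t : ℕ) (ht : 140 ≤ t) (s : State)
    (hA : Arrays A s.regs) (hρ : Lanes N ρ s.regs) :
    Leads I m Λ V (e.code t) s e.cost fun s' =>
      s' t = (List.range N).map (fun l => e.eval I A (ρ l)) ∧ ∀ r < t, s' r = s.regs r := by
  induction e generalizing t s with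
  | var x =>
    simp only [ok, decide_eq_true_eq] at he
    refine (Leads.copy hI t (100 + x)).mono le_rfl fun r h => ?_
    rw [h]
    refine ⟨by simp [hρ x he, eval], fun r hr => Function.update_of_ne (by omega) _ _⟩
  | lit c =>
    refine Leads.seq (u := 2) (Leads.instr hI (by simpa [Instr.Fits, maxLit] using hV) rfl) fun s1 h1 => ?_
    refine Leads.seq (u := 1) (Leads.instr hI (by trivial) rfl) fun s2 h2 => ?_
    refine Leads.mono (Leads.instr hI (by trivial) rfl) le_rfl fun r h3 => ?_
    have h0 := hρ 0 (by norm_num)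
    rw [h3, h2, h1]
    refine ⟨?_, fun r hr => ?_⟩
    · have e1 : (100 : ℕ) ≠ t + 1 := by omega
      simp only [add_zero] at h0
      simp [Instr.val, h0, e1, eval, Function.comp_def, List.map_const']
    · simp [Function.update_of_ne (show r ≠ t by omega), Function.update_of_ne (show r ≠ t + 1 by omega)]
  | par a =>
    simp only [ok, decide_eq_true_eq] at he
    refine Leads.seq (u := 1) (Leads.instr hI (by trivial) rfl) fun s2 h2 => ?_
    refine Leads.mono (Leads.instr hI (by trivial) rfl) le_rfl fun r h3 => ?_
    have h0 := hρ 0 (by norm_num)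
    rw [h3, h2]
    refine ⟨?_, fun r hr => ?_⟩
    · have e1 : a ≠ t := by omega
      simp only [add_zero] at h0
      have : (A a).getD 0 0 = hd A a := by unfold hd; cases A a <;> simp
      simp [Instr.val, h0, e1, eval, hA a he, ← this, Function.comp_def, List.map_const']
    · simp [Function.update_of_ne (show r ≠ t by omega)]
  | add e f ihe ihf | sub e f ihe ihf | less e f ihe ihf =>
    simp only [ok, Bool.and_eq_true] at he
    simp only [maxLit, max_le_iff] at hV
    refine ((ihe he.1 hV.1 t ht s hA hρ).seq (u := f.cost + 1) (fun s1 h1 =>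
      (ihf he.2 hV.2 (t + 1) (by omega) s1 (fun a ha => by rw [h1.2 a (by omega), hA a ha])
      (fun x hx => by rw [h1.2 _ (by omega), hρ x hx])).seq fun s2 h2 => ?_)).mono
      (by simp only [cost]; omega) fun r h => h
    refine Leads.mono (Leads.instr hI (by trivial) rfl) le_rfl fun r h3 => ?_
    rw [h3]
    refine ⟨?_, fun r hr => ?_⟩
    · simp [Instr.val, h2.1, h2.2 t (by omega), h1.1, eval]
    · rw [Function.update_of_ne (by omega), h2.2 r (by omega), h1.2 r hr]
  | half e ihe =>
    refine (ihe he hV t ht s hA hρ).seq fun s1 h1 => ?_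
    refine Leads.mono (Leads.instr hI (by trivial) rfl) le_rfl fun r h3 => ?_
    rw [h3]
    refine ⟨by simp [Instr.val, h1.1, eval, Function.comp_def], fun r hr => ?_⟩
    rw [Function.update_of_ne (by omega), h1.2 r hr]
  | get a e ihe =>
    simp only [ok, Bool.and_eq_true, decide_eq_true_eq] at he
    refine (ihe he.2 hV t ht s hA hρ).seq fun s1 h1 => ?_
    refine Leads.mono (Leads.instr hI (by trivial) rfl) le_rfl fun r h3 => ?_
    rw [h3]
    refine ⟨by simp [Instr.val, h1.1, eval, h1.2 a (by omega), hA a he.1], fun r hr => ?_⟩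
    rw [Function.update_of_ne (by omega), h1.2 r hr]
  | rd k e ihe =>
    refine (ihe he hV t ht s hA hρ).seq fun s1 h1 => ?_
    refine Leads.mono (Leads.instr hI (by trivial) rfl) le_rfl fun r h3 => ?_
    rw [h3]
    refine ⟨by simp [Instr.val, h1.1, eval], fun r hr => ?_⟩
    rw [Function.update_of_ne (by omega), h1.2 r hr]
  | sel c e f ihc ihe ihf =>
    simp only [ok, Bool.and_eq_true] at he
    simp only [maxLit, max_le_iff] at hV
    refine ((ihc he.1.1 hV.1 t ht s hA hρ).seq (u := e.cost + (f.cost + 1)) (fun s0 h0 =>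
      (ihe he.1.2 hV.2.1 (t + 1) (by omega) s0 (fun a ha => by rw [h0.2 a (by omega), hA a ha])
      (fun x hx => by rw [h0.2 _ (by omega), hρ x hx])).seq fun s1 h1 =>
      (ihf he.2 hV.2.2 (t + 2) (by omega) s1
        (fun a ha => by rw [h1.2 a (by omega), h0.2 a (by omega), hA a ha])
        (fun x hx => by rw [h1.2 _ (by omega), h0.2 _ (by omega), hρ x hx])).seq
          fun s2 h2 => ?_)).mono
      (by simp only [cost]; omega) fun r h => h
    refine Leads.mono (Leads.instr hI (by trivial) rfl) le_rfl fun r h3 => ?_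
    rw [h3]
    refine ⟨?_, fun r hr => ?_⟩
    · have e2 : s2.regs t = (List.range N).map fun l => c.eval I A (ρ l) := by
        rw [h2.2 t (by omega), h1.2 t (by omega), h0.1]
      have e3 : s2.regs (t + 1) = (List.range N).map fun l => e.eval I A (ρ l) := by
        rw [h2.2 (t + 1) (by omega), h1.1]
      simp only [Instr.val, Function.update_self, h2.1, e2, e3, List.zip, eval]
      rw [List.zipWith_map, List.zipWith_self, List.zipWith_map, List.zipWith_self]
    · rw [Function.update_of_ne (by omega), h2.2 r (by omega), h1.2 r (by omega), h0.2 r hr]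

/-! ### Lane programs and their simulation in all lanes at once. -/

/-- Programs for a single lane. A loop `loop c P` runs as often as the first entry of array `c` says. -/
inductive LP : Type
  | assign (x : ℕ) (e : Ex)
  | seq (P Q : LP)
  | loop (c : ℕ) (P : LP)

namespace LP

/-- The effect on the variables of a lane. -/
def run (I : Tapes) (A : Regs) : LP → (ℕ → ℕ) → (ℕ → ℕ)
  | assign x e, ρ => Function.update ρ x (e.eval I A ρ)
  | seq P Q, ρ => Q.run I A (P.run I A ρ)
  | loop c P, ρ => (P.run I A)^[hd A c] ρ

/-- Well-formedness. -/
def ok : LP → Bool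
  | assign x e => decide (x < 40) && e.ok
  | seq P Q => P.ok && Q.ok
  | loop c P => decide (c < 90) && P.ok

/-- The largest constant. -/
def maxLit : LP → ℕ
  | assign _ e => e.maxLit
  | seq P Q => max P.maxLit Q.maxLit
  | loop _ P => P.maxLit

/-- The number of steps, if no loop runs more than `X` times. -/
def cost (X : ℕ) : LP → ℕ
  | assign _ e => e.cost + 2
  | seq P Q => P.cost X + Q.cost X
  | loop _ P => 3 + X * (P.cost X + 3)

/-- The registers that control loops. -/
def counters : LP → List ℕ
  | assign _ _ => []
  | seq P Q => P.counters ++ Q.counters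
  | loop c P => c :: P.counters

/-- The variables that are assigned. -/
def writes : LP → List ℕ
  | assign x _ => [x]
  | seq P Q => P.writes ++ Q.writes
  | loop _ P => P.writes

theorem run_frame (I : Tapes) (A : Regs) (P : LP) (ρ : ℕ → ℕ) (x : ℕ) (hx : x ∉ P.writes) :
    P.run I A ρ x = ρ x := by
  induction P generalizing ρ with
  | assign y e => exact Function.update_of_ne (by simpa [writes] using hx) _ _
  | seq P Q ihP ihQ =>
    simp only [writes, List.mem_append, not_or] at hx
    simp [run, ihP _ hx.1, ihQ _ hx.2]
  | loop c P ih =>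
    simp only [run]
    generalize hd A c = n
    induction n with
    | zero => rfl
    | succ n ihn => rw [Function.iterate_succ_apply', ih _ hx, ihn]

/-- Code for all lanes, with temporary registers from `t` on. -/
def code : LP → ℕ → Program
  | assign x e, t => .seq (e.code t)
      (.seq (.instr (.add (100 + x) t t)) (.instr (.half (100 + x) (100 + x))))
  | seq P Q, t => .seq (P.code t) (Q.code t)
  | loop c P, t => .seq (.seq (.instr (.add t c c)) (.instr (.half t t)))
      (.while t (.seq (.instr (.const (t + 1) 1)) (.seq (.instr (.sub t t (t + 1)))
        (P.code (t + 2)))))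

theorem loop_induct {I : Tapes} {A : Regs} {c : ℕ} {P : LP} {ρ : ℕ → ℕ}
    (M : ℕ → (ℕ → ℕ) → Prop) (h0 : M 0 ρ)
    (h : ∀ k < hd A c, ∀ ρ', M k ρ' → M (k + 1) (P.run I A ρ')) :
    M (hd A c) ((loop c P).run I A ρ) := by
  have : ∀ k ≤ hd A c, M k ((P.run I A)^[k] ρ) := by
    intro k
    induction k with
    | zero => exact fun _ => h0
    | succ k ih =>
      intro hk
      rw [Function.iterate_succ_apply']
      exact h k (by omega) _ (ih (by omega))
  exact this _ le_rfl

end LP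

theorem headD_zipWith_sub_one (l : List ℕ) :
    (List.zipWith (· - ·) l [1]).headD 0 = l.headD 0 - 1 := by
  cases l <;> simp

/-- The number of iterations is read from an array and not from a lane, so all lanes stay in lock
step and one machine loop serves them all. The counter sits in register `t` and the body works from
`t + 2` on, out of its way. -/
theorem LP.leads (hI : TapesFit I Λ V) {A : Regs} {N X : ℕ} (P : LP)
    (hP : P.ok = true) (hV : P.maxLit ≤ V) (hX : ∀ c ∈ P.counters, hd A c ≤ X)
    (t : ℕ) (ht : 140 ≤ t) (s : State) (ρ : ℕ → ℕ → ℕ)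
    (hA : Arrays A s.regs) (hρ : Lanes N ρ s.regs) :
    Leads I m Λ V (P.code t) s (P.cost X) fun s' =>
      Lanes N (fun l => P.run I A (ρ l)) s' ∧ (∀ r < 100, s' r = s.regs r) ∧
      ∀ r, 140 ≤ r → r < t → s' r = s.regs r := by
  induction P generalizing t s ρ with
  | assign x e =>
    simp only [ok, Bool.and_eq_true, decide_eq_true_eq] at hP
    refine (Ex.leads hI e hP.2 hV t ht s hA hρ).seq fun s1 h1 => ?_
    refine (Leads.copy hI _ _).mono le_rfl fun r h2 => ?_
    rw [h2, h1.1]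
    refine ⟨fun y hy => ?_, fun r hr => ?_, fun r hr hr' => ?_⟩
    · by_cases hxy : y = x
      · subst hxy; simp [run]
      · rw [Function.update_of_ne (by omega), h1.2 _ (by omega), hρ y hy]
        simp [run, Function.update_of_ne hxy]
    · rw [Function.update_of_ne (by omega), h1.2 r (by omega)]
    · rw [Function.update_of_ne (by omega), h1.2 r (by omega)]
  | seq P Q ihP ihQ =>
    simp only [ok, Bool.and_eq_true] at hP
    simp only [maxLit, max_le_iff] at hV
    simp only [counters, List.mem_append] at hX
    refine (ihP hP.1 hV.1 (fun c hc => hX c (Or.inl hc)) t ht s ρ hA hρ).seq fun s1 h1 => ?_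
    refine (ihQ hP.2 hV.2 (fun c hc => hX c (Or.inr hc)) t ht s1 _
      (fun a ha => by rw [h1.2.1 a (by omega), hA a ha]) h1.1).mono le_rfl fun r h2 => ?_
    refine ⟨h2.1, fun r hr => ?_, fun r hr hr' => ?_⟩
    · rw [h2.2.1 r hr, h1.2.1 r hr]
    · rw [h2.2.2 r hr hr', h1.2.2 r hr hr']
  | loop c P ih =>
    simp only [ok, Bool.and_eq_true, decide_eq_true_eq] at hP
    simp only [counters, List.mem_cons, forall_eq_or_imp] at hX
    have hone : 1 ≤ V := hI.pos.trans hI.le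
    refine Leads.mono ((Leads.copy hI t c).seq (u := hd A c * (1 + (1 + P.cost X) + 1) + 1)
      fun s1 h1 => ?_) (u := (LP.loop c P).cost X) ?_
      fun r (h : (Lanes N (fun l => (P.run I A)^[hd A c] (ρ l)) r ∧ (∀ r' < 100, r r' = s.regs r') ∧
        (∀ r', 140 ≤ r' → r' < t → r r' = s.regs r') ∧ hd r t = hd A c - hd A c)) =>
        ⟨h.1, h.2.1, h.2.2.1⟩
    · refine Leads.loop (u := 1 + (1 + P.cost X)) (Q := fun k r =>
        Lanes N (fun l => (P.run I A)^[k] (ρ l)) r ∧ (∀ r' < 100, r r' = s.regs r') ∧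
        (∀ r', 140 ≤ r' → r' < t → r r' = s.regs r') ∧ hd r t = hd A c - k) ?_ ?_ ?_
      · rintro k hk r ⟨-, -, -, h⟩; omega
      · rintro k hk s2 ⟨g1, g2, g3, g4⟩
        refine Leads.seq (Leads.instr hI (by simpa [Instr.Fits] using hone) rfl) fun s3 h3 => ?_
        refine Leads.seq (Leads.instr hI (by trivial) rfl) fun s4 h4 => ?_
        have h34 : ∀ r < t, s4.regs r = s2.regs r := by
          intro r hr
          rw [h4, Function.update_of_ne (by omega), h3, Function.update_of_ne (by omega)]
          rfl
        have ht4 : hd s4.regs t = hd s2.regs t - 1 := by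
          rw [h4, h3]
          simp only [hd, Instr.val, State.tick, Function.update_self,
            Function.update_of_ne (show t ≠ t + 1 by omega), headD_zipWith_sub_one]
        refine (ih hP.2 hV hX.2 (t + 2) (by omega) s4 _
          (fun a ha => by rw [h34 a (by omega), g2 a (by omega), hA a ha])
          (fun x hx => by rw [h34 _ (by omega), g1 x hx])).mono le_rfl fun r h5 => ?_
        refine ⟨by simpa only [Function.iterate_succ_apply'] using h5.1,
          fun r hr => by rw [h5.2.1 r hr, h34 r (by omega), g2 r hr],
          fun r hr hr' => by rw [h5.2.2 r hr (by omega), h34 r hr', g3 r hr hr'], ?_⟩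
        unfold hd at ht4 g4 ⊢
        rw [h5.2.2 t ht (by omega), ht4, g4, Nat.sub_sub]
      · rw [h1]
        refine ⟨fun x hx => by rw [Function.update_of_ne (by omega), hρ x hx]; rfl,
          fun r hr => Function.update_of_ne (by omega) _ _,
          fun r _ hr => Function.update_of_ne (by omega) _ _, ?_⟩
        simp [hd, hA c hP.1]
    · have : hd A c * (1 + (1 + P.cost X) + 1) ≤ X * (P.cost X + 3) :=
        Nat.mul_le_mul hX.1 (by omega)
      simp only [cost]; omega

end

/-! ### Stages and their simulation. -/

/-- Programs made of data-parallel stages. `tab dst sz P x` fills array `dst` with the final values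
of variable `x` in lanes `0, …, hd sz - 1`, in which variable `0` is the number of the lane. -/
inductive Cmd : Type
  | tab (dst sz : ℕ) (P : LP) (x : ℕ)
  | scat (dst a i v : ℕ)
  | size (dst src : ℕ)
  | tlen (dst k : ℕ)
  | seq (C D : Cmd)
  | loop (c : ℕ) (C : Cmd)

/-- The initial values of the variables of lane `l`. -/
def laneInit (l : ℕ) : ℕ → ℕ := fun x => if x = 0 then l else 0

/-- Code that sets the given registers to zero vectors. -/
def zeroCode : ℕ → Program
  | 0 => .instr (.sub 139 100 100)
  | n + 1 => .seq (zeroCode n) (.instr (.sub (101 + n) 100 100))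

namespace Cmd

/-- The effect on the arrays. -/
def run (I : Tapes) : Cmd → Regs → Regs
  | tab dst sz P x, A =>
      Function.update A dst ((List.range (hd A sz)).map fun l => P.run I A (laneInit l) x)
  | scat dst a i v, A =>
      Function.update A dst (((A i).zip (A v)).foldl (fun l jx => l.set jx.1 jx.2) (A a))
  | size dst src, A => Function.update A dst [Nat.size (hd A src)]
  | tlen dst k, A => Function.update A dst [(I.getD k []).length]
  | seq C D, A => D.run I (C.run I A)
  | loop c C, A => (C.run I)^[hd A c] A

/-- Well-formedness, with at most `k` nested loops. -/
def ok : ℕ → Cmd → Bool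
  | _, tab dst sz P x => decide (dst < 90) && decide (sz < 90) && decide (x < 40) && P.ok
  | _, scat dst a i v => decide (dst < 90) && decide (a < 90) && decide (i < 90) && decide (v < 90)
  | _, size dst src => decide (dst < 90) && decide (src < 90)
  | _, tlen dst _ => decide (dst < 90)
  | k, seq C D => C.ok k && D.ok k
  | 0, loop _ _ => false
  | k + 1, loop c C => decide (c < 90) && C.ok k

/-- The largest constant, and the lengths of the tapes used. -/
def maxLit (I : Tapes) : Cmd → ℕ
  | tab _ _ P _ => P.maxLit
  | scat _ _ _ _ => 0
  | size _ _ => 0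
  | tlen _ k => (I.getD k []).length
  | seq C D => max (C.maxLit I) (D.maxLit I)
  | loop _ C => C.maxLit I

/-- No stage has more than `Λ` lanes, no loop more than `X` iterations. -/
def Safe (I : Tapes) (Λ X : ℕ) : Cmd → Regs → Prop
  | tab _ sz P _, A => hd A sz ≤ Λ ∧ ∀ c ∈ P.counters, hd A c ≤ X
  | scat _ _ _ _, _ => True
  | size _ src, A => Nat.size (hd A src) ≤ X
  | tlen _ _, _ => True
  | seq C D, A => C.Safe I Λ X A ∧ D.Safe I Λ X (C.run I A)
  | loop c C, A => hd A c ≤ X ∧ ∀ k < hd A c, C.Safe I Λ X ((C.run I)^[k] A)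

/-- The time bound, if no loop runs more than `X` times. -/
def cost (X : ℕ) : Cmd → ℕ
  | tab _ _ P _ => P.cost X + 50
  | scat _ _ _ _ => 1
  | size _ _ => X * 3 + 10
  | tlen _ _ => 1
  | seq C D => C.cost X + D.cost X
  | loop _ C => 3 + X * (C.cost X + 3)

/-- The code; loop counters start at register `k`. -/
def code : Cmd → ℕ → Program
  | tab dst sz P x, _ => .seq (.instr (.iota 100 sz)) (.seq (zeroCode 38)
      (.seq (P.code 140) (.seq (.instr (.add dst (100 + x) (100 + x))) (.instr (.half dst dst)))))
  | scat dst a i v, _ => .instr (.scatter dst a i v)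
  | size dst src, _ => .seq (.instr (.const 140 0)) (.seq (.instr (.const 142 1))
      (.seq (.seq (.instr (.add 141 src src)) (.instr (.half 141 141)))
      (.seq (.while 141 (.seq (.instr (.half 141 141)) (.instr (.add 140 140 142))))
        (.seq (.instr (.add dst 140 140)) (.instr (.half dst dst))))))
  | tlen dst k, _ => .instr (.tapeLength dst k)
  | seq C D, k => .seq (C.code k) (D.code k)
  | loop c C, k => .seq (.seq (.instr (.add k c c)) (.instr (.half k k)))
      (.while k (.seq (.instr (.const 140 1)) (.seq (.instr (.sub k k 140)) (C.code (k + 1)))))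

end Cmd

section
variable {I : Tapes} {m Λ V : ℕ}

theorem zeroCode_leads (hI : TapesFit I Λ V) {N : ℕ} (n : ℕ) (hn : n ≤ 38) (s : State)
    (h : s.regs 100 = List.range N) :
    Leads I m Λ V (zeroCode n) s (n + 1) fun s' =>
      (∀ r ≤ 100, s' r = s.regs r) ∧ (∀ r, 140 ≤ r → s' r = s.regs r) ∧
      (∀ x, 1 ≤ x → x ≤ n → s' (100 + x) = (List.range N).map fun _ => 0) ∧
      s' 139 = (List.range N).map fun _ => 0 := by
  have h0 : ∀ s : Regs, s 100 = List.range N → List.zipWith (· - ·) (s 100) (s 100)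
      = (List.range N).map fun _ => 0 := by
    intro s hs
    rw [hs, List.zipWith_self]
    simp
  induction n with
  | zero =>
    refine Leads.mono (Leads.instr hI (by trivial) rfl) le_rfl fun r hr => ?_
    rw [hr]
    refine ⟨fun r hr => Function.update_of_ne (by omega) _ _,
      fun r hr => Function.update_of_ne (by omega) _ _, fun x _ _ => by omega, ?_⟩
    simpa [Instr.val] using h0 _ h
  | succ n ih =>
    refine (ih (by omega)).seq fun s1 h1 => ?_
    refine Leads.mono (Leads.instr hI (by trivial) rfl) le_rfl fun r hr => ?_
    rw [hr]
    refine ⟨fun r hr => ?_, fun r hr => ?_, fun x hx hx' => ?_, ?_⟩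
    · rw [Function.update_of_ne (by omega), h1.1 r hr]
    · rw [Function.update_of_ne (by omega), h1.2.1 r hr]
    · by_cases hxn : x = n + 1
      · subst hxn
        rw [show 100 + (n + 1) = 101 + n by omega, Function.update_self]
        exact h0 _ (by rw [h1.1 100 le_rfl, h])
      · rw [Function.update_of_ne (by omega), h1.2.2.1 x hx (by omega)]
    · rw [Function.update_of_ne (by omega), h1.2.2.2]

theorem Cmd.tab_leads (hI : TapesFit I Λ V) {A : Regs} {X : ℕ} (dst sz : ℕ) (P : LP) (x : ℕ)
    (hdst : dst < 90) (hsz : sz < 90) (hx : x < 40) (hP : P.ok = true) (hV : P.maxLit ≤ V)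
    (hN : hd A sz ≤ Λ) (hX : ∀ c ∈ P.counters, hd A c ≤ X) (k : ℕ) (s : State)
    (hA : Arrays A s.regs) :
    Leads I m Λ V ((Cmd.tab dst sz P x).code k) s ((Cmd.tab dst sz P x).cost X) fun s' =>
      Arrays ((Cmd.tab dst sz P x).run I A) s' ∧ ∀ r, 90 ≤ r → r < 100 → s' r = s.regs r := by
  refine Leads.mono (t := 1 + (39 + (P.cost X + 2))) ?_
    (by simp only [cost]; omega) fun r h => h
  refine Leads.seq (Leads.instr hI (by simpa [Instr.Fits, hd, hA sz hsz] using hN) rfl)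
    fun s1 h1 => ?_
  have h10 : s1.regs 100 = List.range (hd A sz) := by
    rw [h1, Function.update_self]; simp only [Instr.val, hA sz hsz]; rfl
  refine (zeroCode_leads hI 38 le_rfl s1 h10).seq fun s2 h2 => ?_
  have hl : Lanes (hd A sz) laneInit s2.regs := by
    intro y hy
    rcases Nat.eq_zero_or_pos y with rfl | hy0
    · rw [h2.1 _ (by omega), h10]; simp [laneInit]
    · have e : (fun l => laneInit l y) = fun _ => 0 := by
        funext l; simp only [laneInit, if_neg (show y ≠ 0 by omega)]
      rw [e]
      by_cases hy39 : y = 39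
      · subst hy39; exact h2.2.2.2
      · exact h2.2.2.1 y hy0 (by omega)
  have h12 : ∀ r < 100, s2.regs r = s.regs r := by
    intro r hr
    rw [h2.1 r (by omega), h1, Function.update_of_ne (by omega)]
  refine (LP.leads hI P hP hV hX 140 le_rfl s2 _ (fun a ha => by
    rw [h12 a (by omega), hA a ha]) hl).seq fun s3 h3 => ?_
  refine (Leads.copy hI _ _).mono le_rfl fun r h4 => ?_
  rw [h4]
  refine ⟨fun a ha => ?_, fun r hr hr' => ?_⟩
  · by_cases had : a = dst
    · subst had
      simp only [Function.update_self, run]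
      exact h3.1 x hx
    · rw [Function.update_of_ne had, h3.2.1 a (by omega), h12 a (by omega), hA a ha]
      simp [run, Function.update_of_ne had]
  · rw [Function.update_of_ne (by omega), h3.2.1 r hr', h12 r hr']

theorem Nat.size_div_two_pow_eq_zero {v j : ℕ} : v / 2 ^ j = 0 ↔ Nat.size v ≤ j := by
  rw [Nat.size_le, Nat.div_eq_zero_iff]
  have : 0 < 2 ^ j := by positivity
  omega

/-- The binary length is the number of halvings after which zero is reached, so logarithms are
computed in logarithmic time. -/
theorem Cmd.size_leads (hI : TapesFit I Λ V) {A : Regs} {X : ℕ} (dst src : ℕ)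
    (hdst : dst < 90) (hsrc : src < 90) (hX : Nat.size (hd A src) ≤ X)
    (k : ℕ) (s : State) (hA : Arrays A s.regs) :
    Leads I m Λ V ((Cmd.size dst src).code k) s ((Cmd.size dst src).cost X) fun s' =>
      Arrays ((Cmd.size dst src).run I A) s' ∧ ∀ r, 90 ≤ r → r < 100 → s' r = s.regs r := by
  have hone : 1 ≤ V := hI.pos.trans hI.le
  set n := Nat.size (hd A src) with hn
  refine Leads.mono (t := 1 + (1 + (2 + ((n * 3 + 1) + 2)))) ?_
    (by simp only [cost]; omega) fun r h => h
  refine Leads.seq (Leads.instr hI (by simp [Instr.Fits]) rfl) fun s1 h1 => ?_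
  refine Leads.seq (Leads.instr hI (by simpa [Instr.Fits] using hone) rfl) fun s2 h2 => ?_
  refine (Leads.copy hI _ _).seq fun s3 h3 => ?_
  have g1 : s3.regs 140 = [0] := by rw [h3, h2, h1]; simp [Instr.val]
  have g2 : s3.regs 142 = [1] := by rw [h3, h2, h1]; simp [Instr.val]
  have g3 : hd s3.regs 141 = hd A src := by
    rw [h3, h2, h1]
    simp only [hd, Function.update_self]
    rw [Function.update_of_ne (by omega), Function.update_of_ne (by omega), hA src hsrc]
  have g4 : ∀ r < 140, s3.regs r = s.regs r := by
    intro r hr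
    rw [h3, h2, h1, Function.update_of_ne (by omega), Function.update_of_ne (by omega),
      Function.update_of_ne (by omega)]
  have hl := Leads.loop (I := I) (m := m) (Λ := Λ) (V := V) (r := 141) (u := 2) (n := n) (s := s3)
    (P := .seq (.instr (.half 141 141)) (.instr (.add 140 140 142)))
    (Q := fun j r => r 140 = [j] ∧ r 142 = [1] ∧ hd r 141 = hd A src / 2 ^ j ∧
      ∀ r' < 140, r r' = s.regs r')
    (by
      rintro j hj r ⟨-, -, h, -⟩
      rw [h, Nat.size_div_two_pow_eq_zero]
      omega)
    (by
      rintro j hj s4 ⟨i1, i2, i3, i4⟩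
      refine Leads.seq (u := 1) (Leads.instr hI (by trivial) rfl) fun s5 h5 => ?_
      refine Leads.mono (Leads.instr hI (by trivial) rfl) le_rfl fun r hr => ?_
      rw [hr, h5]
      refine ⟨by simp [Instr.val, State.tick, i1, i2], by simp [State.tick, i2], ?_, fun r hr => ?_⟩
      · rw [pow_succ, ← Nat.div_div_eq_div_mul, ← i3]
        simp only [hd, Instr.val, State.tick, ne_eq, Nat.reduceEqDiff, not_false_eq_true,
          Function.update_of_ne, Function.update_self]
        cases s4.regs 141 <;> simp
      · rw [Function.update_of_ne (by omega), Function.update_of_ne (by omega)]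
        exact i4 r hr)
    ⟨g1, g2, by simpa using g3, g4⟩
  refine Leads.seq (Q := fun r => r 140 = [n] ∧ ∀ r' < 140, r r' = s.regs r')
    (hl.mono le_rfl fun r h => ⟨h.1, h.2.2.2⟩) fun s4 h4 => ?_
  refine (Leads.copy hI _ _).mono le_rfl fun r h5 => ?_
  rw [h5, h4.1]
  refine ⟨fun a ha => ?_, fun r hr hr' => ?_⟩
  · by_cases had : a = dst
    · subst had
      simp [run, hn]
    · rw [Function.update_of_ne had, h4.2 a (by omega), hA a ha]
      simp [run, Function.update_of_ne had]
  · rw [Function.update_of_ne (by omega), h4.2 r (by omega)]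

/-- Counters of nested loops occupy successive registers from `k` on, between the arrays and the
lane variables. The body cannot touch the counters of the loops around it, and `k + d ≤ 100` leaves
room for the remaining depth. -/
theorem Cmd.leads (hI : TapesFit I Λ V) {X : ℕ} (C : Cmd) {A : Regs} (d k : ℕ) (hk : 90 ≤ k)
    (hkd : k + d ≤ 100) (hC : C.ok d = true) (hV : C.maxLit I ≤ V) (hS : C.Safe I Λ X A)
    (s : State) (hA : Arrays A s.regs) :
    Leads I m Λ V (C.code k) s (C.cost X) fun s' =>
      Arrays (C.run I A) s' ∧ ∀ r, 90 ≤ r → r < k → s' r = s.regs r := by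
  induction C generalizing A d k s with
  | tab dst sz P x =>
    simp only [ok, Bool.and_eq_true, decide_eq_true_eq] at hC
    exact (Cmd.tab_leads hI dst sz P x hC.1.1.1 hC.1.1.2 hC.1.2 hC.2 hV hS.1 hS.2 k s hA).mono
      le_rfl fun r h => ⟨h.1, fun r hr hr' => h.2 r hr (by omega)⟩
  | scat dst a i v =>
    simp only [ok, Bool.and_eq_true, decide_eq_true_eq] at hC
    refine Leads.mono (Leads.instr hI (by trivial) rfl) le_rfl fun r h => ?_
    rw [h]
    refine ⟨fun b hb => ?_, fun r hr hr' => Function.update_of_ne (by omega) _ _⟩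
    by_cases hbd : b = dst
    · subst hbd
      simp [run, Instr.val, hA a hC.1.1.2, hA i hC.1.2, hA v hC.2]
    · simp [run, Function.update_of_ne hbd, hA b hb]
  | size dst src =>
    simp only [ok, Bool.and_eq_true, decide_eq_true_eq] at hC
    exact (Cmd.size_leads hI dst src hC.1 hC.2 hS k s hA).mono
      le_rfl fun r h => ⟨h.1, fun r hr hr' => h.2 r hr (by omega)⟩
  | tlen dst j =>
    simp only [ok, decide_eq_true_eq] at hC
    refine Leads.mono (Leads.instr hI (by simpa [Instr.Fits, maxLit] using hV) rfl) le_rfl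
      fun r h => ?_
    rw [h]
    refine ⟨fun b hb => ?_, fun r hr hr' => Function.update_of_ne (by omega) _ _⟩
    by_cases hbd : b = dst
    · subst hbd
      simp [run, Instr.val]
    · simp [run, Function.update_of_ne hbd, hA b hb]
  | seq C D ihC ihD =>
    have hC' : C.ok d = true ∧ D.ok d = true := by
      cases d <;> simpa [ok] using hC
    simp only [maxLit, max_le_iff] at hV
    refine (ihC d k hk hkd hC'.1 hV.1 hS.1 s hA).seq fun s1 h1 => ?_
    refine (ihD d k hk hkd hC'.2 hV.2 hS.2 s1 h1.1).mono le_rfl fun r h => ?_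
    exact ⟨h.1, fun r hr hr' => (h.2 r hr hr').trans (h1.2 r hr hr')⟩
  | loop c C ih =>
    cases d with
    | zero => simp [ok] at hC
    | succ d =>
    simp only [ok, Bool.and_eq_true, decide_eq_true_eq] at hC
    have hone : 1 ≤ V := hI.pos.trans hI.le
    refine Leads.mono ((Leads.copy hI k c).seq (u := hd A c * (1 + (1 + C.cost X) + 1) + 1)
      fun s1 h1 => ?_) (u := (Cmd.loop c C).cost X) ?_
      fun r (h : Arrays ((C.run I)^[hd A c] A) r ∧
        (∀ r', 90 ≤ r' → r' < k → r r' = s.regs r') ∧ hd r k = hd A c - hd A c) => ⟨h.1, h.2.1⟩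
    · refine Leads.loop (Q := fun n r => Arrays ((C.run I)^[n] A) r ∧
        (∀ r', 90 ≤ r' → r' < k → r r' = s.regs r') ∧ hd r k = hd A c - n) ?_ ?_ ?_
      · rintro n hn r ⟨-, -, h⟩; omega
      · rintro n hn s2 ⟨g1, g2, g3⟩
        refine Leads.seq (Leads.instr hI (by simpa [Instr.Fits] using hone) rfl) fun s3 h3 => ?_
        refine Leads.seq (Leads.instr hI (by trivial) rfl) fun s4 h4 => ?_
        have h34 : ∀ r < k, s4.regs r = s2.regs r := by
          intro r hr
          rw [h4, Function.update_of_ne (by omega), h3, Function.update_of_ne (by omega)]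
          rfl
        have ht4 : hd s4.regs k = hd s2.regs k - 1 := by
          rw [h4, h3]
          simp only [hd, Instr.val, State.tick, Function.update_self,
            Function.update_of_ne (show k ≠ 140 by omega), headD_zipWith_sub_one]
        refine (ih d (k + 1) (by omega) (by omega) hC.2 hV (hS.2 n hn) s4
          (fun a ha => by rw [h34 a (by omega), g1 a ha])).mono le_rfl fun r h5 => ?_
        refine ⟨by simpa only [Function.iterate_succ_apply'] using h5.1,
          fun r hr hr' => by rw [h5.2 r hr (by omega), h34 r hr', g2 r hr hr'], ?_⟩
        unfold hd at ht4 g3 ⊢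
        rw [h5.2 k hk (by omega), ht4, g3, Nat.sub_sub]
      · rw [h1]
        refine ⟨fun a ha => by rw [Function.update_of_ne (by omega), hA a ha]; rfl,
          fun r _ hr => Function.update_of_ne (by omega) _ _, ?_⟩
        simp [hd, hA c hC.1]
    · have : hd A c * (1 + (1 + C.cost X) + 1) ≤ X * (C.cost X + 3) :=
        Nat.mul_le_mul hS.1 (by omega)
      simp only [cost]; omega

end

/-! ### Static safety, frames and cost -/

/-- Functions bounded by a power. -/
def PowerBounded (f : ℕ → ℕ) : Prop := ∃ a, ∀ L, 1 ≤ L → f L ≤ a * L ^ a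

namespace PowerBounded

theorem mono_exponent {a b L : ℕ} (hL : 1 ≤ L) (h : a ≤ b) : a * L ^ a ≤ b * L ^ b :=
  Nat.mul_le_mul h (Nat.pow_le_pow_right hL h)

theorem const (c : ℕ) : PowerBounded fun _ => c :=
  ⟨c, fun _ hL => Nat.le_mul_of_pos_right _ (Nat.pow_pos hL)⟩

theorem id : PowerBounded fun L => L := ⟨1, fun L _ => by simp⟩

theorem add {f g : ℕ → ℕ} (hf : PowerBounded f) (hg : PowerBounded g) :
    PowerBounded fun L => f L + g L := by
  obtain ⟨a, hf⟩ := hf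
  obtain ⟨b, hg⟩ := hg
  refine ⟨a + b, fun L hL => ?_⟩
  have h1 := Nat.mul_le_mul_left a (Nat.pow_le_pow_right hL (Nat.le_add_right a b))
  have h2 := Nat.mul_le_mul_left b (Nat.pow_le_pow_right hL (Nat.le_add_left b a))
  have h3 := hf L hL
  have h4 := hg L hL
  simp only [add_mul]
  omega

theorem mul {f g : ℕ → ℕ} (hf : PowerBounded f) (hg : PowerBounded g) :
    PowerBounded fun L => f L * g L := by
  obtain ⟨a, hf⟩ := hf
  obtain ⟨b, hg⟩ := hg
  refine ⟨a * b + (a + b), fun L hL => (Nat.mul_le_mul (hf L hL) (hg L hL)).trans ?_⟩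
  rw [mul_mul_mul_comm, ← pow_add]
  exact Nat.mul_le_mul (Nat.le_add_right _ _) (Nat.pow_le_pow_right hL (Nat.le_add_left _ _))

theorem pow {f : ℕ → ℕ} (hf : PowerBounded f) (k : ℕ) : PowerBounded fun L => f L ^ k := by
  induction k with
  | zero => simpa using const 1
  | succ k ih => simpa only [pow_succ] using ih.mul hf

theorem mono {f g : ℕ → ℕ} (hg : PowerBounded g) (h : ∀ L, 1 ≤ L → f L ≤ g L) : PowerBounded f :=
  hg.imp fun _ ha L hL => (h L hL).trans (ha L hL)

end PowerBounded

/-- The nesting of loops is fixed by the text of the program, so its cost is a polynomial in the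
bound `X` on the iterations. -/
theorem LP.powerBounded (P : LP) : PowerBounded fun X => P.cost X := by
  induction P with
  | assign x e => exact .const _
  | seq P Q ihP ihQ => exact ihP.add ihQ
  | loop c P ih => exact (PowerBounded.const 3).add (PowerBounded.id.mul (ih.add (.const 3)))

theorem Cmd.powerBounded (C : Cmd) : PowerBounded fun X => C.cost X := by
  induction C with
  | tab dst sz P x => exact P.powerBounded.add (.const 50)
  | scat | tlen => exact .const 1
  | size => exact (PowerBounded.id.mul (.const 3)).add (.const 10)
  | seq P Q ihP ihQ => exact ihP.add ihQ
  | loop c P ih => exact (PowerBounded.const 3).add (PowerBounded.id.mul (ih.add (.const 3)))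

namespace Cmd

/-- The arrays that are written. -/
def writes : Cmd → List ℕ
  | tab dst _ _ _ => [dst]
  | scat dst _ _ _ => [dst]
  | size dst _ => [dst]
  | tlen dst _ => [dst]
  | seq C D => C.writes ++ D.writes
  | loop _ C => C.writes

theorem run_frame (I : Tapes) (C : Cmd) (A : Regs) (a : ℕ) (ha : a ∉ C.writes) :
    C.run I A a = A a := by
  induction C generalizing A with
  | tab dst sz P x => exact Function.update_of_ne (by simpa [writes] using ha) _ _
  | scat dst sz P x => exact Function.update_of_ne (by simpa [writes] using ha) _ _
  | size dst sz => exact Function.update_of_ne (by simpa [writes] using ha) _ _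
  | tlen dst sz => exact Function.update_of_ne (by simpa [writes] using ha) _ _
  | seq P Q ihP ihQ =>
    simp only [writes, List.mem_append, not_or] at ha
    simp [run, ihP _ ha.1, ihQ _ ha.2]
  | loop c P ih =>
    simp only [run]
    generalize hd A c = n
    induction n with
    | zero => rfl
    | succ n ihn => rw [Function.iterate_succ_apply', ih _ ha, ihn]

theorem hd_run_frame (I : Tapes) (C : Cmd) (A : Regs) (a : ℕ) (ha : a ∉ C.writes) :
    hd (C.run I A) a = hd A a := by
  unfold hd; rw [run_frame I C A a ha]

/-- Programs that control their loops by registers below `40`, the sizes of their stages by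
registers below `60`, and write none of these. -/
def static : Cmd → Bool
  | tab dst sz P _ => decide (60 ≤ dst) && decide (sz < 60) &&
      P.counters.all fun c => decide (c < 40)
  | scat dst _ _ _ => decide (60 ≤ dst)
  | size _ _ => false
  | tlen _ _ => false
  | seq C D => C.static && D.static
  | loop c C => decide (c < 40) && C.static

theorem static_run {I : Tapes} {C : Cmd} (hC : C.static = true) (A : Regs) {a : ℕ} (ha : a < 60) :
    C.run I A a = A a := by
  refine run_frame I C A a fun h => ?_
  induction C with
  | tab dst sz P x => simp [static, writes] at hC h; omega
  | scat dst sz P x => simp [static, writes] at hC h; omega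
  | size dst sz => simp [static] at hC
  | tlen dst sz => simp [static] at hC
  | seq P Q ihP ihQ =>
    simp only [writes, List.mem_append, static, Bool.and_eq_true] at h hC
    exact h.elim (ihP hC.1) (ihQ hC.2)
  | loop c P ih =>
    simp only [writes, static, Bool.and_eq_true] at h hC
    exact ih hC.2 h

/-- Stage sizes and loop counts come from registers that the program never writes, so bounds that
hold at the start hold throughout. -/
theorem safe_of_static {I : Tapes} {C : Cmd} (hC : C.static = true) {A : Regs} {Λ X : ℕ}
    (hΛ : ∀ a < 60, hd A a ≤ Λ) (hX : ∀ a < 40, hd A a ≤ X) : C.Safe I Λ X A := by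
  induction C generalizing A with
  | tab dst sz P x =>
    simp [static] at hC
    exact ⟨hΛ _ hC.1.2, fun c hc => hX c (hC.2 c hc)⟩
  | scat dst sz P x => trivial
  | size dst sz => simp [static] at hC
  | tlen dst sz => simp [static] at hC
  | seq P Q ihP ihQ =>
    simp only [static, Bool.and_eq_true] at hC
    refine ⟨ihP hC.1 hΛ hX, ihQ hC.2 ?_ ?_⟩
    · intro a ha; unfold hd; rw [static_run hC.1 A ha]; exact hΛ a ha
    · intro a ha; unfold hd; rw [static_run hC.1 A (by omega)]; exact hX a ha
  | loop c P ih =>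
    simp only [static, Bool.and_eq_true, decide_eq_true_eq] at hC
    have h : ∀ k, ∀ a < 60, (P.run I)^[k] A a = A a := by
      intro k
      induction k with
      | zero => exact fun _ _ => rfl
      | succ k ihk =>
        intro a ha
        rw [Function.iterate_succ_apply', static_run hC.2 _ ha, ihk a ha]
    refine ⟨hX c hC.1, fun k _ => ih hC.2 ?_ ?_⟩
    · intro a ha; unfold hd; rw [h k a ha]; exact hΛ a ha
    · intro a ha; unfold hd; rw [h k a (by omega)]; exact hX a ha

end Cmd

/-! ### Neighbourhoods of words and their sizes -/

theorem exists_insertIdx_sublist {α : Type} {z l : List α} (h : z.Sublist l)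
    (hlt : z.length < l.length) :
    ∃ t ≤ z.length, ∃ b, (z.insertIdx t b).Sublist l := by
  induction h with
  | slnil => simp at hlt
  | @cons z l a h ih =>
    rcases Nat.lt_or_ge z.length l.length with h1 | h1
    · obtain ⟨t, ht, b, hb⟩ := ih h1
      exact ⟨t, ht, b, hb.cons a⟩
    · exact ⟨0, Nat.zero_le _, a, by simpa using h.cons_cons a⟩
  | @cons_cons z l a h ih =>
    obtain ⟨t, ht, b, hb⟩ := ih (by simpa using hlt)
    exact ⟨t + 1, by simpa using ht, b, by simpa using hb.cons_cons a⟩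

theorem exists_sublist_eraseIdx {α : Type} {z l : List α} (h : z.Sublist l)
    (hlt : z.length < l.length) : ∃ t < l.length, z.Sublist (l.eraseIdx t) := by
  induction h with
  | slnil => simp at hlt
  | @cons z l a h ih => exact ⟨0, by simp, by simpa using h⟩
  | @cons_cons z l a h ih =>
    obtain ⟨t, ht, hb⟩ := ih (by simpa using hlt)
    exact ⟨t + 1, by simpa using ht, by simpa using hb.cons_cons a⟩

/-- The largest label of a word with one more letter; only words of length at most `W` count. -/
def dn (W : ℕ) (F : List Bool → ℕ) (l : List Bool) : ℕ :=
  if l.length ≤ W then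
    (Finset.range (l.length + 1)).sup fun t => max (F (l.insertIdx t false)) (F (l.insertIdx t true))
  else 0

/-- The largest label of a word with one letter less. -/
def up (W : ℕ) (F : List Bool → ℕ) (l : List Bool) : ℕ :=
  if l.length ≤ W then (Finset.range l.length).sup fun t => F (l.eraseIdx t) else 0

/-- The largest label of a word at distance `r` insertions and `r` deletions. -/
def spread (W r : ℕ) (F : List Bool → ℕ) : List Bool → ℕ := (up W)^[r] ((dn W)^[r] F)

/-- The missing letters of `z` are inserted one at a time, staying inside `l`; each insertion is one
application of `dn`. The cut-off at `W` does no harm, since no intermediate word is longer than `l`.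
-/
theorem le_iterate_dn {W : ℕ} {F : List Bool → ℕ} (k : ℕ) {z l : List Bool} (h : z.Sublist l)
    (hl : z.length + k = l.length) (hW : l.length ≤ W) : F l ≤ (dn W)^[k] F z := by
  induction k generalizing z with
  | zero => rw [h.eq_of_length (by omega)]; rfl
  | succ k ih =>
    obtain ⟨t, ht, b, hb⟩ := exists_insertIdx_sublist h (by omega)
    rw [Function.iterate_succ_apply', dn, if_pos (by omega)]
    refine (ih hb (by rw [List.length_insertIdx_of_le_length ht]; omega)).trans ?_
    refine le_trans ?_ (Finset.le_sup (f := fun t => max ((dn W)^[k] F (z.insertIdx t false))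
      ((dn W)^[k] F (z.insertIdx t true))) (Finset.mem_range.2 (Nat.lt_succ_of_le ht)))
    cases b
    · exact le_max_left _ _
    · exact le_max_right _ _

theorem le_iterate_up {W : ℕ} {F : List Bool → ℕ} (k : ℕ) {z l : List Bool} (h : z.Sublist l)
    (hl : z.length + k = l.length) (hW : l.length ≤ W) : F z ≤ (up W)^[k] F l := by
  induction k generalizing l with
  | zero => rw [h.eq_of_length (by omega)]; rfl
  | succ k ih =>
    obtain ⟨t, ht, hb⟩ := exists_sublist_eraseIdx h (by omega)
    have e : (l.eraseIdx t).length + 1 = l.length := by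
      rw [List.length_eraseIdx_of_lt ht]; omega
    rw [Function.iterate_succ_apply', up, if_pos hW]
    refine (ih hb (by omega) (by omega)).trans ?_
    exact Finset.le_sup (f := fun t => (up W)^[k] F (l.eraseIdx t)) (Finset.mem_range.2 ht)

/-- The value zero is reserved for "no label" and for words cut off by `W`; any other value of the
iterated maximum is attained along an actual chain of insertions. -/
theorem exists_of_iterate_dn {W : ℕ} {F : List Bool → ℕ} (k : ℕ) {z : List Bool}
    (h : (dn W)^[k] F z ≠ 0) :
    ∃ l, z.Sublist l ∧ z.length + k = l.length ∧ F l = (dn W)^[k] F z := by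
  induction k generalizing z with
  | zero => exact ⟨z, List.Sublist.refl _, by simp, rfl⟩
  | succ k ih =>
    rw [Function.iterate_succ_apply'] at h ⊢
    unfold dn at h ⊢
    split_ifs at h ⊢ with hW
    · obtain ⟨t, ht, e⟩ := Finset.exists_mem_eq_sup (Finset.range (z.length + 1)) (by simp)
        fun t => max ((dn W)^[k] F (z.insertIdx t false)) ((dn W)^[k] F (z.insertIdx t true))
      have ht' : t ≤ z.length := by simpa [Nat.lt_succ_iff] using ht
      obtain ⟨b, hb⟩ : ∃ b, (dn W)^[k] F (z.insertIdx t b) = max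
          ((dn W)^[k] F (z.insertIdx t false)) ((dn W)^[k] F (z.insertIdx t true)) := by
        rcases max_choice ((dn W)^[k] F (z.insertIdx t false))
          ((dn W)^[k] F (z.insertIdx t true)) with h | h <;> exact ⟨_, h.symm⟩
      unfold dn at e hb
      rw [e] at h ⊢
      rw [← hb] at h ⊢
      have := ih (z := z.insertIdx t b)
      unfold dn at this
      obtain ⟨l, h1, h2, h3⟩ := this h
      refine ⟨l, ?_, ?_, h3⟩
      · exact (List.sublist_insertIdx z t b).trans h1
      · rw [List.length_insertIdx_of_le_length ht'] at h2; omega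
    · exact absurd rfl h

theorem exists_of_iterate_up {W : ℕ} {F : List Bool → ℕ} (k : ℕ) {l : List Bool}
    (h : (up W)^[k] F l ≠ 0) :
    ∃ z : List Bool, z.Sublist l ∧ z.length + k = l.length ∧ F z = (up W)^[k] F l := by
  induction k generalizing l with
  | zero => exact ⟨l, List.Sublist.refl _, by simp, rfl⟩
  | succ k ih =>
    rw [Function.iterate_succ_apply'] at h ⊢
    generalize hG : (up W)^[k] F = G at *
    unfold up at h ⊢
    split_ifs at h ⊢ with hW
    · have hne : (Finset.range l.length).Nonempty := by
        rw [Finset.nonempty_iff_ne_empty]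
        intro h0
        rw [h0] at h
        exact h rfl
      obtain ⟨t, ht, e⟩ := Finset.exists_mem_eq_sup (Finset.range l.length) hne
        fun t => G (l.eraseIdx t)
      rw [e] at h ⊢
      obtain ⟨z, h1, h2, h3⟩ := ih h
      refine ⟨z, h1.trans (List.eraseIdx_sublist l t), ?_, h3⟩
      rw [List.length_eraseIdx_of_lt (by simpa using ht)] at h2
      have : t < l.length := by simpa using ht
      omega
    · exact absurd rfl h

/-- `r` deletions and `r` insertions lead from `l` to `l'`; both have length `W`. -/
def Close (W r : ℕ) (l l' : List Bool) : Prop :=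
  l.length = W ∧ l'.length = W ∧ ∃ z : List Bool, z.Sublist l ∧ z.Sublist l' ∧ z.length + r = W

theorem Close.symm {W r : ℕ} {l l' : List Bool} (h : Close W r l l') : Close W r l' l := by
  obtain ⟨h1, h2, z, h3, h4, h5⟩ := h
  exact ⟨h2, h1, z, h4, h3, h5⟩

theorem Close.le_spread {W r : ℕ} {F : List Bool → ℕ} {l l' : List Bool} (h : Close W r l l') :
    F l' ≤ spread W r F l := by
  obtain ⟨h1, h2, z, h3, h4, h5⟩ := h
  exact (le_iterate_dn r h4 (by omega) h2.le).trans (le_iterate_up r h3 (by omega) h1.le)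

/-- With `Close.le_spread`, this makes a nonzero `spread` exactly the maximum of the labels of close
words. Both halves pass through the common subsequence reached by the deletions. -/
theorem exists_close_of_spread {W r : ℕ} {F : List Bool → ℕ} {l : List Bool} (hl : l.length = W)
    (h : spread W r F l ≠ 0) : ∃ l', Close W r l l' ∧ F l' = spread W r F l := by
  obtain ⟨z, h1, h2, h3⟩ := exists_of_iterate_up r h
  have h' : (dn W)^[r] F z ≠ 0 := by rw [h3]; exact h
  obtain ⟨l', h4, h5, h6⟩ := exists_of_iterate_dn r h'
  exact ⟨l', ⟨hl, by omega, z, h1, h4, by omega⟩, h6.trans h3⟩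

/-! ### Counting close words. -/

/-- All binary words of length `n`. -/
def words : ℕ → Finset (List Bool)
  | 0 => {[]}
  | n + 1 => (words n).image (List.cons false) ∪ (words n).image (List.cons true)

theorem mem_words {n : ℕ} {l : List Bool} : l ∈ words n ↔ l.length = n := by
  induction n generalizing l with
  | zero => simp [words]
  | succ n ih =>
    cases l with
    | nil => simp [words]
    | cons b l => cases b <;> simp [words, ih]

/-- Split by the first letter: a supersequence of `a :: z` either starts with `a` and continues with
a supersequence of `z`, or starts with the other letter and continues with one of `a :: z`. With the
weight `X ^ z.length` this recursion is dominated by `(X + 1) ^ (n + 1) = X * (X + 1) ^ n + (X + 1)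
^ n`. For `z = []` the number of words doubles, which is covered because `2 ≤ X + 1`. -/
theorem card_supers_mul (X : ℕ) (hX : 1 ≤ X) (n : ℕ) (z : List Bool) :
    ((words n).filter fun l => z.Sublist l).card * X ^ z.length ≤ (X + 1) ^ n := by
  induction n generalizing z with
  | zero =>
    cases z with
    | nil => simp [words]
    | cons a z =>
      rw [Finset.filter_eq_empty_iff.2 fun l hl h => by
        rw [mem_words] at hl
        have := h.length_le
        simp [hl] at this]
      simp
  | succ n ih =>
    cases z with
    | nil =>
      have h : (words (n + 1)).card ≤ (words n).card + (words n).card := by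
        rw [show words (n + 1) = (words n).image (List.cons false) ∪
          (words n).image (List.cons true) from rfl]
        refine (Finset.card_union_le _ _).trans (Nat.add_le_add ?_ ?_) <;>
          exact Finset.card_image_le
      have := ih []
      simp only [List.nil_sublist, Finset.filter_true, List.length_nil, pow_zero, mul_one] at this ⊢
      rw [pow_succ, mul_add, mul_one]
      have h3 : (X + 1) ^ n ≤ (X + 1) ^ n * X := Nat.le_mul_of_pos_right _ hX
      omega
    | cons a z =>
      have h : (words (n + 1)).filter (fun l => (a :: z).Sublist l) ⊆
          ((words n).filter fun l => z.Sublist l).image (List.cons a) ∪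
          ((words n).filter fun l => (a :: z).Sublist l).image (List.cons (!a)) := by
        intro l hl
        simp only [Finset.mem_filter, mem_words] at hl
        obtain ⟨h1, h2⟩ := hl
        cases l with
        | nil => simp at h1
        | cons b l =>
          simp only [Finset.mem_union, Finset.mem_image, Finset.mem_filter, mem_words]
          simp only [List.length_cons, Nat.add_right_cancel_iff] at h1
          by_cases hab : b = a
          · subst hab
            exact Or.inl ⟨l, ⟨h1, by simpa using h2⟩, rfl⟩
          · refine Or.inr ⟨l, ⟨h1, ?_⟩, by cases a <;> cases b <;> simp_all⟩
            cases h2 with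
            | cons _ h => exact h
            | cons_cons _ h => exact absurd rfl hab
      have h1 := (Finset.card_le_card h).trans (Finset.card_union_le _ _)
      have h2 := h1.trans (Nat.add_le_add Finset.card_image_le Finset.card_image_le)
      have i1 := ih z
      have i2 := ih (a :: z)
      have h3 := Nat.mul_le_mul_right (X ^ (a :: z).length) h2
      refine h3.trans ?_
      rw [add_mul, pow_succ (X + 1), mul_add, mul_one]
      refine Nat.add_le_add ?_ i2
      rw [List.length_cons, pow_succ, ← mul_assoc]
      exact Nat.mul_le_mul_right _ i1

theorem choose_mul_pow_le (X n k : ℕ) : n.choose k * X ^ k ≤ (X + 1) ^ n := by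
  rcases Nat.lt_or_ge n k with h | h
  · simp [Nat.choose_eq_zero_of_lt h]
  rw [add_pow]
  refine le_trans ?_ (Finset.single_le_sum (f := fun k => X ^ k * 1 ^ (n - k) * (n.choose k))
    (fun _ _ => Nat.zero_le _) (Finset.mem_range.2 (Nat.lt_succ_of_le h)))
  simp only [one_pow, mul_one]
  rw [mul_comm]

/-- The numerical core is `257 ^ 256 / 256 ^ 255 = 256 * (1 + 1 / 256) ^ 256 < 256 * e < 2 ^ 10`. -/
theorem ball_bound {r β : ℕ} (h : β * 256 ^ (255 * r) ≤ 257 ^ (256 * r)) : β ≤ 2 ^ (10 * r) := by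
  have h1 : (257 : ℕ) ^ (256 * r) ≤ 2 ^ (10 * r) * 256 ^ (255 * r) := by
    rw [pow_mul, pow_mul, pow_mul, ← mul_pow]
    exact Nat.pow_le_pow_left (by norm_num) r
  exact Nat.le_of_mul_le_mul_right (h.trans h1) (by positivity)

-- A close word is a supersequence of a subsequence of `l` of length `255 * r`. There are at most `2
-- ^ (10 * r)` choices of either kind, by `choose_mul_pow_le` and `card_supers_mul` with `X = 256`
-- and the same inequality `ball_bound`.
open Classical in
theorem card_close_le (r : ℕ) (l : List Bool) :
    ((words (256 * r)).filter (Close (256 * r) r l)).card ≤ 2 ^ (20 * r) := by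
  by_cases hl : l.length = 256 * r
  swap
  · rw [Finset.filter_eq_empty_iff.2 fun l' _ h => hl h.1]
    simp
  have hsub : (words (256 * r)).filter (Close (256 * r) r l) ⊆
      (List.sublistsLen (255 * r) l).toFinset.biUnion fun z =>
        (words (256 * r)).filter fun l' => z.Sublist l' := by
    intro l' hl'
    simp only [Finset.mem_filter] at hl'
    obtain ⟨h1, -, -, z, h2, h3, h4⟩ := hl'
    simp only [Finset.mem_biUnion, List.mem_toFinset, List.mem_sublistsLen, Finset.mem_filter]
    exact ⟨z, ⟨h2, by omega⟩, h1, h3⟩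
  refine (Finset.card_le_card hsub).trans ?_
  refine (Finset.card_biUnion_le_card_mul _ _ (2 ^ (10 * r)) fun z hz => ?_).trans ?_
  · simp only [List.mem_toFinset, List.mem_sublistsLen] at hz
    have := card_supers_mul 256 (by norm_num) (256 * r) z
    rw [hz.2] at this
    exact ball_bound this
  · have h1 : (List.sublistsLen (255 * r) l).toFinset.card ≤ 2 ^ (10 * r) := by
      refine (List.toFinset_card_le _).trans ?_
      rw [List.length_sublistsLen, hl]
      exact ball_bound (choose_mul_pow_le 256 _ _)
    calc _ ≤ 2 ^ (10 * r) * 2 ^ (10 * r) := Nat.mul_le_mul_right _ h1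
      _ = 2 ^ (20 * r) := by rw [← pow_add]; congr 1; ring

/-! ### A pairwise independent family of hash functions -/

/-- The multiply-shift hash function with seed `s`. -/
def hash (m M s x : ℕ) : ℕ := (s / 2 ^ (M + m) * x + s % 2 ^ (M + m)) / 2 ^ m % 2 ^ M

theorem hash_lt (m M s x : ℕ) : hash m M s x < 2 ^ M := Nat.mod_lt _ (by positivity)

theorem div_mod_two_pow (m M y : ℕ) : y / 2 ^ m % 2 ^ M = y % 2 ^ (M + m) / 2 ^ m := by
  rw [add_comm, pow_add, Nat.mod_mul_right_div_self]

/-- Put `w = M + m`; a seed is a pair `(a, b)` of `w`-bit numbers, and the two hash values are the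
upper `M` bits of `a * x + b` and `a * y + b` modulo `2 ^ w`. Write `y - x = 2 ^ t * o` with `o`
odd. Given the hash values, the seed is determined by the `m` lower bits of the first number, the
bits from `t` to `m` of the second, and the top `t` bits of `a`, which makes `2 * m` bits. For the
`t` lowest bits of both numbers agree, and the difference `2 ^ t * o * a` modulo `2 ^ w` gives `a`
modulo `2 ^ (w - t)`. -/
theorem card_hash_le {m M x y z z' : ℕ} (hxy : x < y) (hy : y < 2 ^ m) :
    ((Finset.range (2 ^ (2 * (M + m)))).filter fun s => hash m M s x = z ∧ hash m M s y = z').card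
      ≤ 2 ^ (2 * m) := by
  set w := M + m with hw
  obtain ⟨t, o, ho, hδ⟩ := Nat.exists_eq_two_pow_mul_odd (n := y - x) (by omega)
  have htm : t < m := by
    by_contra h
    have h1 : 2 ^ m ≤ 2 ^ t := Nat.pow_le_pow_right (by norm_num) (by omega)
    have h2 : 2 ^ t ≤ 2 ^ t * o := Nat.le_mul_of_pos_right _ ho.pos
    omega
  let v : ℕ → ℕ := fun s => (s / 2 ^ w * x + s % 2 ^ w) % 2 ^ w
  let v' : ℕ → ℕ := fun s => (s / 2 ^ w * y + s % 2 ^ w) % 2 ^ w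
  let T : Finset (ℕ × ℕ × ℕ) :=
    Finset.range (2 ^ m) ×ˢ Finset.range (2 ^ (m - t)) ×ˢ Finset.range (2 ^ t)
  have hT : T.card = 2 ^ (2 * m) := by
    simp only [T, Finset.card_product, Finset.card_range, ← pow_add]
    congr 1; omega
  rw [← hT]
  refine Finset.card_le_card_of_injOn
    (fun s => (v s % 2 ^ m, v' s % 2 ^ m / 2 ^ t, s / 2 ^ w / 2 ^ (w - t))) ?_ ?_
  · intro s hs
    simp only [Finset.coe_filter, Finset.mem_range, Set.mem_ofPred_eq] at hs
    simp only [T, Finset.coe_product, Set.mem_prod, Finset.coe_range, Set.mem_Iio]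
    refine ⟨Nat.mod_lt _ (by positivity), ?_, ?_⟩
    · rw [Nat.div_lt_iff_lt_mul (by positivity), ← pow_add, Nat.sub_add_cancel htm.le]
      exact Nat.mod_lt _ (by positivity)
    · rw [Nat.div_lt_iff_lt_mul (by positivity), ← pow_add,
        Nat.div_lt_iff_lt_mul (by positivity), ← pow_add]
      rw [show t + (w - t) + w = 2 * w by omega]
      exact hs.1
  · intro s1 hs1 s2 hs2 h
    simp only [Finset.coe_filter, Finset.mem_range, Set.mem_ofPred_eq, hash, div_mod_two_pow] at hs1 hs2
    simp only [Prod.mk.injEq] at h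
    obtain ⟨h1, h2, h3⟩ := h
    have e1 : v s1 = v s2 := by
      rw [← Nat.div_add_mod (v s1) (2 ^ m), ← Nat.div_add_mod (v s2) (2 ^ m), h1]
      congr 2
      exact hs1.2.1.trans hs2.2.1.symm
    -- As `y ≡ x` modulo `2 ^ t`, the `t` lowest bits of the second number need not be recorded.
    have hmodt : ∀ s, v' s ≡ v s [MOD 2 ^ t] := by
      intro s
      have hd : 2 ^ t ∣ 2 ^ w := pow_dvd_pow _ (by omega)
      have a1 : v' s ≡ s / 2 ^ w * y + s % 2 ^ w [MOD 2 ^ t] := (Nat.mod_modEq _ _).of_dvd hd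
      have a2 : v s ≡ s / 2 ^ w * x + s % 2 ^ w [MOD 2 ^ t] := (Nat.mod_modEq _ _).of_dvd hd
      refine a1.trans (Nat.ModEq.trans ?_ a2.symm)
      have : y = x + 2 ^ t * o := by omega
      rw [this]
      have : s / 2 ^ w * (x + 2 ^ t * o) + s % 2 ^ w
          = s / 2 ^ w * x + s % 2 ^ w + 2 ^ t * (s / 2 ^ w * o) := by ring
      rw [this]
      simp [Nat.ModEq]
    have e2 : v' s1 = v' s2 := by
      have hm : v' s1 % 2 ^ m = v' s2 % 2 ^ m := by
        rw [← Nat.div_add_mod (v' s1 % 2 ^ m) (2 ^ t), ← Nat.div_add_mod (v' s2 % 2 ^ m) (2 ^ t),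
          h2]
        congr 1
        rw [Nat.mod_mod_of_dvd _ (pow_dvd_pow 2 htm.le), Nat.mod_mod_of_dvd _ (pow_dvd_pow 2 htm.le)]
        exact (hmodt s1).trans (by rw [e1]; exact (hmodt s2).symm)
      rw [← Nat.div_add_mod (v' s1) (2 ^ m), ← Nat.div_add_mod (v' s2) (2 ^ m), hm]
      congr 2
      exact hs1.2.2.trans hs2.2.2.symm
    have e3 : s1 / 2 ^ w = s2 / 2 ^ w := by
      have a1 : ((s1 / 2 ^ w * x + s1 % 2 ^ w : ℕ) : ℤ) ≡ (s2 / 2 ^ w * x + s2 % 2 ^ w : ℕ)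
          [ZMOD (2 ^ w : ℕ)] := (Int.natCast_modEq_iff).2 e1
      have a2 : ((s1 / 2 ^ w * y + s1 % 2 ^ w : ℕ) : ℤ) ≡ (s2 / 2 ^ w * y + s2 % 2 ^ w : ℕ)
          [ZMOD (2 ^ w : ℕ)] := (Int.natCast_modEq_iff).2 e2
      have a3 := a2.sub a1
      generalize s1 / 2 ^ w = a at *
      generalize s2 / 2 ^ w = b at *
      generalize s1 % 2 ^ w = c at *
      generalize s2 % 2 ^ w = d at *
      have hyx : (y : ℤ) = x + 2 ^ t * o := by
        have : y = x + 2 ^ t * o := by omega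
        rw [this]; push_cast; ring
      push_cast at a3
      rw [hyx] at a3
      have a4 : ((2 : ℤ) ^ w) ∣ 2 ^ t * (o * ((b : ℤ) - a)) := by
        have := a3.dvd
        convert this using 1
        ring
      have a5 : ((2 : ℤ) ^ (w - t)) ∣ o * ((b : ℤ) - a) := by
        rw [show w = t + (w - t) by omega, pow_add] at a4
        exact Int.dvd_of_mul_dvd_mul_left (by positivity) a4
      -- The odd factor `o` is coprime to the power of two and can be cancelled.
      have a6 : ((2 : ℤ) ^ (w - t)) ∣ (b : ℤ) - a := by
        refine IsCoprime.dvd_of_dvd_mul_left ?_ a5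
        refine IsCoprime.pow_left ?_
        rw [show (2 : ℤ) = ((2 : ℕ) : ℤ) by rfl, Nat.isCoprime_iff_coprime]
        exact (Nat.coprime_two_left).2 ho
      have a7 : a ≡ b [MOD 2 ^ (w - t)] := by
        rw [← Int.natCast_modEq_iff]
        exact Int.modEq_iff_dvd.2 (by exact_mod_cast a6)
      rw [← Nat.div_add_mod a (2 ^ (w - t)), ← Nat.div_add_mod b (2 ^ (w - t)), h3]
      congr 1
    have e4 : s1 % 2 ^ w = s2 % 2 ^ w := by
      have a1 : s1 / 2 ^ w * x + s1 % 2 ^ w ≡ s2 / 2 ^ w * x + s2 % 2 ^ w [MOD 2 ^ w] := e1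
      rw [e3] at a1
      have a2 := Nat.ModEq.add_left_cancel' _ a1
      unfold Nat.ModEq at a2
      simpa using a2
    rw [← Nat.div_add_mod s1 (2 ^ w), ← Nat.div_add_mod s2 (2 ^ w), e3, e4]

/-! ### A code for insertions and deletions -/

/-- The lowest `k` bits of `z`, each followed by a one. -/
def interleave : ℕ → ℕ → List Bool
  | 0, _ => []
  | k + 1, z => decide (z % 2 = 1) :: true :: interleave k (z / 2)

theorem length_interleave (k z : ℕ) : (interleave k z).length = 2 * k := by
  induction k generalizing z with
  | zero => rfl
  | succ k ih => simp [interleave, ih]; ring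

theorem interleave_inj {k z z' : ℕ} (hz : z < 2 ^ k) (hz' : z' < 2 ^ k)
    (h : interleave k z = interleave k z') : z = z' := by
  induction k generalizing z z' with
  | zero => simp at hz hz'; omega
  | succ k ih =>
    simp only [interleave, List.cons.injEq, decide_eq_decide, true_and] at h
    have := ih (z := z / 2) (z' := z' / 2) (by rw [pow_succ] at hz; omega)
      (by rw [pow_succ] at hz'; omega) h.2
    have h1 := h.1
    omega

/-- The number of hash bits for messages of `m` bits. -/
abbrev hashBits (m : ℕ) : ℕ := 2 ^ 13 * m

/-- The length of the codewords for messages of `m` bits. -/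
abbrev wordLen (m : ℕ) : ℕ := 2 ^ 14 * m

/-- The codeword of the message `x` for the seed `s`. -/
def codeword (m s x : ℕ) : List Bool := interleave (hashBits m) (hash m (hashBits m) s x)

theorem length_codeword (m s x : ℕ) : (codeword m s x).length = wordLen m := by
  rw [codeword, length_interleave]; simp only [hashBits, wordLen]; ring

/-- One more than the largest message of less than `m` bits with a given codeword. -/
def label (m s : ℕ) (l : List Bool) : ℕ :=
  ((Finset.range (2 ^ m)).filter fun x => codeword m s x = l).sup fun x => x + 1

/-- The largest label close to a word. -/
def table (m s : ℕ) : List Bool → ℕ := spread (wordLen m) (64 * m) (label m s)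

/-- The seed `s` yields a code with distance. -/
def GoodSeed (m s : ℕ) : Prop :=
  ∀ x < 2 ^ m, spread (wordLen m) (64 * m) (table m s) (codeword m s x) = x + 1

theorem le_label {m s x : ℕ} (hx : x < 2 ^ m) : x + 1 ≤ label m s (codeword m s x) :=
  Finset.le_sup (f := fun x => x + 1) (by simp [hx])

theorem exists_of_label {m s : ℕ} {l : List Bool} (h : label m s l ≠ 0) :
    ∃ x < 2 ^ m, codeword m s x = l ∧ label m s l = x + 1 := by
  have hne : ((Finset.range (2 ^ m)).filter fun x => codeword m s x = l).Nonempty := by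
    rw [Finset.nonempty_iff_ne_empty]
    intro h0
    rw [label, h0] at h
    exact h rfl
  obtain ⟨x, hx, e⟩ := Finset.exists_mem_eq_sup _ hne fun x => x + 1
  simp only [Finset.mem_filter, Finset.mem_range] at hx
  exact ⟨x, hx.1, hx.2, e⟩

theorem close_self {W r : ℕ} {l : List Bool} (hl : l.length = W) (hr : r ≤ W) : Close W r l l :=
  ⟨hl, hl, l.take (W - r), List.take_sublist _ _, List.take_sublist _ _, by
    rw [List.length_take]; omega⟩

theorem exists_of_table {m s : ℕ} {l : List Bool} (hl : l.length = wordLen m)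
    (h : table m s l ≠ 0) :
    ∃ x < 2 ^ m, Close (wordLen m) (64 * m) l (codeword m s x) ∧ table m s l = x + 1 := by
  obtain ⟨l', h1, h2⟩ := exists_close_of_spread hl h
  obtain ⟨x, hx, h3, h4⟩ := exists_of_label (m := m) (s := s) (l := l') (by rw [h2]; exact h)
  exact ⟨x, hx, h3 ▸ h1, h2.symm.trans h4⟩

theorem le_table {m s x : ℕ} {l : List Bool} (hx : x < 2 ^ m)
    (h : Close (wordLen m) (64 * m) l (codeword m s x)) : x + 1 ≤ table m s l :=
  (le_label hx).trans h.le_spread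

/-- With a good seed, the table decodes up to `64 * m` insertions and deletions. -/
theorem GoodSeed.table_eq {m s : ℕ} (hs : GoodSeed m s) {x : ℕ} {l : List Bool} (hx : x < 2 ^ m)
    (h : Close (wordLen m) (64 * m) l (codeword m s x)) : table m s l = x + 1 := by
  refine le_antisymm ?_ (le_table hx h)
  have := h.symm.le_spread (F := table m s)
  rwa [hs x hx] at this

-- Each of the two steps reaches at most `2 ^ (20 * (64 * m)) = 2 ^ (1280 * m)` words, and
-- interleaving with ones is injective, so a hash value has at most `2 ^ (2560 * m)` partners.
open Classical in
theorem card_pairs_le (m : ℕ) :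
    ((Finset.range (2 ^ hashBits m) ×ˢ Finset.range (2 ^ hashBits m)).filter fun p =>
      ∃ l, Close (wordLen m) (64 * m) (interleave (hashBits m) p.1) l ∧
        Close (wordLen m) (64 * m) l (interleave (hashBits m) p.2)).card
      ≤ 2 ^ hashBits m * 2 ^ (2560 * m) := by
  set P := (Finset.range (2 ^ hashBits m) ×ˢ Finset.range (2 ^ hashBits m)).filter fun p =>
      ∃ l, Close (wordLen m) (64 * m) (interleave (hashBits m) p.1) l ∧
        Close (wordLen m) (64 * m) l (interleave (hashBits m) p.2)
  have e : wordLen m = 256 * (64 * m) := by simp only [wordLen]; ring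
  have hP : P ⊆ (Finset.range (2 ^ hashBits m)).biUnion fun z =>
      ((Finset.range (2 ^ hashBits m)).filter fun z' =>
        ∃ l, Close (wordLen m) (64 * m) (interleave (hashBits m) z) l ∧
        Close (wordLen m) (64 * m) l (interleave (hashBits m) z')).image fun z' => (z, z') := by
    intro p hp
    simp only [P, Finset.mem_filter, Finset.mem_product, Finset.mem_range] at hp
    simp only [Finset.mem_biUnion, Finset.mem_image, Finset.mem_filter, Finset.mem_range]
    exact ⟨p.1, hp.1.1, p.2, ⟨hp.1.2, hp.2⟩, rfl⟩
  refine (Finset.card_le_card hP).trans ?_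
  refine (Finset.card_biUnion_le_card_mul _ _ (2 ^ (2560 * m)) fun z _ => ?_).trans (by simp)
  refine Finset.card_image_le.trans ?_
  have hsub : (((Finset.range (2 ^ hashBits m)).filter fun z' =>
        ∃ l, Close (wordLen m) (64 * m) (interleave (hashBits m) z) l ∧
        Close (wordLen m) (64 * m) l (interleave (hashBits m) z')).image
          (interleave (hashBits m))) ⊆
      ((words (256 * (64 * m))).filter
        (Close (256 * (64 * m)) (64 * m) (interleave (hashBits m) z))).biUnion fun l =>
          (words (256 * (64 * m))).filter (Close (256 * (64 * m)) (64 * m) l) := by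
    intro l' hl'
    simp only [Finset.mem_image, Finset.mem_filter] at hl'
    obtain ⟨z', ⟨-, l, h1, h2⟩, rfl⟩ := hl'
    rw [e] at h1 h2
    simp only [Finset.mem_biUnion, Finset.mem_filter, mem_words]
    exact ⟨l, ⟨h1.2.1, h1⟩, h2.2.1, h2⟩
  have hc := Finset.card_le_card hsub
  rw [Finset.card_image_of_injOn] at hc
  · refine hc.trans ?_
    refine (Finset.card_biUnion_le_card_mul _ _ (2 ^ (20 * (64 * m)))
      fun l _ => card_close_le _ _).trans ?_
    refine (Nat.mul_le_mul_right _ (card_close_le _ _)).trans ?_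
    rw [← pow_add]
    exact le_of_eq (by congr 1; ring)
  · intro a ha b hb hab
    simp only [Finset.coe_filter, Finset.mem_range, Set.mem_ofPred_eq] at ha hb
    exact interleave_inj ha.1 hb.1 hab

/-- Union bound over pairs of messages (`2 ^ (2 * m)`), over pairs of hash values at distance two
(`2 ^ (M + 2560 * m)` with `M = 2 ^ 13 * m`) and over the seeds that produce them (`2 ^ (2 * m)`).
The product `2 ^ (10756 * m)` is less than the number `2 ^ (16386 * m)` of seeds. -/
theorem exists_goodSeed {m : ℕ} (hm : 1 ≤ m) :
    ∃ s < 2 ^ (2 * (hashBits m + m)), GoodSeed m s := by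
  classical
  by_contra! hno
  set P := (Finset.range (2 ^ hashBits m) ×ˢ Finset.range (2 ^ hashBits m)).filter fun p =>
      ∃ l, Close (wordLen m) (64 * m) (interleave (hashBits m) p.1) l ∧
        Close (wordLen m) (64 * m) l (interleave (hashBits m) p.2) with hP
  have hbad : Finset.range (2 ^ (2 * (hashBits m + m))) ⊆
      (Finset.range (2 ^ m) ×ˢ Finset.range (2 ^ m)).biUnion fun xy => P.biUnion fun p =>
        (Finset.range (2 ^ (2 * (hashBits m + m)))).filter fun s => xy.1 < xy.2 ∧
          (hash m (hashBits m) s xy.1 = p.1 ∧ hash m (hashBits m) s xy.2 = p.2) := by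
    intro s hs
    rw [Finset.mem_range] at hs
    have h1 := hno s hs
    unfold GoodSeed at h1
    push Not at h1
    obtain ⟨x, hx, hne⟩ := h1
    have hcw := length_codeword m s x
    have hW : 64 * m ≤ wordLen m := by simp only [wordLen]; omega
    -- The maximum is never below the label of `x` itself. A bad seed therefore shows up through a
    -- larger message `y`, and pairs with `x < y` suffice.
    have hge : x + 1 ≤ spread (wordLen m) (64 * m) (table m s) (codeword m s x) :=
      (le_table hx (close_self hcw hW)).trans (close_self hcw hW).le_spread
    obtain ⟨l, h2, h3⟩ := exists_close_of_spread hcw (F := table m s) (r := 64 * m) (by omega)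
    obtain ⟨y, hy, h4, h5⟩ := exists_of_table (m := m) (s := s) h2.2.1 (by omega)
    simp only [Finset.mem_biUnion, Finset.mem_product, Finset.mem_range, Finset.mem_filter]
    refine ⟨(x, y), ⟨hx, hy⟩, (hash m (hashBits m) s x, hash m (hashBits m) s y), ?_, hs,
      by simp only; omega, rfl, rfl⟩
    rw [hP]
    simp only [Finset.mem_filter, Finset.mem_product, Finset.mem_range]
    exact ⟨⟨hash_lt _ _ _ _, hash_lt _ _ _ _⟩, l, h2, h4⟩
  have hc := Finset.card_le_card hbad
  rw [Finset.card_range] at hc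
  have hc2 := hc.trans (Finset.card_biUnion_le_card_mul _ _
    (2 ^ hashBits m * 2 ^ (2560 * m) * 2 ^ (2 * m)) fun xy hxy => by
      refine (Finset.card_biUnion_le_card_mul _ _ (2 ^ (2 * m)) fun p _ => ?_).trans
        (Nat.mul_le_mul_right _ (card_pairs_le m))
      simp only [Finset.mem_product, Finset.mem_range] at hxy
      by_cases h : xy.1 < xy.2
      · simp only [h, true_and]
        exact card_hash_le h hxy.2
      · simp [h])
  rw [Finset.card_product, Finset.card_range, ← pow_add, ← pow_add, ← pow_add, ← pow_add] at hc2
  have := (Nat.pow_le_pow_iff_right (by norm_num)).1 hc2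
  simp only [hashBits] at this
  omega

/-! ### Alignments -/

/-- A common subsequence of `u` and `v` misses at most `e` symbols of the two words. -/
def Aligned {α : Type} (e : ℕ) (u v : List α) : Prop :=
  ∃ z : List α, z.Sublist u ∧ z.Sublist v ∧ u.length + v.length ≤ 2 * z.length + e

theorem Aligned.symm {α : Type} {e : ℕ} {u v : List α} (h : Aligned e u v) : Aligned e v u := by
  obtain ⟨z, h1, h2, h3⟩ := h
  exact ⟨z, h2, h1, by omega⟩

theorem Aligned.length_le {α : Type} {e : ℕ} {u v : List α} (h : Aligned e u v) :
    u.length ≤ v.length + e := by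
  obtain ⟨z, h1, h2, h3⟩ := h
  have := h2.length_le
  omega

theorem Aligned.count_le {e : ℕ} {u v : List Bool} (h : Aligned e u v) :
    u.count true ≤ v.count true + e := by
  obtain ⟨z, h1, h2, h3⟩ := h
  have a1 := h2.count_le true
  have a2 := h2.length_le
  have a3 : u.count true + z.length ≤ z.count true + u.length := by
    have b1 := h1.count_le false
    have b2 : ∀ l : List Bool, l.count true + l.count false = l.length := fun l =>
      List.count_true_add_count_false l
    have := b2 u
    have := b2 z
    omega
  omega

/-- The common subsequence splits at the border of `u₁` and `u₂`, and its first part is matched to a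
prefix of `v`. The errors are the exact deficits of the two parts, so they add up to at most `e`. -/
theorem Aligned.append_left {α : Type} {e : ℕ} {u₁ u₂ v : List α} (h : Aligned e (u₁ ++ u₂) v) :
    ∃ v₁ v₂ e₁ e₂, v = v₁ ++ v₂ ∧ e₁ + e₂ ≤ e ∧ Aligned e₁ u₁ v₁ ∧ Aligned e₂ u₂ v₂ := by
  obtain ⟨z, h1, h2, h3⟩ := h
  obtain ⟨z₁, z₂, rfl, h4, h5⟩ := List.sublist_append_iff.1 h1
  obtain ⟨v₁, v₂, rfl, h6, h7⟩ := List.append_sublist_iff.1 h2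
  have a1 := h4.length_le
  have a2 := h5.length_le
  have a3 := h6.length_le
  have a4 := h7.length_le
  simp only [List.length_append] at h3
  exact ⟨v₁, v₂, u₁.length + v₁.length - 2 * z₁.length, u₂.length + v₂.length - 2 * z₂.length,
    rfl, by omega, ⟨z₁, h4, h6, by omega⟩, ⟨z₂, h5, h7, by omega⟩⟩

theorem Aligned.map {α β : Type} (g : α → β) {e : ℕ} {u v : List α} (h : Aligned e u v) :
    Aligned e (u.map g) (v.map g) := by
  obtain ⟨z, h1, h2, h3⟩ := h
  exact ⟨z.map g, h1.map g, h2.map g, by simpa using h3⟩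

/-- An insertion adds one to the total length. A deletion takes one from the total length and at
most one letter from the common subsequence, which counts twice. Either way the deficit grows by at
most one. -/
theorem InsDelSteps.aligned {σ : Type} {k : ℕ} {u v : List σ} (h : InsDelSteps k u v) :
    Aligned k u v := by
  induction h with
  | refl u => exact ⟨u, List.Sublist.refl _, List.Sublist.refl _, by omega⟩
  | @insert k u v w a _ ih =>
    obtain ⟨z, h1, h2, h3⟩ := ih
    refine ⟨z, h1, h2.trans ((List.sublist_cons_self a w).append_left v), ?_⟩
    simp only [List.length_append, List.length_cons] at h3 ⊢
    omega
  | @delete k u v w a _ ih =>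
    obtain ⟨z, h1, h2, h3⟩ := ih
    obtain ⟨z₁, z₂, rfl, h4, h5⟩ := List.sublist_append_iff.1 h2
    obtain ⟨z₃, h6, h7, h8⟩ : ∃ z₃ : List σ, z₃.Sublist z₂ ∧ z₃.Sublist w ∧
        z₂.length ≤ z₃.length + 1 := by
      cases h5 with
      | cons _ h => exact ⟨z₂, List.Sublist.refl _, h, by omega⟩
      | @cons_cons z₂ _ _ h => exact ⟨z₂, List.sublist_cons_self _ _, h, by simp⟩
    refine ⟨z₁ ++ z₃, (h6.append_left z₁).trans h1, h4.append h7, ?_⟩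
    simp only [List.length_append, List.length_cons] at h3 ⊢
    omega

/-- Needed because the infimum of an empty set would be `0`: the minimum in the edit distance is
attained. -/
theorem exists_insDelSteps {σ : Type} (u v : List σ) : ∃ k, InsDelSteps k u v := by
  have h1 : ∀ (w : List σ) k, InsDelSteps k u w → ∃ k, InsDelSteps k u [] := by
    intro w
    induction w with
    | nil => exact fun k h => ⟨k, h⟩
    | cons a w ih => exact fun k h => ih _ (InsDelSteps.delete (v := []) a h)
  obtain ⟨k, hk⟩ := h1 u 0 (.refl u)
  induction v with
  | nil => exact ⟨k, hk⟩
  | cons a v ih =>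
    obtain ⟨k', hk'⟩ := ih
    exact ⟨_, InsDelSteps.insert (v := []) a hk'⟩

theorem aligned_insDel {σ : Type} (u v : List σ) : Aligned (insDel u v) u v :=
  InsDelSteps.aligned (Nat.sInf_mem (s := {k | InsDelSteps k u v}) (exists_insDelSteps u v))

/-! ### Windows of an infinite word -/

/-- The window of length `n` at position `p`. -/
def win (V : ℕ → Bool) (p n : ℕ) : List Bool := (List.range n).map fun k => V (p + k)

@[simp] theorem length_win (V : ℕ → Bool) (p n : ℕ) : (win V p n).length = n := by simp [win]

theorem win_add (V : ℕ → Bool) (p i j : ℕ) : win V p (i + j) = win V p i ++ win V (p + i) j := by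
  simp [win, List.range_add, Function.comp_def, Nat.add_assoc]

theorem win_sublist (V : ℕ → Bool) {p n a l : ℕ} (h1 : p ≤ a) (h2 : a + l ≤ p + n) :
    (win V a l).Sublist (win V p n) := by
  obtain ⟨i, rfl⟩ := Nat.exists_eq_add_of_le h1
  obtain ⟨j, hj⟩ := Nat.exists_eq_add_of_le (show i + l ≤ n by omega)
  rw [hj, Nat.add_assoc, win_add, win_add]
  exact (List.sublist_append_left _ _).trans (List.sublist_append_right _ _)

theorem win_eq_append {V : ℕ → Bool} {p n : ℕ} {v₁ v₂ : List Bool} (h : win V p n = v₁ ++ v₂) :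
    v₁.length ≤ n ∧ v₁ = win V p v₁.length ∧ v₂ = win V (p + v₁.length) (n - v₁.length) := by
  have h1 : v₁.length + v₂.length = n := by rw [← List.length_append, ← h, length_win]
  have h2 : win V p n = win V p v₁.length ++ win V (p + v₁.length) (n - v₁.length) := by
    rw [← win_add]; congr 1; omega
  rw [h] at h2
  have := List.append_inj h2 (by simp)
  exact ⟨by omega, this.1, this.2⟩

theorem Aligned.win_split {V : ℕ → Bool} {e p n : ℕ} {u₁ u₂ : List Bool}
    (h : Aligned e (u₁ ++ u₂) (win V p n)) :
    ∃ l e₁ e₂, l ≤ n ∧ e₁ + e₂ ≤ e ∧ Aligned e₁ u₁ (win V p l) ∧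
      Aligned e₂ u₂ (win V (p + l) (n - l)) := by
  obtain ⟨v₁, v₂, e₁, e₂, h1, h2, h3, h4⟩ := h.append_left
  obtain ⟨h5, h6, h7⟩ := win_eq_append h1
  rw [h6] at h3
  rw [h7] at h4
  exact ⟨v₁.length, e₁, e₂, h5, h2, h3, h4⟩

/-- The number of ones in a window. -/
def ones (V : ℕ → Bool) (p n : ℕ) : ℕ := (win V p n).count true

theorem ones_add (V : ℕ → Bool) (p i j : ℕ) : ones V p (i + j) = ones V p i + ones V (p + i) j := by
  rw [ones, win_add, List.count_append]; rfl

theorem ones_le (V : ℕ → Bool) (p n : ℕ) : ones V p n ≤ n :=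
  (List.count_le_length (a := true) (l := win V p n)).trans (length_win V p n).le

theorem ones_mono (V : ℕ → Bool) {p n a l : ℕ} (h1 : p ≤ a) (h2 : a + l ≤ p + n) :
    ones V a l ≤ ones V p n := (win_sublist V h1 h2).count_le true

theorem ones_eq_of_forall {V : ℕ → Bool} {p n : ℕ} (h : ∀ k, p ≤ k → V k = true) :
    ones V p n = n := by
  have : win V p n = List.replicate n true := by
    rw [List.eq_replicate_iff]
    refine ⟨length_win _ _ _, fun b hb => ?_⟩
    obtain ⟨k, -, rfl⟩ := List.mem_map.1 hb
    exact h _ (by omega)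
  rw [ones, this, List.count_replicate_self]

/-- The images of consecutive blocks under an alignment. -/
theorem Aligned.flatMap_range {V : ℕ → Bool} {block : ℕ → List Bool} (n E L : ℕ)
    (h : Aligned E ((List.range (n + 1)).flatMap block) (win V 0 L)) :
    ∃ f e : ℕ → ℕ, f 0 = 0 ∧ f (n + 1) = L ∧ ∑ i ∈ Finset.range (n + 1), e i ≤ E ∧
      (∀ i, n + 1 ≤ i → e i = 0) ∧
      ∀ i < n + 1, f i ≤ f (i + 1) ∧ Aligned (e i) (block i) (win V (f i) (f (i + 1) - f i)) := by
  induction n generalizing E L with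
  | zero =>
    refine ⟨fun i => if i = 0 then 0 else L, fun i => if i = 0 then E else 0, rfl, rfl, by simp,
      fun i hi => if_neg (by omega), fun i hi => ?_⟩
    obtain rfl : i = 0 := by omega
    simpa using h
  | succ n ih =>
    rw [List.range_succ, List.flatMap_append, List.flatMap_singleton] at h
    obtain ⟨l, e₁, e₂, h1, h2, h3, h4⟩ := h.win_split
    obtain ⟨f, e, g1, g2, g3, g4, g5⟩ := ih e₁ l h3
    refine ⟨fun i => if i ≤ n + 1 then f i else L, fun i => if i = n + 1 then e₂ else e i,
      by simp [g1], by simp, ?_, fun i hi => ?_, fun i hi => ?_⟩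
    · rw [Finset.sum_range_succ, if_pos rfl]
      rw [Finset.sum_congr rfl fun i hi => if_neg (by
        have := Finset.mem_range.1 hi
        omega)]
      have h6 : ∑ i ∈ Finset.range (n + 1), e i + e₂ ≤ E := by omega
      exact h6
    · simp only
      rw [if_neg (by omega)]
      exact g4 i (by omega)
    · rcases Nat.lt_or_ge i (n + 1) with hin | hin
      · simp only [hin.le, Nat.succ_le_of_lt hin, if_true, if_neg (show i ≠ n + 1 by omega)]
        exact g5 i hin
      · obtain rfl : i = n + 1 := by omega
        simp only [le_refl, if_true, Nat.not_succ_le_self, if_false, g2]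
        refine ⟨h1, ?_⟩
        simpa using h4

/-! ### Words with every other letter one -/

/-- Every letter is followed by a one. -/
def pad (l : List Bool) : List Bool := l.flatMap fun b => [b, true]

theorem interleave_eq_pad (k z : ℕ) : ∃ l, interleave k z = pad l := by
  induction k generalizing z with
  | zero => exact ⟨[], rfl⟩
  | succ k ih =>
    obtain ⟨l, hl⟩ := ih (z / 2)
    exact ⟨decide (z % 2 = 1) :: l, by simp [interleave, hl, pad]⟩

theorem flatMap_pad {α : Type} (s : List α) (g : α → List Bool) (hg : ∀ a, ∃ l, g a = pad l) :
    ∃ l, s.flatMap g = pad l := by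
  induction s with
  | nil => exact ⟨[], rfl⟩
  | cons a s ih =>
    obtain ⟨l, hl⟩ := ih
    obtain ⟨l', hl'⟩ := hg a
    exact ⟨l' ++ l, by simp [hl, hl', pad]⟩

theorem length_take_pad_le (l : List Bool) (k : ℕ) :
    ((pad l).take k).length ≤ 2 * ((pad l).take k).count true + 1 := by
  induction l generalizing k with
  | nil => simp [pad]
  | cons b l ih =>
    match k with
    | 0 => simp
    | 1 => simp [pad]
    | k + 2 =>
      have := ih k
      have e : (pad (b :: l)).take (k + 2) = b :: true :: (pad l).take k := by simp [pad]
      rw [e]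
      simp only [List.length_cons, List.count_cons, beq_self_eq_true, if_true]
      omega

/-- In a padded word every second letter is one, so a factor, whatever the parity of its first
position, has at most one more other letter than ones. -/
theorem length_infix_pad_le (l : List Bool) {a b c : List Bool} (h : pad l = a ++ (b ++ c)) :
    b.length ≤ 2 * b.count true + 1 := by
  induction l generalizing a with
  | nil =>
    simp [pad] at h
    simp [h]
  | cons x l ih =>
    match a, h with
    | [], h =>
      have := length_take_pad_le (x :: l) b.length
      rw [h] at this
      simpa using this
    | [y], h =>
      have h' : true :: pad l = b ++ c := by
        simp [pad] at h
        simpa [pad] using h.2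
      cases b with
      | nil => simp
      | cons z b =>
        simp only [List.cons_append, List.cons.injEq] at h'
        have := length_take_pad_le l b.length
        rw [h'.2] at this
        simp only [List.take_left] at this
        rw [← h'.1]
        simp only [List.length_cons, List.count_cons, beq_self_eq_true, if_true]
        omega
    | y :: z :: a, h =>
      refine ih (a := a) ?_
      simp [pad] at h
      simpa [pad] using h.2.2

/-- Images of such words have many ones in every window. -/
theorem Aligned.le_ones {V : ℕ → Bool} {e p n a l : ℕ} {u : List Bool}
    (h : Aligned e (pad u) (win V p n)) (h1 : p ≤ a) (h2 : a + l ≤ p + n) :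
    l ≤ 2 * ones V a l + 1 + 3 * e := by
  obtain ⟨i, rfl⟩ := Nat.exists_eq_add_of_le h1
  obtain ⟨j, rfl⟩ := Nat.exists_eq_add_of_le (show i + l ≤ n by omega)
  rw [Nat.add_assoc, win_add, win_add] at h
  obtain ⟨u₁, u₂, e₁, e₂, g1, g2, g3, g4⟩ := h.symm.append_left
  obtain ⟨u₃, u₄, e₃, e₄, rfl, g6, g7, g8⟩ := g4.append_left
  have a1 := length_infix_pad_le u g1
  have a2 := g7.length_le
  have a3 := g7.symm.count_le
  rw [length_win] at a2
  change u₃.count true ≤ ones V (p + i) l + e₃ at a3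
  omega

/-- A window close to the image of a word is close to the word. -/
theorem Aligned.window {V : ℕ → Bool} {e a l p W s : ℕ} {u : List Bool} (hu : u.length = W)
    (h : Aligned e u (win V a l)) (h1 : p ≤ a + s) (h2 : a ≤ p + s) :
    ∃ z : List Bool, z.Sublist u ∧ z.Sublist (win V p W) ∧ W ≤ z.length + 2 * e + 2 * s := by
  obtain ⟨z, g1, g2, g3⟩ := h
  have g4 := g2.length_le
  rw [length_win] at g3 g4
  by_cases hl : p - a ≤ l
  swap
  · exact ⟨[], List.nil_sublist _, List.nil_sublist _, by simp; omega⟩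
  set i := p - a with hi
  -- The image sticks out of the window by `i` letters on the left and `k` on the right. Each of
  -- these costs at most one letter of the common subsequence.
  set k := min (l - i) (a + l - (p + W)) with hk
  have e1 : win V a l = win V a i ++ (win V (a + i) (l - i - k) ++ win V (a + i + (l - i - k)) k) := by
    rw [← win_add, ← win_add]; congr 1; omega
  rw [e1] at g2
  obtain ⟨z₁, z', rfl, g5, g6⟩ := List.sublist_append_iff.1 g2
  obtain ⟨z₂, z₃, rfl, g7, g8⟩ := List.sublist_append_iff.1 g6
  have b0 := g1.length_le
  have b1 := g5.length_le
  have b3 := g8.length_le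
  rw [length_win] at b1 b3
  simp only [List.length_append] at g3 g4 b0
  refine ⟨z₂, ((List.sublist_append_left z₂ z₃).trans (List.sublist_append_right z₁ _)).trans g1,
    ?_, ?_⟩
  · rcases Nat.eq_zero_or_pos (l - i - k) with h0 | h0
    · rw [h0] at g7
      have : z₂ = [] := List.eq_nil_of_length_eq_zero (by simpa using g7.length_le)
      rw [this]; exact List.nil_sublist _
    · exact g7.trans (win_sublist V (by omega) (by omega))
  · omega

/-! ### Blocks and their labels -/

/-- The length of the marker of a block. -/
abbrev markLen (η m : ℕ) : ℕ := 2 ^ η * wordLen m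

/-- The length of a block. -/
abbrev blockLen (η m : ℕ) : ℕ := 2 * markLen η m

/-- The digits of `X` in base `2 ^ (m - η)`, from the highest of `2 ^ η` digits. -/
def digit (η m X t : ℕ) : ℕ := X / 2 ^ ((m - η) * (2 ^ η - 1 - t)) % 2 ^ (m - η)

/-- The message of piece `t` of a block: the number of the piece and a digit. -/
def message (η m X t : ℕ) : ℕ := t * 2 ^ (m - η) + digit η m X t

/-- The block of `X`: a marker of zeros, and a codeword for each digit. -/
def block (η m s X : ℕ) : List Bool :=
  List.replicate (markLen η m) false ++
    (List.range (2 ^ η)).flatMap fun t => codeword m s (message η m X t)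

/-- The decoded label of the window where piece `t` should be, if a block starts at `p`. -/
def entry (η m s : ℕ) (V : ℕ → Bool) (p t : ℕ) : ℕ :=
  table m s (win V (p + markLen η m + wordLen m * t) (wordLen m))

/-- The number with `n` digits `g 0, g 1, …` in base `2 ^ v`. -/
def horner (v : ℕ) (g : ℕ → ℕ) : ℕ → ℕ
  | 0 => 0
  | n + 1 => horner v g n * 2 ^ v + g n

/-- One more than the content of the block that starts at `p`; zero if there seems to be none. -/
def labelAt (η m s : ℕ) (V : ℕ → Bool) (p : ℕ) : ℕ :=
  if ones V p (markLen η m) ≤ 4 * m ∧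
      ∀ t < 2 ^ η, entry η m s V p t ≠ 0 ∧ (entry η m s V p t - 1) / 2 ^ (m - η) = t then
    horner (m - η) (fun t => (entry η m s V p t - 1) % 2 ^ (m - η)) (2 ^ η) + 1
  else 0

theorem digit_lt (η m X t : ℕ) : digit η m X t < 2 ^ (m - η) := Nat.mod_lt _ (by positivity)

theorem message_lt {η m X t : ℕ} (hη : η ≤ m) (ht : t < 2 ^ η) : message η m X t < 2 ^ m := by
  have h1 := digit_lt η m X t
  have h2 : (t + 1) * 2 ^ (m - η) ≤ 2 ^ η * 2 ^ (m - η) := Nat.mul_le_mul_right _ ht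
  rw [← pow_add, Nat.add_sub_cancel' hη, add_mul, one_mul] at h2
  unfold message
  omega

theorem horner_congr {v : ℕ} {g g' : ℕ → ℕ} (n : ℕ) (h : ∀ t < n, g t = g' t) :
    horner v g n = horner v g' n := by
  induction n with
  | zero => rfl
  | succ n ih => simp [horner, ih fun t ht => h t (by omega), h n (by omega)]

theorem horner_digits {v X : ℕ} (h : ℕ) (hX : X < 2 ^ (v * h)) :
    horner v (fun t => X / 2 ^ (v * (h - 1 - t)) % 2 ^ v) h = X := by
  have : ∀ t ≤ h, horner v (fun t => X / 2 ^ (v * (h - 1 - t)) % 2 ^ v) t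
      = X / 2 ^ (v * (h - t)) := by
    intro t
    induction t with
    | zero => intro _; simp [horner, Nat.div_eq_of_lt hX]
    | succ t ih =>
      intro ht
      simp only [horner]
      rw [ih (by omega)]
      have e1 : v * (h - t) = v * (h - 1 - t) + v := by
        rw [show h - t = (h - 1 - t) + 1 by omega]; ring
      rw [e1, pow_add, ← Nat.div_div_eq_div_mul, Nat.div_add_mod']
      congr 3
      omega
  simpa using this h le_rfl

theorem length_flatMap_range {W : ℕ} {g : ℕ → List Bool} (hg : ∀ t, (g t).length = W) (n : ℕ) :
    ((List.range n).flatMap g).length = n * W := by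
  induction n with
  | zero => simp
  | succ n ih => rw [List.range_succ, List.flatMap_append, List.length_append, ih]; simp [hg]; ring

theorem length_block (η m s X : ℕ) : (block η m s X).length = blockLen η m := by
  rw [block, List.length_append, List.length_replicate,
    length_flatMap_range fun t => length_codeword m s _]
  simp only [blockLen, markLen]; ring

theorem flatMap_range_split {g : ℕ → List Bool} {n t : ℕ} (ht : t < n) :
    ∃ r, (List.range n).flatMap g = (List.range t).flatMap g ++ (g t ++ r) := by
  obtain ⟨k, rfl⟩ := Nat.exists_eq_add_of_le (Nat.succ_le_of_lt ht)
  rw [List.range_add, List.flatMap_append, List.range_succ, List.flatMap_append]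
  simp

section
variable {η m s : ℕ} {V : ℕ → Bool} {a l p X e : ℕ}

/-- The image of piece `t` begins within `m` of its place relative to `a`, and `p` is within `16 *
m` of `a`, so the window is shifted by at most `17 * m`. With at most `m` edits this costs at most
`2 * m + 34 * m` letters, within the radius `64 * m` of the inner code. -/
theorem entry_eq (hs : GoodSeed m s) (hη : η ≤ m) (he : e ≤ m)
    (hA : Aligned e (block η m s X) (win V a l)) (h1 : p ≤ a + 16 * m) (h2 : a ≤ p + 16 * m)
    {t : ℕ} (ht : t < 2 ^ η) : entry η m s V p t = message η m X t + 1 := by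
  obtain ⟨r, hr⟩ := flatMap_range_split (g := fun t => codeword m s (message η m X t)) ht
  rw [block, hr, ← List.append_assoc] at hA
  obtain ⟨l1, e1, e2, g1, g2, g3, g4⟩ := hA.win_split
  obtain ⟨l2, e3, e4, g5, g6, g7, -⟩ := g4.win_split
  have b1 := g3.length_le
  have b2 := g3.symm.length_le
  rw [List.length_append, List.length_replicate,
    length_flatMap_range fun t => length_codeword m s _, length_win, mul_comm t] at b1 b2
  refine hs.table_eq (message_lt hη ht) ?_
  obtain ⟨z, c1, c2, c3⟩ := g7.window (p := p + markLen η m + wordLen m * t) (s := 17 * m)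
    (length_codeword m s _) (by omega) (by omega)
  have c4 : 64 * m ≤ wordLen m := by simp only [wordLen]; omega
  refine ⟨length_win _ _ _, length_codeword _ _ _, z.take (wordLen m - 64 * m),
    (List.take_sublist _ _).trans c2, (List.take_sublist _ _).trans c1, ?_⟩
  rw [List.length_take]
  omega

theorem labelAt_eq (hs : GoodSeed m s) (hη : η ≤ m) (he : e ≤ m)
    (hX : X < 2 ^ ((m - η) * 2 ^ η))
    (hA : Aligned e (block η m s X) (win V a l)) (h1 : p ≤ a + 16 * m) (h2 : a ≤ p + 16 * m)
    (hones : ones V p (markLen η m) ≤ 4 * m) : labelAt η m s V p = X + 1 := by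
  have h : ∀ t < 2 ^ η, entry η m s V p t = message η m X t + 1 := fun t ht =>
    entry_eq hs hη he hA h1 h2 ht
  have hd : ∀ t, message η m X t / 2 ^ (m - η) = t := fun t => by
    rw [message, mul_comm, Nat.mul_add_div (by positivity), Nat.div_eq_of_lt (digit_lt _ _ _ _),
      add_zero]
  have hm : ∀ t, message η m X t % 2 ^ (m - η) = digit η m X t := fun t => by
    rw [message, mul_comm, Nat.mul_add_mod, Nat.mod_eq_of_lt (digit_lt _ _ _ _)]
  rw [labelAt, if_pos ⟨hones, fun t ht => by simp [h t ht, hd]⟩]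
  congr 1
  rw [horner_congr (g' := digit η m X) _ fun t ht => by simp [h t ht, hm]]
  exact horner_digits _ hX

/-- The image of the marker contains at most `e` ones. The window overhangs this image by less than
`(p - a) + e + 1` positions, and all of these may be ones. This makes fewer than `4 * m` in total.
-/
theorem ones_marker_le (hA : Aligned e (block η m s X) (win V a l)) (he : e ≤ m) (h1 : a ≤ p)
    (h2 : p < a + m) : ones V p (markLen η m) ≤ 4 * m := by
  rw [block] at hA
  obtain ⟨l1, e1, e2, g1, g2, g3, -⟩ := hA.win_split
  have b1 := g3.length_le
  rw [List.length_replicate, length_win] at b1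
  have b2 := g3.symm.count_le
  rw [List.count_replicate] at b2
  simp only [beq_iff_eq, Bool.false_eq_true, if_false, zero_add] at b2
  change ones V a l1 ≤ e1 at b2
  rcases Nat.lt_or_ge (l1 - (p - a)) (markLen η m) with h | h
  · obtain ⟨k, hk⟩ := Nat.exists_eq_add_of_le h.le
    rw [hk, ones_add]
    have c1 := ones_le V (p + (l1 - (p - a))) k
    rcases Nat.lt_or_ge l1 (p - a) with h3 | h3
    · have c2 := ones_le V p (l1 - (p - a))
      omega
    · have c2 := ones_mono V (p := a) (n := l1) (a := p) (l := l1 - (p - a)) h1 (by omega)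
      omega
  · rcases Nat.eq_zero_or_pos (markLen η m) with h0 | h0
    · have := ones_le V p (markLen η m)
      omega
    · have c2 := ones_mono V (p := a) (n := l1) (a := p) (l := markLen η m) h1 (by omega)
      omega

/-- The window is as long as the marker and starts more than `16 * m` inside the block, so it
overlaps the image of the codewords in at least `15 * m` positions. There every second letter was a
one, so more than `(15 * m - 1 - 3 * m) / 2` ones are left up to rounding. This is the reason for
interleaving with ones. -/
theorem lt_ones_of_inner (hm : 1 ≤ m) (hA : Aligned e (block η m s X) (win V a l)) (he : e ≤ m)
    (h1 : a + 16 * m < p) (h2 : p + 16 * m < a + l) : 4 * m < ones V p (markLen η m) := by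
  have hR : 16 * m ≤ markLen η m := by
    have : 1 ≤ 2 ^ η := Nat.one_le_two_pow
    have : 1 * wordLen m ≤ 2 ^ η * wordLen m := Nat.mul_le_mul_right _ this
    simp only [markLen, wordLen] at this ⊢
    omega
  rw [block] at hA
  obtain ⟨u, hu⟩ := flatMap_pad (List.range (2 ^ η)) (fun t => codeword m s (message η m X t))
    fun t => interleave_eq_pad _ _
  have hlen := length_flatMap_range (g := fun t => codeword m s (message η m X t))
    (fun t => length_codeword m s _) (2 ^ η)
  rw [hu] at hA hlen
  obtain ⟨l1, e1, e2, g1, g2, g3, g4⟩ := hA.win_split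
  have b1 := g3.length_le
  have b2 := g3.symm.length_le
  have b3 := g4.length_le
  rw [List.length_replicate, length_win] at b1 b2
  rw [hlen, length_win] at b3
  set R := markLen η m with hRdef
  change R ≤ _ at b3
  have c1 := g4.le_ones (a := max p (a + l1)) (l := min (p + R) (a + l) - max p (a + l1))
    (by omega) (by omega)
  have c2 := ones_mono V (p := p) (n := R) (a := max p (a + l1))
    (l := min (p + R) (a + l) - max p (a + l1)) (by omega) (by omega)
  omega

end

theorem le_markLen (η m : ℕ) : 32 * m ≤ markLen η m := by
  have : 1 ≤ 2 ^ η := Nat.one_le_two_pow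
  have : 1 * wordLen m ≤ 2 ^ η * wordLen m := Nat.mul_le_mul_right _ this
  simp only [markLen, wordLen] at this ⊢
  omega

/-! ### Labels along a whole corrupted word. -/

/-- A corrupted sequence of blocks: block `i`, with content `X i`, is corrupted by `e i` edits to the
window from `f i` to `f (i + 1)` of the word `V`, which is continued by ones. -/
structure Layout (η m s N : ℕ) (X : ℕ → ℕ) (V : ℕ → Bool) (f e : ℕ → ℕ) : Prop where
  good : GoodSeed m s
  pos : 1 ≤ m
  le : η ≤ m
  lt : ∀ i < N, X i < 2 ^ ((m - η) * 2 ^ η)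
  zero : f 0 = 0
  mono : ∀ i < N, f i ≤ f (i + 1)
  aligned : ∀ i < N, Aligned (e i) (block η m s (X i)) (win V (f i) (f (i + 1) - f i))
  none : ∀ i, N ≤ i → e i = 0
  tail : ∀ p, f N ≤ p → V p = true

namespace Layout
variable {η m s N : ℕ} {X : ℕ → ℕ} {V : ℕ → Bool} {f e : ℕ → ℕ}

theorem length_ge (h : Layout η m s N X V f e) {i : ℕ} (hi : i < N) :
    f i + blockLen η m ≤ f (i + 1) + e i := by
  have h1 := (h.aligned i hi).length_le
  have h2 := h.mono i hi
  rw [length_block, length_win] at h1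
  omega

theorem length_le (h : Layout η m s N X V f e) {i : ℕ} (hi : i < N) :
    f (i + 1) ≤ f i + blockLen η m + e i := by
  have h1 := (h.aligned i hi).symm.length_le
  have h2 := h.mono i hi
  rw [length_block, length_win] at h1
  omega

theorem labelAt_start (h : Layout η m s N X V f e) {i p : ℕ} (hi : i < N) (he : e i ≤ m)
    (h1 : f i ≤ p) (h2 : p < f i + m) : labelAt η m s V p = X i + 1 :=
  labelAt_eq h.good h.le he (h.lt i hi) (h.aligned i hi) (by omega) (by omega)
    (ones_marker_le (h.aligned i hi) he h1 h2)

theorem exists_image (h : Layout η m s N X V f e) {p : ℕ} (hp : p < f N) :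
    ∃ i < N, f i ≤ p ∧ p < f (i + 1) := by
  have : ∀ n ≤ N, p < f n → ∃ i < n, f i ≤ p ∧ p < f (i + 1) := by
    intro n
    induction n with
    | zero => intro _ h0; rw [h.zero] at h0; omega
    | succ n ih =>
      intro hn hp
      rcases Nat.lt_or_ge p (f n) with h1 | h1
      · obtain ⟨i, h2, h3⟩ := ih (by omega) h1
        exact ⟨i, by omega, h3⟩
      · exact ⟨n, by omega, h1, hp⟩
  exact this N le_rfl hp

/-- The position lies in the image of some block `i`. Within `16 * m` of its start the label is that
of block `i`; within `16 * m` of its end it is that of block `i + 1`; in between there are too many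
ones for a marker. Behind the last block the word is continued by ones, so no marker is seen there
either. -/
theorem labelAt_ne_zero (h : Layout η m s N X V f e) {p : ℕ} (hp : labelAt η m s V p ≠ 0) :
    ∃ i < N, f i ≤ p ∧ p < f (i + 1) ∧ (e i ≤ m → e (i + 1) ≤ m →
      ∃ j < N, (j = i ∨ j = i + 1) ∧ labelAt η m s V p = X j + 1 ∧
        p ≤ f j + 16 * m ∧ f j ≤ p + 16 * m) := by
  have hm := h.pos
  have hR := le_markLen η m
  have h1 : ones V p (markLen η m) ≤ 4 * m := by
    by_contra h0
    exact hp (if_neg fun h2 => h0 h2.1)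
  have hpN : p < f N := by
    by_contra h0
    rw [ones_eq_of_forall fun k hk => h.tail k (by omega)] at h1
    omega
  obtain ⟨i, hi, h2, h3⟩ := h.exists_image hpN
  refine ⟨i, hi, h2, h3, fun h4 h5 => ?_⟩
  have hmono := h.mono i hi
  by_cases h6 : p ≤ f i + 16 * m
  · exact ⟨i, hi, Or.inl rfl, labelAt_eq h.good h.le h4 (h.lt i hi) (h.aligned i hi) h6 (by omega) h1,
      h6, by omega⟩
  · by_cases h7 : p + 16 * m < f (i + 1)
    · have := lt_ones_of_inner (a := f i) (p := p) (l := f (i + 1) - f i) hm (h.aligned i hi) h4 (by omega) (by omega)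
      omega
    · have h8 : i + 1 < N := by
        by_contra h9
        obtain rfl : N = i + 1 := by omega
        have c := ones_mono V (p := p) (n := markLen η m) (a := f (i + 1))
          (l := markLen η m - 16 * m) (by omega) (by omega)
        rw [ones_eq_of_forall fun k hk => h.tail k (by omega)] at c
        omega
      exact ⟨i + 1, h8, Or.inr rfl, labelAt_eq h.good h.le h5 (h.lt _ h8) (h.aligned _ h8)
        (by omega) (by omega) h1, by omega, by omega⟩

end Layout

/-! ### Maximal inequality -/

/-- Greedy covering from the left: the first `s` with the property owns an interval of `a + 1`
places and weight at least `c * (a + 1)`, which pays for every such place in it, and the argument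
goes on behind it. The intervals are disjoint and all start at their point, so no covering constant
is lost. Weight beyond `N` is zero, so an interval that overshoots is harmless. -/
theorem card_right_mul_le (w : ℕ → ℕ) (c N : ℕ) (hw : ∀ i, N ≤ i → w i = 0) (k s : ℕ)
    (hk : s + k = N) (P : ℕ → Prop) [DecidablePred P]
    (hP : ∀ i, P i → ∃ a, c * (a + 1) ≤ ∑ j ∈ Finset.Icc i (i + a), w j) :
    ((Finset.Ico s N).filter P).card * c ≤ ∑ j ∈ Finset.Ico s N, w j := by
  induction k using Nat.strong_induction_on generalizing s with
  | _ k ih =>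
  rcases Nat.eq_zero_or_pos k with rfl | hk0
  · obtain rfl : s = N := by omega
    simp
  by_cases hs : P s
  · obtain ⟨a, ha⟩ := hP s hs
    rcases Nat.lt_or_ge (s + a + 1) N with h | h
    · have h1 := ih (k - (a + 1)) (by omega) (s + a + 1) (by omega)
      have h2 : Finset.Ico s N = Finset.Icc s (s + a) ∪ Finset.Ico (s + a + 1) N := by
        ext x; simp only [Finset.mem_union, Finset.mem_Ico, Finset.mem_Icc]; omega
      have h3 : Disjoint (Finset.Icc s (s + a)) (Finset.Ico (s + a + 1) N) := by
        rw [Finset.disjoint_left]; intro x; simp only [Finset.mem_Ico, Finset.mem_Icc]; omega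
      rw [h2, Finset.sum_union h3, Finset.filter_union]
      have h4 : ((Finset.Icc s (s + a)).filter P).card ≤ a + 1 := by
        refine (Finset.card_filter_le _ _).trans ?_
        simp; omega
      have h5 := Finset.card_union_le ((Finset.Icc s (s + a)).filter P)
        ((Finset.Ico (s + a + 1) N).filter P)
      calc _ ≤ (a + 1 + ((Finset.Ico (s + a + 1) N).filter P).card) * c :=
            Nat.mul_le_mul_right _ (by omega)
        _ = c * (a + 1) + ((Finset.Ico (s + a + 1) N).filter P).card * c := by ring
        _ ≤ _ := Nat.add_le_add ha h1
    · have h4 : ((Finset.Ico s N).filter P).card ≤ a + 1 := by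
        refine (Finset.card_filter_le _ _).trans ?_
        simp; omega
      have h5 : ∑ j ∈ Finset.Icc s (s + a), w j ≤ ∑ j ∈ Finset.Ico s N, w j := by
        rw [← Finset.sum_filter_add_sum_filter_not (Finset.Icc s (s + a)) (fun j => j < N)]
        rw [Finset.sum_eq_zero (s := (Finset.Icc s (s + a)).filter fun j => ¬ j < N) fun j hj => by
          simp only [Finset.mem_filter] at hj
          exact hw j (by omega), add_zero]
        refine Finset.sum_le_sum_of_subset fun j hj => ?_
        simp only [Finset.mem_filter, Finset.mem_Icc, Finset.mem_Ico] at hj ⊢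
        omega
      calc _ ≤ (a + 1) * c := Nat.mul_le_mul_right _ h4
        _ = c * (a + 1) := by ring
        _ ≤ _ := ha.trans h5
  · have h1 := ih (k - 1) (by omega) (s + 1) (by omega)
    have h2 : (Finset.Ico s N).filter P = (Finset.Ico (s + 1) N).filter P := by
      ext x
      simp only [Finset.mem_filter, Finset.mem_Ico]
      constructor
      · rintro ⟨h3, h4⟩
        have : x ≠ s := fun h => hs (h ▸ h4)
        exact ⟨by omega, h4⟩
      · rintro ⟨h3, h4⟩
        exact ⟨by omega, h4⟩
    rw [h2]
    refine h1.trans (Finset.sum_le_sum_of_subset fun j hj => ?_)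
    simp only [Finset.mem_Ico] at hj ⊢
    omega

/-- The mirror image, by greedy covering from the right. Truncation of `i - a` at zero only shortens
the interval. -/
theorem card_left_mul_le (w : ℕ → ℕ) (c N : ℕ) (P : ℕ → Prop) [DecidablePred P]
    (hP : ∀ i, P i → ∃ a, c * (a + 1) ≤ ∑ j ∈ Finset.Icc (i - a) i, w j) :
    ((Finset.range N).filter P).card * c ≤ ∑ j ∈ Finset.range N, w j := by
  induction N using Nat.strong_induction_on with
  | _ N ih =>
  rcases Nat.eq_zero_or_pos N with rfl | hN
  · simp
  by_cases hs : P (N - 1)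
  · obtain ⟨a, ha⟩ := hP _ hs
    have h1 := ih (N - 1 - a) (by omega)
    have h2 : Finset.range N = Finset.Icc (N - 1 - a) (N - 1) ∪ Finset.range (N - 1 - a) := by
      ext x; simp only [Finset.mem_union, Finset.mem_range, Finset.mem_Icc]; omega
    have h3 : Disjoint (Finset.Icc (N - 1 - a) (N - 1)) (Finset.range (N - 1 - a)) := by
      rw [Finset.disjoint_left]; intro x; simp only [Finset.mem_range, Finset.mem_Icc]; omega
    rw [h2, Finset.sum_union h3, Finset.filter_union]
    have h4 : ((Finset.Icc (N - 1 - a) (N - 1)).filter P).card ≤ a + 1 := by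
      refine (Finset.card_filter_le _ _).trans ?_
      simp; omega
    have h5 := Finset.card_union_le ((Finset.Icc (N - 1 - a) (N - 1)).filter P)
      ((Finset.range (N - 1 - a)).filter P)
    calc _ ≤ (a + 1 + ((Finset.range (N - 1 - a)).filter P).card) * c :=
          Nat.mul_le_mul_right _ (by omega)
      _ = c * (a + 1) + ((Finset.range (N - 1 - a)).filter P).card * c := by ring
      _ ≤ _ := Nat.add_le_add ha h1
  · have h1 := ih (N - 1) (by omega)
    have h2 : (Finset.range N).filter P = (Finset.range (N - 1)).filter P := by
      ext x
      simp only [Finset.mem_filter, Finset.mem_range]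
      constructor
      · rintro ⟨h3, h4⟩
        have : x ≠ N - 1 := fun h => hs (h ▸ h4)
        exact ⟨by omega, h4⟩
      · rintro ⟨h3, h4⟩
        exact ⟨by omega, h4⟩
    rw [h2]
    refine h1.trans (Finset.sum_le_sum_of_subset fun j hj => ?_)
    simp only [Finset.mem_range] at hj ⊢
    omega

/-- The inverse of the tolerated rate of edits around a block, in units of `m` per block. -/
abbrev tolerance (η : ℕ) : ℕ := 8192 * 2 ^ (15 + η)

/-- There are few edits around block `i`, at all scales. -/
def LocallyGood (η m : ℕ) (e : ℕ → ℕ) (i : ℕ) : Prop :=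
  ∀ a, tolerance η * ∑ j ∈ Finset.Icc (i - a) (i + a), e j ≤ m * (a + 1)

-- Where the two-sided sum is too large, the sum on one of the two sides is at least half of the
-- threshold. Hence the doubled weights, and the factor `4` after adding the left and the right
-- inequality.
open Classical in
theorem card_not_locallyGood_mul_le (η m N : ℕ) (e : ℕ → ℕ) (he : ∀ i, N ≤ i → e i = 0) :
    ((Finset.range N).filter fun i => ¬ LocallyGood η m e i).card * m
      ≤ 4 * tolerance η * ∑ j ∈ Finset.range N, e j := by
  let w : ℕ → ℕ := fun j => 2 * tolerance η * e j
  let PR : ℕ → Prop := fun i => ∃ a, m * (a + 1) ≤ ∑ j ∈ Finset.Icc i (i + a), w j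
  let PL : ℕ → Prop := fun i => ∃ a, m * (a + 1) ≤ ∑ j ∈ Finset.Icc (i - a) i, w j
  have hR := card_right_mul_le w m N (fun i hi => by simp [w, he i hi]) N 0 (by simp) PR
    fun i h => h
  have hL := card_left_mul_le w m N PL fun i h => h
  rw [Finset.range_eq_Ico] at hL ⊢
  have hsub : ((Finset.Ico 0 N).filter fun i => ¬ LocallyGood η m e i) ⊆
      (Finset.Ico 0 N).filter PR ∪ (Finset.Ico 0 N).filter PL := by
    intro i hi
    simp only [Finset.mem_filter, Finset.mem_union] at hi ⊢
    obtain ⟨h1, h2⟩ := hi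
    unfold LocallyGood at h2
    push Not at h2
    obtain ⟨a, ha⟩ := h2
    have h3 : Finset.Icc (i - a) (i + a) = Finset.Icc (i - a) i ∪ Finset.Icc i (i + a) := by
      ext x; simp only [Finset.mem_union, Finset.mem_Icc]; omega
    have h4 : ∑ j ∈ Finset.Icc (i - a) (i + a), e j ≤
        ∑ j ∈ Finset.Icc (i - a) i, e j + ∑ j ∈ Finset.Icc i (i + a), e j := by
      rw [h3, ← Finset.sum_union_inter]; exact Nat.le_add_right _ _
    have h5 := Nat.mul_le_mul_left (tolerance η) h4
    rw [Nat.mul_add] at h5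
    by_cases h6 : m * (a + 1) ≤ 2 * (tolerance η * ∑ j ∈ Finset.Icc i (i + a), e j)
    · refine Or.inl ⟨h1, a, ?_⟩
      rw [← Finset.mul_sum, mul_assoc]; exact h6
    · refine Or.inr ⟨h1, a, ?_⟩
      rw [← Finset.mul_sum, mul_assoc]; omega
  have hc := (Finset.card_le_card hsub).trans (Finset.card_union_le _ _)
  have h7 := Nat.mul_le_mul_right m hc
  rw [add_mul] at h7
  have h8 : ∑ j ∈ Finset.Ico 0 N, w j = 2 * tolerance η * ∑ j ∈ Finset.Ico 0 N, e j := by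
    rw [Finset.mul_sum]
  rw [h8] at hR hL
  have h9 : 4 * tolerance η * ∑ j ∈ Finset.Ico 0 N, e j
      = 2 * tolerance η * ∑ j ∈ Finset.Ico 0 N, e j
        + 2 * tolerance η * ∑ j ∈ Finset.Ico 0 N, e j := by ring
  omega

/-! ### The noisy search -/

/-- The number of `t < N` with a property. -/
abbrev tally (N : ℕ) (P : ℕ → Prop) [DecidablePred P] : ℕ :=
  ∑ t ∈ Finset.range N, if P t then 1 else 0

/-- The offset that a label at position `x` suggests. -/
def offset (lab : ℕ → ℕ) (B lam x : ℕ) : ℕ := x - (lab x - 1) % 2 ^ lam * B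

/-- One step of the search for block `i`: the offset `Δ` is corrected by `P / 4` if the majority of
labels at the sampled positions demands a correction by more than `P / 8`. -/
def searchStep (lab : ℕ → ℕ) (B lam N : ℕ) (u : ℕ → ℕ) (P i Δ : ℕ) : ℕ :=
  let x := fun t => i * B + Δ + u t - P
  let all := tally N fun t => lab (x t) ≠ 0
  let hi := tally N fun t => lab (x t) ≠ 0 ∧ Δ + P / 8 < offset lab B lam (x t)
  let lo := tally N fun t => lab (x t) ≠ 0 ∧ offset lab B lam (x t) + P / 8 < Δ
  if all < 2 * hi then Δ + P / 4 else if all < 2 * lo then Δ - P / 4 else Δ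

/-- The offset after `k` steps, from scale `2 ^ J` on. -/
def search (lab : ℕ → ℕ) (B lam N : ℕ) (rho : ℕ → ℕ) (J Z i : ℕ) : ℕ → ℕ
  | 0 => Z
  | k + 1 => searchStep lab B lam N (fun t => rho t / 2 ^ k) (2 ^ J / 2 ^ k) i
      (search lab B lam N rho J Z i k)

/-- The last label of block `i` among `k` positions from `x` on. -/
def scan (lab : ℕ → ℕ) (lam i x : ℕ) : ℕ → ℕ
  | 0 => 0
  | k + 1 => if lab (x + k) ≠ 0 ∧ (lab (x + k) - 1) % 2 ^ lam = i then lab (x + k)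
      else scan lab lam i x k

/-- The labels as an array; position `p` of the word has index `Z + p`. -/
def labels (η m s : ℕ) (V : ℕ → Bool) (Z M x : ℕ) : ℕ :=
  if x < Z ∨ M ≤ x then 0 else labelAt η m s V (x - Z)

/-- Positions of starts of lightly corrupted blocks. -/
def Start (m N : ℕ) (f e : ℕ → ℕ) (Z x : ℕ) : Prop :=
  ∃ j < N, e j ≤ m ∧ Z + f j ≤ x ∧ x < Z + f j + m

/-- Positions whose label is right. -/
def Right (m N : ℕ) (X f : ℕ → ℕ) (lab : ℕ → ℕ) (Z x : ℕ) : Prop :=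
  ∃ j < N, lab x = X j + 1 ∧ x ≤ Z + f j + 16 * m ∧ Z + f j ≤ x + 16 * m

/-- Positions with a wrong label. -/
def Wrong (m N : ℕ) (X f : ℕ → ℕ) (lab : ℕ → ℕ) (Z x : ℕ) : Prop :=
  lab x ≠ 0 ∧ ¬ Right m N X f lab Z x

open Classical in
/-- The samples `u` from the window of length `2 * P` at `w` hit more starts of blocks than wrong
labels, if the densities allow it. -/
def Faithful (η T N : ℕ) (S W : ℕ → Prop) (u : ℕ → ℕ) (P w : ℕ) : Prop :=
  (2 * P ≤ 32 * 2 ^ (15 + η) * ((Finset.Ico w (w + 2 * P)).filter S).card →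
    T < tally N fun t => S (w + u t)) ∧
  (16 * (32 * 2 ^ (15 + η)) * ((Finset.Ico w (w + 2 * P)).filter W).card ≤ 2 * P →
    (tally N fun t => W (w + u t)) < T)

theorem tally_mono {N : ℕ} {P Q : ℕ → Prop} [DecidablePred P] [DecidablePred Q]
    (h : ∀ t < N, P t → Q t) : tally N P ≤ tally N Q := by
  refine Finset.sum_le_sum fun t ht => ?_
  by_cases hP : P t
  · simp [hP, h t (Finset.mem_range.1 ht) hP]
  · simp [hP]

theorem tally_le_add {N : ℕ} {P Q R : ℕ → Prop} [DecidablePred P] [DecidablePred Q]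
    [DecidablePred R] (h : ∀ t < N, P t → Q t ∨ R t) : tally N P ≤ tally N Q + tally N R := by
  rw [tally, tally, tally, ← Finset.sum_add_distrib]
  refine Finset.sum_le_sum fun t ht => ?_
  by_cases hP : P t
  · rcases h t (Finset.mem_range.1 ht) hP with h1 | h1 <;> simp [hP, h1]
  · simp [hP]

theorem tally_add_le {N : ℕ} {P Q R : ℕ → Prop} [DecidablePred P] [DecidablePred Q]
    [DecidablePred R] (h1 : ∀ t < N, P t → R t) (h2 : ∀ t < N, Q t → R t)
    (h3 : ∀ t < N, P t → ¬ Q t) : tally N P + tally N Q ≤ tally N R := by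
  rw [tally, tally, tally, ← Finset.sum_add_distrib]
  refine Finset.sum_le_sum fun t ht => ?_
  have ht' := Finset.mem_range.1 ht
  by_cases hP : P t
  · simp [hP, h3 t ht' hP, h1 t ht' hP]
  · by_cases hQ : Q t
    · simp [hP, hQ, h2 t ht' hQ]
    · simp [hP, hQ]

/-- The majority vote is right if more samples hit starts than wrong labels. -/
theorem searchStep_close {lab : ℕ → ℕ} {B lam N : ℕ} {u : ℕ → ℕ} {y i Δ δ g T : ℕ}
    {S G W : ℕ → Prop} [DecidablePred S] [DecidablePred G] [DecidablePred W] (hg : g ≤ y)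
    (h1 : Δ ≤ δ + 4 * y) (h2 : δ ≤ Δ + 4 * y)
    (hS : T < tally N fun t => S (i * B + Δ + u t - 8 * y))
    (hW : (tally N fun t => W (i * B + Δ + u t - 8 * y)) < T)
    (hSG : ∀ x, S x → G x) (hG0 : ∀ x, G x → lab x ≠ 0) (hGW : ∀ x, lab x ≠ 0 → G x ∨ W x)
    (hWG : ∀ x, W x → lab x ≠ 0 ∧ ¬ G x)
    (hG : ∀ t < N, G (i * B + Δ + u t - 8 * y) →
      offset lab B lam (i * B + Δ + u t - 8 * y) ≤ δ + g ∧
      δ ≤ offset lab B lam (i * B + Δ + u t - 8 * y) + g) :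
    searchStep lab B lam N u (8 * y) i Δ ≤ δ + 2 * y ∧
      δ ≤ searchStep lab B lam N u (8 * y) i Δ + 2 * y := by
  set x := fun t => i * B + Δ + u t - 8 * y with hx
  have e8 : 8 * y / 8 = y := by omega
  have e4 : 8 * y / 4 = 2 * y := by omega
  have a1 : T < tally N fun t => G (x t) := hS.trans_le (tally_mono fun t _ h => hSG _ h)
  have a2 : (tally N fun t => G (x t)) + (tally N fun t => W (x t))
      ≤ tally N fun t => lab (x t) ≠ 0 :=
    tally_add_le (fun t _ h => hG0 _ h) (fun t _ h => (hWG _ h).1) fun t _ h h' => (hWG _ h').2 h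
  have a3 : (tally N fun t => lab (x t) ≠ 0) ≤
      (tally N fun t => G (x t)) + (tally N fun t => W (x t)) :=
    tally_le_add fun t _ h => hGW _ h
  have hW' : (tally N fun t => W (x t)) < T := hW
  -- Right labels outnumber wrong ones among the samples. So a majority for `H` contains a right
  -- label, and if there is no majority for `H`, some right label violates `H`.
  have key : ∀ (H : ℕ → Prop) [DecidablePred H],
      ((tally N fun t => lab (x t) ≠ 0) < 2 * (tally N fun t => lab (x t) ≠ 0 ∧ H (x t)) →
        ∃ t < N, G (x t) ∧ H (x t)) ∧
      (¬ ((tally N fun t => lab (x t) ≠ 0) < 2 * (tally N fun t => lab (x t) ≠ 0 ∧ H (x t))) →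
        ∃ t < N, G (x t) ∧ ¬ H (x t)) := by
    intro H _
    refine ⟨fun h => ?_, fun h => ?_⟩
    · by_contra! hno
      have : (tally N fun t => lab (x t) ≠ 0 ∧ H (x t)) ≤ tally N fun t => W (x t) :=
        tally_mono fun t ht h' => (hGW _ h'.1).resolve_left fun hg => hno t ht hg h'.2
      omega
    · by_contra! hno
      have : (tally N fun t => G (x t)) ≤ tally N fun t => lab (x t) ≠ 0 ∧ H (x t) :=
        tally_mono fun t ht h' => ⟨hG0 _ h', hno t ht h'⟩
      omega
  have k1 := key fun z => Δ + 8 * y / 8 < offset lab B lam z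
  have k2 := key fun z => offset lab B lam z + 8 * y / 8 < Δ
  unfold searchStep
  simp only
  -- With `P = 8 * y` the vote has threshold `y` and the correction is `2 * y`. A right label is off
  -- by at most `g ≤ y`, so an upward vote implies `Δ ≤ δ ≤ Δ + 4 * y`, and `Δ + 2 * y` is within `2
  -- * y` of `δ`; likewise downwards. If neither vote passes, `δ` was already within `2 * y` of `Δ`.
  split_ifs with c1 c2
  · obtain ⟨t, ht, b1, b2⟩ := k1.1 c1
    have := hG t ht b1
    simp only [hx] at b2
    omega
  · obtain ⟨t, ht, b1, b2⟩ := k2.1 c2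
    have := hG t ht b1
    simp only [hx] at b2
    omega
  · obtain ⟨t, ht, b1, b2⟩ := k1.2 c1
    obtain ⟨t', ht', b1', b2'⟩ := k2.2 c2
    have := hG t ht b1
    have := hG t' ht' b1'
    simp only [hx] at b2 b2'
    omega

/-! ### Correctness of the noisy search -/

theorem blockLen_eq (η m : ℕ) : blockLen η m = 2 ^ (15 + η) * m := by
  simp only [blockLen, markLen, wordLen]; ring

theorem le_blockLen (η m : ℕ) : 32768 * m ≤ blockLen η m := by
  rw [blockLen_eq, pow_add]
  have : 1 ≤ 2 ^ η := Nat.one_le_two_pow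
  exact Nat.mul_le_mul_right _ (by omega)

/-- The tolerance contains the factor `2 ^ (15 + η)`, which is the length of a block divided by `m`.
So not only the edits near a good block are few, but also the positions of the blocks that these
edits can ruin. -/
theorem LocallyGood.sum_le {η m i : ℕ} {e : ℕ → ℕ} (h : LocallyGood η m e i) (a : ℕ) {s : Finset ℕ}
    (hs : ∀ j ∈ s, i ≤ j + a ∧ j ≤ i + a) :
    8192 * ∑ j ∈ s, e j ≤ m * (a + 1) ∧ 8192 * (2 ^ (15 + η) * ∑ j ∈ s, e j) ≤ m * (a + 1) := by
  have h1 : ∑ j ∈ s, e j ≤ ∑ j ∈ Finset.Icc (i - a) (i + a), e j :=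
    Finset.sum_le_sum_of_subset fun j hj => by
      have := hs j hj
      rw [Finset.mem_Icc]; omega
  have h2 := h a
  have h3 := Nat.mul_le_mul_left (2 ^ (15 + η)) h1
  have h4 : 1 ≤ 2 ^ (15 + η) := Nat.one_le_two_pow
  have h5 := Nat.mul_le_mul_right (∑ j ∈ s, e j) h4
  rw [tolerance, Nat.mul_assoc] at h2
  omega

theorem LocallyGood.le {η m i a : ℕ} {e : ℕ → ℕ} (h : LocallyGood η m e i) (ha : a < 8192) {j : ℕ}
    (h1 : i ≤ j + a) (h2 : j ≤ i + a) : e j ≤ m := by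
  have h3 := (h.sum_le a (s := {j}) (by simp [h1, h2])).1
  rw [Finset.sum_singleton] at h3
  have h4 := Nat.mul_le_mul_left m (show a + 1 ≤ 8192 by omega)
  omega

namespace Layout
variable {η m s N : ℕ} {X : ℕ → ℕ} {V : ℕ → Bool} {f e : ℕ → ℕ}

theorem drift (h : Layout η m s N X V f e) {j k : ℕ} (hjk : j ≤ k) (hk : k ≤ N) :
    f k ≤ f j + (k - j) * blockLen η m + ∑ i ∈ Finset.Ico j k, e i ∧
      f j + (k - j) * blockLen η m ≤ f k + ∑ i ∈ Finset.Ico j k, e i := by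
  induction k, hjk using Nat.le_induction with
  | base => simp
  | succ k hjk ih =>
    have h1 := ih (by omega)
    have h2 := h.length_le (i := k) (by omega)
    have h3 := h.length_ge (i := k) (by omega)
    rw [Finset.sum_Ico_succ_top hjk, Nat.succ_sub hjk, Nat.succ_mul]
    omega

theorem mono_le (h : Layout η m s N X V f e) {j k : ℕ} (hjk : j ≤ k) (hk : k ≤ N) : f j ≤ f k := by
  induction k, hjk using Nat.le_induction with
  | base => exact le_rfl
  | succ k hjk ih => exact (ih (by omega)).trans (h.mono k (by omega))

variable {i : ℕ}

/-- The starts of the blocks near a good block drift little. -/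
theorem drift_good (h : Layout η m s N X V f e) (hi : i < N) (hg : LocallyGood η m e i) {a j : ℕ}
    (hj : j ≤ N) (h1 : i ≤ j + a) (h2 : j ≤ i + a) :
    ∃ S, 8192 * S ≤ m * (a + 1) ∧ f j + i * blockLen η m ≤ f i + j * blockLen η m + S ∧
      f i + j * blockLen η m ≤ f j + i * blockLen η m + S := by
  rcases le_total i j with hij | hij
  · obtain ⟨k, rfl⟩ := Nat.exists_eq_add_of_le hij
    have h3 := h.drift hij hj
    rw [Nat.add_sub_cancel_left] at h3
    refine ⟨_, (hg.sum_le a (s := Finset.Ico i (i + k)) fun x hx => ?_).1, ?_, ?_⟩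
    · rw [Finset.mem_Ico] at hx; omega
    · rw [Nat.add_mul]; omega
    · rw [Nat.add_mul]; omega
  · obtain ⟨k, rfl⟩ := Nat.exists_eq_add_of_le hij
    have h3 := h.drift hij hi.le
    rw [Nat.add_sub_cancel_left] at h3
    refine ⟨_, (hg.sum_le a (s := Finset.Ico j (j + k)) fun x hx => ?_).1, ?_, ?_⟩
    · rw [Finset.mem_Ico] at hx; omega
    · rw [Nat.add_mul]; omega
    · rw [Nat.add_mul]; omega

/-- Blocks that start near a good block have near numbers. -/
theorem near (h : Layout η m s N X V f e) (hi : i < N) (hg : LocallyGood η m e i) {A j : ℕ}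
    (hj : j ≤ N) (h1 : 2 * f j ≤ 2 * f i + 3 * (A * blockLen η m) + 32 * m)
    (h2 : 2 * f i ≤ 2 * f j + 3 * (A * blockLen η m) + 32 * m) :
    j ≤ i + 2 * A ∧ i ≤ j + 2 * A := by
  have hm := h.pos
  have hB := le_blockLen η m
  set B := blockLen η m with hBdef
  by_contra hcon
  -- Starts of blocks whose numbers differ by `k ≥ 2 * A + 1` are about `k` block lengths apart. The
  -- drift over `k` blocks is a tiny fraction of that and cannot bring them within one and a half
  -- times `A` blocks.
  obtain ⟨k, hk, hk'⟩ : ∃ k, 2 * A + 1 ≤ k ∧ (j = i + k ∨ i = j + k) := by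
    rcases le_total i j with hij | hij
    · exact ⟨j - i, by omega, by omega⟩
    · exact ⟨i - j, by omega, by omega⟩
  obtain ⟨S, h3, h4, h5⟩ := h.drift_good hi hg (a := k) hj (by omega) (by omega)
  rw [← hBdef] at h4 h5
  have h6 : 2 * (k * B) ≤ 3 * (A * B) + 32 * m + 2 * S := by
    rcases hk' with rfl | rfl
    · rw [Nat.add_mul] at h4 h5; omega
    · rw [Nat.add_mul] at h4 h5; omega
  have h7 : (2 * A + 1) * B ≤ k * B := Nat.mul_le_mul_right _ hk
  have h8 : k * (32768 * m) ≤ k * B := Nat.mul_le_mul_left _ hB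
  have h9 : k * (32768 * m) = 32768 * (m * k) := by ring
  have h10 : m * (k + 1) = m * k + m := by ring
  rw [show (2 * A + 1) * B = 2 * (A * B) + B by ring] at h7
  omega

/-- A single good block controls the drift over the whole word, at the scale `a = N`. Consequently
the array of labels, which has length `8 * N * B` and starts the word at `4 * N * B`, contains the
whole received word. -/
theorem sum_le (h : Layout η m s N X V f e) (hi : i < N) (hg : LocallyGood η m e i) :
    f N ≤ 2 * (N * blockLen η m) := by
  have hB := le_blockLen η m
  obtain ⟨S, h1, h2, h3⟩ := h.drift_good hi hg (a := N) le_rfl (by omega) (by omega)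
  obtain ⟨S', h1', h2', h3'⟩ := h.drift_good hi hg (a := N) (j := 0) (by omega) (by omega) (by omega)
  rw [h.zero] at h3' h2'
  have h4 : N * (32768 * m) ≤ N * blockLen η m := Nat.mul_le_mul_left _ hB
  have h5 : m * (N + 1) ≤ 2 * (m * N) := by nlinarith
  have h6 : N * (32768 * m) = 32768 * (m * N) := by ring
  omega

theorem start_right (h : Layout η m s N X V f e) {Z M x : ℕ} (hM : Z + f N + m ≤ M)
    (hx : Start m N f e Z x) : Right m N X f (labels η m s V Z M) Z x := by
  obtain ⟨j, hj, h1, h2, h3⟩ := hx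
  have h4 := h.mono_le hj.le le_rfl
  refine ⟨j, hj, ?_, by omega, by omega⟩
  rw [labels, if_neg (by omega)]
  exact h.labelAt_start hj h1 (by omega) (by omega)

/-- The position is in the image of some block `j`. By `near`, applied to whichever of `f j` and `f
(j + 1)` lies between the position and `f i`, the number `j` is close to `i`; using `j + 1` costs
the extra one. Then `labelAt_ne_zero` applies to `j`. -/
theorem right_or_heavy (h : Layout η m s N X V f e) (hi : i < N) (hg : LocallyGood η m e i)
    {A Z M x : ℕ} (hx : labels η m s V Z M x ≠ 0)
    (h1 : 2 * x ≤ 2 * (Z + f i) + 3 * (A * blockLen η m))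
    (h2 : 2 * (Z + f i) ≤ 2 * x + 3 * (A * blockLen η m)) :
    ∃ j < N, j ≤ i + (2 * A + 1) ∧ i ≤ j + (2 * A + 1) ∧ Z + f j ≤ x ∧ x < Z + f (j + 1) ∧
      (e j ≤ m → e (j + 1) ≤ m → Right m N X f (labels η m s V Z M) Z x) := by
  have hl : labels η m s V Z M x = labelAt η m s V (x - Z) ∧ Z ≤ x := by
    unfold labels at hx ⊢
    split_ifs at hx ⊢ with h3
    · exact absurd rfl hx
    · exact ⟨rfl, by omega⟩
  rw [hl.1] at hx
  obtain ⟨j, hj, h3, h4, h5⟩ := h.labelAt_ne_zero hx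
  refine ⟨j, hj, ?_, ?_, by omega, by omega, fun h6 h7 => ?_⟩
  · rcases le_total i j with hij | hij
    · have h8 := h.mono_le hij hj.le
      have := h.near hi hg (A := A) hj.le (by omega) (by omega)
      omega
    · omega
  · rcases Nat.lt_or_ge j i with hij | hij
    · have h8 := h.mono_le (show j + 1 ≤ i from hij) hi.le
      have := h.near hi hg (A := A) (j := j + 1) hj (by omega) (by omega)
      omega
    · omega
  · obtain ⟨j', h8, -, h9, h10, h11⟩ := h5 h6 h7
    exact ⟨j', h8, by rw [hl.1, h9], by omega, by omega⟩

-- A wrong label lies in the image of a block `j` with more than `m` edits in `j` or `j + 1`. Such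
-- an image has at most `B + e j` positions, which are charged to these edits: as `m ≤ e j + e (j +
-- 1)` and `B = 2 ^ (15 + η) * m`, there are at most `2 ^ (15 + η) * (S + S') + S` of them. Local
-- goodness makes each of the three terms at most `5 * A * m / 8192`.
open Classical in
theorem card_wrong_le (h : Layout η m s N X V f e) (hi : i < N) (hg : LocallyGood η m e i)
    {A Z M w : ℕ} (hA : 1 ≤ A)
    (h1 : 2 * w + 4 * (A * blockLen η m) ≤ 2 * (Z + f i) + 3 * (A * blockLen η m))
    (h2 : 2 * (Z + f i) ≤ 2 * w + 3 * (A * blockLen η m)) :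
    256 * ((Finset.Ico w (w + 2 * (A * blockLen η m))).filter
      (Wrong m N X f (labels η m s V Z M) Z)).card ≤ A * m := by
  set B := blockLen η m with hBdef
  have hB : B = 2 ^ (15 + η) * m := blockLen_eq η m
  set a := 2 * A + 1 with ha
  let H := (Finset.Icc (i - a) (i + a)).filter fun j => m < e j ∨ m < e (j + 1)
  have hsub : (Finset.Ico w (w + 2 * (A * B))).filter (Wrong m N X f (labels η m s V Z M) Z) ⊆
      (H.filter fun j => j < N).biUnion fun j => Finset.Ico (Z + f j) (Z + f (j + 1)) := by
    intro x hx
    simp only [Finset.mem_filter, Finset.mem_Ico] at hx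
    obtain ⟨⟨h3, h4⟩, h5, h6⟩ := hx
    obtain ⟨j, hj, g1, g2, g3, g4, g5⟩ := h.right_or_heavy hi hg (A := A) h5
      (by rw [← hBdef]; omega) (by rw [← hBdef]; omega)
    have : m < e j ∨ m < e (j + 1) := by
      by_contra hcon
      exact h6 (g5 (by omega) (by omega))
    simp only [Finset.mem_biUnion, Finset.mem_filter, H, Finset.mem_Icc, Finset.mem_Ico]
    exact ⟨j, ⟨⟨by omega, this⟩, hj⟩, g3, g4⟩
  have hc := (Finset.card_le_card hsub).trans Finset.card_biUnion_le
  have hc2 : ∑ j ∈ H.filter (fun j => j < N), (Finset.Ico (Z + f j) (Z + f (j + 1))).card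
      ≤ ∑ j ∈ H, (B + e j) := by
    refine (Finset.sum_le_sum (g := fun j => B + e j) fun j hj => ?_).trans
      (Finset.sum_le_sum_of_subset (Finset.filter_subset _ _))
    simp only [Finset.mem_filter] at hj
    have := h.length_le hj.2
    rw [Nat.card_Ico]; omega
  have hc3 : m * ∑ j ∈ H, (B + e j) ≤
      B * (∑ j ∈ Finset.Icc (i - a) (i + a), e j + ∑ j ∈ Finset.Icc (i - a) (i + a), e (j + 1))
        + m * ∑ j ∈ Finset.Icc (i - a) (i + a), e j := by
    rw [← Finset.sum_add_distrib, Finset.mul_sum, Finset.mul_sum, Finset.mul_sum,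
      ← Finset.sum_add_distrib]
    refine (Finset.sum_le_sum (g := fun j => B * (e j + e (j + 1)) + m * e j) fun j hj => ?_).trans
      (Finset.sum_le_sum_of_subset (Finset.filter_subset _ _))
    simp only [H, Finset.mem_filter] at hj
    have h3 : m ≤ e j + e (j + 1) := by omega
    have := Nat.mul_le_mul_left B h3
    rw [Nat.mul_add m, mul_comm m B]
    omega
  have s1 := (hg.sum_le (a + 1) (s := Finset.Icc (i - a) (i + a)) fun x hx => by
    rw [Finset.mem_Icc] at hx; omega).2
  have s2 : ∑ j ∈ Finset.Icc (i - a) (i + a), e (j + 1)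
      = ∑ j ∈ Finset.Icc (i - a + 1) (i + a + 1), e j := by
    rw [← Finset.image_add_right_Icc, Finset.sum_image fun x _ y _ hxy => by simpa using hxy]
  have s3 := (hg.sum_le (a + 1) (s := Finset.Icc (i - a + 1) (i + a + 1)) fun x hx => by
    rw [Finset.mem_Icc] at hx; omega).2
  rw [← s2] at s3
  set S := ∑ j ∈ Finset.Icc (i - a) (i + a), e j
  set S' := ∑ j ∈ Finset.Icc (i - a) (i + a), e (j + 1)
  have h3 := hc.trans hc2
  have hm := h.pos
  have h4 : m * (∑ j ∈ H, (B + e j)) ≤ m * (2 ^ (15 + η) * S + 2 ^ (15 + η) * S' + S) := by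
    refine hc3.trans (le_of_eq ?_)
    rw [hB]; ring
  have h5 := Nat.le_of_mul_le_mul_left h4 hm
  have h6 : S ≤ 2 ^ (15 + η) * S := Nat.le_mul_of_pos_left _ (by positivity)
  have h7 : m * (a + 1 + 1) ≤ 5 * (A * m) := by
    have : a + 1 + 1 ≤ 5 * A := by omega
    calc _ ≤ m * (5 * A) := Nat.mul_le_mul_left _ this
      _ = _ := by ring
  omega

-- Among the blocks with numbers within `A / 4` of `i`, only a fraction of about `1 / 8192` has more
-- than `m` edits. Each of the others contributes `m` starting positions; these lie in the window
-- because the drift is small, and are disjoint because starts are almost `B` apart.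
open Classical in
theorem le_card_start (h : Layout η m s N X V f e) (hi : i < N) (hg : LocallyGood η m e i)
    {A Z w : ℕ} (hA : A ≤ N)
    (h1 : 2 * w + A * blockLen η m ≤ 2 * (Z + f i))
    (h2 : 2 * (Z + f i) ≤ 2 * w + 3 * (A * blockLen η m)) (hA1 : 1 ≤ A) :
    A * m ≤ 16 * ((Finset.Ico w (w + 2 * (A * blockLen η m))).filter
      (Start m N f e Z)).card := by
  have hB := le_blockLen η m
  set B := blockLen η m with hBdef
  have hm := h.pos
  set a := A / 4 with ha
  let R := (Finset.Icc (i - a) (i + a)).filter fun j => j < N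
  let G := R.filter fun j => e j ≤ m
  -- As `4 * a ≤ A ≤ N`, the range of block numbers extends far enough to at least one side of `i`.
  have hR : a + 1 ≤ R.card := by
    have : Finset.Ico (i - a) (min N (i + a + 1)) ⊆ R := fun x hx => by
      simp only [R, Finset.mem_filter, Finset.mem_Icc, Finset.mem_Ico] at hx ⊢
      omega
    have := Finset.card_le_card this
    rw [Nat.card_Ico] at this
    by_cases hia : a ≤ i
    · omega
    · omega
  have hbad : 8192 * (R.filter fun j => ¬ e j ≤ m).card ≤ a + 1 := by
    have h3 : (R.filter fun j => ¬ e j ≤ m).card * m ≤ ∑ j ∈ R.filter (fun j => ¬ e j ≤ m), e j := by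
      rw [← smul_eq_mul]
      refine Finset.card_nsmul_le_sum _ _ _ fun j hj => ?_
      simp only [Finset.mem_filter] at hj
      omega
    have h4 := (hg.sum_le a (s := R.filter fun j => ¬ e j ≤ m) fun j hj => by
      simp only [R, Finset.mem_filter, Finset.mem_Icc] at hj; omega).1
    have h5 : m * (8192 * (R.filter fun j => ¬ e j ≤ m).card) ≤ m * (a + 1) := by
      calc _ = 8192 * ((R.filter fun j => ¬ e j ≤ m).card * m) := by ring
        _ ≤ _ := by omega
    exact Nat.le_of_mul_le_mul_left h5 hm
  have hG : A ≤ 8 * G.card := by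
    have := Finset.card_filter_add_card_filter_not (s := R) (fun j => e j ≤ m)
    change G.card + _ = _ at this
    omega
  have hsub : G.biUnion (fun j => Finset.Ico (Z + f j) (Z + f j + m)) ⊆
      (Finset.Ico w (w + 2 * (A * B))).filter (Start m N f e Z) := by
    intro x hx
    simp only [G, R, Finset.mem_biUnion, Finset.mem_filter, Finset.mem_Icc, Finset.mem_Ico] at hx ⊢
    obtain ⟨j, ⟨⟨⟨g1, g2⟩, g3⟩, g4⟩, g5, g6⟩ := hx
    refine ⟨?_, j, g3, g4, g5, g6⟩
    obtain ⟨S, c1, c2, c3⟩ := h.drift_good hi hg (a := a) g3.le (by omega) (by omega)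
    have c4 : m * (a + 1) ≤ 2 * (m * A) := by
      calc _ ≤ m * (2 * A) := Nat.mul_le_mul_left _ (by omega)
        _ = _ := by ring
    have c5 : 32768 * (m * A) ≤ A * B := by
      calc _ = A * (32768 * m) := by ring
        _ ≤ _ := Nat.mul_le_mul_left _ hB
    have c6 : 4 * (a * B) ≤ A * B := by
      rw [← mul_assoc]; exact Nat.mul_le_mul_right _ (by omega)
    have c8 : m ≤ m * A := Nat.le_mul_of_pos_right _ hA1
    have c7 : j * B ≤ i * B + a * B ∧ i * B ≤ j * B + a * B := by
      rw [← Nat.add_mul, ← Nat.add_mul]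
      exact ⟨Nat.mul_le_mul_right _ (by omega), Nat.mul_le_mul_right _ (by omega)⟩
    rw [← hBdef] at c2 c3
    omega
  have hdis : ∀ x ∈ G, ∀ y ∈ G, x ≠ y → Disjoint (Finset.Ico (Z + f x) (Z + f x + m))
      (Finset.Ico (Z + f y) (Z + f y + m)) := by
    have key : ∀ x ∈ G, ∀ y ∈ G, x < y → f x + m ≤ f y := by
      intro x hx y hy hxy
      simp only [G, R, Finset.mem_filter] at hx hy
      have c1 := h.length_ge hx.1.2
      have c2 := h.mono_le (show x + 1 ≤ y from hxy) hy.1.2.le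
      rw [← hBdef] at c1
      omega
    intro x hx y hy hxy
    rw [Finset.disjoint_left]
    intro z hz hz'
    rw [Finset.mem_Ico] at hz hz'
    rcases Nat.lt_or_gt_of_ne hxy with h3 | h3
    · have := key x hx y hy h3; omega
    · have := key y hy x hx h3; omega
  have hc := Finset.card_le_card hsub
  rw [Finset.card_biUnion hdis] at hc
  simp only [Nat.card_Ico, Nat.add_sub_cancel_left, Finset.sum_const, smul_eq_mul] at hc
  have h3 := Nat.mul_le_mul_right m hG
  rw [mul_assoc] at h3
  omega

end Layout

namespace Layout
variable {η m s N : ℕ} {X : ℕ → ℕ} {V : ℕ → Bool} {f e : ℕ → ℕ} {i lam : ℕ}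

/-- The labels of the windows of a word with `N` blocks; position `0` has index `4 * N * B`. -/
abbrev lab (η m s N : ℕ) (V : ℕ → Bool) : ℕ → ℕ :=
  labels η m s V (4 * (N * blockLen η m)) (8 * (N * blockLen η m))

/-- A right label at `x` names a block `j` that starts within `16 * m` of `x`, and `f j - j * B`
differs from `f i - i * B` only by the drift, which is less than `A * m`. The lower bound on `Z`
keeps the truncated subtractions exact. -/
theorem right_offset (h : Layout η m s N X V f e) (hi : i < N) (hg : LocallyGood η m e i)
    (hX : ∀ j < N, X j % 2 ^ lam = j) {Z A x : ℕ} {lb : ℕ → ℕ} (hA1 : 1 ≤ A)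
    (hZ : N * blockLen η m + 16 * m ≤ Z)
    (hx : Right m N X f lb Z x) (h1 : 2 * x ≤ 2 * (Z + f i) + 3 * (A * blockLen η m))
    (h2 : 2 * (Z + f i) ≤ 2 * x + 3 * (A * blockLen η m)) :
    offset lb (blockLen η m) lam x ≤ Z + f i - i * blockLen η m + 17 * (A * m) ∧
      Z + f i - i * blockLen η m ≤ offset lb (blockLen η m) lam x + 17 * (A * m) := by
  obtain ⟨j, hj, h3, h4, h5⟩ := hx
  have h6 := h.near hi hg (A := A) hj.le (by omega) (by omega)
  obtain ⟨S, c1, c2, c3⟩ := h.drift_good hi hg (a := 2 * A) hj.le (by omega) (by omega)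
  rw [offset, h3, Nat.add_sub_cancel, hX j hj]
  have c4 : m * (2 * A + 1) = 2 * (A * m) + m := by ring
  have c5 : m ≤ A * m := Nat.le_mul_of_pos_left _ hA1
  have c6 : j * blockLen η m ≤ N * blockLen η m := Nat.mul_le_mul_right _ hj.le
  have c7 : i * blockLen η m ≤ N * blockLen η m := Nat.mul_le_mul_right _ hi.le
  omega

/-- The window from `i * B + Δ - P` to `i * B + Δ + P` contains the true start with a margin of `P /
2` on both sides, as the two counting lemmas require. Their densities meet the conditions in
`Faithful`, so more samples hit starts than wrong labels. The error `17 * A * m` of a right label is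
below `P / 8`, since `P ≥ 32768 * A * m`. -/
theorem step_close (h : Layout η m s N X V f e) (hi : i < N) (hg : LocallyGood η m e i)
    (hX : ∀ j < N, X j % 2 ^ lam = j) {A P T n Δ : ℕ} {u : ℕ → ℕ} (hA1 : 1 ≤ A) (hA : A ≤ N)
    (hP : P = A * blockLen η m) (hu : ∀ t < n, u t < 2 * P)
    (hF : ∀ w < 8 * (N * blockLen η m), Faithful η T n (Start m N f e (4 * (N * blockLen η m)))
      (Wrong m N X f (lab η m s N V) (4 * (N * blockLen η m))) u P w)
    (h1 : 2 * Δ ≤ 2 * (4 * (N * blockLen η m) + f i - i * blockLen η m) + P)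
    (h2 : 2 * (4 * (N * blockLen η m) + f i - i * blockLen η m) ≤ 2 * Δ + P) :
    4 * searchStep (lab η m s N V) (blockLen η m) lam n u P i Δ
        ≤ 4 * (4 * (N * blockLen η m) + f i - i * blockLen η m) + P ∧
      4 * (4 * (N * blockLen η m) + f i - i * blockLen η m)
        ≤ 4 * searchStep (lab η m s N V) (blockLen η m) lam n u P i Δ + P := by
  classical
  have hm := h.pos
  have hB := le_blockLen η m
  have hBe := blockLen_eq η m
  have hfN := h.sum_le hi hg
  have hfi := h.mono_le hi.le le_rfl
  -- Divisibility by `8` makes the threshold `P / 8` and the correction `P / 4` exact.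
  obtain ⟨y, hy⟩ : ∃ y, P = 8 * y := by
    refine ⟨A * (2 ^ (12 + η) * m), ?_⟩
    rw [hP, blockLen_eq, show 15 + η = 12 + η + 3 by ring, pow_add]; ring
  have hcard : P = 2 ^ (15 + η) * (A * m) := by rw [hP, hBe]; ring
  have d1 : i * blockLen η m ≤ N * blockLen η m := Nat.mul_le_mul_right _ hi.le
  have d2 : A * blockLen η m ≤ N * blockLen η m := Nat.mul_le_mul_right _ hA
  have d3 : 1 * blockLen η m ≤ N * blockLen η m := Nat.mul_le_mul_right _ (by omega)
  have d4 : 32768 * (A * m) ≤ P := by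
    rw [hP]
    calc _ = A * (32768 * m) := by ring
      _ ≤ _ := Nat.mul_le_mul_left _ hB
  set B := blockLen η m with hBdef
  set δ := 4 * (N * B) + f i - i * B with hδ
  have d5 : i * B + δ = 4 * (N * B) + f i := by omega
  have d6 : ∀ t, i * B + Δ + u t - 8 * y = i * B + Δ - P + u t := fun t => by omega
  obtain ⟨f1, f2⟩ := hF (i * B + Δ - P) (by omega)
  have k1 := h.le_card_start hi hg (A := A) (Z := 4 * (N * B)) (w := i * B + Δ - P) hA
    (by rw [← hBdef]; omega) (by rw [← hBdef]; omega) hA1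
  have k2 := h.card_wrong_le hi hg (A := A) (Z := 4 * (N * B)) (M := 8 * (N * B))
    (w := i * B + Δ - P) hA1 (by rw [← hBdef]; omega) (by rw [← hBdef]; omega)
  rw [← hBdef, ← hP] at k1 k2
  have f1' := f1 (by
    have := Nat.mul_le_mul_left (2 ^ (15 + η)) k1
    rw [← hcard] at this
    calc 2 * P ≤ 2 * _ := Nat.mul_le_mul_left _ this
      _ = _ := by ring)
  have f2' := f2 (by
    have := Nat.mul_le_mul_left (2 * 2 ^ (15 + η)) k2
    rw [mul_assoc 2 _ (A * m), ← hcard] at this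
    refine le_trans (le_of_eq ?_) this
    ring)
  have := searchStep_close (lab := lab η m s N V) (B := B) (lam := lam) (N := n) (u := u) (y := y)
    (i := i) (Δ := Δ) (δ := δ) (g := 17 * (A * m)) (T := T) (S := Start m N f e (4 * (N * B)))
    (G := Right m N X f (lab η m s N V) (4 * (N * B)))
    (W := Wrong m N X f (lab η m s N V) (4 * (N * B))) (by omega) (by omega) (by omega)
    (by simp only [d6]; convert f1') (by simp only [d6]; convert f2')
    (fun x hx => h.start_right (by rw [← hBdef]; omega) hx)
    (fun x hx => by obtain ⟨j, -, hj, -⟩ := hx; omega)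
    (fun x hx => by
      by_cases hr : Right m N X f (lab η m s N V) (4 * (N * B)) x
      · exact Or.inl hr
      · exact Or.inr ⟨hx, hr⟩) (fun x hx => hx)
    (fun t ht hx => by
      have := hu t ht
      rw [d6] at hx ⊢
      exact h.right_offset hi hg hX hA1 (by rw [← hBdef]; omega) hx
        (by rw [← hBdef, ← hP]; omega) (by rw [← hBdef, ← hP]; omega))
  rw [hy]
  omega

/-- The search for a good block finds its start up to a quarter of the length of a block. -/
theorem search_close (h : Layout η m s N X V f e) (hi : i < N) (hg : LocallyGood η m e i)
    (hX : ∀ j < N, X j % 2 ^ lam = j) {c J T n : ℕ} {rho : ℕ → ℕ} (hc : blockLen η m = 2 ^ c)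
    (hJ1 : 2 ^ J ≤ N * blockLen η m) (hJ2 : N * blockLen η m < 2 ^ (J + 1))
    (hrho : ∀ t < n, rho t < 2 ^ (J + 1))
    (hF : ∀ k ≤ J, ∀ w < 8 * (N * blockLen η m), Faithful η T n
      (Start m N f e (4 * (N * blockLen η m)))
      (Wrong m N X f (lab η m s N V) (4 * (N * blockLen η m))) (fun t => rho t / 2 ^ k)
      (2 ^ J / 2 ^ k) w) {k : ℕ} (hk : k + c ≤ J + 1) :
    2 * search (lab η m s N V) (blockLen η m) lam n rho J (4 * (N * blockLen η m)) i k * 2 ^ k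
        ≤ 2 * (4 * (N * blockLen η m) + f i - i * blockLen η m) * 2 ^ k + 2 ^ J ∧
      2 * (4 * (N * blockLen η m) + f i - i * blockLen η m) * 2 ^ k
        ≤ 2 * search (lab η m s N V) (blockLen η m) lam n rho J (4 * (N * blockLen η m)) i k * 2 ^ k
          + 2 ^ J := by
  induction k with
  | zero =>
    -- The initial guess `Z` is off by the drift between block `0` and block `i`, which is well
    -- below `2 ^ J / 2`. The inequalities are multiplied by `2 ^ k` so that no division occurs.
    have hB := le_blockLen η m
    obtain ⟨S, h1, h2, h3⟩ := h.drift_good hi hg (a := N) (j := 0) (by omega) (by omega) (by omega)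
    have h4 : N * (32768 * m) ≤ N * blockLen η m := Nat.mul_le_mul_left _ hB
    have h5 : m * (N + 1) ≤ 2 * (m * N) := by nlinarith
    have h6 : N * (32768 * m) = 32768 * (m * N) := by ring
    rw [h.zero] at h2 h3
    have d1 : i * blockLen η m ≤ N * blockLen η m := Nat.mul_le_mul_right _ hi.le
    rw [pow_succ] at hJ2
    simp only [search, pow_zero]
    omega
  | succ k ih =>
    have ih := ih (by omega)
    obtain ⟨j, rfl⟩ := Nat.exists_eq_add_of_le (show k + c ≤ J by omega)
    have hP : 2 ^ (k + c + j) / 2 ^ k = 2 ^ j * 2 ^ c := by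
      rw [show k + c + j = k + (j + c) by ring, pow_add, Nat.mul_div_cancel_left _ (by positivity),
        pow_add]
    have hJe : 2 ^ (k + c + j) = 2 ^ j * 2 ^ c * 2 ^ k := by rw [← pow_add, ← pow_add]; congr 1; ring
    have hA : 2 ^ j ≤ N := by
      rw [hJe, hc] at hJ1
      refine Nat.le_of_mul_le_mul_right (c := 2 ^ c) (le_trans ?_ hJ1) (by positivity)
      exact Nat.le_mul_of_pos_right _ (by positivity)
    rw [hJe] at ih
    have p0 : 0 < 2 ^ k := by positivity
    have := h.step_close hi hg hX (A := 2 ^ j) (P := 2 ^ j * 2 ^ c) (T := T) (n := n)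
      (u := fun t => rho t / 2 ^ k)
      (Δ := search (lab η m s N V) (blockLen η m) lam n rho (k + c + j)
        (4 * (N * blockLen η m)) i k) Nat.one_le_two_pow hA (by rw [hc]) (fun t ht => by
        have := hrho t ht
        rw [pow_succ, hJe] at this
        rw [Nat.div_lt_iff_lt_mul p0]
        linarith) (fun w hw => by rw [← hP]; exact hF k (by omega) w hw)
      (by
        refine Nat.le_of_mul_le_mul_right (c := 2 ^ k) ?_ p0
        rw [Nat.add_mul]; exact ih.1) (by
        refine Nat.le_of_mul_le_mul_right (c := 2 ^ k) ?_ p0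
        rw [Nat.add_mul]; exact ih.2)
    rw [← hP] at this
    change 4 * search _ _ _ _ _ _ _ _ (k + 1) ≤ _ ∧ _ ≤ 4 * search _ _ _ _ _ _ _ _ (k + 1) + _
      at this
    rw [hP] at this
    obtain ⟨g1, g2⟩ := this
    have g1' := Nat.mul_le_mul_right (2 ^ k) g1
    have g2' := Nat.mul_le_mul_right (2 ^ k) g2
    rw [hJe, pow_succ]
    constructor <;> nlinarith

/-- All blocks in reach of the scan are lightly corrupted, so every label met there is right, and a
right label that names block `i` is `X i + 1`. The scan passes the exact start of block `i`, where
there is such a label. -/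
theorem scan_eq (h : Layout η m s N X V f e) (hi : i < N) (hg : LocallyGood η m e i)
    (hX : ∀ j < N, X j % 2 ^ lam = j) {x k : ℕ}
    (h1 : x ≤ 4 * (N * blockLen η m) + f i) (h2 : 4 * (N * blockLen η m) + f i < x + k)
    (h3 : k ≤ blockLen η m) : scan (lab η m s N V) lam i x k = X i + 1 := by
  have hm := h.pos
  have hB := le_blockLen η m
  have hfN := h.sum_le hi hg
  have hfi := h.mono_le hi.le le_rfl
  have d3 : 1 * blockLen η m ≤ N * blockLen η m := Nat.mul_le_mul_right _ (by omega)
  have key : ∀ j < k, lab η m s N V (x + j) ≠ 0 → (lab η m s N V (x + j) - 1) % 2 ^ lam = i →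
      lab η m s N V (x + j) = X i + 1 := by
    intro j hj g1 g2
    obtain ⟨i', c1, c2, c3, c4, c5, c6⟩ := h.right_or_heavy hi hg (A := 1) g1 (by omega) (by omega)
    obtain ⟨i'', b1, b2, -⟩ := c6 (hg.le (a := 3) (by omega) (by omega) (by omega))
      (hg.le (a := 4) (by omega) (by omega) (by omega))
    change lab η m s N V (x + j) = _ at b2
    rw [b2, Nat.add_sub_cancel, hX i'' b1] at g2
    rw [b2, g2]
  have main : ∀ k' ≤ k, 4 * (N * blockLen η m) + f i < x + k' →
      scan (lab η m s N V) lam i x k' = X i + 1 := by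
    intro k'
    induction k' with
    | zero => intro _ h0; omega
    | succ k' ih =>
      intro hk hlt
      rw [scan]
      split_ifs with hcond
      · exact key k' (by omega) hcond.1 hcond.2
      · refine ih (by omega) ?_
        by_contra h0
        have e1 : x + k' = 4 * (N * blockLen η m) + f i := by omega
        refine hcond ?_
        have : lab η m s N V (x + k') = X i + 1 := by
          rw [e1, lab, labels, if_neg (by omega), Nat.add_sub_cancel_left]
          exact h.labelAt_start hi (hg.le (a := 0) (by omega) (by omega) (by omega)) le_rfl (by omega)
        rw [this, Nat.add_sub_cancel]
        exact ⟨by omega, hX i hi⟩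
  exact main k le_rfl h2

end Layout

/-- The decoded label of block `i`. -/
def decodeBlock (lab : ℕ → ℕ) (c lam n : ℕ) (rho : ℕ → ℕ) (J Z i : ℕ) : ℕ :=
  scan lab lam i (i * 2 ^ c + search lab (2 ^ c) lam n rho J Z i (J + 1 - c) - 2 ^ c / 4)
    (2 ^ c / 2 + 1)

namespace Layout
variable {η m s N : ℕ} {X : ℕ → ℕ} {V : ℕ → Bool} {f e : ℕ → ℕ} {i lam : ℕ}

/-- Blocks with few edits around them are decoded if the samples are faithful. -/
theorem decodeBlock_eq (h : Layout η m s N X V f e) (hi : i < N) (hg : LocallyGood η m e i)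
    (hX : ∀ j < N, X j % 2 ^ lam = j) {c J T n : ℕ} {rho : ℕ → ℕ} (hc : blockLen η m = 2 ^ c)
    (hJ1 : 2 ^ J ≤ N * blockLen η m) (hJ2 : N * blockLen η m < 2 ^ (J + 1))
    (hrho : ∀ t < n, rho t < 2 ^ (J + 1))
    (hF : ∀ k ≤ J, ∀ w < 8 * (N * blockLen η m), Faithful η T n
      (Start m N f e (4 * (N * blockLen η m)))
      (Wrong m N X f (lab η m s N V) (4 * (N * blockLen η m))) (fun t => rho t / 2 ^ k)
      (2 ^ J / 2 ^ k) w) :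
    decodeBlock (lab η m s N V) c lam n rho J (4 * (N * blockLen η m)) i = X i + 1 := by
  have hB := le_blockLen η m
  have hm := h.pos
  have hc2 : 2 ≤ c := by
    by_contra h0
    have : 2 ^ c ≤ 2 ^ 1 := Nat.pow_le_pow_right (by norm_num) (by omega)
    omega
  obtain ⟨c, rfl⟩ := Nat.exists_eq_add_of_le' hc2
  have hJ : c + 2 ≤ J := by
    have : 2 ^ (c + 2) < 2 ^ (J + 1) := by
      rw [← hc]
      exact lt_of_le_of_lt (Nat.le_mul_of_pos_left _ (by omega)) hJ2
    have := (Nat.pow_lt_pow_iff_right (by norm_num)).1 this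
    omega
  have := h.search_close hi hg hX hc hJ1 hJ2 hrho hF (k := J + 1 - (c + 2)) (by omega)
  have hJe : 2 ^ J = 2 * 2 ^ c * 2 ^ (J + 1 - (c + 2)) := by
    rw [← pow_succ', ← pow_add]; congr 1; omega
  rw [hJe, ← Nat.add_mul, ← Nat.add_mul] at this
  have p0 : 0 < 2 ^ (J + 1 - (c + 2)) := by positivity
  have g1 := Nat.le_of_mul_le_mul_right this.1 p0
  have g2 := Nat.le_of_mul_le_mul_right this.2 p0
  rw [decodeBlock, ← hc]
  have d1 : i * blockLen η m ≤ N * blockLen η m := Nat.mul_le_mul_right _ hi.le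
  have d3 : 1 * blockLen η m ≤ N * blockLen η m := Nat.mul_le_mul_right _ (by omega)
  have e4 : blockLen η m = 4 * 2 ^ c := by rw [hc, pow_add]; ring
  refine h.scan_eq hi hg hX ?_ ?_ ?_ <;> omega

end Layout

/-! ### Samples from coins -/

/-- The mean of a function. -/
noncomputable def mean {α : Type} (μ : PMF α) (F : α → ℝ≥0∞) : ℝ≥0∞ := ∑' a, μ a * F a

theorem mean_pure {α : Type} (a : α) (F : α → ℝ≥0∞) : mean (PMF.pure a) F = F a := by
  rw [mean, tsum_eq_single a]
  · simp
  · intro b hb; simp [PMF.pure_apply, hb]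

theorem mean_bind {α β : Type} (μ : PMF α) (g : α → PMF β) (F : β → ℝ≥0∞) :
    mean (μ.bind g) F = mean μ fun a => mean (g a) F := by
  simp only [mean, PMF.bind_apply, ← ENNReal.tsum_mul_right, ← ENNReal.tsum_mul_left]
  rw [ENNReal.tsum_comm]
  simp only [mul_assoc]

theorem mean_map {α β : Type} (μ : PMF α) (g : α → β) (F : β → ℝ≥0∞) :
    mean (μ.map g) F = mean μ fun a => F (g a) := by
  rw [PMF.map, mean_bind]
  simp [mean_pure]

theorem mean_mul_left {α : Type} (μ : PMF α) (c : ℝ≥0∞) (F : α → ℝ≥0∞) :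
    mean μ (fun a => c * F a) = c * mean μ F := by
  simp only [mean, ← ENNReal.tsum_mul_left]
  exact tsum_congr fun a => by ring

theorem mean_mono {α : Type} (μ : PMF α) {F G : α → ℝ≥0∞} (h : ∀ a ∈ μ.support, F a ≤ G a) :
    mean μ F ≤ mean μ G := by
  refine ENNReal.tsum_le_tsum fun a => ?_
  by_cases ha : a ∈ μ.support
  · exact mul_le_mul_right (h a ha) _
  · rw [PMF.mem_support_iff, not_not] at ha
    simp [ha]

theorem mean_indicator {α : Type} (μ : PMF α) (E : Set α) :
    mean μ (E.indicator 1) = μ.toOuterMeasure E := by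
  rw [PMF.toOuterMeasure_apply]
  refine tsum_congr fun a => ?_
  by_cases ha : a ∈ E <;> simp [ha]

theorem mean_coins_succ (n : ℕ) (F : List ℕ → ℝ≥0∞) :
    2 * mean (coins (n + 1)) F = mean (coins n) (fun l => F (0 :: l)) +
      mean (coins n) fun l => F (1 :: l) := by
  rw [coins, mean_bind, mean, tsum_bool]
  simp only [PMF.uniformOfFintype_apply, Fintype.card_bool, mean_map, Bool.toNat_false,
    Bool.toNat_true, Nat.cast_ofNat]
  rw [← mul_add, ← mul_assoc, ENNReal.mul_inv_cancel (by simp) (by simp), one_mul]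

theorem coins_add (a b : ℕ) :
    coins (a + b) = (coins a).bind fun l => (coins b).map fun l' => l ++ l' := by
  induction a with
  | zero =>
    simp only [coins, PMF.pure_bind, Nat.zero_add, List.nil_append]
    exact (PMF.map_id _).symm
  | succ a ih =>
    rw [show a + 1 + b = (a + b) + 1 by ring, coins, coins, ih]
    simp only [PMF.map, PMF.bind_bind, Function.comp_def, PMF.pure_bind]
    rfl

theorem length_of_mem_coins {n : ℕ} {l : List ℕ} (h : l ∈ (coins n).support) : l.length = n := by
  induction n generalizing l with
  | zero => simp [coins] at h; simp [h]
  | succ n ih =>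
    simp only [coins, PMF.mem_support_bind_iff, PMF.mem_support_map_iff] at h
    obtain ⟨b, -, l', h1, rfl⟩ := h
    simp [ih h1]

theorem le_one_of_mem_coins {n : ℕ} {l : List ℕ} (h : l ∈ (coins n).support) :
    ∀ b ∈ l, b ≤ 1 := by
  induction n generalizing l with
  | zero => simp [coins] at h; simp [h]
  | succ n ih =>
    simp only [coins, PMF.mem_support_bind_iff, PMF.mem_support_map_iff] at h
    obtain ⟨b, -, l', h1, rfl⟩ := h
    intro x hx
    rcases List.mem_cons.1 hx with rfl | hx
    · cases b <;> simp
    · exact ih h1 x hx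

/-- Sample number `t`, made of `L` coins. -/
def sample (L : ℕ) (l : List ℕ) (t : ℕ) : ℕ := ∑ k ∈ Finset.range L, l.getD (t * L + k) 0 * 2 ^ k

theorem sum_range_two_mul {M : Type} [AddCommMonoid M] (G : ℕ → M) (n : ℕ) :
    ∑ v ∈ Finset.range (2 * n), G v
      = ∑ v ∈ Finset.range n, G (2 * v) + ∑ v ∈ Finset.range n, G (2 * v + 1) := by
  induction n with
  | zero => simp
  | succ n ih =>
    rw [show 2 * (n + 1) = 2 * n + 1 + 1 by ring, Finset.sum_range_succ, Finset.sum_range_succ, ih,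
      Finset.sum_range_succ, Finset.sum_range_succ]
    abel

/-- `L` fair coins, read as binary digits, form a uniform number below `2 ^ L`. Multiplying out the
denominator avoids division of extended reals. -/
theorem mean_sample_zero (L : ℕ) (G : ℕ → ℝ≥0∞) :
    2 ^ L * mean (coins L) (fun l => G (sample L l 0)) = ∑ v ∈ Finset.range (2 ^ L), G v := by
  induction L generalizing G with
  | zero => simp [coins, mean_pure, sample]
  | succ L ih =>
    have h : ∀ b l, sample (L + 1) (b :: l) 0 = 2 * sample L l 0 + b := by
      intro b l
      simp only [sample, zero_mul, zero_add]
      rw [Finset.sum_range_succ', Finset.mul_sum]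
      congr 1
      · exact Finset.sum_congr rfl fun k _ => by simp [pow_succ]; ring
      · simp
    rw [pow_succ, mul_assoc, mean_coins_succ, mul_add, pow_succ', sum_range_two_mul]
    simp only [h]
    rw [← ih fun v => G (2 * v), ← ih fun v => G (2 * v + 1)]
    simp

theorem sample_append (L : ℕ) {l l' : List ℕ} (h : l.length = L) :
    sample L (l ++ l') 0 = sample L l 0 ∧ ∀ t, sample L (l ++ l') (t + 1) = sample L l' t := by
  refine ⟨Finset.sum_congr rfl fun k hk => ?_, fun t => Finset.sum_congr rfl fun k hk => ?_⟩
  · rw [Finset.mem_range] at hk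
    rw [List.getD_append _ _ _ _ (by omega)]
  · rw [List.getD_append_right _ _ _ _ (by rw [h, Nat.add_mul]; omega)]
    congr 2
    rw [h, Nat.add_mul]; omega

/-- Different samples use disjoint runs of coins, so they are independent and the mean of the
product factorizes. -/
theorem mean_prod_sample (L N : ℕ) (G : ℕ → ℝ≥0∞) :
    (2 ^ L) ^ N * mean (coins (N * L)) (fun l => ∏ t ∈ Finset.range N, G (sample L l t))
      = (∑ v ∈ Finset.range (2 ^ L), G v) ^ N := by
  induction N with
  | zero => simp [coins, mean_pure]
  | succ N ih =>
    have h1 : mean (coins ((N + 1) * L)) (fun l => ∏ t ∈ Finset.range (N + 1), G (sample L l t))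
        = mean (coins L) fun l => mean (coins (N * L)) (fun l' =>
          ∏ t ∈ Finset.range N, G (sample L l' t)) * G (sample L l 0) := by
      rw [show (N + 1) * L = L + N * L by ring, coins_add, mean_bind]
      refine tsum_congr fun l => ?_
      by_cases hl : l ∈ (coins L).support
      · have hs := fun l' => sample_append L (l' := l') (length_of_mem_coins hl)
        simp only [mean_map]
        simp only [Finset.prod_range_succ', fun l' => (hs l').1, fun l' => (hs l').2]
        congr 1
        rw [mul_comm (mean _ _), ← mean_mul_left]
        exact congrArg _ (funext fun _ => mul_comm _ _)
      · rw [PMF.mem_support_iff, not_not] at hl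
        simp [hl]
    rw [h1, mean_mul_left, pow_succ, pow_succ, ← ih, ← mean_sample_zero L G]
    ring

/-! ### Samples are faithful with high probability -/

/-- Markov's inequality for `2` to the power of the sum, as in Chernoff's bound. -/
theorem measure_mul_le (L N : ℕ) (G : ℕ → ℕ) (c : ℕ) (E : Set (List ℕ))
    (h : ∀ l ∈ E, c ≤ ∑ t ∈ Finset.range N, G (sample L l t)) :
    (2 ^ L) ^ N * (2 ^ c * (coins (N * L)).toOuterMeasure E)
      ≤ (∑ v ∈ Finset.range (2 ^ L), (2 : ℝ≥0∞) ^ G v) ^ N := by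
  rw [← mean_prod_sample, ← mean_indicator, ← mean_mul_left]
  refine mul_le_mul_right (mean_mono _ fun l _ => ?_) _
  rw [Finset.prod_pow_eq_pow_sum]
  by_cases hl : l ∈ E
  · simpa [hl] using pow_le_pow_right₀ (by norm_num) (h l hl)
  · simp [hl]

theorem sum_two_pow_ite (n : ℕ) (H : ℕ → Prop) [DecidablePred H] :
    ∑ v ∈ Finset.range n, (2 : ℝ≥0∞) ^ (if H v then 1 else 0)
      = ((n + ∑ v ∈ Finset.range n, if H v then 1 else 0 : ℕ) : ℝ≥0∞) := by
  induction n with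
  | zero => simp
  | succ n ih =>
    rw [Finset.sum_range_succ, ih, Finset.sum_range_succ]
    by_cases h : H n
    · simp only [h, if_true]; push_cast; ring
    · simp only [h, if_false]; push_cast; ring

theorem exp_half_le : Real.exp (1 / 2) ≤ 2 := by
  have h1 : Real.exp (1 / 2) ^ 2 = Real.exp 1 := by rw [← Real.exp_nat_mul]; norm_num
  have h2 := Real.exp_one_lt_d9
  nlinarith [Real.exp_pos (1 / 2)]

/-- `(1 + a / b) ^ (8 * D * R) ≤ exp (8 * D * R / (16 * D)) = exp (R / 2) ≤ 2 ^ R`. -/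
theorem chernoff_upper {D R a b : ℕ} (hD : 1 ≤ D) (h : 16 * D * a ≤ b) :
    (b + a) ^ (8 * D * R) ≤ 2 ^ R * b ^ (8 * D * R) := by
  have h1 : ((b + a : ℕ) : ℝ) ≤ Real.exp (1 / (16 * D)) * b := by
    have h2 : (1 : ℝ) / (16 * D) + 1 ≤ Real.exp (1 / (16 * D)) := Real.add_one_le_exp _
    have h3 : (0 : ℝ) < D := by exact_mod_cast hD
    have h4 : (a : ℝ) ≤ 1 / (16 * D) * b := by
      rw [one_div, ← div_eq_inv_mul, le_div_iff₀ (by positivity)]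
      have : ((16 * D * a : ℕ) : ℝ) ≤ b := by exact_mod_cast h
      push_cast at this
      linarith
    have h5 : (0 : ℝ) ≤ b := by positivity
    push_cast
    nlinarith
  have h2 : ((b + a : ℕ) : ℝ) ^ (8 * D * R) ≤ 2 ^ R * (b : ℝ) ^ (8 * D * R) := by
    refine (pow_le_pow_left₀ (by positivity) h1 _).trans ?_
    rw [mul_pow]
    refine mul_le_mul_of_nonneg_right ?_ (by positivity)
    have h3 : (D : ℝ) ≠ 0 := by
      have : (0 : ℝ) < D := by exact_mod_cast hD
      exact this.ne'
    have h4 : Real.exp (1 / (16 * D)) ^ (8 * D) = Real.exp (1 / 2) := by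
      rw [← Real.exp_nat_mul]; congr 1; push_cast; field_simp; norm_num
    rw [pow_mul, h4]
    exact pow_le_pow_left₀ (Real.exp_pos _).le exp_half_le _
  exact_mod_cast h2

/-- `s / (2 * b) ≤ 1 - 1 / (2 * D) ≤ exp (-1 / (2 * D))`. The power `8 * D * R` of this is at most
`exp (-4 * R) ≤ 2 ^ (-4 * R)`. -/
theorem chernoff_lower {D R a b s : ℕ} (hD : 1 ≤ D) (h : b ≤ D * a) (hs : s + a = 2 * b) :
    2 ^ (4 * R) * s ^ (8 * D * R) ≤ (2 * b) ^ (8 * D * R) := by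
  have h3 : (0 : ℝ) < D := by exact_mod_cast hD
  have h1 : (s : ℝ) ≤ Real.exp (-(1 / (2 * D))) * (2 * b) := by
    have h2 : -(1 / (2 * D) : ℝ) + 1 ≤ Real.exp (-(1 / (2 * D))) := Real.add_one_le_exp _
    have h4 : (1 / (2 * D) : ℝ) * (2 * b) ≤ a := by
      rw [one_div, ← div_eq_inv_mul, div_le_iff₀ (by positivity)]
      have : (b : ℝ) ≤ D * a := by exact_mod_cast h
      linarith
    have h5 : (0 : ℝ) ≤ b := by positivity
    have h6 : (s : ℝ) + a = 2 * b := by exact_mod_cast hs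
    nlinarith
  have h2 : (2 : ℝ) ^ (4 * R) * (s : ℝ) ^ (8 * D * R) ≤ (2 * b) ^ (8 * D * R) := by
    have h4 : Real.exp (-(1 / (2 * D))) ^ (8 * D) = Real.exp (-4) := by
      rw [← Real.exp_nat_mul]; congr 1; push_cast; field_simp; norm_num
    have h5 : (2 : ℝ) ^ 4 * Real.exp (-4) ≤ 1 := by
      have h6 : Real.exp 1 ^ 4 = Real.exp 4 := by rw [← Real.exp_nat_mul]; norm_num
      have h7 : (2 : ℝ) ^ 4 ≤ Real.exp 4 := by
        rw [← h6]
        exact pow_le_pow_left₀ (by norm_num) (by have := Real.exp_one_gt_d9; linarith) _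
      have h8 : Real.exp 4 * Real.exp (-4) = 1 := by rw [← Real.exp_add]; simp
      nlinarith [Real.exp_pos (-4)]
    calc (2 : ℝ) ^ (4 * R) * (s : ℝ) ^ (8 * D * R)
        ≤ 2 ^ (4 * R) * (Real.exp (-(1 / (2 * D))) * (2 * b)) ^ (8 * D * R) := by gcongr
      _ = (2 ^ 4 * Real.exp (-4)) ^ R * (2 * b) ^ (8 * D * R) := by
          rw [mul_pow (Real.exp _), pow_mul (Real.exp _), h4, pow_mul, mul_pow]; ring
      _ ≤ 1 ^ R * (2 * b) ^ (8 * D * R) := by gcongr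
      _ = _ := by simp
  exact_mod_cast h2

/-- At most `R / 2` hits are expected. The exponential moment is at most `2 ^ R`, so the threshold
`2 * R` is reached with probability at most `2 ^ R / 2 ^ (2 * R)`. -/
theorem measure_upper (L : ℕ) {D R : ℕ} (hD : 1 ≤ D) (H : ℕ → Prop) [DecidablePred H]
    (h : 16 * D * (∑ v ∈ Finset.range (2 ^ L), if H v then 1 else 0) ≤ 2 ^ L) :
    2 ^ R * (coins (8 * D * R * L)).toOuterMeasure
      {l | 2 * R ≤ tally (8 * D * R) fun t => H (sample L l t)} ≤ 1 := by
  have h1 := measure_mul_le L (8 * D * R) (fun v => if H v then 1 else 0) (2 * R)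
    {l | 2 * R ≤ tally (8 * D * R) fun t => H (sample L l t)} fun l hl => hl
  rw [sum_two_pow_ite] at h1
  set a := ∑ v ∈ Finset.range (2 ^ L), if H v then 1 else 0
  have h2 : ((2 ^ L + a : ℕ) : ℝ≥0∞) ^ (8 * D * R) ≤ 2 ^ R * (2 ^ L) ^ (8 * D * R) := by
    exact_mod_cast chernoff_upper (R := R) hD h
  have h3 := h1.trans h2
  generalize (coins (8 * D * R * L)).toOuterMeasure
    {l | 2 * R ≤ tally (8 * D * R) fun t => H (sample L l t)} = x at h3 ⊢
  rw [mul_comm (2 ^ R), two_mul R, pow_add, mul_assoc (2 ^ R), ENNReal.mul_le_mul_iff_right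
    (by simp) (by simp [ENNReal.pow_eq_top_iff])] at h3
  conv_rhs at h3 => rw [← mul_one (2 ^ R)]
  rwa [ENNReal.mul_le_mul_iff_right (by simp) (by simp [ENNReal.pow_eq_top_iff])] at h3

/-- At least `8 * R` hits are expected. The misses are counted instead, of which there are at least
`8 * D * R - 2 * R` in the bad event; their exponential moment is smaller than `2 ^ (8 * D * R)` by
a factor `2 ^ (4 * R)`, and `2 ^ (2 * R)` of that remains. -/
theorem measure_lower (L : ℕ) {D R : ℕ} (hD : 1 ≤ D) (H : ℕ → Prop) [DecidablePred H]
    (h : 2 ^ L ≤ D * ∑ v ∈ Finset.range (2 ^ L), if H v then 1 else 0) :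
    2 ^ R * (coins (8 * D * R * L)).toOuterMeasure
      {l | (tally (8 * D * R) fun t => H (sample L l t)) ≤ 2 * R} ≤ 1 := by
  have hadd : ∀ n (K : ℕ → Prop) [DecidablePred K], (∑ v ∈ Finset.range n, if ¬ K v then 1 else 0)
      + (∑ v ∈ Finset.range n, if K v then 1 else 0) = n := by
    intro n K _
    rw [← Finset.sum_add_distrib]
    conv_rhs => rw [← mul_one n, ← Finset.card_range n, ← smul_eq_mul, ← Finset.sum_const]
    exact Finset.sum_congr (by simp) fun v _ => by by_cases hv : K v <;> simp [hv]
  have hN : 2 * R ≤ 8 * D * R := Nat.mul_le_mul_right _ (by omega)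
  have h1 := measure_mul_le L (8 * D * R) (fun v => if ¬ H v then 1 else 0) (8 * D * R - 2 * R)
    {l | (tally (8 * D * R) fun t => H (sample L l t)) ≤ 2 * R} fun l hl => by
      have := hadd (8 * D * R) fun t => H (sample L l t)
      simp only [Set.mem_ofPred_eq, tally] at hl
      omega
  rw [sum_two_pow_ite] at h1
  have hs := hadd (2 ^ L) H
  set a := ∑ v ∈ Finset.range (2 ^ L), if H v then 1 else 0
  set a' := ∑ v ∈ Finset.range (2 ^ L), if ¬ H v then 1 else 0
  have h2 : 2 ^ (4 * R) * ((2 ^ L + a' : ℕ) : ℝ≥0∞) ^ (8 * D * R) ≤ (2 * 2 ^ L) ^ (8 * D * R) := by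
    exact_mod_cast chernoff_lower (R := R) hD h (s := 2 ^ L + a') (by omega)
  have h3 := (mul_le_mul_right h1 (2 ^ (4 * R))).trans h2
  set x := (coins (8 * D * R * L)).toOuterMeasure
      {l | (tally (8 * D * R) fun t => H (sample L l t)) ≤ 2 * R}
  have e : (2 : ℝ≥0∞) ^ (4 * R) * ((2 ^ L) ^ (8 * D * R) * (2 ^ (8 * D * R - 2 * R) * x))
      = (2 * 2 ^ L) ^ (8 * D * R) * (2 ^ (2 * R) * x) := by
    have e1 : (2 : ℝ≥0∞) ^ (8 * D * R) = 2 ^ (8 * D * R - 2 * R) * 2 ^ (2 * R) := by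
      rw [← pow_add]; congr 1; omega
    rw [mul_pow, e1, show 4 * R = 2 * R + 2 * R by ring, pow_add]
    ring
  rw [e] at h3
  conv_rhs at h3 => rw [← mul_one ((2 * 2 ^ L) ^ (8 * D * R))]
  rw [ENNReal.mul_le_mul_iff_right (by simp) (by
    refine ENNReal.pow_ne_top (ENNReal.mul_ne_top (by simp) (ENNReal.pow_ne_top (by simp))))] at h3
  refine le_trans ?_ h3
  gcongr
  · norm_num
  · omega

/-- Dividing a uniform number by `2 ^ k` gives a uniform number on the shorter range. This lets the
same samples serve all scales of the search. -/
theorem sum_div_two_pow (g : ℕ → ℕ) (k M : ℕ) :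
    ∑ v ∈ Finset.range (2 ^ k * M), g (v / 2 ^ k) = 2 ^ k * ∑ u ∈ Finset.range M, g u := by
  induction M with
  | zero => simp
  | succ M ih =>
    rw [Nat.mul_succ, Finset.sum_range_add, ih, Finset.sum_range_succ, mul_add]
    congr 1
    rw [Finset.sum_congr rfl fun x hx => ?_, Finset.sum_const, Finset.card_range, smul_eq_mul]
    rw [Nat.mul_add_div (by positivity), Nat.div_eq_of_lt (Finset.mem_range.1 hx), add_zero]

theorem card_window (H : ℕ → Prop) [DecidablePred H] (w n : ℕ) :
    ∑ u ∈ Finset.range n, (if H (w + u) then 1 else 0) = ((Finset.Ico w (w + n)).filter H).card := by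
  rw [Finset.card_filter, Finset.sum_Ico_eq_sum_range, Nat.add_sub_cancel_left]

/-- The number of samples that are drawn for a word of length about `2 ^ J`. -/
abbrev sampleCount (η J : ℕ) : ℕ := 8 * (32 * 2 ^ (15 + η)) * (J + 1) ^ 2

/-- Both parts of `Faithful` are tail events with `D = 32 * 2 ^ (15 + η)` and `R = (J + 1) ^ 2`; the
threshold `T = 2 * R` separates the two expectations. Each premise of `Faithful` is a density
condition that involves no coins. -/
theorem measure_not_faithful (η J : ℕ) {k : ℕ} (hk : k ≤ J) (w : ℕ) (S W : ℕ → Prop) :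
    2 ^ (J + 1) ^ 2 * (coins (sampleCount η J * (J + 1))).toOuterMeasure
      {l | ¬ Faithful η (2 * (J + 1) ^ 2) (sampleCount η J) S W
        (fun t => sample (J + 1) l t / 2 ^ k) (2 ^ J / 2 ^ k) w} ≤ 2 := by
  classical
  have hP : 2 ^ (J + 1) = 2 ^ k * (2 * (2 ^ J / 2 ^ k)) := by
    obtain ⟨j, rfl⟩ := Nat.exists_eq_add_of_le hk
    rw [pow_add 2 k j, Nat.mul_div_cancel_left _ (show 0 < 2 ^ k by positivity), pow_succ, pow_add]
    ring
  have hsum : ∀ (H : ℕ → Prop), (∑ v ∈ Finset.range (2 ^ (J + 1)),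
      if H (w + v / 2 ^ k) then 1 else 0)
      = 2 ^ k * ((Finset.Ico w (w + 2 * (2 ^ J / 2 ^ k))).filter H).card := by
    intro H
    rw [hP, sum_div_two_pow (fun u => if H (w + u) then 1 else 0), card_window]
  have hD : 1 ≤ 32 * 2 ^ (15 + η) := by
    have : 1 ≤ 2 ^ (15 + η) := Nat.one_le_two_pow
    omega
  set μ := (coins (sampleCount η J * (J + 1))).toOuterMeasure
  have key1 : (2 * (2 ^ J / 2 ^ k) ≤ 32 * 2 ^ (15 + η) *
      ((Finset.Ico w (w + 2 * (2 ^ J / 2 ^ k))).filter S).card) → 2 ^ (J + 1) ^ 2 * μ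
      {l | (tally (sampleCount η J) fun t => S (w + sample (J + 1) l t / 2 ^ k))
        ≤ 2 * (J + 1) ^ 2} ≤ 1 := fun h => by
    refine measure_lower (J + 1) hD (fun v => S (w + v / 2 ^ k)) ?_
    rw [hsum, hP]
    calc _ ≤ 2 ^ k * _ := Nat.mul_le_mul_left _ h
      _ = _ := by ring
  have key2 : (16 * (32 * 2 ^ (15 + η)) *
      ((Finset.Ico w (w + 2 * (2 ^ J / 2 ^ k))).filter W).card ≤ 2 * (2 ^ J / 2 ^ k)) →
      2 ^ (J + 1) ^ 2 * μ {l | 2 * (J + 1) ^ 2 ≤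
        tally (sampleCount η J) fun t => W (w + sample (J + 1) l t / 2 ^ k)} ≤ 1 := fun h => by
    refine measure_upper (J + 1) hD (fun v => W (w + v / 2 ^ k)) ?_
    rw [hsum, hP]
    calc _ = 2 ^ k * _ := by ring
      _ ≤ _ := Nat.mul_le_mul_left _ h
  let E1 : Set (List ℕ) := {l | (2 * (2 ^ J / 2 ^ k) ≤ 32 * 2 ^ (15 + η) *
      ((Finset.Ico w (w + 2 * (2 ^ J / 2 ^ k))).filter S).card) ∧
      (tally (sampleCount η J) fun t => S (w + sample (J + 1) l t / 2 ^ k)) ≤ 2 * (J + 1) ^ 2}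
  let E2 : Set (List ℕ) := {l | (16 * (32 * 2 ^ (15 + η)) *
      ((Finset.Ico w (w + 2 * (2 ^ J / 2 ^ k))).filter W).card ≤ 2 * (2 ^ J / 2 ^ k)) ∧
      2 * (J + 1) ^ 2 ≤ tally (sampleCount η J) fun t => W (w + sample (J + 1) l t / 2 ^ k)}
  have h1 : 2 ^ (J + 1) ^ 2 * μ E1 ≤ 1 := by
    by_cases h : (2 * (2 ^ J / 2 ^ k) ≤ 32 * 2 ^ (15 + η) *
      ((Finset.Ico w (w + 2 * (2 ^ J / 2 ^ k))).filter S).card)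
    · exact (mul_le_mul_right (μ.mono fun l hl => hl.2) _).trans (key1 h)
    · have : E1 = ∅ := Set.eq_empty_of_forall_notMem fun l hl => h hl.1
      rw [this]; simp
  have h2 : 2 ^ (J + 1) ^ 2 * μ E2 ≤ 1 := by
    by_cases h : (16 * (32 * 2 ^ (15 + η)) *
      ((Finset.Ico w (w + 2 * (2 ^ J / 2 ^ k))).filter W).card ≤ 2 * (2 ^ J / 2 ^ k))
    · exact (mul_le_mul_right (μ.mono fun l hl => hl.2) _).trans (key2 h)
    · have : E2 = ∅ := Set.eq_empty_of_forall_notMem fun l hl => h hl.1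
      rw [this]; simp
  have hsub : {l | ¬ Faithful η (2 * (J + 1) ^ 2) (sampleCount η J) S W
        (fun t => sample (J + 1) l t / 2 ^ k) (2 ^ J / 2 ^ k) w} ⊆ E1 ∪ E2 := by
    intro l hl
    by_contra hcon
    simp only [E1, E2, Set.mem_union, Set.mem_ofPred_eq, not_or, not_and, not_le] at hcon
    exact hl ⟨fun h => by convert hcon.1 (by convert h), fun h => by convert hcon.2 (by convert h)⟩
  calc _ ≤ 2 ^ (J + 1) ^ 2 * (μ E1 + μ E2) := by
        gcongr
        exact (μ.mono hsub).trans (MeasureTheory.measure_union_le _ _)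
    _ ≤ 1 + 1 := by rw [mul_add]; exact add_le_add h1 h2
    _ = 2 := by norm_num

/-- All samples are faithful, except with small probability. -/
theorem measure_exists_not_faithful (η J M : ℕ) (S W : ℕ → Prop) :
    2 ^ (J + 1) ^ 2 * (coins (sampleCount η J * (J + 1))).toOuterMeasure
      {l | ∃ k ≤ J, ∃ w < M, ¬ Faithful η (2 * (J + 1) ^ 2) (sampleCount η J) S W
        (fun t => sample (J + 1) l t / 2 ^ k) (2 ^ J / 2 ^ k) w} ≤ 2 * (J + 1) * M := by
  set μ := (coins (sampleCount η J * (J + 1))).toOuterMeasure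
  let E : ℕ × ℕ → Set (List ℕ) := fun p => {l | ¬ Faithful η (2 * (J + 1) ^ 2) (sampleCount η J) S W
        (fun t => sample (J + 1) l t / 2 ^ p.1) (2 ^ J / 2 ^ p.1) p.2}
  have hsub : {l | ∃ k ≤ J, ∃ w < M, ¬ Faithful η (2 * (J + 1) ^ 2) (sampleCount η J) S W
        (fun t => sample (J + 1) l t / 2 ^ k) (2 ^ J / 2 ^ k) w} ⊆
      ⋃ p ∈ Finset.range (J + 1) ×ˢ Finset.range M, E p := by
    rintro l ⟨k, hk, w, hw, h⟩
    simp only [Set.mem_iUnion]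
    exact ⟨(k, w), by simp only [Finset.mem_product, Finset.mem_range]; omega, h⟩
  calc _ ≤ 2 ^ (J + 1) ^ 2 * ∑ p ∈ Finset.range (J + 1) ×ˢ Finset.range M, μ (E p) := by
        gcongr
        exact (μ.mono hsub).trans (MeasureTheory.measure_biUnion_finset_le _ _)
    _ ≤ ∑ p ∈ Finset.range (J + 1) ×ˢ Finset.range M, 2 := by
        rw [Finset.mul_sum]
        refine Finset.sum_le_sum fun p hp => measure_not_faithful η J ?_ _ _ _
        simp only [Finset.mem_product, Finset.mem_range] at hp
        omega
    _ = 2 * (J + 1) * M := by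
        rw [Finset.sum_const, Finset.card_product, Finset.card_range, Finset.card_range]
        rw [nsmul_eq_mul]
        push_cast
        ring

/-! ### Parameters -/

/-- The binary logarithm of the number of pieces of a block. -/
@[irreducible] def pieceExp (d : ℕ) : ℕ := d + 21

/-- The number of bits of the number of a block. -/
def indexBits (K : ℕ) : ℕ := Nat.size K

/-- A symbol has `2 ^ symExp q` bits. -/
def symExp (q : ℕ) : ℕ := Nat.size (Nat.size (q - 1) - 1)

/-- The symbols of a block have `2 ^ payExp d K` bits in total. -/
def payExp (d K : ℕ) : ℕ := Nat.size (d * indexBits K)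

/-- A block holds `2 ^ groupExp d q K` symbols. -/
def groupExp (d q K : ℕ) : ℕ := payExp d K - symExp q

/-- The number of blocks. -/
def blockCount (d q K : ℕ) : ℕ := K / 2 ^ groupExp d q K + 1

/-- The messages of the inner code have `2 ^ msgExp d K` bits. -/
def msgExp (d K : ℕ) : ℕ := pieceExp d + Nat.size (indexBits K / 2 ^ (18 + pieceExp d))

/-- The binary logarithm of the length of a block. -/
def blockExp (d K : ℕ) : ℕ := 15 + pieceExp d + msgExp d K

/-- The length of the compiled word. -/
def codeLen (d q K : ℕ) : ℕ := blockCount d q K * 2 ^ blockExp d K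

theorem blockLen_pow (η μ : ℕ) : blockLen η (2 ^ μ) = 2 ^ (15 + η + μ) := by
  rw [blockLen_eq, ← pow_add]

theorem size_le_self_add_one (n : ℕ) : 2 ^ Nat.size n ≤ 2 * n + 1 := by
  rcases Nat.eq_zero_or_pos n with rfl | h
  · simp
  · obtain ⟨k, hk⟩ := Nat.exists_eq_add_of_le' (Nat.size_pos.2 h)
    have h1 : k < Nat.size n := by omega
    have := Nat.lt_size.1 h1
    rw [hk, pow_succ]
    omega

theorem indexBits_pos {K : ℕ} (hK : 1 ≤ K) : 1 ≤ indexBits K := Nat.size_pos.2 hK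

theorem lt_two_pow_indexBits (K : ℕ) : K < 2 ^ indexBits K := Nat.lt_size_self K

section
variable {d q K : ℕ}

theorem size_pred_le (hq : q ≤ (K + 1) ^ d) : Nat.size (q - 1) ≤ d * indexBits K := by
  rw [Nat.size_le]
  have h1 : (K + 1) ^ d ≤ 2 ^ (d * indexBits K) := by
    rw [mul_comm, pow_mul]
    exact Nat.pow_le_pow_left (lt_two_pow_indexBits K) d
  have h2 : 1 ≤ 2 ^ (d * indexBits K) := Nat.one_le_two_pow
  omega

theorem symExp_le (hq : q ≤ (K + 1) ^ d) : symExp q ≤ payExp d K :=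
  Nat.size_le_size ((Nat.sub_le _ _).trans (size_pred_le hq))

theorem groupExp_add (hq : q ≤ (K + 1) ^ d) : groupExp d q K + symExp q = payExp d K :=
  Nat.sub_add_cancel (symExp_le hq)

theorem le_two_pow_symExp (q : ℕ) : q ≤ 2 ^ 2 ^ symExp q := by
  have h1 : q - 1 < 2 ^ Nat.size (q - 1) := Nat.lt_size_self _
  have h2 : Nat.size (q - 1) ≤ 2 ^ symExp q := by
    have := Nat.lt_size_self (Nat.size (q - 1) - 1)
    unfold symExp
    omega
  have := Nat.pow_le_pow_right (n := 2) (by norm_num) h2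
  omega

theorem two_pow_payExp_le (d K : ℕ) : 2 ^ payExp d K ≤ 2 * (d * indexBits K) + 1 :=
  size_le_self_add_one _

theorem lt_two_pow_payExp (d K : ℕ) : d * indexBits K < 2 ^ payExp d K := Nat.lt_size_self _

theorem pieceExp_le_msgExp (d K : ℕ) : pieceExp d ≤ msgExp d K := Nat.le_add_right _ _

theorem indexBits_lt (d K : ℕ) : indexBits K < 2 ^ 18 * 2 ^ msgExp d K := by
  have h1 := Nat.lt_size_self (indexBits K / 2 ^ (18 + pieceExp d))
  rw [Nat.div_lt_iff_lt_mul (by positivity)] at h1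
  refine h1.trans_le (le_of_eq ?_)
  rw [← pow_add, ← pow_add]
  congr 1
  unfold msgExp
  ring

/-- The message length `m` must be large enough for a block to hold its symbols (`indexBits_lt`) and
small enough for tables of size `2 ^ (2 ^ 16 * m)`; this is the second condition. The additive
constant stems from `m ≥ 2 ^ η`, which matters for small `K`. -/
theorem two_pow_msgExp_le (d K : ℕ) :
    2 ^ 17 * 2 ^ msgExp d K ≤ indexBits K + 2 ^ (17 + pieceExp d) := by
  have key : ∀ p x s l : ℕ, s ≤ 2 * x + 1 → x * (2 ^ 18 * p) ≤ l →
      2 ^ 17 * (p * s) ≤ l + 2 ^ 17 * p := by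
    intro p x s l h1 h2
    have h3 := Nat.mul_le_mul_left p h1
    have h4 : x * (2 ^ 18 * p) = 2 ^ 18 * (p * x) := by ring
    have h5 : p * (2 * x + 1) = 2 * (p * x) + p := by ring
    omega
  rw [msgExp, pow_add 2 (pieceExp d), pow_add 2 17]
  refine key _ _ _ _ (size_le_self_add_one (indexBits K / 2 ^ (18 + pieceExp d))) ?_
  rw [← pow_add]
  exact Nat.div_mul_le_self _ _

theorem pieceExp_le : pieceExp d ≤ 2 ^ msgExp d K :=
  (pieceExp_le_msgExp d K).trans (Nat.lt_two_pow_self).le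

/-- The digits of a block have enough bits for its number and its symbols. -/
theorem capacity (hK : 1 ≤ K) :
    indexBits K + 2 ^ payExp d K ≤ (2 ^ msgExp d K - pieceExp d) * 2 ^ pieceExp d := by
  have h1 := indexBits_lt d K
  have h2 := two_pow_payExp_le d K
  -- The piece number takes at most half of the bits of a message.
  have h3 : 2 * pieceExp d ≤ 2 ^ msgExp d K := by
    have h4 : 2 ^ pieceExp d ≤ 2 ^ msgExp d K :=
      Nat.pow_le_pow_right (by norm_num) (pieceExp_le_msgExp d K)
    have h5 : pieceExp d < 2 ^ (pieceExp d - 1) + 1 := by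
      have := @Nat.lt_two_pow_self (pieceExp d - 1)
      unfold pieceExp at this ⊢
      omega
    have h6 : 2 ^ pieceExp d = 2 * 2 ^ (pieceExp d - 1) := by
      rw [← pow_succ']; congr 1; unfold pieceExp; omega
    omega
  -- The summand `21` in `pieceExp` is used here: half of `m`, times `2 ^ 21 * 2 ^ d`, is `4 * 2 ^ d
  -- * 2 ^ 18 * m`, which covers the block number together with at most `2 * d * indexBits K + 1`
  -- bits of symbols.
  have h4 : 2 ^ pieceExp d = 2 ^ 21 * 2 ^ d := by rw [pieceExp, pow_add]; ring
  have h5 : d < 2 ^ d := Nat.lt_two_pow_self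
  have h6 := indexBits_pos hK
  have h7 : 2 ^ msgExp d K ≤ 2 * (2 ^ msgExp d K - pieceExp d) := by omega
  have h8 : d * indexBits K + indexBits K ≤ 2 ^ d * indexBits K := by
    rw [← Nat.succ_mul]; exact Nat.mul_le_mul_right _ h5
  have h9 : 2 ^ d * indexBits K ≤ 2 ^ d * (2 ^ 18 * 2 ^ msgExp d K) := Nat.mul_le_mul_left _ h1.le
  have h10 : 2 ^ d * (2 ^ 18 * 2 ^ msgExp d K)
      ≤ 2 ^ d * (2 ^ 18 * (2 * (2 ^ msgExp d K - pieceExp d))) :=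
    Nat.mul_le_mul_left _ (Nat.mul_le_mul_left _ h7)
  rw [h4]
  have h11 : (2 ^ msgExp d K - pieceExp d) * (2 ^ 21 * 2 ^ d)
      = 4 * (2 ^ d * (2 ^ 18 * (2 * (2 ^ msgExp d K - pieceExp d)))) := by ring
  omega

theorem le_blockCount_mul (d q K : ℕ) : K < blockCount d q K * 2 ^ groupExp d q K :=
  Nat.lt_mul_of_div_lt (Nat.lt_succ_self _) (by positivity)

theorem blockCount_le (d q : ℕ) (K : ℕ) : blockCount d q K ≤ K + 1 :=
  Nat.succ_le_succ (Nat.div_le_self _ _)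

theorem two_pow_payExp_le_blockLen (hK : 1 ≤ K) : 2 ^ payExp d K ≤ 2 ^ blockExp d K := by
  have h1 := capacity (d := d) hK
  have h2 : (2 ^ msgExp d K - pieceExp d) * 2 ^ pieceExp d ≤ 2 ^ msgExp d K * 2 ^ pieceExp d :=
    Nat.mul_le_mul_right _ (Nat.sub_le _ _)
  have h4 : 2 ^ msgExp d K * 2 ^ pieceExp d ≤ 2 ^ blockExp d K := by
    rw [← pow_add]
    refine Nat.pow_le_pow_right (by norm_num) ?_
    unfold blockExp; omega
  omega

theorem two_pow_groupExp_le (hK : 1 ≤ K) : 2 ^ groupExp d q K ≤ 2 ^ blockExp d K :=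
  (Nat.pow_le_pow_right (by norm_num) (Nat.sub_le _ _)).trans (two_pow_payExp_le_blockLen hK)

theorem le_codeLen (hK : 1 ≤ K) : K ≤ codeLen d q K :=
  (le_blockCount_mul d q K).le.trans (Nat.mul_le_mul_left _ (two_pow_groupExp_le hK))

theorem two_pow_blockExp_le (d q K : ℕ) : 2 ^ blockExp d K ≤ codeLen d q K :=
  Nat.le_mul_of_pos_left _ (Nat.succ_pos _)

/-- `L = log n + 1` for the length `n` of the compiled word. -/
abbrev logLen (d q K : ℕ) : ℕ := Nat.log 2 (codeLen d q K) + 1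

theorem codeLen_pos (d q K : ℕ) : 0 < codeLen d q K := Nat.mul_pos (Nat.succ_pos _) (by positivity)

theorem size_eq_log {n : ℕ} (hn : 0 < n) : Nat.size n = Nat.log 2 n + 1 := by
  refine le_antisymm (Nat.size_le.2 (Nat.lt_pow_succ_log_self (by norm_num) n)) ?_
  exact Nat.lt_size.2 (Nat.pow_log_le_self 2 hn.ne')

theorem indexBits_le_logLen (hK : 1 ≤ K) : indexBits K ≤ logLen d q K := by
  rw [logLen, ← size_eq_log (codeLen_pos d q K)]
  exact Nat.size_le_size (le_codeLen hK)

theorem blockExp_lt_logLen (d q K : ℕ) : blockExp d K < logLen d q K :=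
  Nat.lt_succ_of_le (Nat.le_log_of_pow_le (by norm_num) (two_pow_blockExp_le d q K))

/-- Messages of the inner code are short. -/
theorem two_pow_msgExp_le_logLen (hK : 1 ≤ K) : 2 ^ msgExp d K ≤ 2 ^ pieceExp d * logLen d q K := by
  have h1 := two_pow_msgExp_le d K
  have h2 := indexBits_le_logLen (d := d) (q := q) hK
  have h3 : 1 ≤ logLen d q K := Nat.succ_pos _
  have h4 : 1 ≤ 2 ^ pieceExp d := Nat.one_le_two_pow
  rw [pow_add] at h1
  nlinarith

/-- Blocks are short. -/
theorem two_pow_blockExp_le_logLen (hK : 1 ≤ K) :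
    2 ^ blockExp d K ≤ 2 ^ (15 + 2 * pieceExp d) * logLen d q K := by
  have := Nat.mul_le_mul_left (2 ^ (15 + pieceExp d)) (two_pow_msgExp_le_logLen (d := d) (q := q) hK)
  unfold blockExp
  rw [pow_add]
  refine this.trans (le_of_eq ?_)
  rw [show 15 + 2 * pieceExp d = 15 + pieceExp d + pieceExp d by ring, pow_add _ (15 + pieceExp d)]
  ring

/-- The tables of the inner code are small. -/
theorem two_pow_le_codeLen (hK : 1 ≤ K) :
    2 ^ (2 ^ 16 * 2 ^ msgExp d K) ≤ 2 ^ (2 ^ (16 + pieceExp d) + 1) * codeLen d q K := by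
  have h1 := two_pow_msgExp_le d K
  have h2 : 2 ^ 16 * 2 ^ msgExp d K ≤ indexBits K + 2 ^ (16 + pieceExp d) := by
    rw [pow_add] at h1 ⊢
    omega
  have h3 : 2 ^ indexBits K ≤ 2 * codeLen d q K := by
    have := size_le_self_add_one K
    have h4 := indexBits_pos hK
    have h5 := le_codeLen (d := d) (q := q) hK
    obtain ⟨k, hk⟩ := Nat.exists_eq_add_of_le' h4
    have h6 : 2 ^ indexBits K = 2 * 2 ^ k := by rw [hk, pow_succ]; ring
    change 2 ^ indexBits K ≤ _ at this
    omega
  calc _ ≤ 2 ^ (indexBits K + 2 ^ (16 + pieceExp d)) := Nat.pow_le_pow_right (by norm_num) h2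
    _ = 2 ^ (2 ^ (16 + pieceExp d)) * 2 ^ indexBits K := by rw [pow_add]; ring
    _ ≤ 2 ^ (2 ^ (16 + pieceExp d)) * (2 * codeLen d q K) := Nat.mul_le_mul_left _ h3
    _ = _ := by rw [pow_succ]; ring

end

/-! ### The compiled code -/

open Classical in
/-- The largest good seed. -/
noncomputable def seed (m : ℕ) : ℕ :=
  ((Finset.range (2 ^ (2 * (hashBits m + m)))).filter (GoodSeed m)).sup id

theorem goodSeed_seed {m : ℕ} (hm : 1 ≤ m) : GoodSeed m (seed m) := by
  classical
  obtain ⟨s, hs, h⟩ := exists_goodSeed hm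
  have hne : ((Finset.range (2 ^ (2 * (hashBits m + m)))).filter (GoodSeed m)).Nonempty :=
    ⟨s, by simp [hs, h]⟩
  obtain ⟨t, ht, e⟩ := Finset.exists_mem_eq_sup _ hne id
  rw [seed]
  have : GoodSeed m t := (Finset.mem_filter.1 ht).2
  rw [id] at e
  convert this

/-- A word over an alphabet, continued by zeros. -/
def extend {q K : ℕ} (y : Fin K → Fin q) (j : ℕ) : ℕ := if h : j < K then (y ⟨j, h⟩ : ℕ) else 0

/-- The content of block `i`: its number and its symbols. -/
def content (d q K : ℕ) (Y : ℕ → ℕ) (i : ℕ) : ℕ :=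
  horner (2 ^ symExp q) (fun s => Y (i * 2 ^ groupExp d q K + s)) (2 ^ groupExp d q K)
    * 2 ^ indexBits K + i

/-- The bits of the compiled word. -/
noncomputable def codeBits (d q K : ℕ) (Y : ℕ → ℕ) : List Bool :=
  (List.range (blockCount d q K)).flatMap fun i =>
    block (pieceExp d) (2 ^ msgExp d K) (seed (2 ^ msgExp d K)) (content d q K Y i)

/-- The compiled word. -/
noncomputable def compiled (d : ℕ) {q K : ℕ} (y : Fin K → Fin q) : Fin (codeLen d q K) → Fin 2 :=
  fun p => if (codeBits d q K (extend y)).getD p false then 1 else 0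

/-- A binary word as a sequence of bits, continued by ones. -/
def bitsOf (w : List (Fin 2)) (p : ℕ) : Bool := (w[p]?).elim true fun b => decide (b = 1)

/-- The label of a block that is found with the given coins. -/
noncomputable def blockLabel (d q K : ℕ) (V : ℕ → Bool) (l : List ℕ) (i : ℕ) : ℕ :=
  decodeBlock (Layout.lab (pieceExp d) (2 ^ msgExp d K) (seed (2 ^ msgExp d K)) (blockCount d q K) V)
    (blockExp d K) (indexBits K) (sampleCount (pieceExp d) (Nat.log 2 (codeLen d q K)))
    (sample (logLen d q K) l) (Nat.log 2 (codeLen d q K)) (4 * codeLen d q K) i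

/-- The symbol number `s` of a block with the label `x`. -/
def symbolOf (d q K x s : ℕ) : ℕ :=
  let v := (x - 1) / 2 ^ indexBits K / 2 ^ (2 ^ symExp q * (2 ^ groupExp d q K - 1 - s))
    % 2 ^ 2 ^ symExp q
  if v < q then v else 0

/-- The decoded symbol at position `j`. -/
noncomputable def decodedAt (d q K : ℕ) (V : ℕ → Bool) (l : List ℕ) (j : ℕ) : ℕ :=
  symbolOf d q K (blockLabel d q K V l (j / 2 ^ groupExp d q K)) (j % 2 ^ groupExp d q K)

theorem decodedAt_lt {d q K : ℕ} (hq : 0 < q) (V : ℕ → Bool) (l : List ℕ) (j : ℕ) :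
    decodedAt d q K V l j < q := by
  unfold decodedAt symbolOf
  simp only
  split_ifs with h
  · exact h
  · exact hq

/-- The decoded word. -/
noncomputable def decoded (d : ℕ) {q : ℕ} (K : ℕ) (hq : 0 < q) (V : ℕ → Bool) (l : List ℕ) :
    List (Fin q) :=
  List.ofFn fun j : Fin K => ⟨decodedAt d q K V l j, decodedAt_lt hq V l j⟩

theorem horner_lt {v : ℕ} {g : ℕ → ℕ} (hg : ∀ t, g t < 2 ^ v) (n : ℕ) :
    horner v g n < 2 ^ (v * n) := by
  induction n with
  | zero => simp [horner]
  | succ n ih =>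
    rw [horner, Nat.mul_succ, pow_add]
    have := hg n
    calc _ < horner v g n * 2 ^ v + 2 ^ v := by omega
      _ = (horner v g n + 1) * 2 ^ v := by ring
      _ ≤ _ := Nat.mul_le_mul_right _ ih

theorem horner_div_mod {v : ℕ} {g : ℕ → ℕ} (hg : ∀ t, g t < 2 ^ v) {n t : ℕ} (ht : t < n) :
    horner v g n / 2 ^ (v * (n - 1 - t)) % 2 ^ v = g t := by
  induction n with
  | zero => omega
  | succ n ih =>
    rw [horner]
    by_cases h : t = n
    · subst h
      simp [Nat.mod_eq_of_lt (hg t)]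
    · have e1 : v * (n + 1 - 1 - t) = v + v * (n - 1 - t) := by
        rw [show n + 1 - 1 - t = (n - 1 - t) + 1 by omega]; ring
      rw [e1, pow_add, ← Nat.div_div_eq_div_mul]
      have e2 : (horner v g n * 2 ^ v + g n) / 2 ^ v = horner v g n := by
        rw [mul_comm, Nat.mul_add_div (by positivity), Nat.div_eq_of_lt (hg n), add_zero]
      rw [e2, ih (by omega)]

section
variable {d q K : ℕ}

theorem length_codeBits (d q K : ℕ) (Y : ℕ → ℕ) : (codeBits d q K Y).length = codeLen d q K := by
  rw [codeBits, length_flatMap_range fun t => length_block _ _ _ _, blockLen_pow]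
  rfl

theorem extend_lt {y : Fin K → Fin q} (hq : 0 < q) (j : ℕ) : extend y j < 2 ^ 2 ^ symExp q := by
  refine lt_of_lt_of_le ?_ (le_two_pow_symExp q)
  unfold extend
  split_ifs
  · exact (y _).2
  · exact hq

theorem content_lt (hK : 1 ≤ K) (hq : q ≤ (K + 1) ^ d) {Y : ℕ → ℕ}
    (hY : ∀ j, Y j < 2 ^ 2 ^ symExp q) {i : ℕ} (hi : i < blockCount d q K) :
    content d q K Y i < 2 ^ ((2 ^ msgExp d K - pieceExp d) * 2 ^ pieceExp d) := by
  refine lt_of_lt_of_le ?_ (Nat.pow_le_pow_right (by norm_num) (capacity hK))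
  have h1 := horner_lt (g := fun s => Y (i * 2 ^ groupExp d q K + s)) (fun t => hY _)
    (2 ^ groupExp d q K)
  rw [← pow_add, add_comm, groupExp_add hq] at h1
  have h2 := blockCount_le d q K
  have h3 := lt_two_pow_indexBits K
  rw [content, pow_add]
  calc _ < horner (2 ^ symExp q) (fun s => Y (i * 2 ^ groupExp d q K + s)) (2 ^ groupExp d q K)
        * 2 ^ indexBits K + 2 ^ indexBits K := by omega
    _ = (horner (2 ^ symExp q) (fun s => Y (i * 2 ^ groupExp d q K + s)) (2 ^ groupExp d q K) + 1)
        * 2 ^ indexBits K := by ring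
    _ ≤ 2 ^ 2 ^ payExp d K * 2 ^ indexBits K := Nat.mul_le_mul_right _ h1
    _ = _ := by ring

theorem content_mod {Y : ℕ → ℕ} {i : ℕ} (hi : i < blockCount d q K) :
    content d q K Y i % 2 ^ indexBits K = i := by
  have h2 := blockCount_le d q K
  have h3 := lt_two_pow_indexBits K
  rw [content, Nat.mul_add_mod_self_right, Nat.mod_eq_of_lt (by omega)]

theorem symbolOf_content {y : Fin K → Fin q} (hq : 0 < q) {i s : ℕ} (hi : i < blockCount d q K)
    (hs : s < 2 ^ groupExp d q K) (hj : i * 2 ^ groupExp d q K + s < K) :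
    symbolOf d q K (content d q K (extend y) i + 1) s
      = (y ⟨i * 2 ^ groupExp d q K + s, hj⟩ : ℕ) := by
  have h2 := blockCount_le d q K
  have h3 := lt_two_pow_indexBits K
  rw [symbolOf, Nat.add_sub_cancel, content, mul_comm (horner _ _ _), Nat.mul_add_div (by positivity),
    Nat.div_eq_of_lt (show i < 2 ^ indexBits K by omega), add_zero,
    horner_div_mod (g := fun s => extend y (i * 2 ^ groupExp d q K + s)) (fun t => extend_lt hq _) hs]
  have : extend y (i * 2 ^ groupExp d q K + s) = (y ⟨i * 2 ^ groupExp d q K + s, hj⟩ : ℕ) := by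
    rw [extend, dif_pos hj]
  simp only [this]
  rw [if_pos (y _).2]

theorem codeLen_eq (d q K : ℕ) :
    blockCount d q K * blockLen (pieceExp d) (2 ^ msgExp d K) = codeLen d q K := by
  rw [blockLen_pow]; rfl

theorem win_bitsOf (w : List (Fin 2)) :
    win (bitsOf w) 0 w.length = w.map fun b => decide (b = 1) := by
  refine List.ext_getElem (by simp) fun i h1 h2 => ?_
  simp only [length_win] at h1
  simp [win, bitsOf, h1]

theorem map_compiled (y : Fin K → Fin q) :
    (List.ofFn (compiled d y)).map (fun b => decide (b = 1)) = codeBits d q K (extend y) := by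
  refine List.ext_getElem (by simp [length_codeBits]) fun i h1 h2 => ?_
  simp only [List.getElem_map, List.getElem_ofFn, compiled]
  rw [List.getD_eq_getElem _ _ h2]
  cases (codeBits d q K (extend y))[i] <;> simp

/-- A shortest sequence of edits yields an alignment, which is cut at the borders of the blocks.
Reading ones beyond the end of `w` ensures that no marker is seen there. -/
theorem exists_layout (hK : 1 ≤ K) (hq0 : 0 < q) (hq : q ≤ (K + 1) ^ d) (y : Fin K → Fin q)
    (w : List (Fin 2)) : ∃ f e, Layout (pieceExp d) (2 ^ msgExp d K) (seed (2 ^ msgExp d K))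
      (blockCount d q K) (content d q K (extend y)) (bitsOf w) f e ∧
      ∑ i ∈ Finset.range (blockCount d q K), e i ≤ insDel (List.ofFn (compiled d y)) w := by
  have h1 := (aligned_insDel (List.ofFn (compiled d y)) w).map fun b => decide (b = 1)
  rw [map_compiled, ← win_bitsOf] at h1
  obtain ⟨f, e, h2, h3, h4, h5, h6⟩ := Aligned.flatMap_range _ _ _ h1
  refine ⟨f, e, ⟨goodSeed_seed Nat.one_le_two_pow, Nat.one_le_two_pow, pieceExp_le,
    fun i hi => content_lt hK hq (fun j => extend_lt hq0 j) hi, h2, fun i hi => (h6 i hi).1,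
    fun i hi => (h6 i hi).2, fun i hi => h5 i hi, fun p hp => ?_⟩, h4⟩
  have : w.length ≤ p := h3 ▸ hp
  simp [bitsOf, List.getElem?_eq_none this]

/-- The samples of a list of coins are faithful. -/
def FaithfulCoins (d q K : ℕ) (y : Fin K → Fin q) (V : ℕ → Bool) (f e : ℕ → ℕ) (l : List ℕ) : Prop :=
  ∀ k ≤ Nat.log 2 (codeLen d q K), ∀ w < 8 * codeLen d q K,
    Faithful (pieceExp d) (2 * logLen d q K ^ 2)
      (sampleCount (pieceExp d) (Nat.log 2 (codeLen d q K)))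
      (Start (2 ^ msgExp d K) (blockCount d q K) f e (4 * codeLen d q K))
      (Wrong (2 ^ msgExp d K) (blockCount d q K) (content d q K (extend y)) f
        (Layout.lab (pieceExp d) (2 ^ msgExp d K) (seed (2 ^ msgExp d K)) (blockCount d q K) V)
        (4 * codeLen d q K)) (fun t => sample (logLen d q K) l t / 2 ^ k)
      (2 ^ Nat.log 2 (codeLen d q K) / 2 ^ k) w

theorem sum_digits_lt (b : ℕ → ℕ) (hb : ∀ k, b k ≤ 1) (L : ℕ) :
    ∑ k ∈ Finset.range L, b k * 2 ^ k < 2 ^ L := by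
  induction L with
  | zero => simp
  | succ L ih =>
    rw [Finset.sum_range_succ, pow_succ]
    have := Nat.mul_le_mul_right (2 ^ L) (hb L)
    omega

theorem sample_lt {L : ℕ} {l : List ℕ} (hl : ∀ b ∈ l, b ≤ 1) (t : ℕ) : sample L l t < 2 ^ L := by
  refine sum_digits_lt (fun k => l.getD (t * L + k) 0) (fun k => ?_) L
  rw [List.getD_eq_getElem?_getD]
  cases h : l[t * L + k]? with
  | none => simp
  | some b => exact hl b (List.mem_of_getElem? h)

theorem decodedAt_eq {y : Fin K → Fin q} (hq : 0 < q) {V : ℕ → Bool} {f e : ℕ → ℕ}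
    (h : Layout (pieceExp d) (2 ^ msgExp d K) (seed (2 ^ msgExp d K))
      (blockCount d q K) (content d q K (extend y)) V f e) {l : List ℕ} (hl : ∀ b ∈ l, b ≤ 1)
    (hF : FaithfulCoins d q K y V f e l) (j : Fin K)
    (hg : LocallyGood (pieceExp d) (2 ^ msgExp d K) e (j / 2 ^ groupExp d q K)) :
    decodedAt d q K V l j = y j := by
  have hi : j / 2 ^ groupExp d q K < blockCount d q K :=
    Nat.lt_succ_of_le (Nat.div_le_div_right j.2.le)
  have h1 := h.decodeBlock_eq hi hg (lam := indexBits K) (fun j hj => content_mod hj)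
    (blockLen_pow _ _) (J := Nat.log 2 (codeLen d q K)) (T := 2 * logLen d q K ^ 2)
    (n := sampleCount (pieceExp d) (Nat.log 2 (codeLen d q K))) (rho := sample (logLen d q K) l)
    (by rw [codeLen_eq]; exact Nat.pow_log_le_self 2 (codeLen_pos d q K).ne')
    (by rw [codeLen_eq]; exact Nat.lt_pow_succ_log_self (by norm_num) _)
    (fun t _ => sample_lt hl t) (by rw [codeLen_eq]; exact hF)
  rw [codeLen_eq] at h1
  rw [decodedAt, blockLabel]
  rw [show blockExp d K = 15 + pieceExp d + msgExp d K from rfl, h1]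
  have e1 := Nat.div_add_mod' (j : ℕ) (2 ^ groupExp d q K)
  rw [symbolOf_content hq hi (Nat.mod_lt _ (by positivity)) (by rw [e1]; exact j.2)]
  simp only [e1]

-- Only blocks that are not locally good can be decoded wrongly; each of them spoils the symbols of
-- one group, and their number is bounded by the maximal inequality.
open Classical in
theorem card_wrong_symbols_le (hq : 0 < q) {y : Fin K → Fin q} {V : ℕ → Bool} {f e : ℕ → ℕ}
    (h : Layout (pieceExp d) (2 ^ msgExp d K) (seed (2 ^ msgExp d K))
      (blockCount d q K) (content d q K (extend y)) V f e) {l : List ℕ} (hl : ∀ b ∈ l, b ≤ 1)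
    (hF : FaithfulCoins d q K y V f e l) :
    (Finset.univ.filter fun j : Fin K => (y j : ℕ) ≠ decodedAt d q K V l j).card * 2 ^ msgExp d K
      ≤ min (2 ^ groupExp d q K) K * (4 * tolerance (pieceExp d) *
        ∑ i ∈ Finset.range (blockCount d q K), e i) := by
  set β := groupExp d q K
  let bad := (Finset.range (blockCount d q K)).filter fun i =>
    ¬ LocallyGood (pieceExp d) (2 ^ msgExp d K) e i
  have h1 : ((Finset.univ.filter fun j : Fin K => (y j : ℕ) ≠ decodedAt d q K V l j).image
      Fin.val) ⊆ bad.biUnion fun i => (Finset.range K).filter fun j => j / 2 ^ β = i := by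
    intro j hj
    simp only [Finset.mem_image, Finset.mem_filter, Finset.mem_univ, true_and] at hj
    obtain ⟨j, hj, rfl⟩ := hj
    simp only [bad, Finset.mem_biUnion, Finset.mem_filter, Finset.mem_range]
    refine ⟨j / 2 ^ β, ⟨Nat.lt_succ_of_le (Nat.div_le_div_right j.2.le), fun hg => hj ?_⟩, j.2, rfl⟩
    exact (decodedAt_eq hq h hl hF j hg).symm
  have h2 : ∀ i, ((Finset.range K).filter fun j => j / 2 ^ β = i).card ≤ min (2 ^ β) K := by
    intro i
    refine le_min ?_ ((Finset.card_filter_le _ _).trans (by simp))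
    have : ((Finset.range K).filter fun j => j / 2 ^ β = i) ⊆
        Finset.Ico (i * 2 ^ β) (i * 2 ^ β + 2 ^ β) := by
      intro j hj
      simp only [Finset.mem_filter] at hj
      have := Nat.div_add_mod' j (2 ^ β)
      have h3 := Nat.mod_lt j (show 0 < 2 ^ β by positivity)
      rw [hj.2] at this
      rw [Finset.mem_Ico]; omega
    exact (Finset.card_le_card this).trans (by simp)
  have h3 := (Finset.card_le_card h1).trans
    (Finset.card_biUnion_le_card_mul _ _ (min (2 ^ β) K) fun i _ => h2 i)
  rw [Finset.card_image_of_injective _ Fin.val_injective] at h3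
  have h4 := card_not_locallyGood_mul_le (pieceExp d) (2 ^ msgExp d K) (blockCount d q K) e h.none
  calc _ ≤ bad.card * min (2 ^ β) K * 2 ^ msgExp d K := Nat.mul_le_mul_right _ h3
    _ = min (2 ^ β) K * (bad.card * 2 ^ msgExp d K) := by ring
    _ ≤ _ := Nat.mul_le_mul_left _ h4

/-- The minimum with `K` handles short words: a block may have room for far more symbols than the
word has, and then `2 ^ groupExp` alone would overcount. -/
theorem min_mul_blockCount_le (d q K : ℕ) :
    min (2 ^ groupExp d q K) K * blockCount d q K ≤ 2 * K := by
  rcases le_total (2 ^ groupExp d q K) K with h | h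
  · rw [min_eq_left h, blockCount, mul_add, mul_one, mul_comm]
    have := Nat.div_mul_le_self K (2 ^ groupExp d q K)
    omega
  · rw [min_eq_right h, blockCount]
    rcases Nat.lt_or_ge K (2 ^ groupExp d q K) with h1 | h1
    · rw [Nat.div_eq_of_lt h1]; omega
    · rw [le_antisymm h1 h]
      rcases Nat.eq_zero_or_pos K with rfl | hK
      · simp
      · rw [Nat.div_self hK]; omega

theorem countP_ofFn {α : Type} {n : ℕ} (g : Fin n → α) (p : α → Prop) [DecidablePred p] :
    (List.ofFn g).countP (fun a => decide (p a)) = (Finset.univ.filter fun j => p (g j)).card := by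
  induction n with
  | zero => simp
  | succ n ih =>
    rw [List.ofFn_succ, List.countP_cons, ih, Fin.card_filter_univ_succ]
    by_cases h : p (g 0) <;> simp [h]

/-- The ratio of the tolerated rates of errors. -/
noncomputable def rateLoss (d : ℕ) : ℝ := 16 * tolerance (pieceExp d) * 2 ^ (15 + pieceExp d)

theorem rateLoss_pos (d : ℕ) : 0 < rateLoss d := by unfold rateLoss tolerance; positivity

/-- Words at small edit distance are decoded up to a small Hamming distance. -/
theorem hamDist_decoded_le (hK : 1 ≤ K) (hq : 0 < q) {y : Fin K → Fin q} {w : List (Fin 2)}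
    {f e : ℕ → ℕ} (h : Layout (pieceExp d) (2 ^ msgExp d K) (seed (2 ^ msgExp d K))
      (blockCount d q K) (content d q K (extend y)) (bitsOf w) f e)
    (hE : ∑ i ∈ Finset.range (blockCount d q K), e i ≤ insDel (List.ofFn (compiled d y)) w)
    {l : List ℕ} (hl : ∀ b ∈ l, b ≤ 1) (hF : FaithfulCoins d q K y (bitsOf w) f e l)
    {ρ : ℝ} (hρ : 0 < ρ)
    (hw : editDist (List.ofFn (compiled d y)) w ≤ ENNReal.ofReal (ρ / rateLoss d)) :
    hamDist (List.ofFn y) (decoded d K hq (bitsOf w) l) ≤ ENNReal.ofReal ρ := by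
  classical
  have hn : (0 : ℝ) < codeLen d q K := by exact_mod_cast codeLen_pos d q K
  have hK0 : (0 : ℝ) < K := by exact_mod_cast hK
  have hr := rateLoss_pos d
  have h1 : ((insDel (List.ofFn (compiled d y)) w : ℕ) : ℝ) ≤ ρ / rateLoss d * (2 * codeLen d q K) := by
    rw [editDist, List.length_ofFn, ENNReal.div_le_iff (by
      simpa using (codeLen_pos d q K).ne') (by finiteness)] at hw
    have h2 : ((insDel (List.ofFn (compiled d y)) w : ℕ) : ℝ≥0∞)
        = ENNReal.ofReal (insDel (List.ofFn (compiled d y)) w : ℕ) := by simp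
    have h3 : (2 * (codeLen d q K : ℝ≥0∞)) = ENNReal.ofReal (2 * codeLen d q K) := by
      rw [ENNReal.ofReal_mul (by norm_num)]; simp
    rw [h2, h3, ← ENNReal.ofReal_mul (by positivity)] at hw
    exact (ENNReal.ofReal_le_ofReal_iff (by positivity)).1 hw
  have h2 := card_wrong_symbols_le hq h hl hF
  have h3 := min_mul_blockCount_le d q K
  set wr := (Finset.univ.filter fun j : Fin K => (y j : ℕ) ≠ decodedAt d q K (bitsOf w) l j).card
    with hwr
  have h4 : (wr : ℝ) ≤ ρ * K := by
    have h5 := h2.trans (Nat.mul_le_mul_left _ (Nat.mul_le_mul_left _ hE))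
    have h6 : (wr : ℝ) * 2 ^ msgExp d K ≤ (min (2 ^ groupExp d q K) K : ℕ) *
        (4 * (tolerance (pieceExp d) : ℕ) * (insDel (List.ofFn (compiled d y)) w : ℕ)) := by
      exact_mod_cast h5
    have h7 : ((min (2 ^ groupExp d q K) K : ℕ) : ℝ) * blockCount d q K ≤ 2 * K := by
      exact_mod_cast h3
    have h8 : (codeLen d q K : ℝ) = blockCount d q K * (2 ^ (15 + pieceExp d) * 2 ^ msgExp d K) := by
      rw [codeLen, blockExp, pow_add 2 (15 + pieceExp d)]; push_cast; ring
    have h9 : (0 : ℝ) < 2 ^ msgExp d K := by positivity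
    refine le_of_mul_le_mul_right (h6.trans ?_) h9
    -- The loss `16 * tolerance * 2 ^ (15 + η)` collects `4 * tolerance` from the maximal
    -- inequality, `2` from the normalization of the edit distance, `2` from
    -- `min_mul_blockCount_le`, and the length of a block in units of `m`.
    calc _ ≤ ((min (2 ^ groupExp d q K) K : ℕ) : ℝ) *
          (4 * (tolerance (pieceExp d) : ℕ) * (ρ / rateLoss d * (2 * codeLen d q K))) := by gcongr
      _ = (((min (2 ^ groupExp d q K) K : ℕ) : ℝ) * blockCount d q K) * (8 * (tolerance (pieceExp d) : ℕ)
          * 2 ^ (15 + pieceExp d) * (ρ / rateLoss d)) * 2 ^ msgExp d K := by rw [h8]; ring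
      _ ≤ (2 * K) * (8 * (tolerance (pieceExp d) : ℕ)
          * 2 ^ (15 + pieceExp d) * (ρ / rateLoss d)) * 2 ^ msgExp d K := by gcongr
      _ = ρ * K * (rateLoss d / rateLoss d) * 2 ^ msgExp d K := by rw [rateLoss]; ring
      _ = _ := by rw [div_self hr.ne', mul_one]
  have hcount : ((List.ofFn y).zip (decoded d K hq (bitsOf w) l)).countP
      (fun a => decide (a.1 ≠ a.2)) = wr := by
    have e1 : (List.ofFn y).zip (decoded d K hq (bitsOf w) l) = List.ofFn fun j : Fin K =>
        (y j, (⟨decodedAt d q K (bitsOf w) l j, decodedAt_lt hq _ l j⟩ : Fin q)) := by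
      refine List.ext_getElem (by simp [decoded]) fun i g1 g2 => by simp [decoded]
    rw [e1, countP_ofFn, hwr]
    refine congrArg _ (Finset.filter_congr fun j _ => ?_)
    simp [Fin.ext_iff]
  rw [hamDist, if_pos (by simp [decoded]), hcount, List.length_ofFn,
    ENNReal.div_le_iff (by simpa using (show K ≠ 0 by omega)) (by finiteness)]
  have e2 : (wr : ℝ≥0∞) = ENNReal.ofReal wr := by simp
  have e3 : (K : ℝ≥0∞) = ENNReal.ofReal K := by simp
  rw [e2, e3, ← ENNReal.ofReal_mul hρ.le]
  exact ENNReal.ofReal_le_ofReal h4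

end

/-! ### The failure probability of the sampling. -/

/-- The probability that the samples are not faithful. -/
noncomputable def failure (n : ℕ) : ℝ := 16 * n * (Nat.log 2 n + 1) / 2 ^ (Nat.log 2 n + 1) ^ 2

/-- The number of coins. -/
noncomputable def coinCount (d q K : ℕ) : ℕ :=
  sampleCount (pieceExp d) (Nat.log 2 (codeLen d q K)) * logLen d q K

theorem measure_not_faithfulCoins {d q K : ℕ} (y : Fin K → Fin q) (V : ℕ → Bool) (f e : ℕ → ℕ) :
    2 ^ logLen d q K ^ 2 * (coins (coinCount d q K)).toOuterMeasure
      {l | ¬ FaithfulCoins d q K y V f e l} ≤ 16 * codeLen d q K * logLen d q K := by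
  have h1 := measure_exists_not_faithful (pieceExp d) (Nat.log 2 (codeLen d q K))
    (8 * codeLen d q K) (Start (2 ^ msgExp d K) (blockCount d q K) f e (4 * codeLen d q K))
      (Wrong (2 ^ msgExp d K) (blockCount d q K) (content d q K (extend y)) f
        (Layout.lab (pieceExp d) (2 ^ msgExp d K) (seed (2 ^ msgExp d K)) (blockCount d q K) V)
        (4 * codeLen d q K))
  have h2 : ∀ E : Set (List ℕ), {l | ¬ FaithfulCoins d q K y V f e l} ⊆ E →
      2 ^ logLen d q K ^ 2 * (coins (coinCount d q K)).toOuterMeasure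
        {l | ¬ FaithfulCoins d q K y V f e l}
      ≤ 2 ^ logLen d q K ^ 2 * (coins (coinCount d q K)).toOuterMeasure E := fun E h =>
    mul_le_mul_right (MeasureTheory.measure_mono h) _
  refine (h2 _ fun l hl => ?_).trans (h1.trans ?_)
  · simp only [FaithfulCoins, Set.mem_ofPred_eq] at hl ⊢
    push Not at hl
    exact hl
  · push_cast
    refine le_of_eq ?_
    ring

theorem ofReal_failure (n : ℕ) : 2 ^ (Nat.log 2 n + 1) ^ 2 * ENNReal.ofReal (failure n)
    = 16 * n * (Nat.log 2 n + 1 : ℕ) := by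
  have h1 : (2 : ℝ≥0∞) ^ (Nat.log 2 n + 1) ^ 2
      = ENNReal.ofReal ((2 : ℝ) ^ (Nat.log 2 n + 1) ^ 2) := by
    rw [ENNReal.ofReal_pow (by norm_num)]; simp
  have h2 : (16 * n * (Nat.log 2 n + 1 : ℕ) : ℝ≥0∞)
      = ENNReal.ofReal (16 * n * (Nat.log 2 n + 1 : ℕ)) := by
    rw [ENNReal.ofReal_mul (by positivity), ENNReal.ofReal_mul (by positivity),
      ENNReal.ofReal_natCast, ENNReal.ofReal_natCast]
    simp
  rw [h1, h2, ← ENNReal.ofReal_mul (by positivity), failure, mul_div_cancel₀ _ (by positivity)]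
  push_cast
  rfl

/-- The layout depends on `y` and `w` only and is chosen before the coins are tossed, so the union
bound over scales and windows applies to fixed sets of starts and wrong labels. -/
theorem measure_bad_coins_le {d q K : ℕ} (hK : 1 ≤ K) (hq0 : 0 < q) (hq : q ≤ (K + 1) ^ d)
    (y : Fin K → Fin q) (w : List (Fin 2)) {ρ : ℝ} (hρ : 0 < ρ)
    (hw : editDist (List.ofFn (compiled d y)) w ≤ ENNReal.ofReal (ρ / rateLoss d)) :
    (coins (coinCount d q K)).toOuterMeasure {l |
      ¬ hamDist (List.ofFn y) (decoded d K hq0 (bitsOf w) l) ≤ ENNReal.ofReal ρ}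
      ≤ ENNReal.ofReal (failure (codeLen d q K)) := by
  obtain ⟨f, e, h, hE⟩ := exists_layout hK hq0 hq y w
  have h2 : (coins (coinCount d q K)).toOuterMeasure {l |
      ¬ hamDist (List.ofFn y) (decoded d K hq0 (bitsOf w) l) ≤ ENNReal.ofReal ρ}
      ≤ (coins (coinCount d q K)).toOuterMeasure {l | ¬ FaithfulCoins d q K y (bitsOf w) f e l} := by
    refine PMF.toOuterMeasure_mono _ ?_
    rintro l ⟨hl, hs⟩ hF
    exact hl (hamDist_decoded_le hK hq0 h hE (le_one_of_mem_coins hs) hF hρ hw)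
  refine h2.trans ?_
  rw [← ENNReal.mul_le_mul_iff_right (a := 2 ^ logLen d q K ^ 2) (by simp)
    (by simp [ENNReal.pow_eq_top_iff]), ofReal_failure]
  exact measure_not_faithfulCoins y (bitsOf w) f e

/-- With `L = log n + 1` and `n < 2 ^ L`, the product `n ^ k * 16 * n * L * n` is at most `16 * 2 ^
(L * (k + 3))`, hence at most `16 * 2 ^ (L ^ 2)` once `k + 3 ≤ L`. The spare factor `n` gives
convergence to zero. -/
theorem negligible_failure : Negligible failure := by
  refine ⟨fun n => by unfold failure; positivity, fun k => ?_⟩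
  have h0 : Filter.Tendsto (fun n : ℕ => 16 * ((n : ℝ))⁻¹) Filter.atTop (nhds 0) := by
    simpa using (tendsto_inv_atTop_nhds_zero_nat (𝕜 := ℝ)).const_mul 16
  refine squeeze_zero' (Filter.Eventually.of_forall fun n => by unfold failure; positivity) ?_ h0
  filter_upwards [Filter.eventually_ge_atTop (2 ^ (k + 4))] with n hn
  have hpos : 0 < n := lt_of_lt_of_le (by positivity) hn
  set L := Nat.log 2 n + 1 with hL
  have h1 : n < 2 ^ L := Nat.lt_pow_succ_log_self (by norm_num) n
  have h2 : k + 4 ≤ L := (Nat.le_log_of_pow_le (by norm_num) hn).trans (Nat.le_succ _)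
  have h3 : L < 2 ^ L := Nat.lt_two_pow_self
  have h4 : n ^ k * (16 * n * L) * n ≤ 16 * 2 ^ L ^ 2 := by
    calc n ^ k * (16 * n * L) * n = 16 * (n ^ (k + 2) * L) := by ring
      _ ≤ 16 * ((2 ^ L) ^ (k + 2) * 2 ^ L) := by gcongr
      _ = 16 * 2 ^ (L * (k + 3)) := by rw [← pow_succ, ← pow_mul]
      _ ≤ 16 * 2 ^ L ^ 2 := by
          gcongr
          · norm_num
          · rw [sq]; exact Nat.mul_le_mul_left _ (by omega)
  have h5 : (n : ℝ) ^ k * (16 * n * L) * n ≤ 16 * 2 ^ L ^ 2 := by exact_mod_cast h4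
  have hn0 : (0 : ℝ) < n := by exact_mod_cast hpos
  have h6 : failure n = 16 * n * L / 2 ^ L ^ 2 := by
    rw [failure, hL]; push_cast; ring
  rw [h6, ← mul_div_assoc, ← div_eq_mul_inv, div_le_div_iff₀ (by positivity) hn0]
  exact h5

/-! ### Query algorithms -/

namespace QueryTree
variable {σ τ α β : Type}

/-- One query algorithm after the other. -/
def bind : QueryTree σ α → (α → QueryTree σ β) → QueryTree σ β
  | output b, g => g b
  | query j next, g => query j fun x => (next x).bind g

theorem eval_bind (w : List σ) (T : QueryTree σ α) (g : α → QueryTree σ β) :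
    (T.bind g).eval w = (g (T.eval w)).eval w := by
  induction T with
  | output b => rfl
  | query j next ih => simpa [bind, eval] using ih _

theorem cost_bind (w : List σ) (T : QueryTree σ α) (g : α → QueryTree σ β) :
    (T.bind g).cost w = T.cost w + (g (T.eval w)).cost w := by
  induction T with
  | output b => simp [bind, cost, eval]
  | query j next ih => simp only [bind, cost, eval, ih]; omega

/-- The queries are answered by query algorithms on another word. -/
def subst (g : ℕ → QueryTree τ (Option σ)) : QueryTree σ α → QueryTree τ α
  | output b => output b
  | query j next => (g j).bind fun x => (next x).subst g

theorem eval_subst {g : ℕ → QueryTree τ (Option σ)} {w : List τ} {w' : List σ}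
    (h : ∀ j, (g j).eval w = w'[j]?) (T : QueryTree σ α) : (T.subst g).eval w = T.eval w' := by
  induction T with
  | output b => rfl
  | query j next ih => rw [subst, eval_bind, h, ih, eval]

theorem cost_subst {g : ℕ → QueryTree τ (Option σ)} {w : List τ} {w' : List σ} {a : ℕ}
    (h : ∀ j, (g j).eval w = w'[j]?) (h' : ∀ j, (g j).cost w ≤ a) (T : QueryTree σ α) :
    (T.subst g).cost w ≤ a * T.cost w' := by
  induction T with
  | output b => simp [subst, cost]
  | query j next ih =>
    rw [subst, cost_bind, h, cost, Nat.mul_succ]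
    have := ih w'[j]?
    have := h' j
    omega

end QueryTree

/-- A function of words that can be computed by at most `a` queries. -/
def Local {σ α : Type} (a : ℕ) (Φ : List σ → α) : Prop :=
  ∃ T : QueryTree σ α, ∀ w, T.eval w = Φ w ∧ T.cost w ≤ a

namespace Local
variable {σ α β : Type} {a b : ℕ}

theorem const (x : α) : Local 0 fun _ : List σ => x := ⟨.output x, fun _ => ⟨rfl, le_rfl⟩⟩

theorem mono {Φ : List σ → α} (h : Local a Φ) (hab : a ≤ b) : Local b Φ := by
  obtain ⟨T, hT⟩ := h
  exact ⟨T, fun w => ⟨(hT w).1, (hT w).2.trans hab⟩⟩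

theorem bind {Φ : List σ → α} {Ψ : α → List σ → β} (h : Local a Φ) (h' : ∀ x, Local b (Ψ x)) :
    Local (a + b) fun w => Ψ (Φ w) w := by
  obtain ⟨T, hT⟩ := h
  choose g hg using h'
  refine ⟨T.bind g, fun w => ⟨?_, ?_⟩⟩
  · rw [QueryTree.eval_bind, (hT w).1, (hg _ w).1]
  · rw [QueryTree.cost_bind]
    exact Nat.add_le_add (hT w).2 (hg _ w).2

theorem map {Φ : List σ → α} (h : Local a Φ) (g : α → β) : Local a fun w => g (Φ w) :=
  h.bind fun x => const (g x)

/-- A function of finitely many values of a family of functions. -/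
theorem family {ι : Type} [DecidableEq ι] {lab : List σ → ι → α} (xs : List ι)
    (h : ∀ x ∈ xs, Local a fun w => lab w x) (F : (ι → α) → β)
    (hF : ∀ g g' : ι → α, (∀ x ∈ xs, g x = g' x) → F g = F g') :
    Local (xs.length * a) fun w => F (lab w) := by
  induction xs generalizing F with
  | nil =>
    by_cases hw : Nonempty (List σ)
    · obtain ⟨w⟩ := hw
      have : (fun w => F (lab w)) = fun _ => F (lab w) := funext fun w' => hF _ _ (by simp)
      rw [this]
      exact (const _).mono (Nat.zero_le _)
    · exact absurd ⟨[]⟩ hw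
  | cons x xs ih =>
    have h1 := (h x (by simp)).bind (b := xs.length * a)
      (Ψ := fun v w => F (Function.update (lab w) x v)) fun v =>
        ih (fun z hz => h z (by simp [hz])) (fun g => F (Function.update g x v))
          fun g g' hg => hF _ _ fun z hz => by
            by_cases hzx : z = x
            · simp [hzx]
            · simpa [hzx] using hg z (by simpa [hzx] using hz)
    refine Local.mono (a := a + xs.length * a) ?_ (by rw [List.length_cons, Nat.succ_mul]; omega)
    simpa using h1

end Local

theorem local_bitsOf (p : ℕ) : Local 1 fun w : List (Fin 2) => bitsOf w p :=
  ⟨.query p fun x => .output (x.elim true fun b => decide (b = 1)), fun _ => ⟨rfl, le_rfl⟩⟩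

theorem win_congr {V V' : ℕ → Bool} {p n : ℕ} (h : ∀ x, p ≤ x → x < p + n → V x = V' x) :
    win V p n = win V' p n :=
  List.map_congr_left fun k hk => h _ (by omega) (by rw [List.mem_range] at hk; omega)

theorem labelAt_congr {η m s p : ℕ} {V V' : ℕ → Bool}
    (h : ∀ x, p ≤ x → x < p + blockLen η m → V x = V' x) :
    labelAt η m s V p = labelAt η m s V' p := by
  have h1 : ones V p (markLen η m) = ones V' p (markLen η m) := by
    rw [ones, ones, win_congr fun x h1 h2 => h x h1 (by unfold blockLen; omega)]
  have h2 : ∀ t < 2 ^ η, entry η m s V p t = entry η m s V' p t := fun t ht => by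
    rw [entry, entry, win_congr fun x h1 h2 => h x (by omega) ?_]
    have : (t + 1) * wordLen m ≤ 2 ^ η * wordLen m := Nat.mul_le_mul_right _ ht
    rw [Nat.add_mul, one_mul, mul_comm t] at this
    simp only [blockLen, markLen] at h2 ⊢
    omega
  unfold labelAt
  rw [h1, horner_congr (g' := fun t => (entry η m s V' p t - 1) % 2 ^ (m - η)) _
    fun t ht => by rw [h2 t ht]]
  refine if_congr (and_congr_right fun _ => forall₂_congr fun t ht => ?_) rfl rfl
  rw [h2 t ht]

/-- A label depends only on the letters of one block length from its position on (`labelAt_congr`).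
-/
theorem local_labels (η m s Z M x : ℕ) :
    Local (blockLen η m) fun w => labels η m s (bitsOf w) Z M x := by
  unfold labels
  split_ifs
  · exact (Local.const _).mono (Nat.zero_le _)
  · have := Local.family (lab := bitsOf) (a := 1)
      ((List.range (blockLen η m)).map fun k => x - Z + k)
      (fun x _ => local_bitsOf x) (fun V => labelAt η m s V (x - Z)) fun V V' h =>
        labelAt_congr fun z h1 h2 => h z
          (List.mem_map.2 ⟨z - (x - Z), List.mem_range.2 (by omega), by omega⟩)
    simpa using this

/-! ### Query cost of the search. -/

section
variable {lab : List (Fin 2) → ℕ → ℕ} {a : ℕ}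

theorem tally_congr {N : ℕ} {P Q : ℕ → Prop} [DecidablePred P] [DecidablePred Q]
    (h : ∀ t < N, P t ↔ Q t) : tally N P = tally N Q :=
  le_antisymm (tally_mono fun t ht => (h t ht).1) (tally_mono fun t ht => (h t ht).2)

theorem searchStep_congr {lab lab' : ℕ → ℕ} {B lam N : ℕ} {u : ℕ → ℕ} {P i Δ : ℕ}
    (h : ∀ t < N, lab (i * B + Δ + u t - P) = lab' (i * B + Δ + u t - P)) :
    searchStep lab B lam N u P i Δ = searchStep lab' B lam N u P i Δ := by
  have k1 : (tally N fun t => lab (i * B + Δ + u t - P) ≠ 0)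
      = tally N fun t => lab' (i * B + Δ + u t - P) ≠ 0 := tally_congr fun t ht => by rw [h t ht]
  have k2 : (tally N fun t => lab (i * B + Δ + u t - P) ≠ 0 ∧
        Δ + P / 8 < offset lab B lam (i * B + Δ + u t - P))
      = tally N fun t => lab' (i * B + Δ + u t - P) ≠ 0 ∧
        Δ + P / 8 < offset lab' B lam (i * B + Δ + u t - P) :=
    tally_congr fun t ht => by rw [offset, offset, h t ht]
  have k3 : (tally N fun t => lab (i * B + Δ + u t - P) ≠ 0 ∧
        offset lab B lam (i * B + Δ + u t - P) + P / 8 < Δ)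
      = tally N fun t => lab' (i * B + Δ + u t - P) ≠ 0 ∧
        offset lab' B lam (i * B + Δ + u t - P) + P / 8 < Δ :=
    tally_congr fun t ht => by rw [offset, offset, h t ht]
  simp only [searchStep]
  rw [k1, k2, k3]

/-- The search is adaptive: the positions sampled in a step depend on the offset found so far. Hence
the sequential composition `Local.bind`, with at most `N` labels in each step. -/
theorem local_search (hlab : ∀ x, Local a fun w => lab w x) (B lam N : ℕ) (rho : ℕ → ℕ)
    (J Z i k : ℕ) : Local (k * (N * a)) fun w => search (lab w) B lam N rho J Z i k := by
  induction k with
  | zero => exact (Local.const Z).mono (Nat.zero_le _)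
  | succ k ih =>
    refine Local.mono (a := k * (N * a) + N * a) ?_ (by rw [Nat.succ_mul])
    refine ih.bind (Ψ := fun Δ w => searchStep (lab w) B lam N (fun t => rho t / 2 ^ k)
      (2 ^ J / 2 ^ k) i Δ) fun Δ => ?_
    have := Local.family (lab := lab)
      ((List.range N).map fun t => i * B + Δ + rho t / 2 ^ k - 2 ^ J / 2 ^ k)
      (fun x _ => hlab x) (fun g => searchStep g B lam N (fun t => rho t / 2 ^ k)
        (2 ^ J / 2 ^ k) i Δ) fun g g' h => searchStep_congr fun t ht =>
          h _ (List.mem_map.2 ⟨t, List.mem_range.2 ht, rfl⟩)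
    simpa using this

theorem scan_congr {lab lab' : ℕ → ℕ} {lam i x : ℕ} (k : ℕ) (h : ∀ j < k, lab (x + j) = lab' (x + j)) :
    scan lab lam i x k = scan lab' lam i x k := by
  induction k with
  | zero => rfl
  | succ k ih => rw [scan, scan, h k (by omega), ih fun j hj => h j (by omega)]

theorem local_decodeBlock (hlab : ∀ x, Local a fun w => lab w x) (c lam N : ℕ) (rho : ℕ → ℕ)
    (J Z i : ℕ) : Local (((J + 1 - c) * N + (2 ^ c / 2 + 1)) * a)
      fun w => decodeBlock (lab w) c lam N rho J Z i := by
  refine Local.mono (a := (J + 1 - c) * (N * a) + (2 ^ c / 2 + 1) * a) ?_ (le_of_eq (by ring))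
  refine (local_search hlab (2 ^ c) lam N rho J Z i (J + 1 - c)).bind
    (Ψ := fun Δ w => scan (lab w) lam i (i * 2 ^ c + Δ - 2 ^ c / 4) (2 ^ c / 2 + 1)) fun Δ => ?_
  have := Local.family (lab := lab)
      ((List.range (2 ^ c / 2 + 1)).map fun t => i * 2 ^ c + Δ - 2 ^ c / 4 + t)
      (fun x _ => hlab x) (fun g => scan g lam i (i * 2 ^ c + Δ - 2 ^ c / 4) (2 ^ c / 2 + 1))
        fun g g' h => scan_congr _ fun t ht =>
          h _ (List.mem_map.2 ⟨t, List.mem_range.2 ht, rfl⟩)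
  simpa using this

end

/-- The number of queries that decode a symbol. -/
noncomputable def queryCount (d q K : ℕ) : ℕ :=
  ((Nat.log 2 (codeLen d q K) + 1 - blockExp d K) *
    sampleCount (pieceExp d) (Nat.log 2 (codeLen d q K)) + (2 ^ blockExp d K / 2 + 1))
    * 2 ^ blockExp d K

theorem local_decodedAt (d q K : ℕ) (l : List ℕ) (j : ℕ) :
    Local (queryCount d q K) fun w => decodedAt d q K (bitsOf w) l j := by
  refine Local.map ?_ fun x => symbolOf d q K x (j % 2 ^ groupExp d q K)
  refine local_decodeBlock (lab := fun w => Layout.lab _ _ _ _ (bitsOf w)) (fun x => ?_) _ _ _ _ _ _ _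
  have := local_labels (pieceExp d) (2 ^ msgExp d K) (seed (2 ^ msgExp d K))
    (4 * (blockCount d q K * blockLen (pieceExp d) (2 ^ msgExp d K)))
    (8 * (blockCount d q K * blockLen (pieceExp d) (2 ^ msgExp d K))) x
  have e : blockLen (pieceExp d) (2 ^ msgExp d K) = 2 ^ blockExp d K := blockLen_pow _ _
  rw [← e]
  exact this

theorem local_getElem_decoded (d : ℕ) {q : ℕ} (K : ℕ) (hq : 0 < q) (l : List ℕ) (j : ℕ) :
    Local (queryCount d q K) fun w => (decoded d K hq (bitsOf w) l)[j]? := by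
  by_cases hj : j < K
  · have h := (local_decodedAt d q K l j).map fun v => some (⟨v % q, Nat.mod_lt _ hq⟩ : Fin q)
    convert h using 2 with w
    simp [decoded, hj, Nat.mod_eq_of_lt (decodedAt_lt hq (bitsOf w) l j)]
  · have : (fun w => (decoded d K hq (bitsOf w) l)[j]?) = fun _ => none :=
      funext fun w => by simp [decoded, hj]
    rw [this]
    exact (Local.const _).mono (Nat.zero_le _)

/-- There are at most `log n + 1` scales with `O(log² n)` labels each, and a label costs a block
length, `O(log n)` letters. The final scan costs only `O(log² n)`. -/
theorem queryCount_le {d q K : ℕ} (hK : 1 ≤ K) :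
    queryCount d q K ≤ 2 ^ (40 + 5 * pieceExp d) * logLen d q K ^ 4 := by
  have hB := two_pow_blockExp_le_logLen (d := d) (q := q) hK
  unfold queryCount
  change (_ * (8 * (32 * 2 ^ (15 + pieceExp d)) * logLen d q K ^ 2) + _) * _ ≤ _
  change ((logLen d q K - _) * _ + _) * _ ≤ _
  have hL : 1 ≤ logLen d q K := Nat.succ_pos _
  generalize pieceExp d = p at *
  generalize logLen d q K = L at *
  generalize blockExp d K = c at *
  have hB1 : 1 ≤ 2 ^ c := Nat.one_le_two_pow
  set B := 2 ^ c with hBdef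
  have h1 : L - c ≤ L := Nat.sub_le _ _
  have h2 : B / 2 + 1 ≤ 2 * B := by omega
  have e1 : 2 ^ (15 + 2 * p) = 2 ^ 15 * (2 ^ p) ^ 2 := by rw [pow_add, mul_comm 2 p, pow_mul]
  have e2 : 2 ^ (15 + p) = 2 ^ 15 * 2 ^ p := pow_add _ _ _
  have e3 : 2 ^ (40 + 5 * p) = 2 ^ 40 * (2 ^ p) ^ 5 := by rw [pow_add, mul_comm 5 p, pow_mul]
  have hp : 1 ≤ 2 ^ p := Nat.one_le_two_pow
  rw [e1] at hB
  rw [e2, e3]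
  generalize 2 ^ p = u at *
  have hu : u ^ 2 ≤ u ^ 3 := Nat.pow_le_pow_right hp (by norm_num)
  have hL3 : L ≤ L ^ 3 := Nat.le_self_pow (by norm_num) _
  calc ((L - c) * (8 * (32 * (2 ^ 15 * u)) * L ^ 2) + (B / 2 + 1)) * B
      ≤ (L * (8 * (32 * (2 ^ 15 * u)) * L ^ 2) + 2 * (2 ^ 15 * u ^ 2 * L)) * (2 ^ 15 * u ^ 2 * L) := by
        gcongr
        exact h2.trans (Nat.mul_le_mul_left _ hB)
    _ = 2 ^ 38 * (u ^ 3 * L ^ 4) + 2 ^ 31 * (u ^ 4 * L ^ 2) := by ring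
    _ ≤ 2 ^ 38 * (u ^ 5 * L ^ 4) + 2 ^ 31 * (u ^ 5 * L ^ 4) := by
        gcongr <;> norm_num
    _ ≤ 2 ^ 40 * u ^ 5 * L ^ 4 := by
        have : 0 ≤ u ^ 5 * L ^ 4 := Nat.zero_le _
        rw [mul_assoc (2 ^ 40)]
        generalize u ^ 5 * L ^ 4 = z
        omega

/-! ### Runs with more fuel -/

/-- Every outcome other than `none` is at least as likely under `ν` as under `μ`. -/
def Dominated {α : Type} (μ ν : PMF (Option α)) : Prop := ∀ c, μ (some c) ≤ ν (some c)

theorem Dominated.refl {α : Type} (μ : PMF (Option α)) : Dominated μ μ := fun _ => le_rfl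

theorem dominated_none {α : Type} (μ : PMF (Option α)) : Dominated (PMF.pure none) μ := fun c => by
  simp [PMF.pure_apply]

theorem Dominated.bind {α β : Type} {μ ν : PMF (Option α)} {f g : α → PMF (Option β)}
    (h : Dominated μ ν) (h' : ∀ a, Dominated (f a) (g a)) :
    Dominated (μ.bind fun o => o.elim (PMF.pure none) f) (ν.bind fun o => o.elim (PMF.pure none) g) := by
  intro c
  rw [PMF.bind_apply, PMF.bind_apply]
  refine ENNReal.tsum_le_tsum fun o => ?_
  cases o with
  | none => simp [PMF.pure_apply]
  | some a => exact mul_le_mul' (h a) (h' a c)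

theorem map_eq_bind {α β : Type} (μ : PMF (Option α)) (f : α → β) :
    (μ.map fun o => o.map f) = μ.bind fun o => o.elim (PMF.pure none) fun a => PMF.pure (some (f a)) := by
  rw [PMF.map]
  congr 1
  funext o
  cases o <;> rfl

theorem Dominated.map {α β : Type} {μ ν : PMF (Option α)} (h : Dominated μ ν) (f : α → β) :
    Dominated (μ.map fun o => o.map f) (ν.map fun o => o.map f) := by
  rw [map_eq_bind, map_eq_bind]
  exact h.bind fun a => .refl _

theorem dominated_loop {r : ℕ} {body body' : State → PMF (Option State)}
    (h : ∀ s, Dominated (body s) (body' s)) {fuel fuel' : ℕ} (hf : fuel ≤ fuel') (s : State) :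
    Dominated (loop r body fuel s) (loop r body' fuel' s) := by
  induction fuel generalizing fuel' s with
  | zero => exact dominated_none _
  | succ fuel ih =>
    obtain ⟨k, rfl⟩ := Nat.exists_eq_add_of_le' hf
    rw [loop, show k + (fuel + 1) = k + fuel + 1 by ring, loop]
    split_ifs
    · exact (h _).bind fun s' => ih (by omega) s'
    · exact .refl _

theorem Program.dominated_exec {I : Tapes} {m fuel fuel' : ℕ} (hf : fuel ≤ fuel') (P : Program)
    (s : State) : Dominated (P.exec I m fuel s) (P.exec I m fuel' s) := by
  induction P generalizing s with
  | instr i => exact .refl _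
  | seq P Q ihP ihQ => exact (ihP s).bind ihQ
  | ite r P Q ihP ihQ =>
    rw [Program.exec, Program.exec]
    split_ifs
    · exact ihP _
    · exact ihQ _
  | _ r P ih => exact dominated_loop ih hf s

theorem Program.dominated_run {fuel fuel' : ℕ} (hf : fuel ≤ fuel') (P : Program) (I : Tapes) :
    Dominated (P.run fuel I) (P.run fuel' I) :=
  (P.dominated_exec hf _).map _

theorem ParAlg.dominated_run {fuel fuel' : ℕ} (hf : fuel ≤ fuel') (A : ParAlg) (I : Tapes) :
    Dominated (A.run fuel I) (A.run fuel' I) := by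
  induction A generalizing I with
  | prog P => exact P.dominated_run hf I
  | reduce pre A post ih =>
    exact (pre.dominated_run hf I).bind fun a => (ih _).bind fun b =>
      (post.dominated_run hf _).map _

/-- If `μ` puts all its mass on halting runs, nothing is left for `ν` to exceed it with. Thus more
fuel does not change a run that surely halts. -/
theorem Dominated.eq {α : Type} {μ ν : PMF (Option α)} (h : Dominated μ ν) (h0 : μ none = 0) :
    μ = ν := by
  have hle : ∀ o, μ o ≤ ν o := fun o => by
    cases o with
    | none => rw [h0]; exact zero_le
    | some c => exact h c
  refine PMF.ext fun o => le_antisymm (hle o) (not_lt.1 fun hlt => ?_)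
  have := ENNReal.tsum_lt_tsum (by rw [μ.tsum_coe]; exact ENNReal.one_ne_top) hle hlt
  rw [μ.tsum_coe, ν.tsum_coe] at this
  exact lt_irrefl _ this

theorem ParAlg.RunsIn.of_le {A : ParAlg} {I : Tapes} {t s w : ℕ} {post : List ℕ → Prop}
    (h : A.RunsIn I t s w post) : ∃ fuel, ∀ fuel' ≥ fuel, ∀ o ∈ (A.run fuel' I).support,
    ∃ c, o = some c ∧ c.time ≤ t ∧ c.space ≤ s ∧ c.work ≤ w ∧ post c.out := by
  obtain ⟨fuel, h⟩ := h
  refine ⟨fuel, fun fuel' hf => ?_⟩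
  have h0 : A.run fuel I none = 0 := by
    by_contra h0
    obtain ⟨c, hc, -⟩ := h none (by rwa [PMF.mem_support_iff])
    cases hc
  rw [← (A.dominated_run hf I).eq h0]
  exact h

/-! ### The compiled code against adversaries -/

/-- The queries of the original decoder are answered by decoding symbols. -/
noncomputable def answer (d : ℕ) {q : ℕ} (K : ℕ) (hq : 0 < q) (l : List ℕ) (j : ℕ) :
    QueryTree (Fin 2) (Option (Fin q)) :=
  (local_getElem_decoded d K hq l j).choose

theorem answer_spec (d : ℕ) {q : ℕ} (K : ℕ) (hq : 0 < q) (l : List ℕ) (j : ℕ) (w : List (Fin 2)) :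
    (answer d K hq l j).eval w = (decoded d K hq (bitsOf w) l)[j]? ∧
      (answer d K hq l j).cost w ≤ queryCount d q K :=
  (local_getElem_decoded d K hq l j).choose_spec w

/-- The compiled code. -/
noncomputable def Code.compile (d : ℕ) {K k q₁ q₂ : ℕ} (hq : 0 < q₂) (C : Code K k q₁ q₂) :
    Code (codeLen d q₂ K) k q₁ 2 where
  enc x := (C.enc x).map (compiled d)
  dec i _ := (coins (coinCount d q₂ K)).bind fun l =>
    (C.dec i K).map (QueryTree.subst (answer d K hq l))

section
variable {d K k q₁ q₂ : ℕ} {hq : 0 < q₂} {C : Code K k q₁ q₂}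

theorem length_decoded (V : ℕ → Bool) (l : List ℕ) : (decoded d K hq V l).length = K := by
  simp [decoded]

/-- For fixed coins the new decoder on `w` behaves as the old decoder on the decoded word; the rest
is averaging over the coins. -/
theorem Code.decProb_compile (i : Fin k) (w : List (Fin 2)) (b : Fin q₁) :
    (C.compile d hq).decProb i w b = (mean (coins (coinCount d q₂ K)) fun l =>
      (C.dec i (decoded d K hq (bitsOf w) l).length).toOuterMeasure
        {t | t.eval (decoded d K hq (bitsOf w) l) = b}).toReal := by
  rw [Code.decProb, prob, Code.compile, PMF.toOuterMeasure_bind_apply]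
  congr 1
  refine tsum_congr fun l => ?_
  simp only [length_decoded]
  congr 1
  rw [PMF.toOuterMeasure_map_apply]
  congr 1
  ext t
  simp only [Set.mem_preimage, Set.mem_ofPred_eq]
  rw [QueryTree.eval_subst fun j => (answer_spec d K hq l j w).1]

theorem Code.cost_compile {ℓ : ℕ}
    (hC : ∀ (i : Fin k) (w : List (Fin q₂)), ∀ t ∈ (C.dec i w.length).support, t.cost w ≤ ℓ)
    (i : Fin k) (w : List (Fin 2)) (t : QueryTree (Fin 2) (Fin q₁))
    (ht : t ∈ ((C.compile d hq).dec i w.length).support) : t.cost w ≤ queryCount d q₂ K * ℓ := by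
  simp only [Code.compile, PMF.mem_support_bind_iff, PMF.mem_support_map_iff] at ht
  obtain ⟨l, -, t', h1, rfl⟩ := ht
  refine (QueryTree.cost_subst (fun j => (answer_spec d K hq l j w).1)
    (fun j => (answer_spec d K hq l j w).2) t').trans (Nat.mul_le_mul_left _ ?_)
  refine hC i _ t' ?_
  rwa [length_decoded]

theorem PMF_toOuterMeasure_le_one {α : Type} (μ : PMF α) (E : Set α) : μ.toOuterMeasure E ≤ 1 := by
  have := (μ.toOuterMeasure.mono (Set.subset_univ E)).trans (le_of_eq
    ((PMF.toOuterMeasure_apply_eq_one_iff _ _).2 (Set.subset_univ _)))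
  exact this

/-- Decoding with the coins of the compiled code fools the original code. -/
theorem Code.Fool.decoded (hK : 1 ≤ K) (hq' : q₂ ≤ (K + 1) ^ d) {ρ p pf : ℝ} (hρ : 0 < ρ)
    (hp : 0 < p) {x : Fin k → Fin q₁} {y : Fin K → Fin q₂} {w : List (Fin 2)}
    (h : (C.compile d hq).Fool editDist (ρ / rateLoss d) pf x (compiled d y) w) :
    ENNReal.ofReal (1 - pf / p - failure (codeLen d q₂ K)) ≤
      (coins (coinCount d q₂ K)).toOuterMeasure
        {l | C.Fool hamDist ρ p x y (InsDelLDC.decoded d K hq (bitsOf w) l)} := by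
  obtain ⟨h1, i, h2⟩ := h
  rw [Code.decProb_compile] at h2
  set μ := coins (coinCount d q₂ K)
  set G : List ℕ → ℝ≥0∞ := fun l =>
      (C.dec i (InsDelLDC.decoded d K hq (bitsOf w) l).length).toOuterMeasure
        {t | t.eval (InsDelLDC.decoded d K hq (bitsOf w) l) = x i} with hG
  have hG1 : ∀ l, G l ≤ 1 := fun l => PMF_toOuterMeasure_le_one _ _
  have hmean : mean μ G ≤ ENNReal.ofReal pf := by
    have h3 : mean μ G ≠ ⊤ := by
      have : mean μ G ≤ 1 := by
        calc mean μ G ≤ mean μ fun _ => 1 := mean_mono _ fun l _ => hG1 l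
          _ = 1 := by simp [mean, μ.tsum_coe]
      exact ne_top_of_le_ne_top ENNReal.one_ne_top this
    rw [← ENNReal.ofReal_toReal h3]
    exact ENNReal.ofReal_le_ofReal h2.le
  -- Markov's inequality for the success probability `G` of the old decoder, as a function of the
  -- coins.
  have hmark : ENNReal.ofReal p * μ.toOuterMeasure {l | ENNReal.ofReal p ≤ G l} ≤ ENNReal.ofReal pf := by
    refine le_trans ?_ hmean
    rw [← mean_indicator, ← mean_mul_left]
    refine mean_mono _ fun l _ => ?_
    by_cases hl : ENNReal.ofReal p ≤ G l
    · simp [hl]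
    · simp [hl]
  have hmark' : μ.toOuterMeasure {l | ENNReal.ofReal p ≤ G l} ≤ ENNReal.ofReal (pf / p) := by
    rw [ENNReal.ofReal_div_of_pos hp, ENNReal.le_div_iff_mul_le (by simp [hp]) (by simp), mul_comm]
    exact hmark
  have hbad := measure_bad_coins_le hK hq hq' y w hρ h1
  -- Coins under which the decoded word is close to `y` and the old decoder succeeds at `i` with
  -- probability below `p` make the decoded word fool it. All other coins are in one of two events
  -- of small probability.
  have hcover : (1 : ℝ≥0∞) ≤ μ.toOuterMeasure
      {l | C.Fool hamDist ρ p x y (InsDelLDC.decoded d K hq (bitsOf w) l)} +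
      (μ.toOuterMeasure {l | ENNReal.ofReal p ≤ G l} + μ.toOuterMeasure {l |
      ¬ hamDist (List.ofFn y) (InsDelLDC.decoded d K hq (bitsOf w) l) ≤ ENNReal.ofReal ρ}) := by
    have h4 : μ.toOuterMeasure Set.univ = 1 :=
      (PMF.toOuterMeasure_apply_eq_one_iff _ _).2 (Set.subset_univ _)
    rw [← h4]
    refine le_trans (μ.toOuterMeasure.mono fun l _ => ?_) ((MeasureTheory.measure_union_le _ _).trans
      (add_le_add_right (MeasureTheory.measure_union_le _ _) _))
    by_cases h5 : ENNReal.ofReal p ≤ G l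
    · exact Or.inr (Or.inl h5)
    by_cases h6 : hamDist (List.ofFn y) (InsDelLDC.decoded d K hq (bitsOf w) l) ≤ ENNReal.ofReal ρ
    · refine Or.inl ⟨h6, i, ?_⟩
      rw [not_le] at h5
      rw [Code.decProb, prob, ← ENNReal.toReal_ofReal hp.le]
      exact (ENNReal.toReal_lt_toReal (ne_top_of_le_ne_top ENNReal.one_ne_top (hG1 l))
        ENNReal.ofReal_ne_top).2 h5
    · exact Or.inr (Or.inr h6)
  -- A fooled decoder has a success probability below `pf`, so `pf` cannot be negative here.
  have hpf : 0 ≤ pf := ENNReal.toReal_nonneg.trans h2.le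
  have hf : 0 ≤ failure (codeLen d q₂ K) := negligible_failure.1 _
  have h7 := hcover.trans (add_le_add_right (add_le_add hmark' hbad) _)
  rw [← ENNReal.ofReal_add (by positivity) hf] at h7
  have h8 : (1 : ℝ≥0∞) = ENNReal.ofReal 1 := by simp
  rw [show 1 - pf / p - failure (codeLen d q₂ K) = 1 - (pf / p + failure (codeLen d q₂ K)) by ring,
    ENNReal.ofReal_sub _ (by positivity), ENNReal.ofReal_one]
  exact tsub_le_iff_right.2 h7

end

/-- The programs compute the compiled word and decode a binary word with shared coins. -/
structure Implements (d q K : ℕ) (hq : 0 < q) (compile recover : Program) : Prop where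
  compile : ∃ t, ∀ y : Fin K → Fin q, ∃ c : Outcome, c.out = tape (List.ofFn (compiled d y)) ∧
    ∀ fuel ≥ t, compile.run fuel [[q], tape (List.ofFn y)] = PMF.pure (some c)
  recover : ∃ t, ∀ (y : Fin K → Fin q) (w : List (Fin 2)), ∃ c : List ℕ → Outcome,
    (∀ l ∈ (coins (coinCount d q K)).support, (c l).out = tape (decoded d K hq (bitsOf w) l)) ∧
    ∀ fuel ≥ t, recover.run fuel [[q], tape (List.ofFn y), tape w]
      = (coins (coinCount d q K)).map fun l => some (c l)

section
variable {d K k q₁ q₂ : ℕ} {hq : 0 < q₂} {C : Code K k q₁ q₂}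

/-- An adversary against the compiled code is turned into one against the original code. -/
theorem Implements.attack_le {compile recover : Program} (hP : Implements d q₂ K hq compile recover)
    (hK : 1 ≤ K) (hq' : q₂ ≤ (K + 1) ^ d) {ρ p pf : ℝ} (hρ : 0 < ρ) (hp : 0 < p) (A : ParAlg)
    (x : Fin k → Fin q₁) (fuel : ℕ) : ∃ fuel',
    ENNReal.ofReal (1 - pf / p - failure (codeLen d q₂ K)) *
      ((C.compile d hq).attack A fuel x).toOuterMeasure {a | ∃ c w, a.2 = some c ∧ tape w = c.out ∧
        (C.compile d hq).Fool editDist (ρ / rateLoss d) pf x a.1 w} ≤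
      (C.attack (.reduce compile A recover) fuel' x).toOuterMeasure
        {a | ∃ c w, a.2 = some c ∧ tape w = c.out ∧ C.Fool hamDist ρ p x a.1 w} := by
  obtain ⟨t₁, h1⟩ := hP.compile
  obtain ⟨t₂, h2⟩ := hP.recover
  -- Enough fuel for `compile` and `recover` to halt surely; for the adversary more fuel only raises
  -- the probability of each finished outcome.
  refine ⟨max fuel (max t₁ t₂), ?_⟩
  rw [Code.attack, Code.attack, PMF.toOuterMeasure_bind_apply, PMF.toOuterMeasure_bind_apply]
  have e : (C.compile d hq).enc x = (C.enc x).map (compiled d) := rfl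
  rw [e]
  change _ * mean _ _ ≤ _
  rw [mean_map, ← mean_mul_left]
  refine mean_mono _ fun y _ => ?_
  rw [PMF.toOuterMeasure_map_apply, PMF.toOuterMeasure_map_apply]
  obtain ⟨c, hc, hc'⟩ := h1 y
  rw [ParAlg.run, hc' _ (by omega), PMF.pure_bind]
  simp only [Option.elim_some]
  rw [hc, PMF.toOuterMeasure_bind_apply, PMF.toOuterMeasure_apply, ← ENNReal.tsum_mul_left]
  refine ENNReal.tsum_le_tsum fun o => ?_
  by_cases ho : ∃ c w, o = some c ∧ tape w = c.out ∧
      (C.compile d hq).Fool editDist (ρ / rateLoss d) pf x (compiled d y) w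
  · obtain ⟨b, w, rfl, hw, hF⟩ := ho
    rw [Set.indicator_of_mem (by exact ⟨b, w, rfl, hw, hF⟩), mul_comm]
    refine mul_le_mul' (A.dominated_run (le_max_left _ _) _ b) ?_
    have hb : b.out.map (· % 2) = tape w := by
      rw [← hw, tape, List.map_map]
      exact List.map_congr_left fun v _ => Nat.mod_eq_of_lt v.2
    obtain ⟨g, hg, hg'⟩ := h2 y w
    simp only [Option.elim_some, hb]
    have := hg' (max fuel (max t₁ t₂)) (by omega)
    change recover.run _ ([[q₂], tape (List.ofFn y)] ++ [tape w]) = _ at this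
    rw [this, PMF.map_comp, PMF.toOuterMeasure_map_apply]
    -- Once the adversary has answered with `w`, `recover` tosses fresh coins with the distribution
    -- that the new decoder uses.
    refine (hF.decoded hK hq' hρ hp).trans (PMF.toOuterMeasure_mono _ ?_)
    rintro l ⟨hl, hs⟩
    exact ⟨_, _, rfl, (hg l hs).symm, hl⟩
  · rw [Set.indicator_of_notMem (by exact ho), mul_zero]
    exact zero_le

/-- The compiled code is locally decodable. -/
theorem Implements.isLDC {compile recover : Program} (hP : Implements d q₂ K hq compile recover)
    (hK : 1 ≤ K) (hq' : q₂ ≤ (K + 1) ^ d) {ρ p pf ε : ℝ} (hρ : 0 < ρ) (hp : 0 < p) {ℓ ℓ' : ℕ}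
    {𝒞 𝒞' : Set ParAlg} (h𝒞 : ∀ A ∈ 𝒞, ParAlg.reduce compile A recover ∈ 𝒞')
    (hℓ : queryCount d q₂ K * ℓ ≤ ℓ') (h : C.IsLDC ℓ ρ p ε hamDist 𝒞')
    (hδ : 0 < 1 - pf / p - failure (codeLen d q₂ K)) :
    (C.compile d hq).IsLDC ℓ' (ρ / rateLoss d) pf
      (ε / (1 - pf / p - failure (codeLen d q₂ K))) editDist 𝒞 := by
  refine ⟨fun i w t ht => (Code.cost_compile h.1 i w t ht).trans hℓ, fun A hA x fuel => ?_⟩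
  obtain ⟨fuel', h1⟩ := hP.attack_le (C := C) hK hq' (pf := pf) hρ hp A x fuel
  have h2 := h.2 _ (h𝒞 A hA) x fuel'
  rw [le_div_iff₀ hδ, mul_comm]
  refine le_trans ?_ h2
  have h3 := ENNReal.toReal_mono
    (ne_top_of_le_ne_top ENNReal.one_ne_top (PMF_toOuterMeasure_le_one _ _)) h1
  rwa [ENNReal.toReal_mul, ENNReal.toReal_ofReal hδ.le] at h3

end

/-! ### Programs made of stages -/

/-- No registers are in use. -/
def emptyRegs : Regs := fun _ => []

/-- The bounds on the costs of a run within time `t`. -/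
structure Outcome.Within (c : Outcome) (m Λ V t : ℕ) : Prop where
  time : c.time ≤ t
  work : c.work ≤ t * (4 * Λ + 1)
  space : c.space ≤ m * (Λ * (Nat.size (V * 2 ^ t) + 1))

/-- The outcome that belongs to a state. -/
def State.outcome (s : State) : Outcome := ⟨s.out, s.time, s.work, s.space⟩

theorem Bounded.within {m Λ V t : ℕ} {s : State} (h : Bounded m Λ V s) (ht : s.time ≤ t) :
    s.outcome.Within m Λ V t := by
  refine ⟨ht, h.work.trans (Nat.mul_le_mul_right _ ht), h.space.trans ?_⟩
  have : Nat.size (V * 2 ^ s.time) ≤ Nat.size (V * 2 ^ t) :=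
    Nat.size_le_size (Nat.mul_le_mul_left _ (Nat.pow_le_pow_right (by norm_num) ht))
  gcongr

theorem Bounded.init (m Λ V : ℕ) : Bounded m Λ V State.init := by
  refine ⟨fun r => by simp [State.init], fun r v hv => by simp [State.init] at hv,
    by simp [State.init], by simp [State.init]⟩

theorem PMF_bind_congr {α β : Type} (μ : PMF α) {f g : α → PMF β} (h : ∀ a ∈ μ.support, f a = g a) :
    μ.bind f = μ.bind g := by
  refine PMF.ext fun b => ?_
  rw [PMF.bind_apply, PMF.bind_apply]
  refine tsum_congr fun a => ?_
  by_cases ha : a ∈ μ.support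
  · rw [h a ha]
  · rw [(PMF.apply_eq_zero_iff μ a).2 ha, zero_mul, zero_mul]

section
variable {I : Tapes} {Λ V X : ℕ}

theorem Leads.emit {m : ℕ} (hI : TapesFit I Λ V) {P : Program} {s : State} {t a : ℕ}
    (ha : a < 90) {A : Regs} (h : Leads I m Λ V P s t (Arrays A)) (hs : s.out = []) :
    ∃ s', Runs I m Λ V (.seq P (.instr (.emit a))) s s' (t + 1) ∧ s'.out = A a := by
  obtain ⟨s', h1, h2, h3⟩ := h
  refine ⟨_, h1.seq (Runs.instr hI (by trivial)), ?_⟩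
  simp [Instr.after, Instr.target, h2, hs, Instr.val, h3 a ha]

theorem Cmd.leads_code (hI : TapesFit I Λ V) (C : Cmd) {A : Regs} (hC : C.ok 10 = true)
    (hV : C.maxLit I ≤ V) (hS : C.Safe I Λ X A) (m : ℕ) (s : State) (hA : Arrays A s.regs) :
    Leads I m Λ V (C.code 90) s (C.cost X) (Arrays (C.run I A)) :=
  (C.leads hI 10 90 le_rfl le_rfl hC hV hS s hA).mono le_rfl fun _ h => h.1

/-- A deterministic program. -/
def detProgram (C : Cmd) (a : ℕ) : Program := .seq (C.code 90) (.instr (.emit a))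

theorem detProgram_run (hI : TapesFit I Λ V) (C : Cmd) (a : ℕ) (ha : a < 90)
    (hC : C.ok 10 = true) (hV : C.maxLit I ≤ V) (hS : C.Safe I Λ X emptyRegs) :
    ∃ c : Outcome, c.out = C.run I emptyRegs a ∧
      c.Within (detProgram C a).width Λ V (C.cost X + 1) ∧
      ∀ fuel > C.cost X + 1, (detProgram C a).run fuel I = PMF.pure (some c) := by
  obtain ⟨s, h1, h2⟩ := (C.leads_code hI hC hV hS (detProgram C a).width State.init
    fun _ _ => rfl).emit hI ha rfl
  refine ⟨s.outcome, h2, (h1.bdd (Bounded.init _ _ _)).within (by simpa [State.init] using h1.time),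
    fun fuel hf => ?_⟩
  rw [Program.run, show (detProgram C a).exec I (detProgram C a).width fuel State.init
    = PMF.pure (some s) from h1.exec fuel hf, PMF.pure_map]
  rfl

/-- A program that tosses coins once. -/
def coinProgram (C D : Cmd) (z r a : ℕ) : Program :=
  .seq (C.code 90) (.seq (.instr (.flip r z)) (detProgram D a))

/-- Coins are tossed by a single instruction. Before and after it the program is deterministic, so
the run is the image of the coin distribution under a function, with one fuel bound for all coins.
-/
theorem coinProgram_run (hI : TapesFit I Λ V) (C D : Cmd) (z r a : ℕ) (hz : z < 90) (ha : a < 90)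
    (hC : C.ok 10 = true) (hCV : C.maxLit I ≤ V) (hCS : C.Safe I Λ X emptyRegs)
    (hD : D.ok 10 = true) (hDV : D.maxLit I ≤ V)
    (hDS : ∀ l, D.Safe I Λ X (Function.update (C.run I emptyRegs) r l)) {N : ℕ}
    (hN : (C.run I emptyRegs z).length = N) :
    ∃ c : List ℕ → Outcome, (∀ l ∈ (coins N).support,
      (c l).out = D.run I (Function.update (C.run I emptyRegs) r l) a ∧
      (c l).Within (coinProgram C D z r a).width Λ V (C.cost X + D.cost X + 2)) ∧
      ∀ fuel > C.cost X + D.cost X + 2,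
        (coinProgram C D z r a).run fuel I = (coins N).map fun l => some (c l) := by
  set m := (coinProgram C D z r a).width with hm
  obtain ⟨s, h1, h2, h3⟩ := C.leads_code hI hC hCV hCS m State.init fun _ _ => rfl
  have hb := h1.bdd (Bounded.init _ _ _)
  have hz' : s.regs z = C.run I emptyRegs z := h3 z hz
  have hflip : ∀ l : List ℕ, l ∈ (coins N).support →
      Bounded m Λ V (Instr.after m (.flip r z) l s) := by
    intro l hl
    refine hb.after ?_ fun x hx => ?_
    · rw [length_of_mem_coins hl, ← hN, ← hz']
      exact hb.len z
    · have h4 := le_one_of_mem_coins hl x hx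
      have h5 : 1 ≤ V := hI.pos.trans hI.le
      have h6 : 1 ≤ 2 ^ (s.time + 1) := Nat.one_le_two_pow
      exact h4.trans (Nat.mul_le_mul h5 h6)
  have hrun : ∀ l : List ℕ, ∃ s', Runs I m Λ V (detProgram D a) (Instr.after m (.flip r z) l s) s'
      (D.cost X + 1) ∧ s'.out = D.run I (Function.update (C.run I emptyRegs) r l) a := by
    intro l
    refine (D.leads_code hI hD hDV (hDS l) m (Instr.after m (.flip r z) l s) fun b hb => ?_).emit
      hI ha h2
    by_cases hbr : b = r
    · subst hbr; simp [Instr.after, Instr.target]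
    · simp [Instr.after, Instr.target, Function.update_of_ne hbr, h3 b hb]
  choose s' h4 h5 using hrun
  have ht := h1.time
  refine ⟨fun l => (s' l).outcome, fun l hl => ⟨h5 l, ((h4 l).bdd (hflip l hl)).within ?_⟩,
    fun fuel hf => ?_⟩
  · refine (h4 l).time.trans ?_
    simp only [Instr.after, State.init] at ht ⊢
    omega
  · have e1 : (coinProgram C D z r a).exec I m fuel State.init
        = (coins N).map fun l => some (s' l) := by
      rw [coinProgram, Program.exec, h1.exec fuel (by omega), PMF.pure_bind, Option.elim_some,
        Program.exec, Program.exec, Instr.exec_eq_map, PMF.map_comp, PMF.bind_map,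
        Instr.result, hz', hN, ← PMF.bind_pure_comp]
      exact PMF_bind_congr _ fun l _ => (h4 l).exec fuel (by omega)
    rw [Program.run, ← hm, e1, PMF.map_comp]
    rfl

end

/-! ### Arithmetic on lanes -/

/-- The lowest bit. -/
def Ex.bit (e : Ex) : Ex := .sub e (.add (.half e) (.half e))

@[simp] theorem Ex.eval_bit (I : Tapes) (A : Regs) (ρ : ℕ → ℕ) (e : Ex) :
    (Ex.bit e).eval I A ρ = e.eval I A ρ % 2 := by
  simp only [Ex.bit, Ex.eval]; omega

attribute [simp] Ex.eval

namespace LP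

/-- One program after the other. -/
infixr:30 " ;; " => LP.seq

/-- Shift to the left by the first entry of array `c`. -/
def shl (x c : ℕ) : LP := loop c (assign x (.add (.var x) (.var x)))

/-- Shift to the right. -/
def shr (x c : ℕ) : LP := loop c (assign x (.half (.var x)))

/-- Remainder modulo a power of two. -/
def rem (y x c : ℕ) : LP :=
  assign y (.var x) ;; shr y c ;; shl y c ;; assign y (.sub (.var x) (.var y))

/-- Quotient by a power of two. -/
def quot (y x c : ℕ) : LP := assign y (.var x) ;; shr y c

section
variable (I : Tapes) (A : Regs) (ρ : ℕ → ℕ)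

@[simp] theorem run_assign (x : ℕ) (e : Ex) :
    (assign x e).run I A ρ = Function.update ρ x (e.eval I A ρ) := rfl

@[simp] theorem run_seq (P Q : LP) : (P ;; Q).run I A ρ = Q.run I A (P.run I A ρ) := rfl

@[simp] theorem run_shl (x c : ℕ) :
    (shl x c).run I A ρ = Function.update ρ x (ρ x * 2 ^ hd A c) := by
  refine loop_induct (M := fun k ρ' => ρ' = Function.update ρ x (ρ x * 2 ^ k)) (by simp) ?_
  rintro k - ρ' rfl
  simp only [run_assign, Ex.eval, Function.update_self, Function.update_idem]
  congr 1; ring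

@[simp] theorem run_shr (x c : ℕ) :
    (shr x c).run I A ρ = Function.update ρ x (ρ x / 2 ^ hd A c) := by
  refine loop_induct (M := fun k ρ' => ρ' = Function.update ρ x (ρ x / 2 ^ k)) (by simp) ?_
  rintro k - ρ' rfl
  simp only [run_assign, Ex.eval, Function.update_self, Function.update_idem]
  rw [Nat.div_div_eq_div_mul, pow_succ]

@[simp] theorem run_quot (y x c : ℕ) :
    (quot y x c).run I A ρ = Function.update ρ y (ρ x / 2 ^ hd A c) := by
  simp [quot]

theorem run_rem {y x : ℕ} (h : x ≠ y) (c : ℕ) :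
    (rem y x c).run I A ρ = Function.update ρ y (ρ x % 2 ^ hd A c) := by
  simp only [rem, run_seq, run_assign, run_shr, run_shl, Ex.eval, Function.update_self,
    Function.update_idem, Function.update_of_ne h]
  congr 1
  have := Nat.div_add_mod' (ρ x) (2 ^ hd A c)
  omega

end

end LP

/-! ### Words as numbers -/

/-- A word as a number, lowest bit first. -/
def enc : List Bool → ℕ
  | [] => 0
  | b :: l => b.toNat + 2 * enc l

/-- The word of `k` bits of a number. -/
def dec : ℕ → ℕ → List Bool
  | 0, _ => []
  | k + 1, z => decide (z % 2 = 1) :: dec k (z / 2)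

@[simp] theorem length_dec (k z : ℕ) : (dec k z).length = k := by
  induction k generalizing z with
  | zero => rfl
  | succ k ih => simp [dec, ih]

theorem enc_lt (l : List Bool) : enc l < 2 ^ l.length := by
  induction l with
  | nil => simp [enc]
  | cons b l ih => cases b <;> simp [enc, pow_succ] <;> omega

theorem dec_enc (l : List Bool) : dec l.length (enc l) = l := by
  induction l with
  | nil => rfl
  | cons b l ih =>
    cases b
    · simp [enc, dec, ih]
    · simp only [enc, dec, List.length_cons, Bool.toNat_true]
      rw [show (1 + 2 * enc l) / 2 = enc l by omega, ih]
      simp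

theorem enc_dec {k z : ℕ} (h : z < 2 ^ k) : enc (dec k z) = z := by
  induction k generalizing z with
  | zero => simp at h; simp [dec, enc, h]
  | succ k ih =>
    rw [dec, enc, ih (by rw [pow_succ] at h; omega)]
    rcases Nat.mod_two_eq_zero_or_one z with h1 | h1 <;> simp [h1] <;> omega

theorem enc_eq_iff {l : List Bool} {k z : ℕ} (hl : l.length = k) (hz : z < 2 ^ k) :
    enc l = z ↔ l = dec k z :=
  ⟨fun h => by rw [← h, ← hl, dec_enc], fun h => by rw [h, enc_dec hz]⟩

theorem enc_append (u v : List Bool) : enc (u ++ v) = enc u + 2 ^ u.length * enc v := by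
  induction u with
  | nil => simp [enc]
  | cons b u ih => simp only [List.cons_append, enc, ih, List.length_cons, pow_succ]; ring

theorem enc_getD (l : List Bool) (k : ℕ) : enc l / 2 ^ k % 2 = (l.getD k false).toNat := by
  induction l generalizing k with
  | nil => simp [enc]
  | cons b l ih =>
    cases k with
    | zero => cases b <;> simp [enc]
    | succ k =>
      rw [List.getD_cons_succ, ← ih, enc, pow_succ', ← Nat.div_div_eq_div_mul]
      congr 2
      cases b <;> simp; omega

/-- The lowest bit comes first: the `t` lower bits stay, the new bit has weight `2 ^ t`, and the
remaining bits move up by one, that is, they are doubled. -/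
theorem insertIdx_dec {k t : ℕ} (z : ℕ) (b : Bool) (ht : t ≤ k) :
    (dec k z).insertIdx t b
      = dec (k + 1) (z % 2 ^ t + b.toNat * 2 ^ t + 2 * (z - z % 2 ^ t)) := by
  induction t generalizing k z with
  | zero =>
    rw [List.insertIdx_zero, dec]
    cases b
    · simp [Nat.mod_one]
    · simp only [pow_zero, Nat.mod_one, Bool.toNat_true]
      rw [show (0 + 1 * 1 + 2 * (z - 0)) / 2 = z by omega,
        show (0 + 1 * 1 + 2 * (z - 0)) % 2 = 1 by omega]
      simp
  | succ t ih =>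
    cases k with
    | zero => omega
    | succ k =>
      rw [dec, List.insertIdx_succ_cons, ih _ (by omega)]
      have e1 : z % 2 ^ (t + 1) = z % 2 + 2 * (z / 2 % 2 ^ t) := by rw [pow_succ', Nat.mod_mul]
      have e2 := Nat.mod_le (z / 2) (2 ^ t)
      have e3 : b.toNat * 2 ^ (t + 1) = 2 * (b.toNat * 2 ^ t) := by ring
      conv_rhs => rw [dec]
      congr 1
      · rw [e1, e3]
        congr 2
        omega
      · congr 1
        rw [e1, e3]
        omega

/-- The `t` lower bits stay, bit `t` is dropped, and the higher bits are halved. -/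
theorem eraseIdx_dec {k t : ℕ} (z : ℕ) (ht : t ≤ k) :
    (dec (k + 1) z).eraseIdx t = dec k (z % 2 ^ t + (z - z % 2 ^ (t + 1)) / 2) := by
  induction t generalizing k z with
  | zero =>
    rw [dec, List.eraseIdx_cons_zero]
    congr 1
    simp only [pow_zero, Nat.mod_one, zero_add, pow_one]
    omega
  | succ t ih =>
    cases k with
    | zero => omega
    | succ k =>
      rw [dec, List.eraseIdx_cons_succ, ih _ (by omega)]
      have e1 : z % 2 ^ (t + 1) = z % 2 + 2 * (z / 2 % 2 ^ t) := by rw [pow_succ', Nat.mod_mul]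
      have e1' : z % 2 ^ (t + 1 + 1) = z % 2 + 2 * (z / 2 % 2 ^ (t + 1)) := by
        rw [pow_succ' 2 (t + 1), Nat.mod_mul]
      have e2 := Nat.mod_le (z / 2) (2 ^ (t + 1))
      have e3 : 2 ∣ z / 2 - z / 2 % 2 ^ (t + 1) := by
        refine dvd_trans ?_ (Nat.dvd_sub_mod (n := 2 ^ (t + 1)) (z / 2))
        exact Dvd.intro_left (2 ^ t) rfl
      conv_rhs => rw [dec]
      congr 1
      · rw [e1, e1']
        congr 2
        omega
      · congr 1
        rw [e1, e1']
        omega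

/-! ### Concurrent writes -/

/-- The last write to a cell wins. If the values written to the same cell increase with the number
of the writer, the last one is the maximum, so concurrent writes compute maxima. -/
theorem getD_foldl_set (N : ℕ) (i v : ℕ → ℕ) (a : List ℕ) (p : ℕ) (hp : p < a.length)
    (hv : ∀ j j', j ≤ j' → i j = i j' → v j ≤ v j') (ha : a.getD p 0 = 0) :
    ((((List.range N).map i).zip ((List.range N).map v)).foldl (fun l jx => l.set jx.1 jx.2)
      a).getD p 0 = ((Finset.range N).filter fun j => i j = p).sup v := by
  induction N with
  | zero => simpa using ha
  | succ N ih =>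
    rw [List.range_succ, List.map_append, List.map_append, List.zip_append (by simp),
      List.foldl_append]
    simp only [List.map_cons, List.map_nil, List.zip_cons_cons, List.zip_nil_left, List.foldl_cons,
      List.foldl_nil]
    have hl : p < ((((List.range N).map i).zip ((List.range N).map v)).foldl
        (fun l jx => l.set jx.1 jx.2) a).length := by rwa [foldl_set_length]
    rw [Finset.range_add_one, Finset.filter_insert]
    split_ifs with h
    · rw [Finset.sup_insert, h]
      rw [List.getD_eq_getElem _ _ (by simpa using hl), List.getElem_set_self]
      refine (sup_eq_left.2 (Finset.sup_le fun j hj => ?_)).symm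
      simp only [Finset.mem_filter, Finset.mem_range] at hj
      exact hv j N hj.1.le (by rw [hj.2, h])
    · rw [← ih, List.getD_eq_getElem _ _ (by simpa using hl), List.getElem_set_ne h,
        List.getD_eq_getElem _ _ hl]

@[simp] theorem getD_map_range (f : ℕ → ℕ) {N l : ℕ} (h : l < N) :
    ((List.range N).map f).getD l 0 = f l := by
  rw [List.getD_eq_getElem _ _ (by simpa using h)]; simp

theorem getD_map_range' (f : ℕ → ℕ) {N l : ℕ} (h : N ≤ l) : ((List.range N).map f).getD l 0 = 0 := by
  rw [List.getD_eq_default _ _ (by simpa using h)]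

/-! ### Computation of the parameters -/

/-- The contents of the registers that control loops (below `40`) and give the sizes of stages, and
the size of the alphabet in register `60`. -/
noncomputable def param (d q K : ℕ) : ℕ → ℕ
  | 0 => indexBits K
  | 1 => Nat.size (q - 1)
  | 2 => symExp q
  | 3 => d
  | 4 => payExp d K
  | 5 => groupExp d q K
  | 6 => pieceExp d
  | 7 => 18 + pieceExp d
  | 8 => Nat.size (indexBits K / 2 ^ (18 + pieceExp d))
  | 9 => msgExp d K
  | 10 => blockExp d K
  | 11 => 2 ^ msgExp d K
  | 12 => hashBits (2 ^ msgExp d K)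
  | 13 => wordLen (2 ^ msgExp d K)
  | 14 => 64 * 2 ^ msgExp d K
  | 15 => 2 ^ pieceExp d
  | 16 => 2 ^ msgExp d K - pieceExp d
  | 17 => markLen (pieceExp d) (2 ^ msgExp d K)
  | 18 => 2 ^ groupExp d q K
  | 19 => 2 ^ symExp q
  | 20 => hashBits (2 ^ msgExp d K) + 2 ^ msgExp d K
  | 21 => logLen d q K
  | 22 => logLen d q K - blockExp d K
  | 23 => sampleCount (pieceExp d) (Nat.log 2 (codeLen d q K))
  | 24 => 2 * (hashBits (2 ^ msgExp d K) + 2 ^ msgExp d K)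
  | 25 => 2 ^ blockExp d K / 2 + 1
  | 26 => 14 + msgExp d K
  | 40 => K
  | 41 => 1
  | 42 => blockCount d q K
  | 43 => codeLen d q K
  | 44 => 8 * codeLen d q K
  | 45 => 2 ^ (2 * (hashBits (2 ^ msgExp d K) + 2 ^ msgExp d K))
  | 46 => 2 ^ (2 * (hashBits (2 ^ msgExp d K) + 2 ^ msgExp d K)) * 2 ^ 2 ^ msgExp d K
  | 47 => 2 ^ (2 * (hashBits (2 ^ msgExp d K) + 2 ^ msgExp d K)) * 2 ^ wordLen (2 ^ msgExp d K)
  | 48 => coinCount d q K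
  | 60 => q
  | _ => 0

namespace Cmd

/-- One stage after the other. -/
infixr:30 " ;;; " => Cmd.seq

/-- From registers that satisfy `Pre`, the stages `C` are safe and lead to registers that satisfy
`Post`. -/
def Triple (I : Tapes) (Λ X : ℕ) (Pre : Regs → Prop) (C : Cmd) (Post : Regs → Prop) : Prop :=
  ∀ A, Pre A → C.Safe I Λ X A ∧ Post (C.run I A)

theorem Triple.seq {I : Tapes} {Λ X : ℕ} {P Q R : Regs → Prop} {C D : Cmd}
    (h : Triple I Λ X P C Q) (h' : Triple I Λ X Q D R) : Triple I Λ X P (C ;;; D) R :=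
  fun A hA => ⟨⟨(h A hA).1, (h' _ (h A hA).2).1⟩, (h' _ (h A hA).2).2⟩

end Cmd

@[simp] theorem laneInit_zero : laneInit 0 = fun _ => 0 := by
  funext x; simp [laneInit]

theorem hd_update_self (A : Regs) (r v : ℕ) : hd (Function.update A r [v]) r = v := by simp [hd]

theorem hd_update_of_ne {r a : ℕ} (h : a ≠ r) (A : Regs) (l : List ℕ) :
    hd (Function.update A r l) a = hd A a := by simp [hd, Function.update_of_ne h]

/-- The registers in `S` are set, and the others below `61` are empty. -/
def Agree (d q K : ℕ) (S : List ℕ) (A : Regs) : Prop :=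
  (∀ a ∈ S, hd A a = param d q K a) ∧ ∀ a < 61, a ∉ S → A a = []

/-- The constant `c`, shifted to the left. -/
def powLP (c a : ℕ) : LP := .assign 1 (.lit c) ;; .shl 1 a

/-- The value of an expression. -/
def valLP (e : Ex) : LP := .assign 1 e

section
variable {I : Tapes} {Λ X d q K : ℕ} {S : List ℕ}

theorem Agree.update {A : Regs} (h : Agree d q K S A) {r v : ℕ} (hv : v = param d q K r) :
    Agree d q K (r :: S) (Function.update A r [v]) := by
  refine ⟨fun a ha => ?_, fun a ha hS => ?_⟩
  · by_cases har : a = r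
    · rw [har, hd_update_self, hv]
    · rw [hd_update_of_ne har]
      exact h.1 a ((List.mem_cons.1 ha).resolve_left har)
  · simp only [List.mem_cons, not_or] at hS
    rw [Function.update_of_ne hS.1]
    exact h.2 a ha hS.2

theorem Agree.update_scratch {A : Regs} (h : Agree d q K S A) (hS : 61 ∉ S) (l : List ℕ) :
    Agree d q K S (Function.update A 61 l) := by
  refine ⟨fun a ha => ?_, fun a ha hS => ?_⟩
  · rw [hd_update_of_ne (by rintro rfl; exact hS ha)]
    exact h.1 a ha
  · rw [Function.update_of_ne (by omega)]
    exact h.2 a ha hS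

theorem triple_tab (hΛ : 1 ≤ Λ) (hX : ∀ a < 40, param d q K a ≤ X) (r : ℕ) {P : LP}
    (h : ∀ A, Agree d q K S A → P.run I A (fun _ => 0) 1 = param d q K r)
    (h41 : 41 ∈ S := by decide)
    (hc : ∀ c ∈ P.counters, c ∈ S ∧ c < 40 := by simp [LP.counters, valLP, powLP, LP.shl, LP.shr]) :
    Cmd.Triple I Λ X (Agree d q K S) (.tab r 41 P 1) (Agree d q K (r :: S)) := by
  intro A hA
  have h1 : hd A 41 = 1 := hA.1 41 h41
  refine ⟨⟨by rwa [h1], fun c hcP => ?_⟩, ?_⟩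
  · rw [hA.1 c (hc c hcP).1]; exact hX c (hc c hcP).2
  · simpa [Cmd.run, h1] using hA.update (h A hA)

theorem triple_size (hΛ : 1 ≤ Λ) (hX : ∀ a < 40, param d q K a ≤ X) (r : ℕ) {P : LP}
    (h : ∀ A, Agree d q K S A → Nat.size (P.run I A (fun _ => 0) 1) = param d q K r)
    (hr : r < 40 := by decide) (h41 : 41 ∈ S := by decide) (hS : 61 ∉ S := by decide)
    (hc : ∀ c ∈ P.counters, c ∈ S ∧ c < 40 := by simp [LP.counters, valLP, LP.shr]) :
    Cmd.Triple I Λ X (Agree d q K S) (.tab 61 41 P 1 ;;; .size r 61) (Agree d q K (r :: S)) := by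
  intro A hA
  have h1 : hd A 41 = 1 := hA.1 41 h41
  have h2 := h A hA
  refine ⟨⟨⟨by rwa [h1], fun c hcP => ?_⟩, ?_⟩, ?_⟩
  · rw [hA.1 c (hc c hcP).1]; exact hX c (hc c hcP).2
  · simp only [Cmd.Safe, Cmd.run, h1, List.range_one, List.map_cons, List.map_nil, laneInit_zero,
      hd_update_self, h2]
    exact hX r hr
  · simp only [Cmd.run, h1, List.range_one, List.map_cons, List.map_nil, laneInit_zero,
      hd_update_self, h2]
    exact (hA.update_scratch hS _).update rfl

end

/-- The computation of the parameters. -/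
noncomputable def setup (d : ℕ) : Cmd :=
  .tlen 40 1 ;;;
  .tab 41 40 (valLP (.lit 1)) 1 ;;;
  (.tab 61 41 (valLP (.par 40)) 1 ;;; .size 0 61) ;;;
  .tab 60 41 (valLP (.sub (.rd 0 (.lit 0)) (.lit 1))) 1 ;;;
  (.tab 61 41 (valLP (.sub (.par 60) (.lit 1))) 1 ;;; .size 1 61) ;;;
  (.tab 61 41 (valLP (.sub (.par 1) (.lit 1))) 1 ;;; .size 2 61) ;;;
  .tab 3 41 (valLP (.lit d)) 1 ;;;
  (.tab 61 41 (.loop 3 (.assign 1 (.add (.var 1) (.par 0)))) 1 ;;; .size 4 61) ;;;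
  .tab 5 41 (valLP (.sub (.par 4) (.par 2))) 1 ;;;
  .tab 6 41 (valLP (.lit (pieceExp d))) 1 ;;;
  .tab 7 41 (valLP (.lit (18 + pieceExp d))) 1 ;;;
  (.tab 61 41 (.assign 1 (.par 0) ;; .shr 1 7) 1 ;;; .size 8 61) ;;;
  .tab 9 41 (valLP (.add (.par 6) (.par 8))) 1 ;;;
  .tab 10 41 (valLP (.add (.add (.lit 15) (.par 6)) (.par 9))) 1 ;;;
  .tab 11 41 (powLP 1 9) 1 ;;;
  .tab 12 41 (powLP (2 ^ 13) 9) 1 ;;;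
  .tab 13 41 (powLP (2 ^ 14) 9) 1 ;;;
  .tab 14 41 (powLP 64 9) 1 ;;;
  .tab 15 41 (valLP (.lit (2 ^ pieceExp d))) 1 ;;;
  .tab 16 41 (valLP (.sub (.par 11) (.par 6))) 1 ;;;
  .tab 17 41 (powLP (2 ^ pieceExp d * 2 ^ 14) 9) 1 ;;;
  .tab 18 41 (powLP 1 5) 1 ;;;
  .tab 19 41 (powLP 1 2) 1 ;;;
  .tab 20 41 (valLP (.add (.par 12) (.par 11))) 1 ;;;
  .tab 42 41 (.assign 1 (.par 40) ;; .shr 1 5 ;; .assign 1 (.add (.var 1) (.lit 1))) 1 ;;;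
  .tab 43 41 (.assign 1 (.par 42) ;; .shl 1 10) 1 ;;;
  .tab 44 41 (.assign 1 (.par 43) ;; .assign 1 (.add (.var 1) (.var 1)) ;;
    .assign 1 (.add (.var 1) (.var 1)) ;; .assign 1 (.add (.var 1) (.var 1))) 1 ;;;
  (.tab 61 41 (valLP (.par 43)) 1 ;;; .size 21 61) ;;;
  .tab 22 41 (valLP (.sub (.par 21) (.par 10))) 1 ;;;
  .tab 23 41 (.loop 21 (.loop 21 (.assign 1
    (.add (.var 1) (.lit (8 * (32 * 2 ^ (15 + pieceExp d)))))))) 1 ;;;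
  .tab 24 41 (valLP (.add (.par 20) (.par 20))) 1 ;;;
  .tab 25 41 (powLP 1 10 ;; .assign 1 (.add (.half (.var 1)) (.lit 1))) 1 ;;;
  .tab 26 41 (valLP (.add (.lit 14) (.par 9))) 1 ;;;
  .tab 45 41 (powLP 1 24) 1 ;;;
  .tab 46 41 (powLP 1 24 ;; .shl 1 11) 1 ;;;
  .tab 47 41 (powLP 1 24 ;; .shl 1 13) 1 ;;;
  .tab 48 41 (.loop 21 (.assign 1 (.add (.var 1) (.par 23)))) 1

theorem LP.run_accumulate (I : Tapes) (A : Regs) (ρ : ℕ → ℕ) (x c v : ℕ) (e : Ex)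
    (he : ∀ ρ, e.eval I A ρ = v) :
    (LP.loop c (.assign x (.add (.var x) e))).run I A ρ
      = Function.update ρ x (ρ x + hd A c * v) := by
  refine LP.loop_induct (M := fun k ρ' => ρ' = Function.update ρ x (ρ x + k * v)) (by simp) ?_
  rintro k - ρ' rfl
  simp only [LP.run_assign, Ex.eval, Function.update_self, Function.update_idem, he]
  congr 1; ring

theorem LP.run_accumulate_twice (I : Tapes) (A : Regs) (ρ : ℕ → ℕ) (x c c' v : ℕ) (e : Ex)
    (he : ∀ ρ, e.eval I A ρ = v) :
    (LP.loop c' (LP.loop c (.assign x (.add (.var x) e)))).run I A ρ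
      = Function.update ρ x (ρ x + hd A c' * (hd A c * v)) := by
  refine LP.loop_induct (M := fun k ρ' => ρ' = Function.update ρ x (ρ x + k * (hd A c * v)))
    (by simp) ?_
  rintro k - ρ' rfl
  rw [LP.run_accumulate I A _ x c v e he]
  simp only [Function.update_self, Function.update_idem]
  congr 1; ring

/-- The registers hold the parameters. -/
def Params (d q K : ℕ) (A : Regs) : Prop := ∀ a < 61, hd A a = param d q K a

/-- The stages are ordered so that each one reads only registers set before. `Agree` tracks the set
of finished registers; the ones never set stay empty, which matches the default value `0` of
`param`. -/
theorem triple_setup {I : Tapes} {Λ X d q K : ℕ} (hK : 1 ≤ K) (hΛ : K ≤ Λ)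
    (hX : ∀ a < 40, param d q K a ≤ X) (h0 : I.getD 0 [] = [q]) (h1 : (I.getD 1 []).length = K) :
    Cmd.Triple I Λ X (fun A => A = emptyRegs) (setup d) (Params d q K) := by
  have hΛ1 : 1 ≤ Λ := hK.trans hΛ
  have h0' : I[0]?.getD [] = [q] := by simpa using h0
  have hfin : ∀ A, Agree d q K [48, 47, 46, 45, 26, 25, 24, 23, 22, 21, 44, 43, 42, 20, 19, 18, 17,
      16, 15, 14, 13, 12, 11, 10, 9, 8, 7, 6, 5, 4, 3, 2, 1, 60, 0, 41, 40] A → Params d q K A := by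
    intro A h a ha
    by_cases hS : a ∈ [48, 47, 46, 45, 26, 25, 24, 23, 22, 21, 44, 43, 42, 20, 19, 18, 17,
      16, 15, 14, 13, 12, 11, 10, 9, 8, 7, 6, 5, 4, 3, 2, 1, 60, 0, 41, 40]
    · exact h.1 a hS
    · rw [hd, h.2 a ha hS]
      interval_cases a <;> first | rfl | exact absurd (by decide) hS
  intro A hA
  suffices h : Cmd.Triple I Λ X (fun A => A = emptyRegs) (setup d) (Agree d q K _) from
    ⟨(h A hA).1, hfin _ (h A hA).2⟩
  clear hfin hA A
  refine Cmd.Triple.seq (Q := Agree d q K [40]) ?_ ?_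
  · rintro A rfl
    refine ⟨trivial, ?_⟩
    rw [Cmd.run, h1]
    exact Agree.update (S := []) ⟨by simp, fun _ _ _ => rfl⟩ rfl
  refine Cmd.Triple.seq (Q := Agree d q K [41, 40]) ?_ ?_
  -- No register holds `1` yet, so this stage takes its size from the register with `K`. This is
  -- where `1 ≤ K` and `K ≤ Λ` are needed: it fills `K` entries, of which the first one counts.
  · intro A hA
    have h2 : hd A 40 = K := hA.1 40 (by simp)
    refine ⟨⟨by rwa [h2], by simp [valLP, LP.counters]⟩, fun a ha => ?_, fun a ha hS => ?_⟩
    · simp only [List.mem_cons, List.not_mem_nil, or_false] at ha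
      obtain ⟨k, rfl⟩ := Nat.exists_eq_add_of_le' hK
      rcases ha with rfl | rfl
      · simp [Cmd.run, hd, valLP, param] at h2 ⊢
        simp [h2, List.replicate_succ]
      · simpa [Cmd.run, hd, param] using h2
    · simp only [List.mem_cons, List.not_mem_nil, or_false, not_or] at hS
      simp only [Cmd.run]
      rw [Function.update_of_ne hS.1]
      exact hA.2 a ha (by simpa using hS.2)
  refine (triple_size hΛ1 hX 0 fun A h => ?_).seq ?_
  · simp [valLP, h.1 40, param, indexBits]
  refine (triple_tab hΛ1 hX 60 fun A h => ?_).seq ?_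
  · simp [valLP, h0', param]
  refine (triple_size hΛ1 hX 1 fun A h => ?_).seq ?_
  · simp [valLP, h.1 60, param]
  refine (triple_size hΛ1 hX 2 fun A h => ?_).seq ?_
  · simp [valLP, h.1 1, param, symExp]
  refine (triple_tab hΛ1 hX 3 fun A h => ?_).seq ?_
  · simp [valLP, param]
  refine (triple_size hΛ1 hX 4 fun A h => ?_).seq ?_
  · rw [LP.run_accumulate _ _ _ _ _ (indexBits K) _ fun ρ => by simp [h.1 0, param]]
    simp [h.1 3, param, payExp]
  refine (triple_tab hΛ1 hX 5 fun A h => ?_).seq ?_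
  · simp [valLP, param, h.1 4, h.1 2, groupExp]
  refine (triple_tab hΛ1 hX 6 fun A h => ?_).seq ?_
  · simp [valLP, param]
  refine (triple_tab hΛ1 hX 7 fun A h => ?_).seq ?_
  · simp [valLP, param]
  refine (triple_size hΛ1 hX 8 fun A h => ?_).seq ?_
  · simp [h.1 0, h.1 7, param]
  refine (triple_tab hΛ1 hX 9 fun A h => ?_).seq ?_
  · simp [valLP, param, h.1 6, h.1 8, msgExp]
  refine (triple_tab hΛ1 hX 10 fun A h => ?_).seq ?_
  · simp [valLP, param, h.1 6, h.1 9, blockExp]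
  refine (triple_tab hΛ1 hX 11 fun A h => ?_).seq ?_
  · simp [powLP, param, h.1 9]
  refine (triple_tab hΛ1 hX 12 fun A h => ?_).seq ?_
  · simp [powLP, param, h.1 9]
  refine (triple_tab hΛ1 hX 13 fun A h => ?_).seq ?_
  · simp [powLP, param, h.1 9]
  refine (triple_tab hΛ1 hX 14 fun A h => ?_).seq ?_
  · simp [powLP, param, h.1 9]
  refine (triple_tab hΛ1 hX 15 fun A h => ?_).seq ?_
  · simp [valLP, param]
  refine (triple_tab hΛ1 hX 16 fun A h => ?_).seq ?_
  · simp [valLP, param, h.1 11, h.1 6]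
  refine (triple_tab hΛ1 hX 17 fun A h => ?_).seq ?_
  · simp [powLP, param, h.1 9, mul_assoc]
  refine (triple_tab hΛ1 hX 18 fun A h => ?_).seq ?_
  · simp [powLP, param, h.1 5]
  refine (triple_tab hΛ1 hX 19 fun A h => ?_).seq ?_
  · simp [powLP, param, h.1 2]
  refine (triple_tab hΛ1 hX 20 fun A h => ?_).seq ?_
  · simp [valLP, param, h.1 11, h.1 12]
  refine (triple_tab hΛ1 hX 42 fun A h => ?_).seq ?_
  · simp [param, h.1 40, h.1 5, blockCount]
  refine (triple_tab hΛ1 hX 43 fun A h => ?_).seq ?_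
  · simp [param, h.1 42, h.1 10, codeLen]
  refine (triple_tab hΛ1 hX 44 fun A h => ?_).seq ?_
  · simp [param, h.1 43]; ring
  refine (triple_size hΛ1 hX 21 fun A h => ?_).seq ?_
  · simp [valLP, h.1 43, param, size_eq_log (codeLen_pos d q K)]
  refine (triple_tab hΛ1 hX 22 fun A h => ?_).seq ?_
  · simp [valLP, param, h.1 21, h.1 10]
  refine (triple_tab hΛ1 hX 23 fun A h => ?_).seq ?_
  · rw [LP.run_accumulate_twice _ _ _ _ _ _ (8 * (32 * 2 ^ (15 + pieceExp d))) _ fun ρ => rfl]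
    simp [h.1 21, param]; ring
  refine (triple_tab hΛ1 hX 24 fun A h => ?_).seq ?_
  · simp [valLP, param, h.1 20]; ring
  refine (triple_tab hΛ1 hX 25 fun A h => ?_).seq ?_
  · simp [powLP, param, h.1 10]
  refine (triple_tab hΛ1 hX 26 fun A h => ?_).seq ?_
  · simp [valLP, param, h.1 9]
  refine (triple_tab hΛ1 hX 45 fun A h => ?_).seq ?_
  · simp [powLP, param, h.1 24]
  refine (triple_tab hΛ1 hX 46 fun A h => ?_).seq ?_
  · simp [powLP, param, h.1 24, h.1 11]
  refine (triple_tab hΛ1 hX 47 fun A h => ?_).seq ?_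
  · simp [powLP, param, h.1 24, h.1 13]
  refine (triple_tab hΛ1 hX 48 fun A h => ?_)
  rw [LP.run_accumulate _ _ _ _ _ (param d q K 23) _ fun ρ => by simp [h.1 23]]
  simp [h.1 21, param, coinCount]; ring

/-! ### Codewords of the inner code -/

theorem enc_interleave_succ (k z : ℕ) :
    enc (interleave (k + 1) z) = enc (interleave k z) + 4 ^ k * (z / 2 ^ k % 2 + 2) := by
  have h0 : ∀ z, (decide (z % 2 = 1)).toNat = z % 2 := fun z => by
    rcases Nat.mod_two_eq_zero_or_one z with h | h <;> simp [h]
  induction k generalizing z with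
  | zero => simp [interleave, enc, h0]
  | succ k ih =>
    rw [interleave, enc, enc, ih (z / 2), h0, interleave, enc, enc, h0, Nat.div_div_eq_div_mul,
      ← pow_succ', pow_succ 4]
    simp only [Bool.toNat_true]
    ring

/-- The codewords for all seeds and messages, as indices into a table. -/
def codewordLP : LP :=
  .quot 1 0 11 ;; .rem 2 0 11 ;; .quot 3 1 20 ;; .rem 4 1 20 ;;
  .loop 11 (.assign 4 (.add (.var 4) (.sel (.bit (.var 2)) (.var 3) (.lit 0))) ;;
    .assign 2 (.half (.var 2)) ;; .assign 3 (.add (.var 3) (.var 3))) ;;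
  .shr 4 11 ;; .rem 5 4 12 ;; .assign 6 (.lit 1) ;;
  .loop 12 (.assign 7 (.add (.var 7) (.add (.sel (.bit (.var 5)) (.var 6) (.lit 0))
      (.add (.var 6) (.var 6)))) ;;
    .assign 5 (.half (.var 5)) ;;
    .assign 6 (.add (.add (.var 6) (.var 6)) (.add (.var 6) (.var 6)))) ;;
  .shl 1 13 ;; .assign 1 (.add (.var 1) (.var 7))

/-- Lane `l = s * 2 ^ m + x` handles seed `s` and message `x`. The result is an index into a table
with one row of `2 ^ wordLen m` words per seed, so that lookups for all seeds run in one stage. -/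
theorem run_codewordLP {I : Tapes} {A : Regs} {m : ℕ} (h11 : hd A 11 = m)
    (h12 : hd A 12 = hashBits m) (h13 : hd A 13 = wordLen m) (h20 : hd A 20 = hashBits m + m)
    (l : ℕ) : codewordLP.run I A (laneInit l) 1
      = l / 2 ^ m * 2 ^ wordLen m + enc (codeword m (l / 2 ^ m) (l % 2 ^ m)) := by
  set s := l / 2 ^ m with hs
  set x := l % 2 ^ m with hx
  set a := s / 2 ^ (hashBits m + m) with ha
  set b := s % 2 ^ (hashBits m + m) with hb
  unfold codewordLP
  simp only [LP.run_seq]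
  set ρ1 := (LP.rem 4 1 20).run I A ((LP.quot 3 1 20).run I A ((LP.rem 2 0 11).run I A
    ((LP.quot 1 0 11).run I A (laneInit l)))) with hρ1
  have e1 : ρ1 1 = s ∧ ρ1 2 = x ∧ ρ1 3 = a ∧ ρ1 4 = b ∧ ρ1 7 = 0 := by
    rw [hρ1]
    rw [LP.run_rem _ _ _ (by norm_num), LP.run_quot, LP.run_rem _ _ _ (by norm_num), LP.run_quot]
    simp [laneInit, h11, h20, hs, hx, ha, hb]
  clear_value ρ1
  generalize hρ2 : (LP.loop 11 _).run I A ρ1 = ρ2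
  have e2 : ρ2 1 = s ∧ ρ2 4 = a * x + b ∧ ρ2 7 = 0 := by
    -- The machine cannot multiply; the product is formed by shifting and adding. The invariant says
    -- that the accumulator plus the product of what is left of the factors stays `a * x + b`.
    have := LP.loop_induct (I := I) (A := A) (c := 11) (ρ := ρ1)
      (P := .assign 4 (.add (.var 4) (.sel (.bit (.var 2)) (.var 3) (.lit 0))) ;;
        .assign 2 (.half (.var 2)) ;; .assign 3 (.add (.var 3) (.var 3)))
      (M := fun k ρ => ρ 1 = s ∧ ρ 2 = x / 2 ^ k ∧ ρ 4 + ρ 3 * (x / 2 ^ k) = a * x + b ∧ ρ 7 = 0)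
      (by obtain ⟨h1, h2, h3, h4, h5⟩ := e1
          refine ⟨h1, by simp [h2], by simp [h3, h4]; ring, h5⟩) ?_
    · rw [hρ2] at this
      obtain ⟨h1, -, h3, h4⟩ := this
      refine ⟨h1, ?_, h4⟩
      rw [h11, Nat.div_eq_of_lt (Nat.mod_lt _ (by positivity))] at h3
      simpa using h3
    · rintro k - ρ ⟨h1, h2, h3, h4⟩
      refine ⟨by simp [h1], by simp [h2, Nat.div_div_eq_div_mul, pow_succ], ?_, by simp [h4]⟩
      rw [pow_succ, ← Nat.div_div_eq_div_mul]
      generalize x / 2 ^ k = y at *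
      rcases Nat.mod_two_eq_zero_or_one y with h | h
      · simp [h2, h]
        rw [← h3]
        conv_rhs => rw [← Nat.div_add_mod y 2, h]
        ring
      · simp [h2, h]
        rw [← h3]
        conv_rhs => rw [← Nat.div_add_mod y 2, h]
        ring
  clear hρ2 e1 hρ1 ρ1
  have hz : (a * x + b) / 2 ^ m % 2 ^ hashBits m = hash m (hashBits m) s x := rfl
  set z := hash m (hashBits m) s x with hzdef
  generalize hρ3 : (LP.assign 6 (.lit 1)).run I A ((LP.rem 5 4 12).run I A
    ((LP.shr 4 11).run I A ρ2)) = ρ3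
  have e3 : ρ3 1 = s ∧ ρ3 5 = z ∧ ρ3 6 = 1 ∧ ρ3 7 = 0 := by
    rw [← hρ3, LP.run_rem _ _ _ (by norm_num)]
    simp [e2, h11, h12, hz]
  generalize hρ4 : (LP.loop 12 _).run I A ρ3 = ρ4
  have e4 : ρ4 1 = s ∧ ρ4 7 = enc (codeword m s x) := by
    have := LP.loop_induct (I := I) (A := A) (c := 12) (ρ := ρ3)
      (P := .assign 7 (.add (.var 7) (.add (.sel (.bit (.var 5)) (.var 6) (.lit 0))
        (.add (.var 6) (.var 6)))) ;; .assign 5 (.half (.var 5)) ;;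
        .assign 6 (.add (.add (.var 6) (.var 6)) (.add (.var 6) (.var 6))))
      (M := fun k ρ => ρ 1 = s ∧ ρ 5 = z / 2 ^ k ∧ ρ 6 = 4 ^ k ∧ ρ 7 = enc (interleave k z))
      (by obtain ⟨h1, h2, h3, h4⟩ := e3
          exact ⟨h1, by simp [h2], by simp [h3], by simp [h4, interleave, enc]⟩) ?_
    · rw [hρ4, h12] at this
      exact ⟨this.1, this.2.2.2⟩
    · rintro k - ρ ⟨h1, h2, h3, h4⟩
      refine ⟨by simp [h1], by simp [h2, Nat.div_div_eq_div_mul, pow_succ], ?_, ?_⟩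
      · simp [h3]; ring
      · rw [enc_interleave_succ]
        rcases Nat.mod_two_eq_zero_or_one (z / 2 ^ k) with h | h
        · simp [h2, h3, h4, h]; ring
        · simp [h2, h3, h4, h]; ring
  simp [e4, h13]

/-! ### Spreading of labels -/

/-- The maximum. -/
def Ex.max (e f : Ex) : Ex := .add e (.sub f e)

@[simp] theorem Ex.eval_max (I : Tapes) (A : Regs) (ρ : ℕ → ℕ) (e f : Ex) :
    (Ex.max e f).eval I A ρ = Max.max (e.eval I A ρ) (f.eval I A ρ) := by
  simp only [Ex.max, Ex.eval]; omega

/-- The labels of the words with one letter less, from the table `62`; register `64` holds the length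
of the words of the table. -/
def downLP : LP :=
  .rem 2 0 13 ;; .assign 3 (.sub (.var 0) (.var 2)) ;; .assign 5 (.lit 1) ;;
  .assign 6 (.var 2) ;;
  .loop 13 (
    .assign 10 (.add (.add (.var 3) (.var 4)) (.add (.sub (.var 2) (.var 4))
      (.sub (.var 2) (.var 4)))) ;;
    .assign 8 (.max (.get 62 (.var 10)) (.get 62 (.add (.var 10) (.var 5)))) ;;
    .assign 1 (.max (.var 1) (.sel (.less (.var 7) (.par 64)) (.var 8) (.lit 0))) ;;
    .assign 4 (.add (.var 4) (.sel (.bit (.var 6)) (.var 5) (.lit 0))) ;;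
    .assign 6 (.half (.var 6)) ;; .assign 5 (.add (.var 5) (.var 5)) ;;
    .assign 7 (.add (.var 7) (.lit 1)))

/-- The labels of the words with one letter more; register `64` holds their length. -/
def upLP : LP :=
  .rem 2 0 13 ;; .assign 3 (.sub (.var 0) (.var 2)) ;; .assign 5 (.lit 1) ;;
  .assign 6 (.var 2) ;;
  .loop 13 (
    .assign 9 (.add (.var 4) (.sel (.bit (.var 6)) (.var 5) (.lit 0))) ;;
    .assign 8 (.get 62 (.add (.add (.var 3) (.var 4)) (.half (.sub (.var 2) (.var 9))))) ;;
    .assign 1 (.max (.var 1) (.sel (.less (.var 7) (.par 64)) (.var 8) (.lit 0))) ;;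
    .assign 4 (.var 9) ;;
    .assign 6 (.half (.var 6)) ;; .assign 5 (.add (.var 5) (.var 5)) ;;
    .assign 7 (.add (.var 7) (.lit 1)))

theorem mod_two_pow_succ (z k : ℕ) :
    z % 2 ^ (k + 1) = z % 2 ^ k + if z / 2 ^ k % 2 = 1 then 2 ^ k else 0 := by
  rw [pow_succ, Nat.mod_mul]
  rcases Nat.mod_two_eq_zero_or_one (z / 2 ^ k) with h | h <;> simp [h]

theorem sup_range_succ (f : ℕ → ℕ) (k : ℕ) :
    (Finset.range (k + 1)).sup f = max ((Finset.range k).sup f) (f k) := by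
  rw [Finset.range_add_one, Finset.sup_insert, sup_comm]

theorem sup_range_guard (f : ℕ → ℕ) {n k : ℕ} (h : k ≤ n) :
    (Finset.range n).sup (fun t => if t < k then f t else 0) = (Finset.range k).sup f := by
  refine le_antisymm (Finset.sup_le fun t _ => ?_) (Finset.sup_le fun t ht => ?_)
  · split_ifs with h1
    · exact Finset.le_sup (f := f) (Finset.mem_range.2 h1)
    · exact Nat.zero_le _
  · rw [Finset.mem_range] at ht
    have := Finset.le_sup (f := fun t => if t < k then f t else 0)
      (Finset.mem_range.2 (lt_of_lt_of_le ht h))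
    simpa [ht] using this

theorem run_downLP {I : Tapes} {A : Regs} {W : ℕ} (h13 : hd A 13 = W) (l : ℕ) :
    downLP.run I A (laneInit l) 1 = (Finset.range W).sup fun t => if t < hd A 64 then
      max ((A 62).getD (l - l % 2 ^ W + l % 2 ^ W % 2 ^ t
        + 2 * (l % 2 ^ W - l % 2 ^ W % 2 ^ t)) 0)
      ((A 62).getD (l - l % 2 ^ W + l % 2 ^ W % 2 ^ t
        + 2 * (l % 2 ^ W - l % 2 ^ W % 2 ^ t) + 2 ^ t) 0) else 0 := by
  unfold downLP
  simp only [LP.run_seq]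
  generalize hρ1 : (LP.assign 6 (.var 2)).run I A _ = ρ1
  set z := l % 2 ^ W with hz
  have e1 : ρ1 0 = l ∧ ρ1 1 = 0 ∧ ρ1 2 = z ∧ ρ1 3 = l - z ∧ ρ1 4 = 0 ∧ ρ1 5 = 1 ∧ ρ1 6 = z ∧
      ρ1 7 = 0 := by
    rw [← hρ1, LP.run_rem _ _ _ (by norm_num)]
    simp [laneInit, h13, hz]
  clear hρ1
  generalize hρ2 : (LP.loop 13 _).run I A ρ1 = ρ2
  have := LP.loop_induct (I := I) (A := A) (c := 13) (ρ := ρ1)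
    (P := .assign 10 (.add (.add (.var 3) (.var 4)) (.add (.sub (.var 2) (.var 4))
      (.sub (.var 2) (.var 4)))) ;;
    .assign 8 (.max (.get 62 (.var 10)) (.get 62 (.add (.var 10) (.var 5)))) ;;
    .assign 1 (.max (.var 1) (.sel (.less (.var 7) (.par 64)) (.var 8) (.lit 0))) ;;
    .assign 4 (.add (.var 4) (.sel (.bit (.var 6)) (.var 5) (.lit 0))) ;;
    .assign 6 (.half (.var 6)) ;; .assign 5 (.add (.var 5) (.var 5)) ;;
    .assign 7 (.add (.var 7) (.lit 1)))
    (M := fun k ρ => (ρ 2 = z ∧ ρ 3 = l - z ∧ ρ 4 = z % 2 ^ k ∧ ρ 5 = 2 ^ k ∧ ρ 6 = z / 2 ^ k ∧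
      ρ 7 = k) ∧ ρ 1 = (Finset.range k).sup fun t => if t < hd A 64 then
      max ((A 62).getD (l - z + z % 2 ^ t + 2 * (z - z % 2 ^ t)) 0)
      ((A 62).getD (l - z + z % 2 ^ t + 2 * (z - z % 2 ^ t) + 2 ^ t) 0) else 0)
    (by simp [e1, Nat.mod_one]) ?_
  · rw [hρ2, h13] at this
    exact this.2
  · rintro k - ρ ⟨⟨h2, h3, h4, h5, h6, h7⟩, h1⟩
    refine ⟨⟨by simp [h2], by simp [h3], ?_, ?_, ?_, by simp [h7]⟩, ?_⟩
    · rw [mod_two_pow_succ]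
      simp [h4, h5, h6]
    · simp [h5]; ring
    · simp [h6, Nat.div_div_eq_div_mul, pow_succ]
    · rw [sup_range_succ]
      simp [h1, h2, h3, h4, h5, h7, two_mul]

theorem run_upLP {I : Tapes} {A : Regs} {W : ℕ} (h13 : hd A 13 = W) (l : ℕ) :
    upLP.run I A (laneInit l) 1 = (Finset.range W).sup fun t => if t < hd A 64 then
      (A 62).getD (l - l % 2 ^ W + l % 2 ^ W % 2 ^ t
        + (l % 2 ^ W - l % 2 ^ W % 2 ^ (t + 1)) / 2) 0 else 0 := by
  unfold upLP
  simp only [LP.run_seq]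
  generalize hρ1 : (LP.assign 6 (.var 2)).run I A _ = ρ1
  set z := l % 2 ^ W with hz
  have e1 : ρ1 0 = l ∧ ρ1 1 = 0 ∧ ρ1 2 = z ∧ ρ1 3 = l - z ∧ ρ1 4 = 0 ∧ ρ1 5 = 1 ∧ ρ1 6 = z ∧
      ρ1 7 = 0 := by
    rw [← hρ1, LP.run_rem _ _ _ (by norm_num)]
    simp [laneInit, h13, hz]
  clear hρ1
  generalize hρ2 : (LP.loop 13 _).run I A ρ1 = ρ2
  have := LP.loop_induct (I := I) (A := A) (c := 13) (ρ := ρ1)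
    (P := .assign 9 (.add (.var 4) (.sel (.bit (.var 6)) (.var 5) (.lit 0))) ;;
    .assign 8 (.get 62 (.add (.add (.var 3) (.var 4)) (.half (.sub (.var 2) (.var 9))))) ;;
    .assign 1 (.max (.var 1) (.sel (.less (.var 7) (.par 64)) (.var 8) (.lit 0))) ;;
    .assign 4 (.var 9) ;;
    .assign 6 (.half (.var 6)) ;; .assign 5 (.add (.var 5) (.var 5)) ;;
    .assign 7 (.add (.var 7) (.lit 1)))
    (M := fun k ρ => (ρ 2 = z ∧ ρ 3 = l - z ∧ ρ 4 = z % 2 ^ k ∧ ρ 5 = 2 ^ k ∧ ρ 6 = z / 2 ^ k ∧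
      ρ 7 = k) ∧ ρ 1 = (Finset.range k).sup fun t => if t < hd A 64 then
      (A 62).getD (l - z + z % 2 ^ t + (z - z % 2 ^ (t + 1)) / 2) 0 else 0)
    (by simp [e1, Nat.mod_one]) ?_
  · rw [hρ2, h13] at this
    exact this.2
  · rintro k - ρ ⟨⟨h2, h3, h4, h5, h6, h7⟩, h1⟩
    refine ⟨⟨by simp [h2], by simp [h3], ?_, ?_, ?_, by simp [h7]⟩, ?_⟩
    · rw [mod_two_pow_succ]
      simp [h4, h5, h6]
    · simp [h5]; ring
    · simp [h6, Nat.div_div_eq_div_mul, pow_succ]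
    · rw [sup_range_succ]
      simp only [mod_two_pow_succ z k]
      simp [h1, h2, h3, h4, h5, h6, h7]

theorem Cmd.loop_induct {I : Tapes} {A : Regs} {c : ℕ} {C : Cmd} (M : ℕ → Regs → Prop) (h0 : M 0 A)
    (h : ∀ k < hd A c, ∀ A', M k A' → M (k + 1) (C.run I A')) :
    M (hd A c) ((Cmd.loop c C).run I A) := by
  have : ∀ k ≤ hd A c, M k ((C.run I)^[k] A) := by
    intro k
    induction k with
    | zero => exact fun _ => h0
    | succ k ih =>
      intro hk
      rw [Function.iterate_succ_apply']
      exact h k (by omega) _ (ih (by omega))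
  exact this _ le_rfl

theorem Params.run {d q K : ℕ} {I : Tapes} {A : Regs} (h : Params d q K A) {C : Cmd}
    (hC : C.static = true) (h60 : 60 ∉ C.writes) : Params d q K (C.run I A) := by
  intro a ha
  rw [← h a ha]
  rcases Nat.lt_or_ge a 60 with h1 | h1
  · unfold hd; rw [Cmd.static_run hC A h1]
  · obtain rfl : a = 60 := by omega
    exact Cmd.hd_run_frame I C A 60 h60

/-- The number of seeds. -/
abbrev seedCount (m : ℕ) : ℕ := 2 ^ (2 * (hashBits m + m))

/-- The table `62` holds the labels of the words of length `len`. -/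
structure Holds (A : Regs) (S W len : ℕ) (F : ℕ → List Bool → ℕ) : Prop where
  length : hd A 64 = len
  val : ∀ s < S, ∀ z < 2 ^ len, (A 62).getD (s * 2 ^ W + z) 0 = F s (dec len z)

theorem mul_add_mod_two_pow {s W z : ℕ} (hz : z < 2 ^ W) : (s * 2 ^ W + z) % 2 ^ W = z := by
  rw [Nat.mul_add_mod_self_right, Nat.mod_eq_of_lt hz]

theorem mul_add_div_two_pow {s W z : ℕ} (hz : z < 2 ^ W) : (s * 2 ^ W + z) / 2 ^ W = s := by
  rw [mul_comm, Nat.mul_add_div (by positivity), Nat.div_eq_of_lt hz, add_zero]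

theorem mul_add_lt_mul {s S W z : ℕ} (hs : s < S) (hz : z < 2 ^ W) :
    s * 2 ^ W + z < S * 2 ^ W := by
  have := Nat.mul_le_mul_right (2 ^ W) hs
  rw [Nat.succ_mul] at this
  omega

theorem insert_lt {z k t b : ℕ} (hz : z < 2 ^ k) (ht : t ≤ k) (hb : b ≤ 1) :
    z % 2 ^ t + b * 2 ^ t + 2 * (z - z % 2 ^ t) < 2 ^ (k + 1) := by
  have h1 := Nat.mod_lt z (show 0 < 2 ^ t by positivity)
  have h2 := Nat.div_add_mod z (2 ^ t)
  have h3 : b * 2 ^ t ≤ 1 * 2 ^ t := Nat.mul_le_mul_right _ hb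
  obtain ⟨j, rfl⟩ := Nat.exists_eq_add_of_le ht
  have h4 : z / 2 ^ t < 2 ^ j := by
    rw [Nat.div_lt_iff_lt_mul (by positivity), ← pow_add, add_comm]; exact hz
  have h5 := Nat.mul_le_mul_left (2 ^ t) h4
  rw [Nat.mul_succ, ← pow_add] at h5
  rw [pow_succ]
  omega

theorem erase_lt {z k t : ℕ} (hz : z < 2 ^ (k + 1)) (ht : t ≤ k) :
    z % 2 ^ t + (z - z % 2 ^ (t + 1)) / 2 < 2 ^ k := by
  have h1 := Nat.mod_lt z (show 0 < 2 ^ t by positivity)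
  have h2 := Nat.div_add_mod z (2 ^ (t + 1))
  obtain ⟨j, rfl⟩ := Nat.exists_eq_add_of_le ht
  have h4 : z / 2 ^ (t + 1) < 2 ^ j := by
    rw [Nat.div_lt_iff_lt_mul (by positivity), ← pow_add, show j + (t + 1) = t + j + 1 by ring]
    exact hz
  have h5 := Nat.mul_le_mul_left (2 ^ t) h4
  rw [Nat.mul_succ, ← pow_add] at h5
  have h6 : 2 ^ (t + 1) * (z / 2 ^ (t + 1)) = 2 * (2 ^ t * (z / 2 ^ (t + 1))) := by ring
  omega

/-- One round of insertions. -/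
def downCmd : Cmd := .tab 62 47 downLP 1 ;;; .tab 64 41 (valLP (.sub (.par 64) (.lit 1))) 1

/-- One round of deletions. -/
def upCmd : Cmd := .tab 64 41 (valLP (.add (.par 64) (.lit 1))) 1 ;;; .tab 62 47 upLP 1

section
variable {I : Tapes} {A : Regs} {d q K : ℕ} {F : ℕ → List Bool → ℕ} {len : ℕ}

/-- A word of length `len` has `len + 1` places for an insertion. The loop over places runs
`wordLen` times in every lane, and register `64`, still `len + 1` at this point, cuts it off; it is
decremented afterwards. For deletions the order is reversed, as a word of length `len + 1` has `len
+ 1` letters to erase. -/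
theorem Holds.down {m : ℕ} (hm : m = 2 ^ msgExp d K) (hA : Params d q K A)
    (h : Holds A (seedCount m) (wordLen m) (len + 1) F) (hl : len + 1 ≤ wordLen m) :
    Holds (downCmd.run I A) (seedCount m) (wordLen m) len fun s => dn (wordLen m) (F s) := by
  subst hm
  set W := wordLen (2 ^ msgExp d K) with hW
  set S := seedCount (2 ^ msgExp d K) with hS
  have h13 : hd A 13 = W := hA 13 (by norm_num)
  have h47 : hd A 47 = S * 2 ^ W := hA 47 (by norm_num)
  have h41 : hd A 41 = 1 := hA 41 (by norm_num)
  constructor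
  · simp only [downCmd, Cmd.run]
    rw [hd_update_of_ne (show (41 : ℕ) ≠ 62 by norm_num), h41]
    simp [valLP, hd_update_of_ne, h.length, hd_update_self]
  · intro s hs z hz
    have hzW : z < 2 ^ W := hz.trans_le (Nat.pow_le_pow_right (by norm_num) (by omega))
    have hlt := mul_add_lt_mul (W := W) hs hzW
    simp only [downCmd, Cmd.run]
    rw [Function.update_of_ne (by norm_num), Function.update_self, h47, getD_map_range _ hlt,
      run_downLP h13, mul_add_mod_two_pow hzW, Nat.add_sub_cancel, h.length, sup_range_guard _ hl,
      dn, if_pos (by rw [length_dec]; omega), length_dec]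
    refine Finset.sup_congr rfl fun t ht => ?_
    rw [Finset.mem_range] at ht
    have e0 := insert_lt (b := 0) hz (show t ≤ len by omega) (by norm_num)
    have e1 := insert_lt (b := 1) hz (show t ≤ len by omega) (by norm_num)
    have f0 := h.val s hs _ e0
    have f1 := h.val s hs _ e1
    rw [insertIdx_dec z false (by omega), insertIdx_dec z true (by omega), Bool.toNat_false,
      Bool.toNat_true, ← f0, ← f1]
    congr 2 <;> ring

theorem Holds.up {m : ℕ} (hm : m = 2 ^ msgExp d K) (hA : Params d q K A)
    (h : Holds A (seedCount m) (wordLen m) len F) (hl : len + 1 ≤ wordLen m) :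
    Holds (upCmd.run I A) (seedCount m) (wordLen m) (len + 1) fun s => up (wordLen m) (F s) := by
  subst hm
  set W := wordLen (2 ^ msgExp d K) with hW
  set S := seedCount (2 ^ msgExp d K) with hS
  have h13 : hd A 13 = W := hA 13 (by norm_num)
  have h47 : hd A 47 = S * 2 ^ W := hA 47 (by norm_num)
  have h41 : hd A 41 = 1 := hA 41 (by norm_num)
  have h64 : (Cmd.run I (.tab 64 41 (valLP (.add (.par 64) (.lit 1))) 1) A)
      = Function.update A 64 [len + 1] := by
    simp [Cmd.run, h41, valLP, h.length]
  simp only [upCmd, Cmd.run]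
  simp only [Cmd.run] at h64
  rw [h64]
  constructor
  · rw [hd_update_of_ne (by norm_num), hd_update_self]
  · intro s hs z hz
    have hzW : z < 2 ^ W := hz.trans_le (Nat.pow_le_pow_right (by norm_num) (by omega))
    have hlt := mul_add_lt_mul (W := W) hs hzW
    rw [Function.update_self, hd_update_of_ne (by norm_num), h47, getD_map_range _ hlt,
      run_upLP (W := W) (by rw [hd_update_of_ne (by norm_num), h13]), mul_add_mod_two_pow hzW,
      Nat.add_sub_cancel, hd_update_self, sup_range_guard _ hl,
      InsDelLDC.up, if_pos (by rw [length_dec]; omega), length_dec]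
    refine Finset.sup_congr rfl fun t ht => ?_
    rw [Finset.mem_range] at ht
    rw [Function.update_of_ne (by norm_num), eraseIdx_dec z (by omega),
      ← h.val s hs _ (erase_lt hz (by omega)), add_assoc]

/-- The labels of words at a distance. -/
def spreadCmd : Cmd :=
  .tab 64 41 (valLP (.par 13)) 1 ;;; .loop 14 downCmd ;;; .loop 14 upCmd

/-- The words shrink by `64 * m` letters and grow back. All lengths use the same stride `2 ^ wordLen
m` per seed, so entries of shorter words fit, and those beyond `2 ^ len` are never consulted. -/
theorem spreadCmd_spec {m : ℕ} (hm : m = 2 ^ msgExp d K) (hA : Params d q K A)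
    (h : ∀ s < seedCount m, ∀ z < 2 ^ wordLen m,
      (A 62).getD (s * 2 ^ wordLen m + z) 0 = F s (dec (wordLen m) z)) :
    ∀ s < seedCount m, ∀ z < 2 ^ wordLen m,
      (spreadCmd.run I A 62).getD (s * 2 ^ wordLen m + z) 0
        = spread (wordLen m) (64 * m) (F s) (dec (wordLen m) z) := by
  set W := wordLen m with hW
  have h13 : hd A 13 = W := by rw [hA 13 (by norm_num), hW, hm]; rfl
  have h14 : ∀ A, Params d q K A → hd A 14 = 64 * m := fun A hA => by
    rw [hA 14 (by norm_num), hm]; rfl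
  have hr : 64 * m ≤ W := by rw [hW]; unfold wordLen; omega
  have h41 : hd A 41 = 1 := hA 41 (by norm_num)
  set A1 := Cmd.run I (.tab 64 41 (valLP (.par 13)) 1) A with hA1
  have p1 : Params d q K A1 := hA.run rfl (by decide)
  have e1 : Holds A1 (seedCount m) W W F := by
    constructor
    · simp only [hA1, Cmd.run, h41]
      simp [valLP, h13, hd_update_self]
    · simp only [hA1, Cmd.run]
      rw [Function.update_of_ne (by norm_num)]
      exact h
  set A2 := Cmd.run I (.loop 14 downCmd) A1 with hA2
  obtain ⟨p2, e2⟩ : Params d q K A2 ∧ Holds A2 (seedCount m) W (W - 64 * m)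
      (fun s => (dn W)^[64 * m] (F s)) := by
    have := Cmd.loop_induct (I := I) (A := A1) (c := 14) (C := downCmd) (M := fun k A =>
      Params d q K A ∧ Holds A (seedCount m) W (W - k) fun s => (dn W)^[k] (F s)) ⟨p1, e1⟩ ?_
    · rwa [h14 A1 p1] at this
    · rintro k hk A' ⟨h1, h2⟩
      rw [h14 A1 p1] at hk
      refine ⟨h1.run rfl (by decide), ?_⟩
      have h3 := Holds.down (I := I) (len := W - (k + 1)) hm h1
        (by rwa [show W - (k + 1) + 1 = W - k by omega]) (by omega)
      simpa only [Function.iterate_succ_apply'] using h3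
  obtain ⟨-, e3⟩ : Params d q K (Cmd.run I (.loop 14 upCmd) A2) ∧
      Holds (Cmd.run I (.loop 14 upCmd) A2) (seedCount m) W (W - 64 * m + 64 * m)
      (fun s => (up W)^[64 * m] ((dn W)^[64 * m] (F s))) := by
    have := Cmd.loop_induct (I := I) (A := A2) (c := 14) (C := upCmd) (M := fun k A =>
      Params d q K A ∧ Holds A (seedCount m) W (W - 64 * m + k)
        fun s => (up W)^[k] ((dn W)^[64 * m] (F s))) ⟨p2, e2⟩ ?_
    · rwa [h14 A2 p2] at this
    · rintro k hk A' ⟨h1, h2⟩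
      rw [h14 A2 p2] at hk
      refine ⟨h1.run rfl (by decide), ?_⟩
      have h3 := Holds.up (I := I) hm h1 h2 (by omega)
      simpa only [Function.iterate_succ_apply', add_assoc] using h3
  rw [Nat.sub_add_cancel hr] at e3
  exact e3.val

/-! ### The tables -/

/-- The codewords and their labels. -/
def labelCmd : Cmd :=
  .tab 61 46 codewordLP 1 ;;; .tab 62 47 (valLP (.lit 0)) 1 ;;;
  .tab 63 46 (.rem 1 0 11 ;; .assign 1 (.add (.var 1) (.lit 1))) 1 ;;; .scat 62 62 61 63

/-- Marks for the seeds that are not good. -/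
def badCmd : Cmd :=
  .tab 66 46 (.quot 1 0 11 ;; .rem 2 0 11 ;; .assign 3 (.add (.var 2) (.lit 1)) ;;
    .assign 4 (.get 62 (.get 61 (.var 0))) ;;
    .assign 1 (.sel (.less (.var 3) (.var 4)) (.var 1)
      (.sel (.less (.var 4) (.var 3)) (.var 1) (.par 45)))) 1 ;;;
  .tab 67 46 (valLP (.lit 1)) 1 ;;; .tab 69 45 (valLP (.lit 0)) 1 ;;; .scat 69 69 66 67

/-- The largest seed without a mark. -/
def seedCmd : Cmd :=
  .tab 66 45 (valLP (.sel (.get 69 (.var 0)) (.lit 1) (.lit 0))) 1 ;;;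
  .tab 67 45 (valLP (.var 0)) 1 ;;; .tab 68 41 (valLP (.lit 0)) 1 ;;; .scat 68 68 66 67

/-- The tables of the inner code. -/
def tableCmd : Cmd :=
  labelCmd ;;; spreadCmd ;;; .tab 65 47 (valLP (.get 62 (.var 0))) 1 ;;; spreadCmd ;;;
  badCmd ;;; seedCmd

/-- The registers hold the codewords. -/
def HasCodewords (A : Regs) (m : ℕ) : Prop :=
  A 61 = (List.range (seedCount m * 2 ^ m)).map fun l =>
    l / 2 ^ m * 2 ^ wordLen m + enc (codeword m (l / 2 ^ m) (l % 2 ^ m))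

theorem HasCodewords.getD {m : ℕ} (h : HasCodewords A m) {s x : ℕ} (hs : s < seedCount m)
    (hx : x < 2 ^ m) :
    (A 61).getD (s * 2 ^ m + x) 0 = s * 2 ^ wordLen m + enc (codeword m s x) := by
  rw [h, getD_map_range _ (mul_add_lt_mul hs hx), mul_add_div_two_pow hx, mul_add_mod_two_pow hx]

/-- Every pair of seed and message writes `x + 1` into the cell of its codeword. Lanes of one seed
are ordered by message, so the surviving write is the largest message, as in `label`. -/
theorem labelCmd_spec {m : ℕ} (hm : m = 2 ^ msgExp d K) (hA : Params d q K A) :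
    HasCodewords (labelCmd.run I A) m ∧ ∀ s < seedCount m, ∀ z < 2 ^ wordLen m,
      (labelCmd.run I A 62).getD (s * 2 ^ wordLen m + z) 0 = label m s (dec (wordLen m) z) := by
  have h46 : hd A 46 = seedCount m * 2 ^ m := by rw [hA 46 (by norm_num), hm]; rfl
  have h47 : hd A 47 = seedCount m * 2 ^ wordLen m := by rw [hA 47 (by norm_num), hm]; rfl
  have h11 : hd A 11 = m := by rw [hA 11 (by norm_num), hm]; rfl
  have h61 : HasCodewords (labelCmd.run I A) m := by
    simp only [labelCmd, Cmd.run, HasCodewords]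
    rw [Function.update_of_ne (by norm_num), Function.update_of_ne (by norm_num),
      Function.update_of_ne (by norm_num), Function.update_self, h46]
    refine List.map_congr_left fun l _ => run_codewordLP h11 ?_ ?_ ?_ l
    · rw [hA 12 (by norm_num), hm]; rfl
    · rw [hA 13 (by norm_num), hm]; rfl
    · rw [hA 20 (by norm_num), hm]; rfl
  refine ⟨h61, fun s hs z hz => ?_⟩
  have e61 : labelCmd.run I A 61 = _ := h61
  simp only [labelCmd, Cmd.run] at e61 ⊢
  rw [Function.update_self, Function.update_self]
  rw [Function.update_of_ne (by norm_num)] at e61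
  rw [e61, Function.update_of_ne (by norm_num), Function.update_self]
  have e63 : ∀ A' : Regs, hd A' 11 = m → ∀ l, LP.run I A' (.rem 1 0 11 ;;
      .assign 1 (.add (.var 1) (.lit 1))) (laneInit l) 1 = l % 2 ^ m + 1 := by
    intro A' h l
    rw [LP.run_seq, LP.run_rem _ _ _ (by norm_num)]
    simp [laneInit, h]
  simp only [hd_update_of_ne (show (46 : ℕ) ≠ 62 by norm_num),
    hd_update_of_ne (show (46 : ℕ) ≠ 61 by norm_num), h46,
    hd_update_of_ne (show (47 : ℕ) ≠ 61 by norm_num), h47]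
  rw [show (fun l => LP.run I _ (.rem 1 0 11 ;; .assign 1 (.add (.var 1) (.lit 1))) (laneInit l) 1)
    = fun l => l % 2 ^ m + 1 from funext fun l => e63 _ (by simp [hd_update_of_ne, h11]) l]
  rw [getD_foldl_set]
  · rw [label]
    refine le_antisymm (Finset.sup_le fun l hl => ?_) (Finset.sup_le fun x hx => ?_)
    · simp only [Finset.mem_filter, Finset.mem_range] at hl
      have h2 := enc_lt (codeword m (l / 2 ^ m) (l % 2 ^ m))
      rw [length_codeword] at h2
      have h3 : l / 2 ^ m = s := by
        have := congrArg (· / 2 ^ wordLen m) hl.2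
        simpa [mul_add_div_two_pow h2, mul_add_div_two_pow hz] using this
      have h4 : enc (codeword m (l / 2 ^ m) (l % 2 ^ m)) = z := by
        have := hl.2; rw [h3] at this ⊢; omega
      refine Finset.le_sup (f := fun x => x + 1) ?_
      rw [Finset.mem_filter, Finset.mem_range, ← h3]
      exact ⟨Nat.mod_lt _ (by positivity), (enc_eq_iff (length_codeword _ _ _) hz).1 h4⟩
    · simp only [Finset.mem_filter, Finset.mem_range] at hx
      have h5 := Finset.le_sup (f := fun l => l % 2 ^ m + 1) (b := s * 2 ^ m + x)
        (s := (Finset.range (seedCount m * 2 ^ m)).filter fun l =>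
          l / 2 ^ m * 2 ^ wordLen m + enc (codeword m (l / 2 ^ m) (l % 2 ^ m))
            = s * 2 ^ wordLen m + z) (by
        rw [Finset.mem_filter, Finset.mem_range, mul_add_div_two_pow hx.1, mul_add_mod_two_pow hx.1,
          hx.2, enc_dec hz]
        exact ⟨mul_add_lt_mul hs hx.1, rfl⟩)
      simpa [mul_add_mod_two_pow hx.1] using h5
  · simpa using mul_add_lt_mul hs hz
  · intro j j' hj h
    have h2 := enc_lt (codeword m (j / 2 ^ m) (j % 2 ^ m))
    have h2' := enc_lt (codeword m (j' / 2 ^ m) (j' % 2 ^ m))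
    rw [length_codeword] at h2 h2'
    have h3 : j / 2 ^ m = j' / 2 ^ m := by
      have := congrArg (· / 2 ^ wordLen m) h
      simpa [mul_add_div_two_pow h2, mul_add_div_two_pow h2'] using this
    have h4 := Nat.div_add_mod j (2 ^ m)
    have h5 := Nat.div_add_mod j' (2 ^ m)
    rw [h3] at h4
    omega
  · rw [getD_map_range _ (mul_add_lt_mul hs hz)]
    simp [valLP]

/-- The registers hold the table of the inner code for all seeds, and the largest good seed. -/
structure HasTables (A : Regs) (m : ℕ) : Prop where
  codewords : HasCodewords A m
  table : ∀ s < seedCount m, ∀ z < 2 ^ wordLen m,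
    (A 65).getD (s * 2 ^ wordLen m + z) 0 = table m s (dec (wordLen m) z)
  seed : hd A 68 = seed m

/-- A lane that finds a discrepancy marks its seed. The other lanes write to the cell with index
`seedCount m`, which is out of range, so their writes are ignored. -/
theorem badCmd_spec {m : ℕ} (hm : m = 2 ^ msgExp d K) (hA : Params d q K A)
    (hw : HasCodewords A m) (h : ∀ s < seedCount m, ∀ z < 2 ^ wordLen m,
      (A 62).getD (s * 2 ^ wordLen m + z) 0 = F s (dec (wordLen m) z)) {s : ℕ}
    (hs : s < seedCount m) :
    (badCmd.run I A 69).getD s 0 = 0 ↔ ∀ x < 2 ^ m, F s (codeword m s x) = x + 1 := by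
  have h46 : hd A 46 = seedCount m * 2 ^ m := by rw [hA 46 (by norm_num), hm]; rfl
  have h45 : hd A 45 = seedCount m := by rw [hA 45 (by norm_num), hm]; rfl
  have h11 : hd A 11 = m := by rw [hA 11 (by norm_num), hm]; rfl
  have e66 : ∀ l < seedCount m * 2 ^ m, LP.run I A (.quot 1 0 11 ;; .rem 2 0 11 ;;
      .assign 3 (.add (.var 2) (.lit 1)) ;; .assign 4 (.get 62 (.get 61 (.var 0))) ;;
      .assign 1 (.sel (.less (.var 3) (.var 4)) (.var 1)
        (.sel (.less (.var 4) (.var 3)) (.var 1) (.par 45)))) (laneInit l) 1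
      = if F (l / 2 ^ m) (codeword m (l / 2 ^ m) (l % 2 ^ m)) = l % 2 ^ m + 1 then seedCount m
        else l / 2 ^ m := by
    intro l hl
    have h1 : l / 2 ^ m < seedCount m := by
      rwa [Nat.div_lt_iff_lt_mul (by positivity)]
    have h2 : l % 2 ^ m < 2 ^ m := Nat.mod_lt _ (by positivity)
    have h3 := hw.getD h1 h2
    rw [mul_comm, Nat.div_add_mod l (2 ^ m)] at h3
    have h4 := enc_lt (codeword m (l / 2 ^ m) (l % 2 ^ m))
    have h6 := dec_enc (codeword m (l / 2 ^ m) (l % 2 ^ m))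
    rw [length_codeword] at h4 h6
    have h5 := h _ h1 _ h4
    rw [h6, ← h3] at h5
    rw [LP.run_seq, LP.run_seq, LP.run_rem _ _ _ (by norm_num), LP.run_quot]
    simp only [LP.run_seq, LP.run_assign]
    rw [Function.update_self]
    simp [h11, h45, laneInit, -List.getD_eq_getElem?_getD]
    rw [h5]
    split_ifs <;> first | rfl | omega
  simp only [badCmd, Cmd.run]
  rw [Function.update_self, Function.update_self, Function.update_of_ne (by norm_num),
    Function.update_of_ne (by norm_num), Function.update_self,
    Function.update_of_ne (by norm_num), Function.update_self]
  simp only [hd_update_of_ne (show (46 : ℕ) ≠ 66 by norm_num), h46,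
    hd_update_of_ne (show (45 : ℕ) ≠ 66 by norm_num), h45,
    hd_update_of_ne (show (45 : ℕ) ≠ 67 by norm_num)]
  rw [List.map_congr_left fun l hl => e66 l (List.mem_range.1 hl), getD_foldl_set]
  · simp only [valLP, LP.run_assign, Ex.eval, Function.update_self]
    rw [← Nat.bot_eq_zero, Finset.sup_eq_bot_iff]
    simp only [Finset.mem_filter, Finset.mem_range, Nat.bot_eq_zero, one_ne_zero, imp_false,
      not_and]
    refine ⟨fun H x hx => ?_, fun H l hl => ?_⟩
    · have := H (s * 2 ^ m + x) (mul_add_lt_mul hs hx)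
      rw [mul_add_div_two_pow hx, mul_add_mod_two_pow hx] at this
      by_contra hne
      simp [hne] at this
    · split_ifs with h1
      · omega
      · rintro rfl
        exact h1 (H _ (Nat.mod_lt _ (by positivity)))
  · simpa using hs
  · simp [valLP]
  · rw [getD_map_range _ hs]
    simp [valLP]

-- Unmarked seeds all write their number into cell `0` of an array of length one, and the last,
-- hence largest, one survives. Marked seeds aim at cell `1`, out of range.
open Classical in
theorem seedCmd_spec {m : ℕ} (hm : m = 2 ^ msgExp d K) (hA : Params d q K A)
    (h : ∀ s < seedCount m, (A 69).getD s 0 = 0 ↔ GoodSeed m s) :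
    hd (seedCmd.run I A) 68 = seed m := by
  have h45 : hd A 45 = seedCount m := by rw [hA 45 (by norm_num), hm]; rfl
  have h41 : hd A 41 = 1 := hA 41 (by norm_num)
  have e : ∀ l : List ℕ, l.headD 0 = l.getD 0 0 := fun l => by cases l <;> simp
  rw [hd, e]
  simp only [seedCmd, Cmd.run]
  rw [Function.update_self, Function.update_self, Function.update_of_ne (by norm_num),
    Function.update_of_ne (by norm_num), Function.update_self,
    Function.update_of_ne (by norm_num), Function.update_self]
  simp only [hd_update_of_ne (show (45 : ℕ) ≠ 66 by norm_num), h45,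
    hd_update_of_ne (show (41 : ℕ) ≠ 66 by norm_num), h41,
    hd_update_of_ne (show (41 : ℕ) ≠ 67 by norm_num)]
  rw [getD_foldl_set]
  · simp only [valLP, LP.run_assign, Ex.eval, Function.update_self, laneInit, if_true]
    rw [seed]
    refine Finset.sup_congr ?_ fun _ _ => rfl
    refine Finset.filter_congr fun s hs => ?_
    rw [← h s (Finset.mem_range.1 hs)]
    split_ifs with h1
    · simpa using h1
    · simpa using h1
  · simp
  · intro j j' hj _
    simpa [valLP, laneInit] using hj
  · simp [valLP]

theorem tableCmd_spec {m : ℕ} (hm : m = 2 ^ msgExp d K) (hA : Params d q K A) :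
    HasTables (tableCmd.run I A) m := by
  have h47 : ∀ A, Params d q K A → hd A 47 = seedCount m * 2 ^ wordLen m := fun A hA => by
    rw [hA 47 (by norm_num), hm]; rfl
  obtain ⟨c1, l1⟩ := labelCmd_spec (I := I) hm hA
  have p1 : Params d q K (labelCmd.run I A) := hA.run rfl (by decide)
  simp only [tableCmd, Cmd.run]
  generalize labelCmd.run I A = A1 at *
  have l2 := spreadCmd_spec (I := I) hm p1 l1
  have p2 : Params d q K (spreadCmd.run I A1) := p1.run rfl (by decide)
  have c2 : HasCodewords (spreadCmd.run I A1) m := by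
    rw [HasCodewords, Cmd.run_frame _ _ _ _ (by decide)]; exact c1
  generalize spreadCmd.run I A1 = A2 at *
  have e3 : ∀ s < seedCount m, ∀ z < 2 ^ wordLen m,
      (Cmd.run I (.tab 65 47 (valLP (.get 62 (.var 0))) 1) A2 65).getD (s * 2 ^ wordLen m + z) 0
        = table m s (dec (wordLen m) z) := by
    intro s hs z hz
    rw [Cmd.run, Function.update_self, h47 _ p2, getD_map_range _ (mul_add_lt_mul hs hz), table,
      ← l2 s hs z hz]
    simp [valLP, laneInit]
  have p3 : Params d q K (Cmd.run I (.tab 65 47 (valLP (.get 62 (.var 0))) 1) A2) :=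
    p2.run rfl (by decide)
  have l3 : ∀ s < seedCount m, ∀ z < 2 ^ wordLen m,
      (Cmd.run I (.tab 65 47 (valLP (.get 62 (.var 0))) 1) A2 62).getD (s * 2 ^ wordLen m + z) 0
        = table m s (dec (wordLen m) z) := by
    intro s hs z hz
    rw [Cmd.run_frame _ _ _ _ (by decide), l2 s hs z hz, table]
  have c3 : HasCodewords (Cmd.run I (.tab 65 47 (valLP (.get 62 (.var 0))) 1) A2) m := by
    rw [HasCodewords, Cmd.run_frame _ _ _ _ (by decide)]; exact c2
  simp only [Cmd.run] at e3 p3 l3 c3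
  generalize Function.update A2 65 _ = A3 at *
  have l4 := spreadCmd_spec (I := I) hm p3 l3
  have p4 : Params d q K (spreadCmd.run I A3) := p3.run rfl (by decide)
  have c4 : HasCodewords (spreadCmd.run I A3) m := by
    rw [HasCodewords, Cmd.run_frame _ _ _ _ (by decide)]; exact c3
  have e4 : spreadCmd.run I A3 65 = A3 65 := Cmd.run_frame _ _ _ _ (by decide)
  generalize spreadCmd.run I A3 = A4 at *
  have p5 : Params d q K (badCmd.run I A4) := p4.run rfl (by decide)
  refine ⟨?_, ?_, seedCmd_spec hm p5 fun s hs => badCmd_spec hm p4 c4 l4 hs⟩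
  · rw [HasCodewords, Cmd.run_frame _ _ _ _ (by decide), Cmd.run_frame _ _ _ _ (by decide)]
    exact c4
  · rw [Cmd.run_frame _ _ _ _ (by decide), Cmd.run_frame _ _ _ _ (by decide), e4]
    exact e3

theorem seed_lt (m : ℕ) : seed m < seedCount m := by
  classical
  rw [seed, Finset.sup_lt_iff (by positivity)]
  intro s hs
  simpa using (Finset.mem_filter.1 hs).1

end

/-! ### The program that compiles -/

theorem getD_flatMap_range {f : ℕ → List Bool} {B : ℕ} (hf : ∀ i, (f i).length = B) {N i o : ℕ}
    (hi : i < N) (ho : o < B) (a : Bool) : ((List.range N).flatMap f).getD (i * B + o) a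
      = (f i).getD o a := by
  induction N with
  | zero => omega
  | succ N ih =>
    rw [List.range_succ, List.flatMap_append]
    have hl : ((List.range N).flatMap f).length = N * B := length_flatMap_range hf N
    rcases Nat.lt_or_ge i N with h | h
    · have h1 : i * B + o < N * B := by
        have := Nat.mul_le_mul_right B h
        rw [Nat.succ_mul] at this
        omega
      rw [List.getD_append _ _ _ _ (by omega), ih h]
    · obtain rfl : i = N := by omega
      rw [List.getD_append_right _ _ _ _ (by omega), hl, Nat.add_sub_cancel_left]
      simp

/-- Shift of variable `7` by as many multiples of the first entry of array `v` as there are numbers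
below that of array `c` and above variable `5`. -/
def digitLP (c v : ℕ) : LP :=
  .loop c (.assign 8 (.add (.var 8) (.lit 1)) ;; .assign 9 (.var 7) ;; .shr 9 v ;;
    .assign 7 (.sel (.less (.add (.var 5) (.var 8)) (.par c)) (.var 9) (.var 7)))

/-- The shift depends on the lane, whereas loop counts may not. So every lane runs the full loop and
performs the shift only as long as its own condition holds. -/
theorem run_digitLP {I : Tapes} {A : Regs} (c v : ℕ) {ρ : ℕ → ℕ} (h8 : ρ 8 = 0) :
    (digitLP c v).run I A ρ 7 = ρ 7 / 2 ^ (hd A v * (hd A c - 1 - ρ 5)) := by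
  have := LP.loop_induct (I := I) (A := A) (c := c) (ρ := ρ)
    (P := .assign 8 (.add (.var 8) (.lit 1)) ;; .assign 9 (.var 7) ;; .shr 9 v ;;
      .assign 7 (.sel (.less (.add (.var 5) (.var 8)) (.par c)) (.var 9) (.var 7)))
    (M := fun k ρ' => ρ' 5 = ρ 5 ∧ ρ' 8 = k ∧
      ρ' 7 = ρ 7 / 2 ^ (hd A v * min k (hd A c - 1 - ρ 5))) (by simp [h8]) ?_
  · rw [show min (hd A c) (hd A c - 1 - ρ 5) = hd A c - 1 - ρ 5 by omega] at this
    exact this.2.2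
  · rintro k hk ρ' ⟨h1, h2, h3⟩
    refine ⟨by simp [h1], by simp [h2], ?_⟩
    by_cases h : ρ 5 + (k + 1) < hd A c
    · simp only [LP.run_seq, LP.run_assign, LP.run_shr]
      simp [h1, h2, h3, h]
      rw [Nat.div_div_eq_div_mul, ← pow_add, min_eq_left (by omega), min_eq_left (by omega)]
      rfl
    · simp [h1, h2, h3, h]
      rw [min_eq_right (by omega), min_eq_right (by omega)]

theorem digitLP_frame {I : Tapes} {A : Regs} (c v : ℕ) {ρ : ℕ → ℕ} {x : ℕ} (hx : x ≠ 7) (h8 : x ≠ 8)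
    (h9 : x ≠ 9) : (digitLP c v).run I A ρ x = ρ x :=
  LP.run_frame _ _ _ _ _ (by simp [digitLP, LP.writes, LP.shr, hx, h8, h9])

/-- The contents of the blocks. -/
def contentLP : LP :=
  .assign 2 (.var 0) ;; .shl 2 5 ;;
  .loop 18 (.shl 1 19 ;; .assign 1 (.add (.var 1) (.sub (.rd 1 (.add (.var 2) (.var 3))) (.lit 1))) ;;
    .assign 3 (.add (.var 3) (.lit 1))) ;;
  .shl 1 0 ;; .assign 1 (.add (.var 1) (.var 0))

/-- The bits of the compiled word. -/
def outputLP : LP :=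
  .quot 2 0 10 ;; .rem 3 0 10 ;; .assign 4 (.sub (.var 3) (.par 17)) ;; .quot 5 4 26 ;;
  .rem 6 4 26 ;; .assign 7 (.get 71 (.var 2)) ;; digitLP 15 16 ;; .rem 9 7 16 ;;
  .assign 10 (.var 5) ;; .shl 10 16 ;; .assign 11 (.par 68) ;; .shl 11 11 ;;
  .assign 12 (.get 61 (.add (.var 11) (.add (.var 10) (.var 9)))) ;;
  .loop 13 (.assign 12 (.sel (.less (.var 13) (.var 6)) (.half (.var 12)) (.var 12)) ;;
    .assign 13 (.add (.var 13) (.lit 1))) ;;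
  .assign 1 (.sel (.less (.var 3) (.par 17)) (.lit 0) (.bit (.var 12)))

/-- The stages that compute the compiled word. -/
def compileCmd : Cmd := tableCmd ;;; .tab 71 42 contentLP 1 ;;; .tab 72 43 outputLP 1

section
variable {I : Tapes} {A : Regs} {d q K : ℕ}

theorem rd_tape (y : Fin K → Fin q) (j : ℕ) :
    ((tape (List.ofFn y))[j]?.elim 0 fun v => v + 1) - 1 = extend y j := by
  unfold extend tape
  split_ifs with h
  · simp [h]
  · simp [h]

theorem run_contentLP (hA : Params d q K A) {y : Fin K → Fin q} (hI : I.getD 1 [] = tape (List.ofFn y))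
    (i : ℕ) : contentLP.run I A (laneInit i) 1 = content d q K (extend y) i := by
  have h0 : hd A 0 = indexBits K := hA 0 (by norm_num)
  have h5 : hd A 5 = groupExp d q K := hA 5 (by norm_num)
  have h18 : hd A 18 = 2 ^ groupExp d q K := hA 18 (by norm_num)
  have h19 : hd A 19 = 2 ^ symExp q := hA 19 (by norm_num)
  unfold contentLP
  simp only [LP.run_seq]
  generalize hρ1 : (LP.shl 2 5).run I A _ = ρ1
  have e1 : ρ1 0 = i ∧ ρ1 1 = 0 ∧ ρ1 2 = i * 2 ^ groupExp d q K ∧ ρ1 3 = 0 := by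
    rw [← hρ1]; simp [laneInit, h5]
  clear hρ1
  generalize hρ2 : (LP.loop 18 _).run I A ρ1 = ρ2
  have := LP.loop_induct (I := I) (A := A) (c := 18) (ρ := ρ1)
    (P := .shl 1 19 ;; .assign 1 (.add (.var 1) (.sub (.rd 1 (.add (.var 2) (.var 3))) (.lit 1))) ;;
      .assign 3 (.add (.var 3) (.lit 1)))
    (M := fun k ρ => ρ 0 = i ∧ ρ 2 = i * 2 ^ groupExp d q K ∧ ρ 3 = k ∧
      ρ 1 = horner (2 ^ symExp q) (fun s => extend y (i * 2 ^ groupExp d q K + s)) k)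
    (by simp [e1, horner]) ?_
  · rw [hρ2, h18] at this
    simp [this, h0, content]
  · rintro k - ρ ⟨h1, h2, h3, h4⟩
    refine ⟨by simp [h1], by simp [h2], by simp [h3], ?_⟩
    rw [horner, ← rd_tape, ← hI]
    simp [h2, h3, h4, h19, -List.getD_eq_getElem?_getD]

theorem shift_loop {I : Tapes} {A : Regs} {c : ℕ} {ρ : ℕ → ℕ} (h13 : ρ 13 = 0) (h6 : ρ 6 ≤ hd A c) :
    (LP.loop c (.assign 12 (.sel (.less (.var 13) (.var 6)) (.half (.var 12)) (.var 12)) ;;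
      .assign 13 (.add (.var 13) (.lit 1)))).run I A ρ 12 = ρ 12 / 2 ^ ρ 6 := by
  have := LP.loop_induct (I := I) (A := A) (c := c) (ρ := ρ)
    (P := .assign 12 (.sel (.less (.var 13) (.var 6)) (.half (.var 12)) (.var 12)) ;;
      .assign 13 (.add (.var 13) (.lit 1)))
    (M := fun k ρ' => ρ' 6 = ρ 6 ∧ ρ' 13 = k ∧ ρ' 12 = ρ 12 / 2 ^ min k (ρ 6)) (by simp [h13]) ?_
  · rw [min_eq_right h6] at this
    exact this.2.2
  · rintro k - ρ' ⟨h1, h2, h3⟩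
    refine ⟨by simp [h1], by simp [h2], ?_⟩
    by_cases h : k < ρ 6
    · simp [h1, h2, h3, h]
      rw [Nat.div_div_eq_div_mul, ← pow_succ, min_eq_left (by omega)]
    · simp [h1, h2, h3, h]
      rw [min_eq_right (by omega), min_eq_right (by omega)]

theorem getD_block {η m s X o : ℕ} (ho : o < blockLen η m) :
    (block η m s X).getD o false = if o < markLen η m then false else
      (codeword m s (message η m X ((o - markLen η m) / wordLen m))).getD
        ((o - markLen η m) % wordLen m) false := by
  unfold block
  split_ifs with h
  · rw [List.getD_append _ _ _ _ (by simpa using h), List.getD_eq_getElem _ _ (by simpa using h)]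
    simp
  · rw [List.getD_append_right _ _ _ _ (by simpa using h), List.length_replicate]
    have h1 : 0 < wordLen m := by
      rcases Nat.eq_zero_or_pos (wordLen m) with h0 | h0
      · simp only [blockLen, markLen, h0] at ho; omega
      · exact h0
    have h2 : (o - markLen η m) / wordLen m < 2 ^ η := by
      rw [Nat.div_lt_iff_lt_mul h1]
      unfold blockLen markLen at ho
      unfold markLen at h ⊢
      omega
    have h3 := Nat.div_add_mod' (o - markLen η m) (wordLen m)
    have h4 := getD_flatMap_range (f := fun t => codeword m s (message η m X t)) (B := wordLen m)
      (fun t => length_codeword _ _ _) h2 (Nat.mod_lt (o - markLen η m) h1) false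
    rw [h3] at h4
    exact h4

/-- Lane `p` splits its number into block, piece and place within the piece, extracts the digit, and
looks the codeword up in the row of the chosen seed. -/
theorem run_outputLP {m : ℕ} (hm : m = 2 ^ msgExp d K) (hA : Params d q K A) (hT : HasTables A m)
    {X : ℕ → ℕ} (hX : ∀ i < blockCount d q K, (A 71).getD i 0 = X i) {p : ℕ}
    (hp : p < codeLen d q K) : outputLP.run I A (laneInit p) 1
      = (((List.range (blockCount d q K)).flatMap fun i =>
          block (pieceExp d) m (seed m) (X i)).getD p false).toNat := by
  have h10 : hd A 10 = blockExp d K := hA 10 (by norm_num)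
  have h11 : hd A 11 = m := by rw [hm]; exact hA 11 (by norm_num)
  have h13 : hd A 13 = wordLen m := by rw [hm]; exact hA 13 (by norm_num)
  have h15 : hd A 15 = 2 ^ pieceExp d := hA 15 (by norm_num)
  have h16 : hd A 16 = m - pieceExp d := by rw [hm]; exact hA 16 (by norm_num)
  have h17 : hd A 17 = markLen (pieceExp d) m := by rw [hm]; exact hA 17 (by norm_num)
  have h26 : hd A 26 = 14 + msgExp d K := hA 26 (by norm_num)
  have hW : 2 ^ (14 + msgExp d K) = wordLen m := by rw [hm, pow_add]
  have hB : blockLen (pieceExp d) m = 2 ^ blockExp d K := by rw [hm]; exact blockLen_pow _ _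
  have hηm : pieceExp d ≤ m := by rw [hm]; exact pieceExp_le
  set o := p % 2 ^ blockExp d K with ho
  set i := p / 2 ^ blockExp d K with hi
  have hiN : i < blockCount d q K := by
    rw [hi, Nat.div_lt_iff_lt_mul (by positivity)]
    exact hp
  have hoB : o < blockLen (pieceExp d) m := by rw [hB]; exact Nat.mod_lt _ (by positivity)
  have hpo : p = i * 2 ^ blockExp d K + o := (Nat.div_add_mod' p _).symm
  set R := markLen (pieceExp d) m with hR
  set t := (o - R) / wordLen m with ht
  set u := (o - R) % wordLen m with hu
  have hWpos : 0 < wordLen m := by rw [← hW]; positivity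
  have huW : u < wordLen m := Nat.mod_lt _ hWpos
  have htη : t < 2 ^ pieceExp d := by
    rw [ht, Nat.div_lt_iff_lt_mul hWpos]
    have : o < 2 * R := hoB
    have h1 : R = 2 ^ pieceExp d * wordLen m := rfl
    have h2 : 0 < R := by rw [h1]; positivity
    omega
  have hrhs : (((List.range (blockCount d q K)).flatMap fun i =>
      block (pieceExp d) m (seed m) (X i)).getD p false).toNat = if o < R then 0 else
      enc (codeword m (seed m) (message (pieceExp d) m (X i) t)) / 2 ^ u % 2 := by
    have h1 := getD_flatMap_range (f := fun i => block (pieceExp d) m (seed m) (X i))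
      (B := 2 ^ blockExp d K) (fun i => by rw [length_block, hB]) hiN (by rwa [hB] at hoB) false
    rw [hpo, h1, getD_block hoB, enc_getD]
    split_ifs <;> rfl
  rw [hrhs]
  unfold outputLP
  simp only [LP.run_seq]
  generalize hρ1 : (LP.assign 7 (.get 71 (.var 2))).run I A _ = ρ1
  have e1 : ρ1 3 = o ∧ ρ1 5 = t ∧ ρ1 6 = u ∧ ρ1 7 = X i ∧ ρ1 8 = 0 ∧ ρ1 13 = 0 := by
    rw [← hρ1, LP.run_rem _ _ _ (by norm_num), LP.run_quot, LP.run_assign,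
      LP.run_rem _ _ _ (by norm_num), LP.run_quot, ← hX i hiN]
    simp [laneInit, h10, h17, h26, hW, -List.getD_eq_getElem?_getD]
    exact ⟨rfl, rfl, rfl, rfl⟩
  clear hρ1
  generalize hρ2 : (digitLP 15 16).run I A ρ1 = ρ2
  have e2 : ρ2 3 = o ∧ ρ2 5 = t ∧ ρ2 6 = u ∧ ρ2 7 = X i / 2 ^ ((m - pieceExp d) *
      (2 ^ pieceExp d - 1 - t)) ∧ ρ2 13 = 0 := by
    rw [← hρ2, run_digitLP 15 16 e1.2.2.2.2.1, digitLP_frame _ _ (by norm_num) (by norm_num) (by norm_num),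
      digitLP_frame _ _ (by norm_num) (by norm_num) (by norm_num),
      digitLP_frame _ _ (by norm_num) (by norm_num) (by norm_num),
      digitLP_frame _ _ (by norm_num) (by norm_num) (by norm_num)]
    simp [e1, h15, h16]
  clear hρ2 e1 ρ1
  generalize hρ3 : (LP.assign 12 (.get 61 _)).run I A _ = ρ3
  have e3 : ρ3 3 = o ∧ ρ3 6 = u ∧ ρ3 12 = seed m * 2 ^ wordLen m +
      enc (codeword m (seed m) (message (pieceExp d) m (X i) t)) ∧ ρ3 13 = 0 := by
    rw [← hρ3, LP.run_rem _ _ _ (by norm_num),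
      ← hT.codewords.getD (seed_lt m) (message_lt hηm htη)]
    simp [e2, h11, h16, hT.seed, message, digit, -List.getD_eq_getElem?_getD]
  clear hρ3 e2 ρ2
  rw [LP.run_assign, Function.update_self]
  have e4 : ∀ ρ, (LP.loop 13 (.assign 12 (.sel (.less (.var 13) (.var 6)) (.half (.var 12))
      (.var 12)) ;; .assign 13 (.add (.var 13) (.lit 1)))).run I A ρ 3 = ρ 3 := fun ρ =>
    LP.run_frame _ _ _ _ _ (by decide)
  have e5 := shift_loop (I := I) (A := A) (c := 13) e3.2.2.2 (by rw [e3.2.1, h13]; exact huW.le)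
  rw [e3.2.1, e3.2.2.1] at e5
  simp only [Ex.eval, Ex.eval_bit, e4, e5, e3.1, h17]
  -- The table entry also contains the seed, above bit `wordLen m`; it does not affect the bit at `u
  -- < wordLen m`.
  have e6 : (seed m * 2 ^ wordLen m + enc (codeword m (seed m) (message (pieceExp d) m (X i) t)))
      / 2 ^ u % 2 = enc (codeword m (seed m) (message (pieceExp d) m (X i) t)) / 2 ^ u % 2 := by
    obtain ⟨k, hk⟩ := Nat.exists_eq_add_of_lt huW
    rw [show seed m * 2 ^ wordLen m = 2 ^ u * (seed m * 2 ^ k * 2) by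
      rw [hk, pow_succ, pow_add]; ring, Nat.mul_add_div (by positivity), Nat.mul_add_mod_self_right]
  rw [e6]
  by_cases h : o < R <;> simp [h]

theorem compileCmd_spec (hA : Params d q K A) {y : Fin K → Fin q}
    (hI : I.getD 1 [] = tape (List.ofFn y)) :
    compileCmd.run I A 72 = tape (List.ofFn (compiled d y)) := by
  have hT := tableCmd_spec (I := I) rfl hA
  have p1 : Params d q K (tableCmd.run I A) := hA.run rfl (by decide)
  simp only [compileCmd, Cmd.run]
  generalize tableCmd.run I A = A1 at *
  have p2 : Params d q K (Cmd.run I (.tab 71 42 contentLP 1) A1) := p1.run rfl (by decide)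
  have h42 : hd A1 42 = blockCount d q K := p1 42 (by norm_num)
  have c2 : ∀ i < blockCount d q K, (Cmd.run I (.tab 71 42 contentLP 1) A1 71).getD i 0
      = content d q K (extend y) i := by
    intro i hi
    rw [Cmd.run, Function.update_self, h42, getD_map_range _ hi, run_contentLP p1 hI]
  have t2 : HasTables (Cmd.run I (.tab 71 42 contentLP 1) A1) (2 ^ msgExp d K) := by
    constructor
    · rw [HasCodewords, Cmd.run_frame _ _ _ _ (by decide)]; exact hT.codewords
    · rw [Cmd.run_frame _ _ _ _ (by decide)]; exact hT.table
    · rw [Cmd.hd_run_frame _ _ _ _ (by decide)]; exact hT.seed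
  simp only [Cmd.run] at p2 c2 t2
  generalize Function.update A1 71 _ = A2 at *
  have h43 : hd A2 43 = codeLen d q K := p2 43 (by norm_num)
  rw [Function.update_self, h43]
  refine List.ext_getElem (by simp [tape]) fun p h1 h2 => ?_
  have hp : p < codeLen d q K := by simpa using h1
  rw [List.getElem_map, List.getElem_range, run_outputLP rfl p2 t2 c2 hp]
  simp only [tape, List.getElem_map, List.getElem_ofFn, compiled, codeBits]
  have hb : ∀ b : Bool, b.toNat = ((if b = true then 1 else 0 : Fin 2) : ℕ) := by decide
  exact hb _

end

/-! ### The program that recovers -/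

/-- Distinctness. -/
def Ex.neq (e f : Ex) : Ex := .add (.sub e f) (.sub f e)

theorem Ex.eval_neq {I : Tapes} {A : Regs} {ρ : ℕ → ℕ} (e f : Ex) :
    (Ex.neq e f).eval I A ρ ≠ 0 ↔ e.eval I A ρ ≠ f.eval I A ρ := by
  simp only [Ex.neq, Ex.eval]; omega

/-- A letter of the received word. -/
def Ex.letter (e : Ex) : Ex := .sel (.rd 2 e) (.sub (.rd 2 e) (.lit 1)) (.lit 1)

theorem Ex.eval_letter {I : Tapes} {A : Regs} {ρ : ℕ → ℕ} {w : List (Fin 2)}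
    (hI : I.getD 2 [] = tape w) (e : Ex) :
    (Ex.letter e).eval I A ρ = (bitsOf w (e.eval I A ρ)).toNat := by
  simp only [Ex.letter, Ex.eval, hI, bitsOf, tape, List.getElem?_map]
  cases h : w[e.eval I A ρ]? with
  | none => simp
  | some b =>
    have : ∀ b : Fin 2, (b : ℕ) = (decide (b = 1)).toNat := by decide
    simp [this b]

/-- The number of ones in the marker, which is then checked. -/
def markLP : LP :=
  .assign 2 (.half (.par 44)) ;; .assign 3 (.sub (.var 0) (.var 2)) ;;
  .loop 17 (.assign 4 (.add (.var 4) (.letter (.var 3))) ;;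
    .assign 3 (.add (.var 3) (.lit 1))) ;;
  .assign 5 (.sel (.sub (.var 4) (.add (.add (.par 11) (.par 11)) (.add (.par 11) (.par 11))))
    (.lit 0) (.lit 1)) ;;
  .assign 6 (.par 68) ;; .shl 6 13

/-- The window of a piece, as a number. -/
def windowLP : LP :=
  .assign 7 (.lit 0) ;; .assign 8 (.lit 1) ;;
  .loop 13 (.assign 7 (.add (.var 7) (.sel (.letter (.var 3)) (.var 8) (.lit 0))) ;;
    .assign 8 (.add (.var 8) (.var 8)) ;; .assign 3 (.add (.var 3) (.lit 1)))

/-- The check of a piece. -/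
def pieceLP : LP :=
  .assign 9 (.get 65 (.add (.var 6) (.var 7))) ;; .assign 10 (.sub (.var 9) (.lit 1)) ;;
  .quot 11 10 16 ;;
  .assign 5 (.sel (.var 9) (.sel (.neq (.var 11) (.var 12)) (.lit 0) (.var 5)) (.lit 0)) ;;
  .rem 13 10 16 ;; .shl 1 16 ;; .assign 1 (.add (.var 1) (.var 13)) ;;
  .assign 12 (.add (.var 12) (.lit 1))

/-- The labels of all positions. -/
def labelLP : LP :=
  markLP ;; .loop 15 (windowLP ;; pieceLP) ;;
  .assign 1 (.sel (.less (.var 0) (.var 2)) (.lit 0) (.sel (.var 5) (.add (.var 1) (.lit 1)) (.lit 0)))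

section
variable {I : Tapes} {A : Regs} {w : List (Fin 2)}

theorem enc_win_succ (V : ℕ → Bool) (p k : ℕ) :
    enc (win V p (k + 1)) = enc (win V p k) + 2 ^ k * (V (p + k)).toNat := by
  rw [win_add, enc_append, length_win]
  simp [win, enc]

theorem ones_succ (V : ℕ → Bool) (p k : ℕ) :
    ones V p (k + 1) = ones V p k + (V (p + k)).toNat := by
  rw [ones_add]
  simp only [ones, win, List.range_one, List.map_cons, List.map_nil, add_zero]
  cases V (p + k) <;> simp

theorem run_windowLP (hI : I.getD 2 [] = tape w) {ρ : ℕ → ℕ} {W p : ℕ} (h13 : hd A 13 = W)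
    (h3 : ρ 3 = p) :
    windowLP.run I A ρ 7 = enc (win (bitsOf w) p W) ∧ windowLP.run I A ρ 3 = p + W := by
  unfold windowLP
  simp only [LP.run_seq]
  generalize hρ1 : (LP.assign 8 (.lit 1)).run I A _ = ρ1
  have e1 : ρ1 3 = p ∧ ρ1 7 = 0 ∧ ρ1 8 = 1 := by rw [← hρ1]; simp [h3]
  have := LP.loop_induct (I := I) (A := A) (c := 13) (ρ := ρ1)
    (P := .assign 7 (.add (.var 7) (.sel (.letter (.var 3)) (.var 8) (.lit 0))) ;;
      .assign 8 (.add (.var 8) (.var 8)) ;; .assign 3 (.add (.var 3) (.lit 1)))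
    (M := fun k ρ => ρ 7 = enc (win (bitsOf w) p k) ∧ ρ 3 = p + k ∧ ρ 8 = 2 ^ k)
    (by simp [e1, win, enc]) ?_
  · rw [h13] at this
    exact ⟨this.1, this.2.1⟩
  · rintro k - ρ ⟨h1, h2, h3⟩
    refine ⟨?_, by simp [h2, add_assoc], by simp [h3]; ring⟩
    rw [enc_win_succ]
    simp only [LP.run_seq, LP.run_assign, Ex.eval, Ex.eval_letter hI, h1, h2, h3]
    cases bitsOf w (p + k) <;> simp

theorem run_pieceLP {ρ : ℕ → ℕ} {v : ℕ} (h16 : hd A 16 = v) :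
    pieceLP.run I A ρ 5 = (if (A 65).getD (ρ 6 + ρ 7) 0 ≠ 0 ∧
        ((A 65).getD (ρ 6 + ρ 7) 0 - 1) / 2 ^ v = ρ 12 then ρ 5 else 0) ∧
      pieceLP.run I A ρ 1 = ρ 1 * 2 ^ v + ((A 65).getD (ρ 6 + ρ 7) 0 - 1) % 2 ^ v ∧
      pieceLP.run I A ρ 12 = ρ 12 + 1 := by
  unfold pieceLP
  simp only [LP.run_seq, LP.run_rem I A _ (show (10 : ℕ) ≠ 13 by norm_num)]
  generalize hE : (A 65).getD (ρ 6 + ρ 7) 0 = E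
  have h1 : (LP.assign 9 (.get 65 (.add (.var 6) (.var 7)))).run I A ρ = Function.update ρ 9 E := by
    simp only [LP.run_assign, Ex.eval, hE]
  rw [h1]
  refine ⟨?_, by simp [h16], by simp⟩
  simp only [LP.run_assign, LP.run_shl, LP.run_quot]
  simp only [Ex.eval]
  simp [h16, Ex.neq]
  split_ifs <;> first | rfl | omega

theorem run_markLP (hI : I.getD 2 [] = tape w) {Z R m W x : ℕ} (h44 : hd A 44 / 2 = Z)
    (h17 : hd A 17 = R) (h11 : hd A 11 = m) (h13 : hd A 13 = W) :
    markLP.run I A (laneInit x) 0 = x ∧ markLP.run I A (laneInit x) 1 = 0 ∧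
    markLP.run I A (laneInit x) 2 = Z ∧ markLP.run I A (laneInit x) 3 = x - Z + R ∧
    markLP.run I A (laneInit x) 5 = (if ones (bitsOf w) (x - Z) R ≤ 4 * m then 1 else 0) ∧
    markLP.run I A (laneInit x) 6 = hd A 68 * 2 ^ W ∧ markLP.run I A (laneInit x) 12 = 0 := by
  unfold markLP
  simp only [LP.run_seq]
  generalize hρ1 : (LP.assign 3 _).run I A _ = ρ1
  have e1 : ρ1 0 = x ∧ ρ1 1 = 0 ∧ ρ1 2 = Z ∧ ρ1 3 = x - Z ∧ ρ1 4 = 0 ∧ ρ1 12 = 0 := by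
    rw [← hρ1]; simp [laneInit, h44]
  clear hρ1
  generalize hρ2 : (LP.loop 17 _).run I A ρ1 = ρ2
  have e2 := LP.loop_induct (I := I) (A := A) (c := 17) (ρ := ρ1)
    (P := .assign 4 (.add (.var 4) (.letter (.var 3))) ;; .assign 3 (.add (.var 3) (.lit 1)))
    (M := fun k ρ => ρ 0 = x ∧ ρ 1 = 0 ∧ ρ 2 = Z ∧ ρ 3 = x - Z + k ∧
      ρ 4 = ones (bitsOf w) (x - Z) k ∧ ρ 12 = 0)
    (by simp [e1, ones, win]) ?_
  · rw [hρ2, h17] at e2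
    refine ⟨by simp [e2], by simp [e2], by simp [e2], by simp [e2], ?_, by simp [e2, h13],
      by simp [e2]⟩
    simp [e2, h11]
    split_ifs <;> first | rfl | omega
  · rintro k - ρ ⟨h1, h2, h3, h4, h5, h6⟩
    refine ⟨by simp [h1], by simp [h2], by simp [h3], by simp [h4, add_assoc], ?_, by simp [h6]⟩
    rw [ones_succ]
    simp only [LP.run_seq, LP.run_assign, Ex.eval, Ex.eval_letter hI, h4, h5]
    simp

variable {d q K : ℕ}

/-- The loop runs through the pieces. Variable `5` is a flag that says whether the marker and all
pieces so far passed their checks, and variable `1` accumulates the digits by Horner's rule;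
together they evaluate `labelAt`. -/
theorem run_labelLP {m : ℕ} (hm : m = 2 ^ msgExp d K) (hA : Params d q K A) (hT : HasTables A m)
    (hI : I.getD 2 [] = tape w) {x : ℕ} (hx : x < 8 * codeLen d q K) :
    labelLP.run I A (laneInit x) 1
      = Layout.lab (pieceExp d) m (seed m) (blockCount d q K) (bitsOf w) x := by
  have h11 : hd A 11 = m := by rw [hm]; exact hA 11 (by norm_num)
  have h13 : hd A 13 = wordLen m := by rw [hm]; exact hA 13 (by norm_num)
  have h15 : hd A 15 = 2 ^ pieceExp d := hA 15 (by norm_num)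
  have h16 : hd A 16 = m - pieceExp d := by rw [hm]; exact hA 16 (by norm_num)
  have h17 : hd A 17 = markLen (pieceExp d) m := by rw [hm]; exact hA 17 (by norm_num)
  have h44 : hd A 44 / 2 = 4 * codeLen d q K := by
    rw [hA 44 (by norm_num)]
    change 8 * codeLen d q K / 2 = _
    omega
  obtain ⟨a0, a1, a2, a3, a5, a6, a12⟩ := run_markLP (x := x) hI h44 h17 h11 h13
  unfold labelLP
  simp only [LP.run_seq]
  generalize markLP.run I A (laneInit x) = ρ1 at *
  set p := x - 4 * codeLen d q K with hp
  set R := markLen (pieceExp d) m with hR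
  set v := m - pieceExp d with hv
  set E := entry (pieceExp d) m (seed m) (bitsOf w) p with hE
  generalize hρ2 : (LP.loop 15 _).run I A ρ1 = ρ2
  have e2 := LP.loop_induct (I := I) (A := A) (c := 15) (ρ := ρ1) (P := windowLP ;; pieceLP)
    (M := fun k ρ => ρ 0 = x ∧ ρ 2 = 4 * codeLen d q K ∧ ρ 3 = p + R + wordLen m * k ∧
      ρ 6 = seed m * 2 ^ wordLen m ∧ ρ 12 = k ∧ ρ 1 = horner v (fun t => (E t - 1) % 2 ^ v) k ∧
      ρ 5 = if ones (bitsOf w) p R ≤ 4 * m ∧ ∀ t < k, E t ≠ 0 ∧ (E t - 1) / 2 ^ v = t then 1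
        else 0)
    (by simp [a0, a1, a2, a3, a5, a6, a12, hT.seed, horner]) ?_
  · rw [hρ2, h15] at e2
    obtain ⟨b0, b2, -, -, -, b1, b5⟩ := e2
    have hlab : Layout.lab (pieceExp d) m (seed m) (blockCount d q K) (bitsOf w) x
        = if x < 4 * codeLen d q K then 0 else labelAt (pieceExp d) m (seed m) (bitsOf w) p := by
      have h1 : blockCount d q K * blockLen (pieceExp d) m = codeLen d q K := by
        rw [hm]; exact codeLen_eq d q K
      rw [Layout.lab, labels, h1]
      by_cases h : x < 4 * codeLen d q K
      · simp [h]
      · rw [if_neg (by omega), if_neg h]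
    rw [hlab, labelAt]
    simp only [LP.run_assign, Function.update_self, Ex.eval, b0, b1, b2, b5]
    split_ifs <;> first | rfl | omega
  · rintro k - ρ ⟨b0, b2, b3, b6, b12, b1, b5⟩
    obtain ⟨c7, c3⟩ := run_windowLP (A := A) hI h13 b3
    have hfr : ∀ x, x ≠ 7 → x ≠ 8 → x ≠ 3 → windowLP.run I A ρ x = ρ x := fun x h1 h2 h3 =>
      LP.run_frame _ _ _ _ _ (by simp [windowLP, LP.writes, h1, h2, h3])
    have hfr' : ∀ ρ x, x ≠ 9 → x ≠ 10 → x ≠ 11 → x ≠ 5 → x ≠ 13 → x ≠ 1 → x ≠ 12 →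
      pieceLP.run I A ρ x = ρ x := fun ρ x h1 h2 h3 h4 h5 h6 h7 =>
      LP.run_frame _ _ _ _ _ (by
        simp [pieceLP, LP.writes, LP.quot, LP.rem, LP.shr, LP.shl, h1, h2, h3, h4, h5, h6, h7])
    rw [LP.run_seq]
    obtain ⟨d5, d1, d12⟩ := run_pieceLP (I := I) (ρ := windowLP.run I A ρ) h16
    have hent : (A 65).getD (windowLP.run I A ρ 6 + windowLP.run I A ρ 7) 0 = E k := by
      have h1 := enc_lt (win (bitsOf w) (p + R + wordLen m * k) (wordLen m))
      have h2 := dec_enc (win (bitsOf w) (p + R + wordLen m * k) (wordLen m))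
      rw [length_win] at h1 h2
      rw [hfr 6 (by norm_num) (by norm_num) (by norm_num), b6, c7,
        hT.table (seed m) (seed_lt m) _ h1, h2, hE, entry]
    rw [hent] at d5 d1
    refine ⟨?_, ?_, ?_, ?_, ?_, ?_, ?_⟩
    · rw [hfr' _ 0 (by norm_num) (by norm_num) (by norm_num) (by norm_num) (by norm_num) (by norm_num)
        (by norm_num), hfr 0 (by norm_num) (by norm_num) (by norm_num), b0]
    · rw [hfr' _ 2 (by norm_num) (by norm_num) (by norm_num) (by norm_num) (by norm_num) (by norm_num)
        (by norm_num), hfr 2 (by norm_num) (by norm_num) (by norm_num), b2]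
    · rw [hfr' _ 3 (by norm_num) (by norm_num) (by norm_num) (by norm_num) (by norm_num) (by norm_num)
        (by norm_num), c3]
      ring
    · rw [hfr' _ 6 (by norm_num) (by norm_num) (by norm_num) (by norm_num) (by norm_num) (by norm_num)
        (by norm_num), hfr 6 (by norm_num) (by norm_num) (by norm_num), b6]
    · rw [d12, hfr 12 (by norm_num) (by norm_num) (by norm_num), b12]
    · rw [d1, hfr 1 (by norm_num) (by norm_num) (by norm_num), b1, horner]
    · rw [d5, hfr 12 (by norm_num) (by norm_num) (by norm_num),
        hfr 5 (by norm_num) (by norm_num) (by norm_num), b5, b12]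
      have h1 : (∀ t < k + 1, E t ≠ 0 ∧ (E t - 1) / 2 ^ v = t) ↔
          (∀ t < k, E t ≠ 0 ∧ (E t - 1) / 2 ^ v = t) ∧ E k ≠ 0 ∧ (E k - 1) / 2 ^ v = k := by
        refine ⟨fun h => ⟨fun t ht => h t (by omega), h k (by omega)⟩, fun h t ht => ?_⟩
        rcases Nat.lt_succ_iff_lt_or_eq.1 ht with h' | rfl
        · exact h.1 t h'
        · exact h.2
      rw [← ite_and]
      refine if_congr ?_ rfl rfl
      rw [h1]
      tauto

end

/-! ### Samples, search and symbols as programs. -/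

/-- The samples, from the coins in register `75`. -/
def sampleLP : LP :=
  .loop 21 (.assign 2 (.add (.var 2) (.var 0))) ;; .assign 3 (.lit 1) ;;
  .loop 21 (.assign 1 (.add (.var 1) (.sel (.get 75 (.var 2)) (.var 3) (.lit 0))) ;;
    .assign 3 (.add (.var 3) (.var 3)) ;; .assign 2 (.add (.var 2) (.lit 1)))

/-- The tallies of a step of the search. -/
def tallyLP : LP :=
  .assign 4 (.get 76 (.var 5)) ;;
  .assign 6 (.sub (.add (.var 3) (.var 4)) (.par 78)) ;; .assign 7 (.get 73 (.var 6)) ;;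
  .assign 8 (.sub (.var 7) (.lit 1)) ;; .rem 9 8 0 ;; .shl 9 10 ;;
  .assign 10 (.sub (.var 6) (.var 9)) ;;
  .assign 11 (.add (.var 11) (.sel (.var 7) (.lit 1) (.lit 0))) ;;
  .assign 12 (.add (.var 12) (.sel (.var 7) (.less (.add (.var 2) (.var 13)) (.var 10)) (.lit 0))) ;;
  .assign 14 (.add (.var 14) (.sel (.var 7) (.less (.add (.var 10) (.var 13)) (.var 2)) (.lit 0))) ;;
  .assign 5 (.add (.var 5) (.lit 1))

/-- A step of the search. -/
def stepLP : LP :=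
  .assign 2 (.get 77 (.var 0)) ;; .assign 3 (.var 0) ;; .shl 3 10 ;;
  .assign 3 (.add (.var 3) (.var 2)) ;; .assign 13 (.half (.half (.half (.par 78)))) ;;
  .loop 23 tallyLP ;;
  .assign 1 (.sel (.less (.var 11) (.add (.var 12) (.var 12)))
    (.add (.var 2) (.half (.half (.par 78))))
    (.sel (.less (.var 11) (.add (.var 14) (.var 14)))
      (.sub (.var 2) (.half (.half (.par 78)))) (.var 2)))

/-- The search. -/
def searchCmd : Cmd :=
  .tab 77 42 (valLP (.half (.par 44))) 1 ;;; .tab 78 41 (powLP 1 21 ;; .assign 1 (.half (.var 1))) 1 ;;;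
  .loop 22 (.tab 77 42 stepLP 1 ;;; .tab 76 23 (valLP (.half (.get 76 (.var 0)))) 1 ;;;
    .tab 78 41 (valLP (.half (.par 78))) 1)

/-- The labels of the blocks. -/
def scanLP : LP :=
  .assign 2 (.var 0) ;; .shl 2 10 ;;
  .assign 2 (.sub (.add (.var 2) (.get 77 (.var 0))) (.half (.sub (.par 25) (.lit 1)))) ;;
  .loop 25 (.assign 3 (.get 73 (.var 2)) ;; .assign 4 (.sub (.var 3) (.lit 1)) ;; .rem 5 4 0 ;;
    .assign 1 (.sel (.var 3) (.sel (.neq (.var 5) (.var 0)) (.var 1) (.var 3)) (.var 1)) ;;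
    .assign 2 (.add (.var 2) (.lit 1)))

/-- The symbols. -/
def symbolLP : LP :=
  .quot 2 0 5 ;; .rem 5 0 5 ;; .assign 7 (.sub (.get 79 (.var 2)) (.lit 1)) ;; .shr 7 0 ;;
  digitLP 18 19 ;; .rem 9 7 19 ;; .assign 1 (.sel (.less (.var 9) (.par 60)) (.var 9) (.lit 0))

/-- The stages that use the coins. -/
def recoverCmd : Cmd :=
  tableCmd ;;; .tab 73 44 labelLP 1 ;;; .tab 76 23 sampleLP 1 ;;; searchCmd ;;;
  .tab 79 42 scanLP 1 ;;; .tab 80 40 symbolLP 1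

section
variable {I : Tapes} {A : Regs} {d q K : ℕ}

theorem run_sampleLP {L : ℕ} (h21 : hd A 21 = L) (hl : ∀ b ∈ A 75, b ≤ 1) (t : ℕ) :
    sampleLP.run I A (laneInit t) 1 = sample L (A 75) t := by
  unfold sampleLP
  simp only [LP.run_seq]
  generalize hρ1 : (LP.loop 21 (.assign 2 (.add (.var 2) (.var 0)))).run I A (laneInit t) = ρ1
  have e1 := LP.loop_induct (I := I) (A := A) (c := 21) (ρ := laneInit t)
    (P := .assign 2 (.add (.var 2) (.var 0)))
    (M := fun k ρ => ρ 0 = t ∧ ρ 1 = 0 ∧ ρ 2 = t * k) (by simp [laneInit])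
    (by rintro k - ρ ⟨h1, h2, h3⟩; exact ⟨by simp [h1], by simp [h2], by simp [h1, h3]; ring⟩)
  rw [hρ1, h21] at e1
  generalize hρ2 : (LP.assign 3 (.lit 1)).run I A ρ1 = ρ2
  have e2 : ρ2 1 = 0 ∧ ρ2 2 = t * L ∧ ρ2 3 = 1 := by rw [← hρ2]; simp [e1]
  have := LP.loop_induct (I := I) (A := A) (c := 21) (ρ := ρ2)
    (P := .assign 1 (.add (.var 1) (.sel (.get 75 (.var 2)) (.var 3) (.lit 0))) ;;
      .assign 3 (.add (.var 3) (.var 3)) ;; .assign 2 (.add (.var 2) (.lit 1)))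
    (M := fun k ρ => ρ 1 = ∑ j ∈ Finset.range k, (A 75).getD (t * L + j) 0 * 2 ^ j ∧
      ρ 2 = t * L + k ∧ ρ 3 = 2 ^ k) (by simp [e2]) ?_
  · rw [h21] at this
    exact this.1
  · rintro k - ρ ⟨h1, h2, h3⟩
    refine ⟨?_, by simp [h2, add_assoc], by simp [h3]; ring⟩
    have h4 : (A 75).getD (t * L + k) 0 ≤ 1 := getD_le hl _
    rw [Finset.sum_range_succ]
    simp only [LP.run_seq, LP.run_assign, Ex.eval, h1, h2, h3]
    generalize (A 75).getD (t * L + k) 0 = b at *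
    interval_cases b <;> simp

theorem run_tallyLP {ρ : ℕ → ℕ} {lam c : ℕ} (h0 : hd A 0 = lam) (h10 : hd A 10 = c) {lab : ℕ → ℕ}
    (hlab : ∀ x, (A 73).getD x 0 = lab x) {u y : ℕ} (hu : (A 76).getD (ρ 5) 0 = u)
    (hy : ρ 3 + u - hd A 78 = y) :
    tallyLP.run I A ρ 2 = ρ 2 ∧ tallyLP.run I A ρ 3 = ρ 3 ∧ tallyLP.run I A ρ 13 = ρ 13 ∧
    tallyLP.run I A ρ 5 = ρ 5 + 1 ∧
    tallyLP.run I A ρ 11 = ρ 11 + (if lab y ≠ 0 then 1 else 0) ∧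
    tallyLP.run I A ρ 12 = ρ 12 +
      (if lab y ≠ 0 ∧ ρ 2 + ρ 13 < offset lab (2 ^ c) lam y then 1 else 0) ∧
    tallyLP.run I A ρ 14 = ρ 14 +
      (if lab y ≠ 0 ∧ offset lab (2 ^ c) lam y + ρ 13 < ρ 2 then 1 else 0) := by
  have e1 : (LP.assign 8 (.sub (.var 7) (.lit 1))).run I A ((LP.assign 7 (.get 73 (.var 6))).run I A
      ((LP.assign 6 (.sub (.add (.var 3) (.var 4)) (.par 78))).run I A
      ((LP.assign 4 (.get 76 (.var 5))).run I A ρ))) = Function.update (Function.update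
      (Function.update (Function.update ρ 4 u) 6 y) 7 (lab y)) 8 (lab y - 1) := by
    simp only [LP.run_assign, Ex.eval, hu]
    simp [hy, hlab, -List.getD_eq_getElem?_getD]
  unfold tallyLP
  simp only [LP.run_seq]
  rw [e1, LP.run_rem _ _ _ (by norm_num)]
  simp only [LP.run_shl, LP.run_assign]
  simp [h0, h10, offset]
  constructor
  · by_cases h : lab y = 0 <;> simp [h]
  · by_cases h : lab y = 0 <;> simp [h]

theorem run_stepLP {lam c N P i : ℕ} (h0 : hd A 0 = lam) (h10 : hd A 10 = c) (h23 : hd A 23 = N)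
    (h78 : hd A 78 = P) {lab : ℕ → ℕ} (hlab : ∀ x, (A 73).getD x 0 = lab x) {u : ℕ → ℕ}
    (hu : ∀ t < N, (A 76).getD t 0 = u t) :
    stepLP.run I A (laneInit i) 1 = searchStep lab (2 ^ c) lam N u P i ((A 77).getD i 0) := by
  have hP8 : P / 2 / 2 / 2 = P / 8 := by omega
  have hP4 : P / 2 / 2 = P / 4 := by omega
  unfold stepLP
  simp only [LP.run_seq]
  generalize hρ1 : (LP.assign 13 _).run I A _ = ρ1
  set Δ := (A 77).getD i 0 with hΔ
  have e1 : ρ1 2 = Δ ∧ ρ1 3 = i * 2 ^ c + Δ ∧ ρ1 5 = 0 ∧ ρ1 11 = 0 ∧ ρ1 12 = 0 ∧ ρ1 13 = P / 8 ∧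
      ρ1 14 = 0 := by
    rw [← hρ1]
    simp [laneInit, h10, h78, hP8, hΔ]
  clear hρ1
  generalize hρ2 : (LP.loop 23 tallyLP).run I A ρ1 = ρ2
  have e2 := LP.loop_induct (I := I) (A := A) (c := 23) (ρ := ρ1) (P := tallyLP)
    (M := fun k ρ => ρ 2 = Δ ∧ ρ 3 = i * 2 ^ c + Δ ∧ ρ 13 = P / 8 ∧ ρ 5 = k ∧
      ρ 11 = tally k (fun t => lab (i * 2 ^ c + Δ + u t - P) ≠ 0) ∧
      ρ 12 = tally k (fun t => lab (i * 2 ^ c + Δ + u t - P) ≠ 0 ∧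
        Δ + P / 8 < offset lab (2 ^ c) lam (i * 2 ^ c + Δ + u t - P)) ∧
      ρ 14 = tally k (fun t => lab (i * 2 ^ c + Δ + u t - P) ≠ 0 ∧
        offset lab (2 ^ c) lam (i * 2 ^ c + Δ + u t - P) + P / 8 < Δ))
    (by simp [e1, tally]) ?_
  · rw [hρ2, h23] at e2
    obtain ⟨b2, -, -, -, b11, b12, b14⟩ := e2
    rw [LP.run_assign, Function.update_self]
    simp only [Ex.eval, b2, b11, b12, b14, h78, hP4, searchStep, ← two_mul]
    split_ifs <;> first | rfl | omega
  · rintro k hk ρ ⟨b2, b3, b13, b5, b11, b12, b14⟩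
    rw [h23] at hk
    obtain ⟨c2, c3, c13, c5, c11, c12, c14⟩ := run_tallyLP (I := I) (ρ := ρ)
      (y := i * 2 ^ c + Δ + u k - P) h0 h10 hlab
      (u := u k) (by rw [b5, hu k hk]) (by rw [b3, h78])
    refine ⟨by rw [c2, b2], by rw [c3, b3], by rw [c13, b13], by rw [c5, b5], ?_, ?_, ?_⟩
    · rw [c11, b11]; exact (Finset.sum_range_succ _ _).symm
    · rw [c12, b12, b2, b13]; exact (Finset.sum_range_succ _ _).symm
    · rw [c14, b14, b2, b13]; exact (Finset.sum_range_succ _ _).symm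

/-- All blocks are searched in parallel with the same samples. In every round the samples and the
scale in register `78` are halved, which realizes `rho t / 2 ^ k` and `2 ^ J / 2 ^ k`. -/
theorem searchCmd_spec (hA : Params d q K A) {lab : ℕ → ℕ} (hlab : ∀ x, (A 73).getD x 0 = lab x)
    {rho : ℕ → ℕ} {N : ℕ} (hN : N = sampleCount (pieceExp d) (Nat.log 2 (codeLen d q K)))
    (hrho : ∀ t < N, (A 76).getD t 0 = rho t) :
    ∀ i < blockCount d q K, (searchCmd.run I A 77).getD i 0 =
      search lab (2 ^ blockExp d K) (indexBits K) N rho (Nat.log 2 (codeLen d q K))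
        (4 * codeLen d q K) i (logLen d q K - blockExp d K) := by
  set J := Nat.log 2 (codeLen d q K) with hJ
  have h42 : ∀ A, Params d q K A → hd A 42 = blockCount d q K := fun A h => h 42 (by norm_num)
  have h41 : ∀ A, Params d q K A → hd A 41 = 1 := fun A h => h 41 (by norm_num)
  have h22 : ∀ A, Params d q K A → hd A 22 = logLen d q K - blockExp d K := fun A h => h 22 (by norm_num)
  have h23 : ∀ A, Params d q K A → hd A 23 = N := fun A h => by rw [hN]; exact h 23 (by norm_num)
  have h21 : hd A 21 = J + 1 := hA 21 (by norm_num)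
  have h44 : hd A 44 = 8 * codeLen d q K := hA 44 (by norm_num)
  set C0 : Cmd := .tab 77 42 (valLP (.half (.par 44))) 1 ;;;
    .tab 78 41 (powLP 1 21 ;; .assign 1 (.half (.var 1))) 1 with hC0
  set C1 : Cmd := .tab 77 42 stepLP 1 ;;; .tab 76 23 (valLP (.half (.get 76 (.var 0)))) 1 ;;;
    .tab 78 41 (valLP (.half (.par 78))) 1 with hC1
  have hrun : searchCmd.run I A = (Cmd.loop 22 C1).run I (C0.run I A) := rfl
  have p0 : Params d q K (C0.run I A) := hA.run rfl (by decide)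
  rw [hrun]
  have := Cmd.loop_induct (I := I) (A := C0.run I A) (c := 22) (C := C1) (M := fun k A' =>
    Params d q K A' ∧ (∀ x, (A' 73).getD x 0 = lab x) ∧ hd A' 78 = 2 ^ J / 2 ^ k ∧
    (∀ t < N, (A' 76).getD t 0 = rho t / 2 ^ k) ∧ ∀ i < blockCount d q K, (A' 77).getD i 0 =
      search lab (2 ^ blockExp d K) (indexBits K) N rho J (4 * codeLen d q K) i k)
    ⟨p0, ?_, ?_, ?_, ?_⟩ ?_
  · rw [h22 _ p0] at this
    exact this.2.2.2.2
  · rw [Cmd.run_frame _ _ _ _ (by decide)]; exact hlab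
  · simp only [hC0, Cmd.run]
    rw [hd_update_of_ne (show (41 : ℕ) ≠ 77 by norm_num), h41 A hA]
    simp [powLP, hd_update_of_ne, h21, hd_update_self, pow_succ]
  · intro t ht
    rw [Cmd.run_frame _ _ _ _ (by decide), hrho t ht]; simp
  · intro i hi
    simp only [hC0, Cmd.run]
    rw [Function.update_of_ne (by norm_num), Function.update_self, h42 A hA, getD_map_range _ hi]
    simp [valLP, h44, search]
    omega
  · rintro k - A' ⟨p, g73, g78, g76, g77⟩
    refine ⟨p.run rfl (by decide), ?_, ?_, fun t ht => ?_, fun i hi => ?_⟩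
    · rw [Cmd.run_frame _ _ _ _ (by decide)]; exact g73
    · simp only [hC1, Cmd.run]
      rw [hd_update_of_ne (show (41 : ℕ) ≠ 76 by norm_num),
        hd_update_of_ne (show (41 : ℕ) ≠ 77 by norm_num), h41 A' p]
      simp [valLP, hd_update_of_ne, g78, hd_update_self, pow_succ, Nat.div_div_eq_div_mul]
    · simp only [hC1, Cmd.run]
      rw [Function.update_of_ne (by norm_num), Function.update_self,
        hd_update_of_ne (show (23 : ℕ) ≠ 77 by norm_num), h23 A' p, getD_map_range _ ht]
      have := g76 t ht
      simp [valLP, laneInit, Function.update_of_ne, -List.getD_eq_getElem?_getD, this,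
        Nat.div_div_eq_div_mul, pow_succ]
    · simp only [hC1, Cmd.run]
      rw [Function.update_of_ne (by norm_num), Function.update_of_ne (by norm_num),
        Function.update_self, h42 A' p, getD_map_range _ hi,
        run_stepLP (p 0 (by norm_num)) (p 10 (by norm_num)) (h23 A' p) g78 g73 g76, g77 i hi]
      rfl

theorem run_scanLP (hA : Params d q K A) {lab : ℕ → ℕ} (hlab : ∀ x, (A 73).getD x 0 = lab x) (i : ℕ) :
    scanLP.run I A (laneInit i) 1 = scan lab (indexBits K) i
      (i * 2 ^ blockExp d K + (A 77).getD i 0 - 2 ^ blockExp d K / 4) (2 ^ blockExp d K / 2 + 1) := by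
  have h0 : hd A 0 = indexBits K := hA 0 (by norm_num)
  have h10 : hd A 10 = blockExp d K := hA 10 (by norm_num)
  have h25 : hd A 25 = 2 ^ blockExp d K / 2 + 1 := hA 25 (by norm_num)
  have hB : 2 ^ blockExp d K / 2 / 2 = 2 ^ blockExp d K / 4 := by omega
  unfold scanLP
  simp only [LP.run_seq]
  generalize hρ1 : (LP.assign 2 (.sub _ _)).run I A _ = ρ1
  set x := i * 2 ^ blockExp d K + (A 77).getD i 0 - 2 ^ blockExp d K / 4 with hx
  have e1 : ρ1 0 = i ∧ ρ1 1 = 0 ∧ ρ1 2 = x := by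
    rw [← hρ1]
    simp [laneInit, h10, h25, hB, hx]
  clear hρ1
  generalize hρ2 : (LP.loop 25 _).run I A ρ1 = ρ2
  have e2 := LP.loop_induct (I := I) (A := A) (c := 25) (ρ := ρ1)
    (P := .assign 3 (.get 73 (.var 2)) ;; .assign 4 (.sub (.var 3) (.lit 1)) ;; .rem 5 4 0 ;;
      .assign 1 (.sel (.var 3) (.sel (.neq (.var 5) (.var 0)) (.var 1) (.var 3)) (.var 1)) ;;
      .assign 2 (.add (.var 2) (.lit 1)))
    (M := fun k ρ => ρ 0 = i ∧ ρ 2 = x + k ∧ ρ 1 = scan lab (indexBits K) i x k)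
    (by simp [e1, scan]) ?_
  · rw [hρ2, h25] at e2
    exact e2.2.2
  · rintro k - ρ ⟨b0, b2, b1⟩
    have g3 : (LP.assign 3 (.get 73 (.var 2))).run I A ρ = Function.update ρ 3 (lab (x + k)) := by
      simp only [LP.run_assign, Ex.eval, b2, hlab]
    simp only [LP.run_seq, g3, LP.run_rem I A _ (show (4 : ℕ) ≠ 5 by norm_num)]
    refine ⟨by simp [b0], by simp [b2, add_assoc], ?_⟩
    rw [scan]
    simp only [LP.run_assign]
    rw [Function.update_of_ne (by norm_num), Function.update_self]
    simp only [Ex.eval, Ex.eval_neq, Function.update_self]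
    simp [h0, b0, b1]
    split_ifs <;> first | rfl | omega

theorem run_symbolLP (hA : Params d q K A) {x : ℕ} (j : ℕ)
    (hx : (A 79).getD (j / 2 ^ groupExp d q K) 0 = x) :
    symbolLP.run I A (laneInit j) 1 = symbolOf d q K x (j % 2 ^ groupExp d q K) := by
  have h0 : hd A 0 = indexBits K := hA 0 (by norm_num)
  have h5 : hd A 5 = groupExp d q K := hA 5 (by norm_num)
  have h18 : hd A 18 = 2 ^ groupExp d q K := hA 18 (by norm_num)
  have h19 : hd A 19 = 2 ^ symExp q := hA 19 (by norm_num)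
  have h60 : hd A 60 = q := hA 60 (by norm_num)
  unfold symbolLP
  simp only [LP.run_seq]
  generalize hρ1 : (LP.shr 7 0).run I A _ = ρ1
  have e1 : ρ1 5 = j % 2 ^ groupExp d q K ∧ ρ1 7 = (x - 1) / 2 ^ indexBits K ∧ ρ1 8 = 0 := by
    rw [← hρ1, LP.run_rem _ _ _ (by norm_num)]
    simp [laneInit, h0, h5, hx, -List.getD_eq_getElem?_getD]
  clear hρ1
  rw [LP.run_rem _ _ _ (by norm_num), LP.run_assign, Function.update_self]
  simp only [Ex.eval, Function.update_self, run_digitLP 18 19 e1.2.2, h18, h19, h60, e1.1, e1.2.1]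
  simp only [symbolOf]
  split_ifs <;> first | rfl | omega

theorem recoverCmd_spec (hq : 0 < q) (hA : Params d q K A) {w : List (Fin 2)} (hI : I.getD 2 [] = tape w)
    (hl : ∀ b ∈ A 75, b ≤ 1) :
    recoverCmd.run I A 80 = tape (decoded d K hq (bitsOf w) (A 75)) := by
  set lab := Layout.lab (pieceExp d) (2 ^ msgExp d K) (seed (2 ^ msgExp d K)) (blockCount d q K)
    (bitsOf w) with hlabdef
  have hT := tableCmd_spec (I := I) rfl hA
  have p1 : Params d q K (tableCmd.run I A) := hA.run rfl (by decide)
  have c1 : tableCmd.run I A 75 = A 75 := Cmd.run_frame _ _ _ _ (by decide)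
  simp only [recoverCmd, Cmd.run]
  generalize tableCmd.run I A = A1 at *
  rw [← c1] at hl ⊢
  set l := A1 75 with hldef
  have h44 : hd A1 44 = 8 * codeLen d q K := p1 44 (by norm_num)
  have p2 : Params d q K (Cmd.run I (.tab 73 44 labelLP 1) A1) := p1.run rfl (by decide)
  have c2 : Cmd.run I (.tab 73 44 labelLP 1) A1 75 = l := Cmd.run_frame _ _ _ _ (by decide)
  have l2 : ∀ x, (Cmd.run I (.tab 73 44 labelLP 1) A1 73).getD x 0 = lab x := by
    intro x
    rw [Cmd.run, Function.update_self, h44]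
    rcases Nat.lt_or_ge x (8 * codeLen d q K) with h | h
    · rw [getD_map_range _ h, run_labelLP rfl p1 hT hI h]
    · rw [getD_map_range' _ h, hlabdef, Layout.lab, labels, codeLen_eq, if_pos (Or.inr h)]
  simp only [Cmd.run] at p2 c2 l2
  generalize Function.update A1 73 _ = A2 at *
  set N := sampleCount (pieceExp d) (Nat.log 2 (codeLen d q K)) with hN
  have h23 : hd A2 23 = N := p2 23 (by norm_num)
  have p3 : Params d q K (Cmd.run I (.tab 76 23 sampleLP 1) A2) := p2.run rfl (by decide)
  have l3 : ∀ x, (Cmd.run I (.tab 76 23 sampleLP 1) A2 73).getD x 0 = lab x := by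
    rw [Cmd.run_frame _ _ _ _ (by decide)]; exact l2
  have s3 : ∀ t < N, (Cmd.run I (.tab 76 23 sampleLP 1) A2 76).getD t 0
      = sample (logLen d q K) l t := by
    intro t ht
    rw [Cmd.run, Function.update_self, h23, getD_map_range _ ht,
      run_sampleLP (p2 21 (by norm_num)) (by rw [c2]; exact hl), c2]
    rfl
  simp only [Cmd.run] at p3 l3 s3
  generalize Function.update A2 76 _ = A3 at *
  have p4 : Params d q K (searchCmd.run I A3) := p3.run rfl (by decide)
  have l4 : ∀ x, (searchCmd.run I A3 73).getD x 0 = lab x := by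
    rw [Cmd.run_frame _ _ _ _ (by decide)]; exact l3
  have s4 := searchCmd_spec (I := I) p3 l3 hN s3
  generalize searchCmd.run I A3 = A4 at *
  have h42 : hd A4 42 = blockCount d q K := p4 42 (by norm_num)
  have p5 : Params d q K (Cmd.run I (.tab 79 42 scanLP 1) A4) := p4.run rfl (by decide)
  have s5 : ∀ i < blockCount d q K, (Cmd.run I (.tab 79 42 scanLP 1) A4 79).getD i 0
      = blockLabel d q K (bitsOf w) l i := by
    intro i hi
    rw [Cmd.run, Function.update_self, h42, getD_map_range _ hi, run_scanLP p4 l4, s4 i hi,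
      blockLabel, decodeBlock]
  simp only [Cmd.run] at p5 s5
  generalize Function.update A4 79 _ = A5 at *
  have h40 : hd A5 40 = K := p5 40 (by norm_num)
  rw [Function.update_self, h40]
  refine List.ext_getElem (by simp [tape, decoded]) fun j h1 h2 => ?_
  have hj : j < K := by simpa using h1
  have hi : j / 2 ^ groupExp d q K < blockCount d q K :=
    Nat.lt_succ_of_le (Nat.div_le_div_right hj.le)
  rw [List.getElem_map, List.getElem_range, run_symbolLP p5 j (s5 _ hi)]
  simp [tape, decoded, decodedAt]

end

/-! ### The costs of the programs -/

/-- A bound on the number of iterations of loops. -/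
def loopBound (d L : ℕ) : ℕ := 2 ^ 25 * (2 ^ pieceExp d * 2 ^ pieceExp d) * L ^ 2

/-- A bound on the sizes of stages, relative to the length of the compiled word. -/
def sizeBound (d L : ℕ) : ℕ :=
  loopBound d L + (2 ^ (2 ^ (16 + pieceExp d) + 1) + (8 + 2 ^ 23 * 2 ^ pieceExp d * L ^ 3))

/-- The binary logarithm of a bound on the entries of registers. -/
def entryBound (d c L : ℕ) : ℕ := L + sizeBound d L + (d * L + (c + 2))

theorem powerBounded_loopBound (d : ℕ) : PowerBounded (loopBound d) :=
  (PowerBounded.const _).mul (PowerBounded.id.pow 2)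

theorem powerBounded_sizeBound (d : ℕ) : PowerBounded (sizeBound d) :=
  (powerBounded_loopBound d).add ((PowerBounded.const _).add ((PowerBounded.const _).add
    ((PowerBounded.const _).mul (PowerBounded.id.pow 3))))

theorem powerBounded_entryBound (d c : ℕ) : PowerBounded (entryBound d c) :=
  (PowerBounded.id.add (powerBounded_sizeBound d)).add
    (((PowerBounded.const _).mul PowerBounded.id).add (PowerBounded.const _))

theorem Cmd.powerBounded_cost (d : ℕ) (C : Cmd) : PowerBounded fun L => C.cost (loopBound d L) := by
  obtain ⟨c, hc⟩ := C.powerBounded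
  refine ((PowerBounded.const c).mul ((powerBounded_loopBound d).pow c)).mono fun L hL => hc _ ?_
  exact Nat.mul_pos (by positivity) (Nat.pow_pos hL)

section
variable {d q K : ℕ}

/-- All loop counts are `O(log² n)`; the number of samples is the one that needs the square. Since
loops are nested to a fixed depth, the running time is polylogarithmic. -/
theorem param_le_loopBound (hK : 1 ≤ K) (hq : q ≤ (K + 1) ^ d) {a : ℕ} (ha : a < 40) :
    param d q K a ≤ loopBound d (logLen d q K) := by
  have h1 := indexBits_le_logLen (d := d) (q := q) hK
  have h2 := two_pow_msgExp_le_logLen (d := d) (q := q) hK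
  have h3 := two_pow_blockExp_le_logLen (d := d) (q := q) hK
  have h4 := blockExp_lt_logLen d q K
  have h5 := size_pred_le hq
  have h6 := two_pow_payExp_le d K
  have h7 := symExp_le hq
  have h8 := groupExp_add hq
  have h9 := @Nat.lt_two_pow_self (payExp d K)
  have h10 := Nat.pow_le_pow_right (n := 2) (by norm_num) h7
  have h11 := Nat.pow_le_pow_right (n := 2) (by norm_num)
    (show groupExp d q K ≤ payExp d K from Nat.sub_le _ _)
  have h12 := @Nat.lt_two_pow_self (msgExp d K)
  have h13 := pieceExp_le_msgExp d K
  have h14 : Nat.size (indexBits K / 2 ^ (18 + pieceExp d)) ≤ msgExp d K := Nat.le_add_left _ _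
  have h15 : d < 2 ^ pieceExp d := (by unfold pieceExp; omega : d ≤ pieceExp d).trans_lt
    Nat.lt_two_pow_self
  have h16 : 1 ≤ logLen d q K := Nat.succ_pos _
  have h17 := Nat.mul_le_mul h15.le h1
  have h18 : 1 ≤ 2 ^ pieceExp d := Nat.one_le_two_pow
  set L := logLen d q K with hL
  set M := 2 ^ pieceExp d with hM
  have w1 : M * L ≤ M * L * (M * L) := Nat.le_mul_of_pos_left _ (by positivity)
  have w2 : L ≤ M * L := Nat.le_mul_of_pos_left _ h18
  have w3 : M ≤ M * L := Nat.le_mul_of_pos_right _ h16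
  have w4 : M * (M * L) ≤ M * L * (M * L) := Nat.mul_le_mul_right _ w3
  have w5 : M * 2 ^ msgExp d K ≤ M * (M * L) := Nat.mul_le_mul_left _ h2
  have w6 : M * L ^ 2 ≤ M * L * (M * L) := by
    rw [show M * L * (M * L) = M * (M * L ^ 2) by ring]
    exact Nat.le_mul_of_pos_left _ h18
  have e1 : 2 ^ (15 + 2 * pieceExp d) * L = 2 ^ 15 * (M * (M * L)) := by
    rw [pow_add, two_mul, pow_add, hM]; ring
  have e2 : param d q K 23 = 2 ^ 23 * (M * L ^ 2) := by
    rw [param, sampleCount, pow_add]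
    ring
  have e3 : param d q K 17 = 2 ^ 14 * (M * 2 ^ msgExp d K) := by
    rw [param, markLen, wordLen]; ring
  have e4 : loopBound d L = 2 ^ 25 * (M * L * (M * L)) := by rw [loopBound, hM]; ring
  rw [e4]
  rw [e1] at h3
  by_cases h23 : a = 23
  · rw [h23, e2]; omega
  by_cases h17 : a = 17
  · rw [h17, e3]; omega
  clear e1 e2 e3 e4
  generalize M * L * (M * L) = W at *
  interval_cases a <;> simp only [param, wordLen, hashBits] <;> omega

/-- The critical sizes are those of the tables over seeds and words: with `M = 2 ^ 13 * m` their
exponents are at most `2 * (M + m) + 2 ^ 14 * m ≤ 2 ^ 16 * m`, so `two_pow_le_codeLen` bounds them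
by a constant times `n`. -/
theorem param_le_sizeBound (hK : 1 ≤ K) (hq : q ≤ (K + 1) ^ d) {a : ℕ} (ha : a < 60) :
    param d q K a ≤ codeLen d q K * sizeBound d (logLen d q K) := by
  have hn := codeLen_pos d q K
  rcases Nat.lt_or_ge a 40 with h | h
  · exact (param_le_loopBound hK hq h).trans ((Nat.le_add_right _ _).trans
      (Nat.le_mul_of_pos_left _ hn))
  have h1 := le_codeLen (d := d) (q := q) hK
  have h2 := two_pow_le_codeLen (d := d) (q := q) hK
  have h3 : blockCount d q K ≤ codeLen d q K := Nat.le_mul_of_pos_right _ (by positivity)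
  set n := codeLen d q K with hn'
  set L := logLen d q K with hL
  have h4 : n * 1 ≤ n * (2 ^ 23 * 2 ^ pieceExp d * L ^ 3) :=
    Nat.mul_le_mul_left _ (Nat.mul_pos (by positivity) (Nat.pow_pos (Nat.succ_pos _)))
  have h5 : param d q K 48 ≤ n * (2 ^ 23 * 2 ^ pieceExp d * L ^ 3) := by
    refine le_trans (le_of_eq ?_) (Nat.le_mul_of_pos_left _ hn)
    rw [param, coinCount, sampleCount, pow_add]
    ring
  rw [sizeBound, mul_add, mul_add, mul_add, mul_comm n (2 ^ (2 ^ (16 + pieceExp d) + 1))]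
  have e : ∀ x, x ≤ 2 ^ 16 * 2 ^ msgExp d K →
      2 ^ x ≤ 2 ^ (2 ^ (16 + pieceExp d) + 1) * n := fun x hx =>
    (Nat.pow_le_pow_right (by norm_num) hx).trans h2
  by_cases h45 : a = 45
  · rw [h45, param]
    have := e _ (show 2 * (hashBits (2 ^ msgExp d K) + 2 ^ msgExp d K) ≤ 2 ^ 16 * 2 ^ msgExp d K by
      unfold hashBits; omega)
    omega
  by_cases h46 : a = 46
  · rw [h46, param, ← pow_add]
    have := e _ (show 2 * (hashBits (2 ^ msgExp d K) + 2 ^ msgExp d K) + 2 ^ msgExp d K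
      ≤ 2 ^ 16 * 2 ^ msgExp d K by unfold hashBits; omega)
    omega
  by_cases h47 : a = 47
  · rw [h47, param, ← pow_add]
    have := e _ (show 2 * (hashBits (2 ^ msgExp d K) + 2 ^ msgExp d K) + wordLen (2 ^ msgExp d K)
      ≤ 2 ^ 16 * 2 ^ msgExp d K by unfold hashBits wordLen; omega)
    omega
  by_cases h48 : a = 48
  · rw [h48]; omega
  interval_cases a <;> simp only [param] <;> omega

theorem Params.le_sizeBound {A : Regs} (hA : Params d q K A) (hK : 1 ≤ K) (hq : q ≤ (K + 1) ^ d) :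
    ∀ a < 60, hd A a ≤ codeLen d q K * sizeBound d (logLen d q K) := fun a ha => by
  rw [hA a (by omega)]; exact param_le_sizeBound hK hq ha

theorem Params.le_loopBound {A : Regs} (hA : Params d q K A) (hK : 1 ≤ K) (hq : q ≤ (K + 1) ^ d) :
    ∀ a < 40, hd A a ≤ loopBound d (logLen d q K) := fun a ha => by
  rw [hA a (by omega)]; exact param_le_loopBound hK hq ha

theorem lt_two_pow_logLen (d q K : ℕ) : codeLen d q K < 2 ^ logLen d q K :=
  Nat.lt_pow_succ_log_self (by norm_num) _

theorem sizeBound_pos (d L : ℕ) : 1 ≤ sizeBound d L := by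
  have : 1 ≤ 2 ^ (2 ^ (16 + pieceExp d) + 1) := Nat.one_le_two_pow
  unfold sizeBound
  omega

theorem le_two_pow_entryBound (hK : 1 ≤ K) (c : ℕ) :
    codeLen d q K * sizeBound d (logLen d q K) ≤ 2 ^ entryBound d c (logLen d q K) ∧
    c + K ≤ 2 ^ entryBound d c (logLen d q K) := by
  have h1 := lt_two_pow_logLen d q K
  have h2 := @Nat.lt_two_pow_self (sizeBound d (logLen d q K))
  have h3 : codeLen d q K * sizeBound d (logLen d q K) ≤ 2 ^ (logLen d q K + sizeBound d (logLen d q K)) := by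
    rw [pow_add]; exact Nat.mul_le_mul h1.le h2.le
  refine ⟨h3.trans (Nat.pow_le_pow_right (by norm_num) (Nat.le_add_right _ _)), ?_⟩
  have h4 := le_codeLen (d := d) (q := q) hK
  have h5 := @Nat.lt_two_pow_self c
  have h6 : 1 ≤ 2 ^ c := Nat.one_le_two_pow
  have h7 : 1 ≤ 2 ^ logLen d q K := Nat.one_le_two_pow
  calc c + K ≤ 2 ^ c + 2 ^ logLen d q K := by omega
    _ ≤ 2 * (2 ^ c * 2 ^ logLen d q K) := by nlinarith
    _ = 2 ^ (logLen d q K + c + 1) := by rw [pow_succ, pow_add]; ring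
    _ ≤ _ := Nat.pow_le_pow_right (by norm_num) (by unfold entryBound; omega)

theorem tapesFit (hK : 1 ≤ K) (hq : q ≤ (K + 1) ^ d) (c : ℕ) {I : Tapes}
    (hI : ∀ k, ∀ v ∈ I.getD k [], v ≤ max q 1) :
    TapesFit I (codeLen d q K * sizeBound d (logLen d q K)) (2 ^ entryBound d c (logLen d q K)) := by
  refine ⟨Nat.mul_pos (codeLen_pos d q K) (sizeBound_pos _ _), (le_two_pow_entryBound hK c).1,
    fun k v hv => ?_⟩
  have h1 := hI k v hv
  have h2 : q ≤ 2 ^ (d * logLen d q K) := by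
    refine hq.trans ?_
    rw [mul_comm, pow_mul]
    refine Nat.pow_le_pow_left ?_ d
    have := lt_two_pow_logLen d q K
    have := le_codeLen (d := d) (q := q) hK
    omega
  have h3 : 1 ≤ 2 ^ (d * logLen d q K) := Nat.one_le_two_pow
  calc v + 1 ≤ 2 ^ (d * logLen d q K + 1) := by rw [pow_succ]; omega
    _ ≤ _ := Nat.pow_le_pow_right (by norm_num) (by unfold entryBound; omega)

end

/-- The program that compiles. -/
noncomputable def compileProgram (d : ℕ) : Program := detProgram (setup d ;;; compileCmd) 72

/-- The parameters and a register with one entry per coin. -/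
noncomputable def prepareCmd (d : ℕ) : Cmd := setup d ;;; .tab 74 48 (valLP (.lit 0)) 1

/-- The program that recovers. -/
noncomputable def recoverProgram (d : ℕ) : Program :=
  coinProgram (prepareCmd d) recoverCmd 74 75 80

theorem maxLit_setup (d : ℕ) (I : Tapes) :
    (setup d).maxLit I ≤ (setup d).maxLit [] + (I.getD 1 []).length := by
  have h : ∀ C : Cmd, C.maxLit I = C.maxLit [] →
      (Cmd.tlen 40 1 ;;; C).maxLit I ≤ (Cmd.tlen 40 1 ;;; C).maxLit [] + (I.getD 1 []).length := by
    intro C h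
    simp only [Cmd.maxLit, h]
    omega
  exact h _ rfl

section
variable {d q K : ℕ} {I : Tapes}

theorem compileProgram_run (hK : 1 ≤ K) (hq : q ≤ (K + 1) ^ d) (y : Fin K → Fin q) :
    ∃ c : Outcome, c.out = tape (List.ofFn (compiled d y)) ∧
      c.Within (compileProgram d).width (codeLen d q K * sizeBound d (logLen d q K))
        (2 ^ entryBound d ((setup d ;;; compileCmd).maxLit []) (logLen d q K))
        ((setup d ;;; compileCmd).cost (loopBound d (logLen d q K)) + 1) ∧
      ∀ fuel > (setup d ;;; compileCmd).cost (loopBound d (logLen d q K)) + 1,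
        (compileProgram d).run fuel [[q], tape (List.ofFn y)] = PMF.pure (some c) := by
  set I : Tapes := [[q], tape (List.ofFn y)] with hI
  have hfit := tapesFit hK hq ((setup d ;;; compileCmd).maxLit []) (I := I) (by
    rintro (_ | _ | k) v hv
    · simp [hI] at hv; omega
    · simp [hI, tape] at hv; obtain ⟨i, rfl⟩ := hv; omega
    · simp [hI] at hv)
  have hlen : (I.getD 1 []).length = K := by simp [hI, tape]
  have hS := triple_setup (d := d) (Λ := codeLen d q K * sizeBound d (logLen d q K)) hK
    ((le_codeLen hK).trans (Nat.le_mul_of_pos_right _ (sizeBound_pos _ _)))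
    (fun a ha => param_le_loopBound hK hq ha) rfl hlen emptyRegs rfl
  obtain ⟨c, h1, h2, h3⟩ := detProgram_run hfit (setup d ;;; compileCmd) 72 (by norm_num)
    (X := loopBound d (logLen d q K)) rfl (by
      refine le_trans ?_ (le_two_pow_entryBound (q := q) hK _).2
      have := maxLit_setup d I
      have e : compileCmd.maxLit I = compileCmd.maxLit [] := rfl
      rw [hlen] at this
      simp only [Cmd.maxLit, e]
      omega)
    ⟨hS.1, Cmd.safe_of_static rfl (hS.2.le_sizeBound hK hq) (hS.2.le_loopBound hK hq)⟩
  exact ⟨c, h1.trans (compileCmd_spec hS.2 rfl), h2, h3⟩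

theorem recoverProgram_run (hK : 1 ≤ K) (hq0 : 0 < q) (hq : q ≤ (K + 1) ^ d) (y : Fin K → Fin q)
    (w : List (Fin 2)) :
    ∃ c : List ℕ → Outcome, (∀ l ∈ (coins (coinCount d q K)).support,
      (c l).out = tape (decoded d K hq0 (bitsOf w) l) ∧
      (c l).Within (recoverProgram d).width (codeLen d q K * sizeBound d (logLen d q K))
        (2 ^ entryBound d ((prepareCmd d).maxLit [] + recoverCmd.maxLit []) (logLen d q K))
        ((prepareCmd d).cost (loopBound d (logLen d q K)) +
          recoverCmd.cost (loopBound d (logLen d q K)) + 2)) ∧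
      ∀ fuel > (prepareCmd d).cost (loopBound d (logLen d q K)) +
          recoverCmd.cost (loopBound d (logLen d q K)) + 2,
        (recoverProgram d).run fuel [[q], tape (List.ofFn y), tape w]
          = (coins (coinCount d q K)).map fun l => some (c l) := by
  set I : Tapes := [[q], tape (List.ofFn y), tape w] with hI
  have hfit := tapesFit hK hq ((prepareCmd d).maxLit [] + recoverCmd.maxLit []) (I := I) (by
    rintro (_ | _ | _ | k) v hv
    · simp [hI] at hv; omega
    · simp [hI, tape] at hv; obtain ⟨i, rfl⟩ := hv; omega
    · simp only [hI, tape, List.getD_cons_succ, List.getD_cons_zero, List.mem_map] at hv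
      obtain ⟨i, -, rfl⟩ := hv; omega
    · simp [hI] at hv)
  have hlen : (I.getD 1 []).length = K := by simp [hI, tape]
  have hS := triple_setup (d := d) (Λ := codeLen d q K * sizeBound d (logLen d q K)) hK
    ((le_codeLen hK).trans (Nat.le_mul_of_pos_right _ (sizeBound_pos _ _)))
    (fun a ha => param_le_loopBound hK hq ha) rfl hlen emptyRegs rfl
  have hA : Params d q K ((prepareCmd d).run I emptyRegs) :=
    hS.2.run (C := .tab 74 48 (valLP (.lit 0)) 1) rfl (by decide)
  have hAl : ∀ l, Params d q K (Function.update ((prepareCmd d).run I emptyRegs) 75 l) :=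
    fun l a ha => by rw [hd_update_of_ne (by omega)]; exact hA a ha
  have hV := (le_two_pow_entryBound (d := d) (q := q) hK
    ((prepareCmd d).maxLit [] + recoverCmd.maxLit [])).2
  obtain ⟨c, h1, h2⟩ := coinProgram_run hfit (prepareCmd d) recoverCmd 74 75 80 (by norm_num)
    (by norm_num) (X := loopBound d (logLen d q K)) rfl (by
      have := maxLit_setup d I
      rw [hlen] at this
      simp only [prepareCmd, Cmd.maxLit] at hV ⊢
      omega)
    ⟨hS.1, Cmd.safe_of_static rfl (hS.2.le_sizeBound hK hq) (hS.2.le_loopBound hK hq)⟩ rfl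
    (by
      have e : recoverCmd.maxLit I = recoverCmd.maxLit [] := rfl
      rw [e]; omega)
    (fun l => Cmd.safe_of_static rfl ((hAl l).le_sizeBound hK hq) ((hAl l).le_loopBound hK hq))
    (N := coinCount d q K) (by
      have h48 : hd ((setup d).run I emptyRegs) 48 = coinCount d q K := hS.2 48 (by norm_num)
      simp only [prepareCmd, Cmd.run]
      rw [Function.update_self, List.length_map, List.length_range, h48])
  refine ⟨c, fun l hl => ⟨(h1 l hl).1.trans ?_, (h1 l hl).2⟩, h2⟩
  refine (recoverCmd_spec hq0 (hAl l) rfl ?_).trans ?_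
  · rw [Function.update_self]; exact le_one_of_mem_coins hl
  · rw [Function.update_self]

theorem implements_programs (hK : 1 ≤ K) (hq0 : 0 < q) (hq : q ≤ (K + 1) ^ d) :
    Implements d q K hq0 (compileProgram d) (recoverProgram d) := by
  refine ⟨⟨(setup d ;;; compileCmd).cost (loopBound d (logLen d q K)) + 2, fun y => ?_⟩,
    ⟨(prepareCmd d).cost (loopBound d (logLen d q K)) +
      recoverCmd.cost (loopBound d (logLen d q K)) + 3, fun y w => ?_⟩⟩
  · obtain ⟨c, h1, -, h2⟩ := compileProgram_run hK hq y
    exact ⟨c, h1, fun fuel hf => h2 fuel (Nat.lt_of_succ_le hf)⟩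
  · obtain ⟨c, h1, h2⟩ := recoverProgram_run hK hq0 hq y w
    exact ⟨c, fun l hl => (h1 l hl).1, fun fuel hf => h2 fuel (Nat.lt_of_succ_le hf)⟩

end

/-- Runs of an outcome within the cost bounds are within polylogarithmic bounds. -/
theorem exists_within_le (d m c : ℕ) {t : ℕ → ℕ} (ht : PowerBounded t) :
    ∃ a, ∀ n L, 1 ≤ L → 1 ≤ n → ∀ o : Outcome,
      o.Within m (n * sizeBound d L) (2 ^ entryBound d c L) (t L) →
      o.time ≤ a * L ^ a ∧ o.space ≤ n * (a * L ^ a) ∧ o.work ≤ n * (a * L ^ a) := by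
  have hs := powerBounded_sizeBound d
  obtain ⟨a₁, h1⟩ := ht
  obtain ⟨a₂, h2⟩ := PowerBounded.mul ⟨a₁, h1⟩
    (((PowerBounded.const 4).mul hs).add (PowerBounded.const 1))
  obtain ⟨a₃, h3⟩ := (PowerBounded.const m).mul (hs.mul
    (((powerBounded_entryBound d c).add ⟨a₁, h1⟩).add (PowerBounded.const 2)))
  have hmono : ∀ {x L : ℕ}, 1 ≤ L → x ≤ a₁ + a₂ + a₃ → x * L ^ x ≤
      (a₁ + a₂ + a₃) * L ^ (a₁ + a₂ + a₃) := fun hL h => PowerBounded.mono_exponent hL h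
  refine ⟨a₁ + a₂ + a₃, fun n L hL hn o ho => ⟨?_, ?_, ?_⟩⟩
  · exact ho.time.trans ((h1 L hL).trans (hmono hL (by omega)))
  · refine ho.space.trans (le_trans (le_of_eq ?_) (Nat.mul_le_mul_left n ((h3 L hL).trans
      (hmono hL (by omega)))))
    rw [← pow_add, Nat.size_pow]
    ring
  · refine ho.work.trans (le_trans ?_ (Nat.mul_le_mul_left n ((h2 L hL).trans
      (hmono hL (by omega)))))
    simp only
    rw [Nat.mul_left_comm n (t L)]
    refine Nat.mul_le_mul_left _ ?_
    rw [mul_add]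
    have : 4 * (n * sizeBound d L) = n * (4 * sizeBound d L) := by ring
    omega

theorem polylog_mono {a b : ℕ} (h : a ≤ b) (n : ℕ) : polylog a n ≤ polylog b n :=
  PowerBounded.mono_exponent (Nat.succ_pos _) h

/-- The compiler. -/
noncomputable def blockCompiler (d : ℕ) : Compiler where
  len q K := codeLen d q K
  map := compiled d
  compile := compileProgram d
  recover := recoverProgram d

/-- The runs of `A` with loops cut off after at least `fuel` iterations halt within the bounds. -/
def ParAlg.RunsWithin (A : ParAlg) (fuel : ℕ) (I : Tapes) (t s w : ℕ) (post : List ℕ → Prop) : Prop :=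
  ∀ fuel' ≥ fuel, ∀ o ∈ (A.run fuel' I).support,
    ∃ c, o = some c ∧ c.time ≤ t ∧ c.space ≤ s ∧ c.work ≤ w ∧ post c.out

theorem blockCompiler_runsWithin (d : ℕ) : ∃ a, ∀ K q : ℕ, 1 ≤ K → 2 ≤ q → q ≤ (K + 1) ^ d →
    ∃ fuel, ∀ y : Fin K → Fin q,
      (ParAlg.prog (compileProgram d)).RunsWithin fuel [[q], tape (List.ofFn y)]
        (polylog a (codeLen d q K)) (codeLen d q K * polylog a (codeLen d q K))
        (codeLen d q K * polylog a (codeLen d q K)) (fun z => z = tape (List.ofFn (compiled d y))) ∧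
      ∀ w : List (Fin 2),
        (ParAlg.prog (recoverProgram d)).RunsWithin fuel [[q], tape (List.ofFn y), tape w]
          (polylog a (codeLen d q K)) (codeLen d q K * polylog a (codeLen d q K))
          (codeLen d q K * polylog a (codeLen d q K)) (fun _ => True) := by
  obtain ⟨a₁, h1⟩ := exists_within_le d (compileProgram d).width
    ((setup d ;;; compileCmd).maxLit []) (((setup d ;;; compileCmd).powerBounded_cost d).add
      (PowerBounded.const 1))
  obtain ⟨a₂, h2⟩ := exists_within_le d (recoverProgram d).width
    ((prepareCmd d).maxLit [] + recoverCmd.maxLit []) ((((prepareCmd d).powerBounded_cost d).add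
      (recoverCmd.powerBounded_cost d)).add (PowerBounded.const 2))
  refine ⟨a₁ + a₂, fun K q hK hq2 hq => ?_⟩
  refine ⟨(setup d ;;; compileCmd).cost (loopBound d (logLen d q K)) + 2 +
    ((prepareCmd d).cost (loopBound d (logLen d q K)) +
      recoverCmd.cost (loopBound d (logLen d q K)) + 3), fun y =>
    ⟨fun fuel hf o ho => ?_, fun w fuel hf o ho => ?_⟩⟩
  · obtain ⟨c, g1, g2, g3⟩ := compileProgram_run hK hq y
    rw [ParAlg.run, g3 _ (by omega), PMF.support_pure] at ho
    obtain ⟨b1, b2, b3⟩ := h1 _ _ (Nat.succ_pos _) (codeLen_pos d q K) c g2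
    have e := polylog_mono (Nat.le_add_right a₁ a₂) (codeLen d q K)
    exact ⟨c, ho, b1.trans e, b2.trans (Nat.mul_le_mul_left _ e),
      b3.trans (Nat.mul_le_mul_left _ e), g1⟩
  · obtain ⟨c, g1, g3⟩ := recoverProgram_run hK (by omega) hq y w
    rw [ParAlg.run, g3 _ (by omega), PMF.support_map] at ho
    obtain ⟨l, hl, rfl⟩ := ho
    obtain ⟨b1, b2, b3⟩ := h2 _ _ (Nat.succ_pos _) (codeLen_pos d q K) (c l) (g1 l hl).2
    have e := polylog_mono (Nat.le_add_left a₂ a₁) (codeLen d q K)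
    exact ⟨c l, rfl, b1.trans e, b2.trans (Nat.mul_le_mul_left _ e),
      b3.trans (Nat.mul_le_mul_left _ e), trivial⟩

/-! ### Costs of reductions -/

/-- The costs of a composite are the sums of the costs of its parts. -/
theorem ParAlg.RunsIn.reduce {pre post : Program} {A : ParAlg} {I : Tapes} {z : List ℕ}
    {t₁ s₁ w₁ t₂ s₂ w₂ t₃ s₃ w₃ fuel : ℕ}
    (h1 : (ParAlg.prog pre).RunsWithin fuel I t₁ s₁ w₁ fun x => x = z)
    (h2 : A.RunsIn [[2], z] t₂ s₂ w₂ fun _ => True)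
    (h3 : ∀ w : List (Fin 2),
      (ParAlg.prog post).RunsWithin fuel (I ++ [tape w]) t₃ s₃ w₃ fun _ => True) :
    (ParAlg.reduce pre A post).RunsIn I (t₁ + t₂ + t₃) (s₁ + s₂ + s₃) (w₁ + w₂ + w₃)
      fun _ => True := by
  obtain ⟨fuel₂, h2⟩ := h2.of_le
  refine ⟨max fuel fuel₂, fun o ho => ?_⟩
  rw [ParAlg.run, PMF.mem_support_bind_iff] at ho
  obtain ⟨oa, hoa, ho⟩ := ho
  obtain ⟨a, rfl, ta, sa, wa, ea⟩ := h1 _ (le_max_left _ _) oa hoa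
  rw [Option.elim_some, PMF.mem_support_bind_iff, ea] at ho
  obtain ⟨ob, hob, ho⟩ := ho
  obtain ⟨b, rfl, tb, sb, wb, -⟩ := h2 _ (le_max_right _ _) ob hob
  have e : b.out.map (· % 2)
      = tape (b.out.map fun v => (⟨v % 2, Nat.mod_lt _ two_pos⟩ : Fin 2)) := by
    simp [tape]
  rw [Option.elim_some, PMF.mem_support_map_iff, e] at ho
  obtain ⟨oc, hoc, rfl⟩ := ho
  obtain ⟨c, rfl, tc, sc, wc, -⟩ := h3 _ _ (le_max_left _ _) oc hoc
  exact ⟨_, rfl, by simp only; omega, by simp only; omega, by simp only; omega, trivial⟩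

theorem polylog_add_self_le (a n : ℕ) : polylog a n + polylog a n ≤ polylog (2 * a) n := by
  have := Nat.mul_le_mul_left (2 * a) (Nat.pow_le_pow_right (Nat.succ_pos (Nat.log 2 n))
    (show a ≤ 2 * a by omega))
  unfold polylog
  rw [← two_mul, ← mul_assoc]
  exact this

theorem polylog_le (a n : ℕ) : polylog a n ≤ a * (n + 1) ^ a :=
  Nat.mul_le_mul_left _ (Nat.pow_le_pow_left (Nat.succ_le_succ (Nat.log_le_self 2 n)) _)

theorem blockCompiler_costs (d : ℕ) : ∃ a,
    (∀ K q : ℕ, 1 ≤ K → 2 ≤ q → q ≤ (K + 1) ^ d → (blockCompiler d).RunsInPolylog a q K) ∧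
    ∀ (T S : ℕ → ℕ), ∀ B ∈ (blockCompiler d).closure (parPPT T S), ∃ P : Polynomial ℕ,
      ∀ K q : ℕ, 1 ≤ K → 2 ≤ q → q ≤ (K + 1) ^ d → ∀ y : Fin K → Fin q,
        B.RunsIn [[q], tape (List.ofFn y)] (T (codeLen d q K) + polylog a (codeLen d q K))
          (S (codeLen d q K) + codeLen d q K * polylog a (codeLen d q K))
          (P.eval (codeLen d q K)) (fun _ => True) := by
  obtain ⟨a, h⟩ := blockCompiler_runsWithin d
  refine ⟨2 * a, fun K q hK hq2 hq y => ?_, ?_⟩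
  · obtain ⟨fuel, h⟩ := h K q hK hq2 hq
    have e := polylog_mono (show a ≤ 2 * a by omega) (codeLen d q K)
    have e' := Nat.mul_le_mul_left (codeLen d q K) e
    refine ⟨⟨fuel, fun o ho => ?_⟩, fun w => ⟨fuel, fun o ho => ?_⟩⟩
    · obtain ⟨c, h0, h1, h2, h3, h4⟩ := (h y).1 fuel le_rfl o ho
      exact ⟨c, h0, h1.trans e, h2.trans e', h3.trans e', h4⟩
    · obtain ⟨c, h0, h1, h2, h3, h4⟩ := (h y).2 w fuel le_rfl o ho
      exact ⟨c, h0, h1.trans e, h2.trans e', h3.trans e', h4⟩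
  · intro T S B hB
    obtain ⟨A, ⟨P, hA⟩, hB⟩ := hB
    rw [hB]
    clear hB
    refine ⟨P + 2 * (Polynomial.X * (Polynomial.C a * (Polynomial.X + 1) ^ a)),
      fun K q hK hq2 hq y => ?_⟩
    obtain ⟨fuel, h⟩ := h K q hK hq2 hq
    have h2 := hA (List.ofFn (compiled d y))
    rw [List.length_ofFn] at h2
    obtain ⟨fuel', h'⟩ := ParAlg.RunsIn.reduce (h y).1 h2 (h y).2
    have e := polylog_add_self_le a (codeLen d q K)
    have e1 := Nat.mul_le_mul_left (codeLen d q K) e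
    have e2 := Nat.mul_le_mul_left (codeLen d q K) (polylog_le a (codeLen d q K))
    rw [mul_add] at e1
    refine ⟨fuel', fun o ho => ?_⟩
    obtain ⟨c, h0, h1, h2, h3, h4⟩ := h' o ho
    refine ⟨c, h0, by omega, by omega, ?_, trivial⟩
    have e3 : ∀ n, (P + 2 * (Polynomial.X * (Polynomial.C a * (Polynomial.X + 1) ^ a))).eval n
        = P.eval n + 2 * (n * (a * (n + 1) ^ a)) := fun n => by simp
    rw [e3]
    omega

/-! ### The rate -/

section
variable {d q K : ℕ}

/-- The symbols of a block have at most as many bits as the block has letters, and the blocks have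
room for all `K` symbols. -/
theorem mul_two_pow_symExp_le (hK : 1 ≤ K) (hq : q ≤ (K + 1) ^ d) :
    K * 2 ^ symExp q ≤ codeLen d q K := by
  have h1 := Nat.mul_le_mul_right (2 ^ blockExp d K * 2 ^ symExp q) (le_blockCount_mul d q K).le
  have h2 : 2 ^ groupExp d q K * 2 ^ symExp q ≤ 2 ^ blockExp d K := by
    rw [← pow_add, groupExp_add hq]; exact two_pow_payExp_le_blockLen hK
  have h3 := Nat.mul_le_mul_left (codeLen d q K) h2
  refine Nat.le_of_mul_le_mul_right (c := 2 ^ blockExp d K) ?_ (by positivity)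
  calc _ = K * (2 ^ blockExp d K * 2 ^ symExp q) := by ring
    _ ≤ _ := h1
    _ = codeLen d q K * (2 ^ groupExp d q K * 2 ^ symExp q) := by rw [codeLen]; ring
    _ ≤ _ := h3

/-- A block has length `O(indexBits K)` and is filled with at least `indexBits K` bits of symbols,
because `1 ≤ d`. So the full groups cost a constant factor, and the one additional block costs
`O(indexBits K) ≤ O(K)`. -/
theorem codeLen_le (hK : 1 ≤ K) (hd : 1 ≤ d) (hq : q ≤ (K + 1) ^ d) :
    codeLen d q K ≤ 2 ^ (15 + pieceExp d) * (1 + 2 ^ (17 + pieceExp d)) * (K * 2 ^ symExp q + K) := by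
  have h1 := two_pow_msgExp_le d K
  have h2 := indexBits_pos hK
  have h3 : indexBits K ≤ K := Nat.size_le.2 Nat.lt_two_pow_self
  have h4 : 2 ^ blockExp d K ≤
      2 ^ (15 + pieceExp d) * (1 + 2 ^ (17 + pieceExp d)) * indexBits K := by
    rw [blockExp, pow_add, mul_assoc]
    refine Nat.mul_le_mul_left _ ?_
    have : 2 ^ (17 + pieceExp d) ≤ 2 ^ (17 + pieceExp d) * indexBits K :=
      Nat.le_mul_of_pos_right _ h2
    rw [add_mul]
    omega
  have h5 : K / 2 ^ groupExp d q K * indexBits K ≤ K * 2 ^ symExp q := by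
    have g1 : indexBits K ≤ 2 ^ groupExp d q K * 2 ^ symExp q := by
      rw [← pow_add, groupExp_add hq]
      exact (Nat.le_mul_of_pos_left _ hd).trans (lt_two_pow_payExp d K).le
    calc _ ≤ K / 2 ^ groupExp d q K * (2 ^ groupExp d q K * 2 ^ symExp q) :=
          Nat.mul_le_mul_left _ g1
      _ = K / 2 ^ groupExp d q K * 2 ^ groupExp d q K * 2 ^ symExp q := by ring
      _ ≤ _ := Nat.mul_le_mul_right _ (Nat.div_mul_le_self _ _)
  calc codeLen d q K ≤ (K / 2 ^ groupExp d q K + 1) *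
        (2 ^ (15 + pieceExp d) * (1 + 2 ^ (17 + pieceExp d)) * indexBits K) :=
        Nat.mul_le_mul_left _ h4
    _ = 2 ^ (15 + pieceExp d) * (1 + 2 ^ (17 + pieceExp d)) *
        (K / 2 ^ groupExp d q K * indexBits K + indexBits K) := by ring
    _ ≤ _ := Nat.mul_le_mul_left _ (Nat.add_le_add h5 h3)

theorem log_le_two_pow_symExp (hq : 2 ≤ q) : Real.log q ≤ 2 ^ symExp q := by
  have h1 : (q : ℝ) ≤ 2 ^ 2 ^ symExp q := by exact_mod_cast le_two_pow_symExp q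
  have h2 := Real.log_le_log (by positivity) h1
  rw [Real.log_pow] at h2
  have h3 : Real.log 2 ≤ 1 := by linarith [Real.log_two_lt_d9]
  push_cast at h2
  nlinarith [show (0 : ℝ) < 2 ^ symExp q by positivity]

/-- The number of bits per symbol is the bit length of `q - 1` rounded up to a power of two.
Rounding and the change to natural logarithms cost a constant factor, and the additive constant is
absorbed because `log q ≥ log 2`. -/
theorem two_pow_symExp_le_log (hq : 2 ≤ q) : (2 : ℝ) ^ symExp q ≤ 8 * Real.log q := by
  have h1 : 2 ^ symExp q ≤ 2 * (Nat.size (q - 1) - 1) + 1 := size_le_self_add_one _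
  have h2 : 2 ^ (Nat.size (q - 1) - 1) ≤ q := by
    have h3 : Nat.size (q - 1) - 1 < Nat.size (q - 1) :=
      Nat.sub_lt (Nat.size_pos.2 (by omega)) one_pos
    have := Nat.lt_size.1 h3
    omega
  set s := Nat.size (q - 1) - 1
  have h4 : (2 : ℝ) ^ s ≤ q := by exact_mod_cast h2
  have h5 := Real.log_le_log (by positivity) h4
  rw [Real.log_pow] at h5
  have h6 : (1 : ℝ) / 2 ≤ Real.log 2 := by linarith [Real.log_two_gt_d9]
  have h7 : Real.log 2 ≤ Real.log q := Real.log_le_log two_pos (by exact_mod_cast hq)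
  have h8 : (2 : ℝ) ^ symExp q ≤ 2 * s + 1 := by exact_mod_cast h1
  nlinarith [show (0 : ℝ) ≤ s from Nat.cast_nonneg s]

/-- The constant in the bound on the length of the compiled word. -/
def rateConst (d : ℕ) : ℕ := 10 * (2 ^ (15 + pieceExp d) * (1 + 2 ^ (17 + pieceExp d)))

theorem codeLen_bounds (hK : 1 ≤ K) (hq2 : 2 ≤ q) (hq : q ≤ (K + 1) ^ d) :
    K * Real.log q ≤ codeLen d q K ∧ (codeLen d q K : ℝ) ≤ rateConst d * (K * Real.log q) := by
  have hK' : (0 : ℝ) < K := by exact_mod_cast hK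
  have h1 : (K : ℝ) * 2 ^ symExp q ≤ codeLen d q K := by
    exact_mod_cast mul_two_pow_symExp_le hK hq
  have hd : 1 ≤ d := by
    rcases Nat.eq_zero_or_pos d with rfl | h
    · simp at hq; omega
    · exact h
  have h2 : (codeLen d q K : ℝ) ≤ (2 ^ (15 + pieceExp d) * (1 + 2 ^ (17 + pieceExp d)) : ℕ) *
      (K * 2 ^ symExp q + K) := by exact_mod_cast codeLen_le hK hd hq
  have h3 := log_le_two_pow_symExp hq2
  have h4 := two_pow_symExp_le_log hq2
  have h5 : (1 : ℝ) ≤ 2 * Real.log q := by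
    have h6 : (1 : ℝ) / 2 ≤ Real.log 2 := by linarith [Real.log_two_gt_d9]
    have h7 : Real.log 2 ≤ Real.log q := Real.log_le_log two_pos (by exact_mod_cast hq2)
    linarith
  refine ⟨(mul_le_mul_of_nonneg_left h3 hK'.le).trans h1, h2.trans ?_⟩
  unfold rateConst
  generalize 2 ^ (15 + pieceExp d) * (1 + 2 ^ (17 + pieceExp d)) = c
  rw [Nat.cast_mul, mul_comm ((10 : ℕ) : ℝ), mul_assoc]
  refine mul_le_mul_of_nonneg_left ?_ (Nat.cast_nonneg _)
  push_cast
  nlinarith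

/-- A single block is already long, so the binary logarithm of `n` is at least `2` and absorbs the
added one. -/
theorem logLen_le_log (d q K : ℕ) : (logLen d q K : ℝ) ≤ 3 * Real.log (codeLen d q K) := by
  have h0 := codeLen_pos d q K
  have h1 : (2 : ℝ) ^ Nat.log 2 (codeLen d q K) ≤ codeLen d q K := by
    exact_mod_cast Nat.pow_log_le_self 2 h0.ne'
  have h2 := Real.log_le_log (by positivity) h1
  rw [Real.log_pow] at h2
  have h3 : (1 : ℝ) / 2 ≤ Real.log 2 := by linarith [Real.log_two_gt_d9]
  have h4 : 2 ≤ Nat.log 2 (codeLen d q K) := by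
    have := blockExp_lt_logLen d q K
    unfold blockExp logLen at this
    omega
  have h5 : (2 : ℝ) ≤ Nat.log 2 (codeLen d q K) := by exact_mod_cast h4
  rw [logLen]
  push_cast
  nlinarith

end

theorem negligible_zero : Negligible fun _ => 0 :=
  ⟨fun _ => le_rfl, Asymptotics.superpolynomialDecay_zero _ _⟩

end InsDelLDC

theorem theorem4p1 (d : ℕ) :
    ∃ (R : Compiler) (ϑ₁ ϑ₂ : ℕ → ℝ) (ρf : ℝ → ℝ) (c₁ c₂ c₃ : ℝ) (a : ℕ),
      0 < c₁ ∧ 0 < c₂ ∧ 0 < c₃ ∧ Negligible ϑ₁ ∧ Negligible ϑ₂ ∧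
      (∀ ρ : ℝ, 0 < ρ → c₁ * ρ ≤ ρf ρ ∧ ρf ρ ≤ c₂ * ρ) ∧
      (∀ K q : ℕ, 1 ≤ K → 2 ≤ q → q ≤ (K + 1) ^ d →
        c₁ * (K * Real.log q) ≤ R.len q K ∧ (R.len q K : ℝ) ≤ c₂ * (K * Real.log q) ∧
        R.RunsInPolylog a q K) ∧
      (∀ (T S : ℕ → ℕ), ∀ B ∈ R.closure (parPPT T S), ∃ P : Polynomial ℕ,
        ∀ K q : ℕ, 1 ≤ K → 2 ≤ q → q ≤ (K + 1) ^ d → ∀ y : Fin K → Fin q,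
          B.RunsIn [[q], tape (List.ofFn y)] (T (R.len q K) + polylog a (R.len q K))
            (S (R.len q K) + R.len q K * polylog a (R.len q K)) (P.eval (R.len q K))
            (fun _ => True)) ∧
      ∀ (K k q₁ q₂ : ℕ), 1 ≤ K → 2 ≤ q₂ → q₂ ≤ (K + 1) ^ d → ∀ C : Code K k q₁ q₂,
        ∃ Cf : Code (R.len q₂ K) k q₁ 2,
          (∀ x, Cf.enc x = (C.enc x).map R.map) ∧
          ∀ (T S : ℕ → ℕ) (ℓ : ℕ) (ρ p pf ε : ℝ), 0 < ρ → 0 < p → pf < p →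
            C.IsLDC ℓ ρ p ε hamDist (R.closure (parPPT T S)) →
            0 < 1 - pf / p - ϑ₁ (R.len q₂ K) / p - ϑ₂ (R.len q₂ K) →
            Cf.IsLDC ⌊c₃ * ℓ * Real.log (R.len q₂ K) ^ 4⌋₊ (ρf ρ) pf
              (ε / (1 - pf / p - ϑ₁ (R.len q₂ K) / p - ϑ₂ (R.len q₂ K)))
              editDist (parPPT T S) := by
  obtain ⟨a, ha, hcl⟩ := blockCompiler_costs d
  have hr := rateLoss_pos d
  have hc : (1 : ℝ) ≤ rateConst d := by
    have : 1 ≤ rateConst d := by unfold rateConst; exact Nat.mul_pos (by norm_num) (by positivity)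
    exact_mod_cast this
  -- The sampling error enters once, as `ϑ₂`, and nothing is needed for `ϑ₁`. The factor `81 = 3 ^
  -- 4` turns `logLen ^ 4` into the fourth power of the natural logarithm.
  refine ⟨blockCompiler d, fun _ => 0, failure, fun ρ => ρ / rateLoss d, min 1 (1 / rateLoss d),
    max (rateConst d) (1 / rateLoss d), 81 * 2 ^ (40 + 5 * pieceExp d), a, by positivity,
    lt_max_of_lt_left (by linarith), by positivity, negligible_zero, negligible_failure,
    fun ρ hρ => ?_, fun K q hK hq2 hq => ?_, hcl, fun K k q₁ q₂ hK hq2 hq C => ?_⟩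
  · have e : ρ / rateLoss d = 1 / rateLoss d * ρ := by ring
    simp only [e]
    exact ⟨mul_le_mul_of_nonneg_right (min_le_right _ _) hρ.le,
      mul_le_mul_of_nonneg_right (le_max_right _ _) hρ.le⟩
  · obtain ⟨h1, h2⟩ := codeLen_bounds hK hq2 hq
    have h3 : 0 ≤ K * Real.log q := mul_nonneg (Nat.cast_nonneg _) (Real.log_natCast_nonneg _)
    exact ⟨(mul_le_of_le_one_left h3 (min_le_left _ _)).trans h1,
      h2.trans (mul_le_mul_of_nonneg_right (le_max_left _ _) h3), ha K q hK hq2 hq⟩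
  · have hq0 : 0 < q₂ := by omega
    refine ⟨C.compile d hq0, fun x => rfl, fun T S ℓ ρ p pf ε hρ hp hpf hC hδ => ?_⟩
    simp only [zero_div, sub_zero] at hδ ⊢
    refine (implements_programs hK hq0 hq).isLDC (𝒞' := (blockCompiler d).closure (parPPT T S)) hK hq
      hρ hp (fun A hA => ⟨A, hA, rfl⟩) (Nat.le_floor ?_) hC hδ
    have h1 : (queryCount d q₂ K : ℝ) ≤ 2 ^ (40 + 5 * pieceExp d) * (logLen d q₂ K : ℝ) ^ 4 := by
      exact_mod_cast queryCount_le (d := d) (q := q₂) hK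
    have h2 := pow_le_pow_left₀ (Nat.cast_nonneg _) (logLen_le_log d q₂ K) 4
    rw [mul_pow] at h2
    push_cast
    calc (queryCount d q₂ K : ℝ) * ℓ
        ≤ 2 ^ (40 + 5 * pieceExp d) * (3 ^ 4 * Real.log (codeLen d q₂ K) ^ 4) * ℓ :=
          mul_le_mul_of_nonneg_right (h1.trans (mul_le_mul_of_nonneg_left h2 (by positivity)))
            (Nat.cast_nonneg _)
      _ = _ := by
        change _ = 81 * 2 ^ (40 + 5 * pieceExp d) * (ℓ : ℝ) * Real.log (codeLen d q₂ K) ^ 4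
        ring
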